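/- Let $k$ be a field, let $d\ge 0$ be an integer, and let $G$ be a finitely generated group which is an oriented Poincaré duality group of dimension $d$ over $k$: the trivial module $k$ has a finite resolution $P$ by finitely generated projective left $k[G]$-modules, $H^i(G,k[G])=H^i(\mathrm{Hom}_{k[G]}(P,k[G]))$ is zero for $i\ne d$, and $H^d(G,k[G])$ is isomorphic to the trivial $k[G]$-module $k$ (where $G$ acts on $H^d(G,k[G])$ from the left via the coefficient module). Write $A=k[G]$ and $A^e=A\otimes_k A^{op}$. A $d$-dimensional Calabi–Yau structure on $A$ consists of a finite resolution $Q\to A$ by finitely generated projective $A$-bimodules and a quasi-isomorphism of complexes of bimodules $\psi\colon Q\to \mathrm{Hom}_{A^e}(Q,A^e)[d]$ (the bimodule structure on $\mathrm{Hom}_{A^e}(Q,A^e)$ being induced by right multiplication on $A^e$), that is $\psi\colon A\simeq A^![d]$ with $A^!=\mathrm{RHom}_{A^e}(A,A^e)$, such that $\psi^!=\psi[d]$ up to homotopy. Here, if $\langle x,y\rangle=\psi(x)(y)\in A^e$ and $\tau(a\otimes b)=b\otimes a$, the condition $\psi^!=\psi[d]$ means that $\psi$ is homotopic to the morphism given by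 the pairing $(-1)^{|x||y|+d}\,\tau\langle y,x\rangle$. Then: 1. $k[G]$ is a $d$-dimensional Calabi–Yau algebra, i.e. $A=k[G]$ has a $d$-dimensional Calabi–Yau structure. 2. Consequently $HH^*(A,A)$ is a BV-algebra. Precisely, for every $d$-dimensional Calabi–Yau structure $\psi$ on $A$, let $\pi=\psi(1)\in \mathrm{Ext}^d_{A^e}(A,A^e)$ be its volume. There is a class $c\in HH_d(A,A)$ whose pairing with $\pi$ is $1$, where $x\otimes y\in A^e$ and $a_0\in A$ pair to $y a_0 x$, such that $f\mapsto i_f c$ (the contraction $i_f(a_0[a_1,\dots,a_d])=(-1)^n a_0f(a_1,\dots,a_n)[a_{n+1},\dots,a_d]$ for $f$ of degree $n$) is an isomorphism $HH^*(A,A)\to HH_{d-*}(A,A)$, with inverse $D$. With $B$ the Connes operator and $\Delta=D\circ B\circ D^{-1}$, and with $\cup$ and $[\,,]$ the operations induced on $HH^*(A,A)$ by the cup product $(f\cup g)(a_1,\dots,a_{m+n})=(-1)^{mn}f(a_1,\dots,a_m)\,g(a_{m+1},\dots,a_{m+n})$ and by the Gerstenhaber bracket, $(HH^*(A,A),\cup,[\,,],\Delta)$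 is a BV-algebra. That is, $\cup$ is associative and graded commutative of degree $0$; $[\,,]$ has degree $-1$ and satisfies $$[x,y\cup z]=[x,y]\cup z+(-1)^{(|x|-1)|y|}y\cup[x,z],\qquad [x,y]=-(-1)^{(|x|-1)(|y|-1)}[y,x],$$ $$[[x,y],z]=[x,[y,z]]-(-1)^{(|x|-1)(|y|-1)}[y,[x,z]];$$ $\Delta$ is linear, lowers the Hochschild cohomological degree by one, satisfies $\Delta^2=0$, and $$[x,y]=(-1)^{|x|}\Delta(x\cup y)-(-1)^{|x|}\Delta(x)\cup y-x\cup\Delta(y).$$ -/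

import Mathlib

open CategoryTheory TensorProduct

namespace CalabiYau

noncomputable section

universe u v w

/-! ## Duality for complexes of left modules over a ring with anti-involution -/

/-- An anti-involution of a ring `R`: a ring homomorphism `R → Rᵐᵒᵖ` which is its own inverse. -/
structure AntiInvolution (R : Type u) [Ring R] where
  toOp : R →+* Rᵐᵒᵖ
  involutive : ∀ r, (toOp (toOp r).unop).unop = r

/-- The action of the anti-involution on elements. -/
def AntiInvolution.conj {R : Type u} [Ring R] (τ : AntiInvolution R) (r : R) : R :=
  (τ.toOp r).unop

section Duality

variable {R : Type u} [Ring R] (τ : AntiInvolution R)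

theorem AntiInvolution.conj_conj (r : R) : τ.conj (τ.conj r) = r := τ.involutive r

theorem AntiInvolution.conj_mul (r s : R) : τ.conj (r * s) = τ.conj s * τ.conj r := by
  simp [AntiInvolution.conj]

theorem AntiInvolution.conj_add (r s : R) : τ.conj (r + s) = τ.conj r + τ.conj s := by
  simp [AntiInvolution.conj]

/-- The dual `Hom_R(M, R)` of a left `R`-module `M`.  It is a right module by right multiplication
on the values, and is regarded as a left module through `τ`. -/
def dualObj (M : ModuleCat.{u} R) : ModuleCat.{u} R :=
  (ModuleCat.restrictScalars τ.toOp).obj (ModuleCat.of Rᵐᵒᵖ (M →ₗ[R] R))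

/-- The linear form underlying an element of the dual. -/
def dualObj.toLin {M : ModuleCat.{u} R} (f : dualObj τ M) : M →ₗ[R] R := f

/-- A linear form as an element of the dual. -/
def dualObj.ofLin {M : ModuleCat.{u} R} (f : M →ₗ[R] R) : dualObj τ M := f

variable {τ} in
theorem dualObj.ext {M : ModuleCat.{u} R} {f g : dualObj τ M}
    (h : ∀ x, dualObj.toLin τ f x = dualObj.toLin τ g x) : f = g :=
  LinearMap.ext h

theorem dualObj.toLin_add {M : ModuleCat.{u} R} (f g : dualObj τ M) (x : M) :
    dualObj.toLin τ (f + g) x = dualObj.toLin τ f x + dualObj.toLin τ g x := rfl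

/-- The module structure of the dual: `(r • f)(x) = f(x) * τ(r)`. -/
theorem dualObj.toLin_smul {M : ModuleCat.{u} R} (r : R) (f : dualObj τ M) (x : M) :
    dualObj.toLin τ (r • f) x = dualObj.toLin τ f x * τ.conj r := rfl

/-- The transpose `f ↦ f ∘ φ`. -/
def dualMap {M N : ModuleCat.{u} R} (φ : M ⟶ N) : dualObj τ N ⟶ dualObj τ M :=
  ModuleCat.ofHom (X := dualObj τ N) (Y := dualObj τ M)
    { toFun := fun f => dualObj.ofLin τ ((dualObj.toLin τ f).comp φ.hom)
      map_add' := fun _ _ => rfl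
      map_smul' := fun _ _ => rfl }

theorem dualMap_apply {M N : ModuleCat.{u} R} (φ : M ⟶ N) (f : dualObj τ N) (x : M) :
    dualObj.toLin τ ((dualMap τ φ).hom f) x = dualObj.toLin τ f (φ.hom x) := rfl

theorem dualMap_comp {M N L : ModuleCat.{u} R} (φ : M ⟶ N) (χ : N ⟶ L) :
    dualMap τ (φ ≫ χ) = dualMap τ χ ≫ dualMap τ φ := rfl

theorem dualMap_zero {M N : ModuleCat.{u} R} : dualMap τ (0 : M ⟶ N) = 0 := by
  ext f
  refine dualObj.ext fun x => ?_
  rw [dualMap_apply]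
  exact (dualObj.toLin τ f).map_zero

/-- Biduality `x ↦ (f ↦ τ(f(x)))`. -/
def bidual (M : ModuleCat.{u} R) : M ⟶ dualObj τ (dualObj τ M) :=
  ModuleCat.ofHom (Y := dualObj τ (dualObj τ M))
    { toFun := fun x => dualObj.ofLin τ
        { toFun := fun f => τ.conj (dualObj.toLin τ f x)
          map_add' := fun f g => by rw [dualObj.toLin_add, τ.conj_add]
          map_smul' := fun r f => by
            rw [dualObj.toLin_smul, τ.conj_mul, τ.conj_conj]; rfl }
      map_add' := fun x y => dualObj.ext fun f => by
        change τ.conj _ = τ.conj _ + τ.conj _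
        rw [map_add, τ.conj_add]
      map_smul' := fun r x => dualObj.ext fun f => by
        change τ.conj _ = τ.conj _ * τ.conj r
        rw [map_smul, smul_eq_mul, τ.conj_mul] }

theorem bidual_naturality {M N : ModuleCat.{u} R} (φ : M ⟶ N) :
    φ ≫ bidual τ N = bidual τ M ≫ dualMap τ (dualMap τ φ) := rfl

/-- The `d`-shifted dual `Hom_R(P, R)[d]` of a complex `P` of left modules, homologically graded:
in degree `n` it is `Hom_R(P_{d-n}, R)`, and the differential is `f ↦ (-1)^(n+1) f ∘ d_P`
(the Koszul sign `-(-1)^|f|` of the dual complex times the sign `(-1)^d` of the shift). -/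
def dualShift (d : ℤ) (P : ChainComplex (ModuleCat.{u} R) ℤ) :
    ChainComplex (ModuleCat.{u} R) ℤ where
  X n := dualObj τ (P.X (d - n))
  d i j := (i + 1).negOnePow • dualMap τ (P.d (d - j) (d - i))
  shape i j hij := by
    rw [P.shape, dualMap_zero, smul_zero]
    intro h
    apply hij
    simp only [ComplexShape.down_Rel] at h ⊢
    omega
  d_comp_d' i j k _ _ := by
    rw [Linear.units_smul_comp, Linear.comp_units_smul, ← dualMap_comp, P.d_comp_d, dualMap_zero,
      smul_zero, smul_zero]

/-- The functoriality of the `d`-shifted dual. -/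
def dualShiftMap (d : ℤ) {P Q : ChainComplex (ModuleCat.{u} R) ℤ} (φ : P ⟶ Q) :
    dualShift τ d Q ⟶ dualShift τ d P where
  f n := dualMap τ (φ.f (d - n))
  comm' i j _ := by
    change dualMap τ _ ≫ ((i + 1).negOnePow • dualMap τ _) =
      ((i + 1).negOnePow • dualMap τ _) ≫ dualMap τ _
    rw [Linear.units_smul_comp, Linear.comp_units_smul, ← dualMap_comp, ← dualMap_comp, φ.comm]

/-- The biduality morphism from `P` to its double `d`-shifted dual.  In degree `n` it is, up to the
identification `d - (d - n) = n`, the map `x ↦ (f ↦ (-1)^(n(d-n)+d) τ(f(x)))`: the Koszul sign for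
exchanging an element of degree `n` with one of degree `d - n`, and the sign `(-1)^d` for the two
suspensions.  So `ψ : P ⟶ P^∨[d]` and its transpose `bidualShift ≫ dualShiftMap ψ` correspond to the
pairings `⟨x, y⟩` and `(-1)^(|x||y|+d) τ⟨y, x⟩`. -/
def bidualShift (d : ℤ) (P : ChainComplex (ModuleCat.{u} R) ℤ) :
    P ⟶ dualShift τ d (dualShift τ d P) where
  f n := (n * (d - n) + d).negOnePow •
    ((P.XIsoOfEq (show n = d - (d - n) by omega)).hom ≫ bidual τ (P.X (d - (d - n))))
  comm' i j hij := by
    have hij' : j + 1 = i := hij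
    change _ ≫ ((i + 1).negOnePow • dualMap τ ((d - j + 1).negOnePow • dualMap τ _)) =
      P.d i j ≫ (show P.X j ⟶ dualObj τ (dualObj τ (P.X (d - (d - j)))) from
        (j * (d - j) + d).negOnePow • ((P.XIsoOfEq _).hom ≫ bidual τ (P.X (d - (d - j)))))
    have hs : ∀ {M N : ModuleCat.{u} R} (φ : M ⟶ N) (s : ℤˣ),
        dualMap τ (s • φ) = s • dualMap τ φ := by
      intro M N φ s
      rcases Int.units_eq_one_or s with rfl | rfl
      · simp
      · ext f
        refine dualObj.ext fun x => ?_
        simp only [Units.neg_smul, one_smul]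
        change dualObj.toLin τ f (-(φ.hom x)) = -(dualObj.toLin τ f (φ.hom x))
        rw [map_neg]
    rw [hs]
    simp only [Linear.units_smul_comp, Linear.comp_units_smul, Category.assoc, smul_smul,
      ← bidual_naturality]
    rw [HomologicalComplex.XIsoOfEq_hom_comp_d_assoc, HomologicalComplex.d_comp_XIsoOfEq_hom_assoc]
    congr 1
    rw [← Int.negOnePow_add, ← Int.negOnePow_add, Int.negOnePow_eq_iff]
    subst hij'
    exact ⟨1 + d - j, by ring⟩

end Duality

/-! ## Finite projective resolutions -/

/-- A resolution of `M` by a bounded complex of finitely generated projective `R`-modules. -/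
structure FiniteProjectiveResolution (R : Type u) [Ring R] (M : Type w) [AddCommGroup M]
    [Module R M] where
  complex : ChainComplex (ModuleCat.{u} R) ℤ
  projective : ∀ n, Module.Projective R (complex.X n)
  finite : ∀ n, Module.Finite R (complex.X n)
  bounded : ∃ N : ℤ, ∀ n, n < 0 ∨ N < n → Subsingleton (complex.X n)
  augmentation : complex.X 0 →ₗ[R] M
  augmentation_surjective : Function.Surjective augmentation
  exact_augmentation : Function.Exact (complex.d 1 0).hom augmentation
  exactAt : ∀ n : ℤ, 0 < n → complex.ExactAt n

/-! ## Oriented Poincaré duality groups -/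

section PoincareDuality

variable (k : Type u) [Field k] (G : Type v) [Group G]

/-- The algebra homomorphism `k[G] → k[G]ᵐᵒᵖ` with `g ↦ g⁻¹`. -/
def groupAntiInvolutionHom : MonoidAlgebra k G →ₐ[k] (MonoidAlgebra k G)ᵐᵒᵖ :=
  MonoidAlgebra.lift k (MonoidAlgebra k G)ᵐᵒᵖ G
    { toFun := fun g => MulOpposite.op (MonoidAlgebra.of k G g⁻¹)
      map_one' := by rw [inv_one, map_one, MulOpposite.op_one]
      map_mul' := fun g h => by
        rw [mul_inv_rev, map_mul, MulOpposite.op_mul] }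

theorem groupAntiInvolutionHom_of (g : G) :
    groupAntiInvolutionHom k G (MonoidAlgebra.of k G g) =
      MulOpposite.op (MonoidAlgebra.of k G g⁻¹) := by
  simp [groupAntiInvolutionHom]

/-- The anti-involution `g ↦ g⁻¹` of `k[G]`, through which right modules become left modules. -/
def groupAntiInvolution : AntiInvolution (MonoidAlgebra k G) where
  toOp := (groupAntiInvolutionHom k G).toRingHom
  involutive r := by
    change (groupAntiInvolutionHom k G (groupAntiInvolutionHom k G r).unop).unop = r
    induction r using MonoidAlgebra.induction_on with
    | of g => simp only [groupAntiInvolutionHom_of, MulOpposite.unop_op, inv_inv]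
    | add a b ha hb => simp only [map_add, MulOpposite.unop_add, ha, hb]
    | smul c a ha => simp only [map_smul, MulOpposite.unop_smul, ha]

/-- The trivial `k[G]`-module `k`. -/
abbrev TrivialModule := (Representation.trivial k G k).asModule

/-- The group cohomology `H^i(G, k[G])`, computed by a projective resolution `P` of the trivial
module `k` as the cohomology of `Hom_{k[G]}(P, k[G])`.  The group acts from the left on this complex
through the coefficient module: `(g • f)(x) = f(x) * g⁻¹`. -/
def cohomologyGroupRing (P : FiniteProjectiveResolution (MonoidAlgebra k G) (TrivialModule k G))
    (i : ℤ) : ModuleCat.{max u v} (MonoidAlgebra k G) :=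
  (dualShift (groupAntiInvolution k G) 0 P.complex).homology (-i)

/-- `G` is an oriented Poincaré duality group of dimension `d` over `k`: the trivial module `k` has
a finite resolution by finitely generated projective left `k[G]`-modules, `H^i(G, k[G])` is zero for
`i ≠ d`, and `H^d(G, k[G])` is isomorphic to the trivial module `k`. -/
def IsOrientedPoincareDualityGroup (d : ℕ) : Prop :=
  ∃ P : FiniteProjectiveResolution (MonoidAlgebra k G) (TrivialModule k G),
    (∀ i : ℤ, i ≠ d → Subsingleton (cohomologyGroupRing k G P i)) ∧
    Nonempty (cohomologyGroupRing k G P d ≃ₗ[MonoidAlgebra k G] TrivialModule k G)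

end PoincareDuality

/-! ## Calabi–Yau algebras -/

section CalabiYau

variable (k : Type u) [Field k] (A : Type v) [Ring A] [Algebra k A]

/-- The enveloping algebra `A ⊗ A^op`; its left modules are the `A`-bimodules. -/
abbrev Env := A ⊗[k] Aᵐᵒᵖ

attribute [local instance] TensorProduct.Algebra.module

/-- The algebra homomorphism `A^e → (A^e)^op` with `a ⊗ b ↦ b ⊗ a`. -/
def flipHom : Env k A →ₐ[k] (Env k A)ᵐᵒᵖ :=
  ((Algebra.TensorProduct.opAlgEquiv k k A Aᵐᵒᵖ).toAlgHom.comp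
    (Algebra.TensorProduct.map (AlgHom.id k Aᵐᵒᵖ) (AlgEquiv.opOp k A).toAlgHom)).comp
    (Algebra.TensorProduct.comm k A Aᵐᵒᵖ).toAlgHom

theorem flipHom_tmul (a b : A) :
    flipHom k A (a ⊗ₜ MulOpposite.op b) = MulOpposite.op (b ⊗ₜ MulOpposite.op a) := by
  simp [flipHom]

/-- The anti-involution `a ⊗ b ↦ b ⊗ a` of `A^e`.  It exchanges the outer bimodule structure of
`A ⊗ A` (left multiplication of `A^e` on itself) with the inner one (right multiplication). -/
def flip : AntiInvolution (Env k A) where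
  toOp := (flipHom k A).toRingHom
  involutive r := by
    change (flipHom k A (flipHom k A r).unop).unop = r
    induction r using TensorProduct.induction_on with
    | zero => simp
    | tmul a b =>
      obtain ⟨b, rfl⟩ := MulOpposite.op_surjective b
      simp only [flipHom_tmul, MulOpposite.unop_op]
    | add x y hx hy => simp only [map_add, MulOpposite.unop_add, hx, hy]

/-- A `d`-dimensional Calabi–Yau structure on the algebra `A` (concentrated in degree zero).
The resolution `P` witnesses that `A` is homologically smooth, and `A^! = RHom_{A^e}(A, A^e)` is
computed as `Hom_{A^e}(P, A^e)` with the bimodule structure coming from the right multiplication of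
`A^e` on itself.  The morphism `ψ : A ⟶ A^![d]` of the derived category is a quasi-isomorphism of
complexes of bimodules `P ⟶ Hom_{A^e}(P, A^e)[d]`, and it is self-dual up to homotopy. -/
structure CalabiYauStructure (d : ℕ) where
  resolution : FiniteProjectiveResolution (Env k A) A
  ψ : resolution.complex ⟶ dualShift (flip k A) d resolution.complex
  quasiIso : QuasiIso ψ
  selfDual : Nonempty (Homotopy
    (bidualShift (flip k A) d resolution.complex ≫ dualShiftMap (flip k A) d ψ) ψ)

end CalabiYau

/-! ## Hochschild cochains, cup product and Gerstenhaber bracket -/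

section Hochschild

/-- The quotient `Z / (Z ∩ B)` of a subspace `Z` of `M`. -/
def Subquotient {k : Type u} [Field k] {M : Type w} [AddCommGroup M] [Module k M]
    (Z B : Submodule k M) := Z ⧸ B.submoduleOf Z

instance {k : Type u} [Field k] {M : Type w} [AddCommGroup M] [Module k M]
    (Z B : Submodule k M) : AddCommGroup (Subquotient Z B) :=
  inferInstanceAs (AddCommGroup (Z ⧸ B.submoduleOf Z))

instance {k : Type u} [Field k] {M : Type w} [AddCommGroup M] [Module k M]
    (Z B : Submodule k M) : Module k (Subquotient Z B) :=
  inferInstanceAs (Module k (Z ⧸ B.submoduleOf Z))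

/-- The class of an element of `Z`. -/
def Subquotient.mk {k : Type u} [Field k] {M : Type w} [AddCommGroup M] [Module k M]
    {Z B : Submodule k M} (z : Z) : Subquotient Z B := (B.submoduleOf Z).mkQ z

/-- The arguments `(a_0, …, a_{j-1}, g(a_j, …, a_{j+n-1}), a_{j+n}, …, a_{p-1})`. -/
def insertArgs {A : Type v} {m n p : ℕ} (g : (Fin n → A) → A) (j : ℕ) (hj : j < m)
    (h : p + 1 = m + n) (a : Fin p → A) : Fin m → A := fun i =>
  if h₁ : i.1 < j then a ⟨i.1, by omega⟩
  else if h₂ : i.1 = j then g fun l => a ⟨j + l.1, by omega⟩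
  else a ⟨i.1 + n - 1, by omega⟩

theorem insertArgs_update {A : Type v} {m n p : ℕ} (g : (Fin n → A) → A) (j : ℕ)
    (hj : j < m) (h : p + 1 = m + n) (a : Fin p → A) (c : Fin p) :
    (∃ i : Fin m, ∀ x, insertArgs g j hj h (Function.update a c x) =
      Function.update (insertArgs g j hj h a) i x) ∨
    (∃ l : Fin n, ∀ x, insertArgs g j hj h (Function.update a c x) =
      Function.update (insertArgs g j hj h a) ⟨j, hj⟩
        (g (Function.update (fun l => a ⟨j + l.1, by omega⟩) l x))) := by
  rcases lt_or_ge c.1 j with hc | hc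
  · refine Or.inl ⟨⟨c.1, by omega⟩, fun x => funext fun i => ?_⟩
    have hg : (fun l : Fin n => Function.update a c x ⟨j + l.1, by omega⟩) =
        fun l => a ⟨j + l.1, by omega⟩ := funext fun l =>
      Function.update_of_ne (by intro e; have := congrArg Fin.val e; simp at this; omega) _ _
    rw [Function.update_apply]
    simp only [insertArgs, hg]
    clear hg
    split_ifs <;> first | rfl | grind [Function.update_apply]
  · rcases lt_or_ge c.1 (j + n) with hc' | hc'
    · refine Or.inr ⟨⟨c.1 - j, by omega⟩, fun x => funext fun i => ?_⟩
      have hg : (fun l : Fin n => Function.update a c x ⟨j + l.1, by omega⟩) =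
          Function.update (fun l : Fin n => a ⟨j + l.1, by omega⟩) ⟨c.1 - j, by omega⟩ x := by
        funext l
        grind [Function.update_apply]
      rw [Function.update_apply]
      simp only [insertArgs, hg]
      clear hg
      split_ifs <;> first | rfl | grind [Function.update_apply]
    · refine Or.inl ⟨⟨c.1 + 1 - n, by omega⟩, fun x => funext fun i => ?_⟩
      have hg : (fun l : Fin n => Function.update a c x ⟨j + l.1, by omega⟩) =
          fun l => a ⟨j + l.1, by omega⟩ := funext fun l =>
        Function.update_of_ne (by intro e; have := congrArg Fin.val e; simp at this; omega) _ _
      rw [Function.update_apply]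
      simp only [insertArgs, hg]
      clear hg
      split_ifs <;> first | rfl | grind [Function.update_apply]

variable (k : Type u) [Field k] (A : Type v) [Ring A] [Algebra k A]

/-- Hochschild cochains `C^n(A, A) = Hom_k(A^{⊗n}, A)`. -/
abbrev Cochain (n : ℕ) := MultilinearMap k (fun _ : Fin n => A) A

variable {k A}

/-- Insertion of the cochain `g` into the `j`-th argument (counted from `0`) of a multilinear
map `f` with `m` arguments. -/
def insertion {M : Type w} [AddCommMonoid M] [Module k M] {m n p : ℕ}
    (f : MultilinearMap k (fun _ : Fin m => A) M) (g : Cochain k A n) (j : ℕ) (hj : j < m)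
    (h : p + 1 = m + n) : MultilinearMap k (fun _ : Fin p => A) M :=
  MultilinearMap.mk' (fun a => f (insertArgs g j hj h a))
    (by
      intro a c x y
      rcases insertArgs_update g j hj h a c with ⟨i, hi⟩ | ⟨l, hl⟩
      · simp only [hi, MultilinearMap.map_update_add]
      · simp only [hl, MultilinearMap.map_update_add])
    (by
      intro a c r x
      rcases insertArgs_update g j hj h a c with ⟨i, hi⟩ | ⟨l, hl⟩
      · simp only [hi, MultilinearMap.map_update_smul]
      · simp only [hl, MultilinearMap.map_update_smul])

theorem insertion_apply {M : Type w} [AddCommMonoid M] [Module k M] {m n p : ℕ}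
    (f : MultilinearMap k (fun _ : Fin m => A) M) (g : Cochain k A n) (j : ℕ) (hj : j < m)
    (h : p + 1 = m + n) (a : Fin p → A) :
    insertion f g j hj h a = f (insertArgs g j hj h a) := rfl

variable (k A) in
/-- The multiplication of `A` as a cochain of degree two. -/
def mulCochain : Cochain k A 2 := MultilinearMap.mkPiAlgebraFin k 2 A

theorem mulCochain_apply (a : Fin 2 → A) : mulCochain k A a = a 0 * a 1 := by
  simp [mulCochain, List.ofFn_succ]

/-- The Hochschild differential
`(δf)(a_0, …, a_n) = a_0 f(a_1, …, a_n) + ∑_i (-1)^(i+1) f(…, a_i a_{i+1}, …)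
  + (-1)^(n+1) f(a_0, …, a_{n-1}) a_n`. -/
def delta (n : ℕ) : Cochain k A n →ₗ[k] Cochain k A (n + 1) where
  toFun f :=
    insertion (mulCochain k A) f 1 (by omega) (by omega) +
    ∑ i : Fin n, (-1 : k) ^ (i.1 + 1) • insertion f (mulCochain k A) i.1 i.2 (by omega) +
    (-1 : k) ^ (n + 1) • insertion (mulCochain k A) f 0 (by omega) (by omega)
  map_add' f g := by
    ext a
    simp [insertion_apply, mulCochain_apply, insertArgs, mul_add, add_mul,
      Finset.sum_add_distrib]
    abel
  map_smul' c f := by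
    ext a
    simp [insertion_apply, mulCochain_apply, insertArgs, Finset.smul_sum, smul_comm c]

/-- The cup product `(f ∪ g)(a_0, …, a_{m+n-1}) = (-1)^(mn) f(a_0, …, a_{m-1}) g(a_m, …)`. -/
def cup {m n : ℕ} (f : Cochain k A m) (g : Cochain k A n) : Cochain k A (m + n) :=
  (-1 : k) ^ (m * n) •
    insertion (insertion (p := m + 1) (mulCochain k A) f 0 (by omega) (by omega)) g m (by omega)
      (by omega)

/-- Gerstenhaber's product
`f ∘ g = ∑_j (-1)^((n-1)j) f(a_0, …, a_{j-1}, g(a_j, …, a_{j+n-1}), …)` in degree `p = m + n - 1`. -/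
def circ {m n p : ℕ} (f : Cochain k A m) (g : Cochain k A n) (h : p + 1 = m + n) :
    Cochain k A p :=
  ∑ j : Fin m, (-1 : k) ^ ((n + 1) * j.1) • insertion f g j.1 j.2 h

/-- The Gerstenhaber bracket `[f, g] = f ∘ g - (-1)^((m-1)(n-1)) g ∘ f`. -/
def bracket {m n p : ℕ} (f : Cochain k A m) (g : Cochain k A n) (h : p + 1 = m + n) :
    Cochain k A p :=
  circ f g h - (-1 : k) ^ ((m + 1) * (n + 1)) • circ g f (by omega)

variable (k A)

/-- Hochschild cocycles. -/
def Cocycles (n : ℕ) : Submodule k (Cochain k A n) := LinearMap.ker (delta n)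

/-- Hochschild coboundaries. -/
def coboundaries : ∀ n : ℕ, Submodule k (Cochain k A n)
  | 0 => ⊥
  | n + 1 => LinearMap.range (delta n)

/-- The Hochschild cohomology `HH^n(A, A)`. -/
abbrev HHCoh (n : ℕ) := Subquotient (Cocycles k A n) (coboundaries k A n)

/-- The total Hochschild cohomology `HH^*(A, A)`. -/
abbrev HHCohTot := DirectSum ℕ (HHCoh k A)

/-- The part of degree `i` of the total Hochschild cohomology (zero for `i < 0`). -/
def HHCohTot.deg (i : ℤ) : Submodule k (HHCohTot k A) :=
  ⨆ (n : ℕ) (_ : (n : ℤ) = i), LinearMap.range (DirectSum.lof k ℕ (HHCoh k A) n)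

variable {k A}

/-- The class of a cocycle. -/
def cohClass {n : ℕ} (f : Cocycles k A n) : HHCohTot k A :=
  DirectSum.lof k ℕ (HHCoh k A) n (Subquotient.mk f)

/-- The bilinear operation `mul` on `HH^*(A, A)` is the one induced by the cup product. -/
def IsCupProduct (mul : HHCohTot k A →ₗ[k] HHCohTot k A →ₗ[k] HHCohTot k A) : Prop :=
  ∀ (m n : ℕ) (f : Cocycles k A m) (g : Cocycles k A n),
    ∃ h : cup f.1 g.1 ∈ Cocycles k A (m + n), mul (cohClass f) (cohClass g) = cohClass ⟨_, h⟩

/-- The bilinear operation `br` on `HH^*(A, A)` is the one induced by the Gerstenhaber bracket; it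
is zero on two classes of degree zero, where it takes values in degree `-1`. -/
def IsGerstenhaberBracket (br : HHCohTot k A →ₗ[k] HHCohTot k A →ₗ[k] HHCohTot k A) : Prop :=
  (∀ (m n p : ℕ) (hp : p + 1 = m + n) (f : Cocycles k A m) (g : Cocycles k A n),
    ∃ h : bracket f.1 g.1 hp ∈ Cocycles k A p, br (cohClass f) (cohClass g) = cohClass ⟨_, h⟩) ∧
  ∀ f g : Cocycles k A 0, br (cohClass f) (cohClass g) = 0

/-! ## Hochschild chains, Connes operator and cap product -/

variable (k A)

/-- Hochschild chains `C_n(A, A) = A ⊗ A^{⊗n}`. -/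
abbrev Chain (n : ℕ) := PiTensorProduct k (fun _ : Fin (n + 1) => A)

/-- The universal multilinear map `(a_0, …, a_n) ↦ a_0 ⊗ … ⊗ a_n`. -/
abbrev pureTensor (n : ℕ) : MultilinearMap k (fun _ : Fin (n + 1) => A) (Chain k A n) :=
  PiTensorProduct.tprod k

/-- A multilinear map with its arguments rotated: `(a_0, …, a_n) ↦ f(a_n, a_0, …, a_{n-1})`. -/
def rotate {M : Type w} [AddCommMonoid M] [Module k M] {n : ℕ}
    (f : MultilinearMap k (fun _ : Fin (n + 1) => A) M) :
    MultilinearMap k (fun _ : Fin (n + 1) => A) M :=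
  f.domDomCongr (finRotate (n + 1)).symm

/-- The Hochschild boundary
`b(a_0 ⊗ … ⊗ a_{n+1}) = ∑_{i ≤ n} (-1)^i a_0 ⊗ … ⊗ a_i a_{i+1} ⊗ … ⊗ a_{n+1}
  + (-1)^(n+1) a_{n+1} a_0 ⊗ a_1 ⊗ … ⊗ a_n`. -/
def boundary (n : ℕ) : Chain k A (n + 1) →ₗ[k] Chain k A n :=
  PiTensorProduct.lift
    (∑ i : Fin (n + 1), (-1 : k) ^ i.1 •
      insertion (p := n + 2) (pureTensor k A n) (mulCochain k A) i.1 i.2 (by omega) +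
    (-1 : k) ^ (n + 1) •
      rotate k A (insertion (p := n + 2) (pureTensor k A n) (mulCochain k A) 0 (by omega)
        (by omega)))

/-- The signed cyclic operator `t(a_0 ⊗ … ⊗ a_n) = (-1)^n a_n ⊗ a_0 ⊗ … ⊗ a_{n-1}`. -/
def cyclic (n : ℕ) : Module.End k (Chain k A n) :=
  (-1 : k) ^ n • PiTensorProduct.lift (rotate k A (pureTensor k A n))

/-- The Connes operator `B = (1 - t) s N`, where `s(a_0 ⊗ … ⊗ a_n) = 1 ⊗ a_0 ⊗ … ⊗ a_n` and
`N = 1 + t + … + t^n`. -/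
def connes (n : ℕ) : Chain k A n →ₗ[k] Chain k A (n + 1) :=
  (1 - cyclic k A (n + 1)) ∘ₗ PiTensorProduct.lift ((pureTensor k A (n + 1)).curryLeft 1) ∘ₗ
    (∑ i ∈ Finset.range (n + 1), cyclic k A n ^ i)

/-- Hochschild cycles. -/
def Cycles : ∀ n : ℕ, Submodule k (Chain k A n)
  | 0 => ⊤
  | n + 1 => LinearMap.ker (boundary k A n)

/-- The Hochschild homology `HH_n(A, A)`. -/
abbrev HHHom (n : ℕ) := Subquotient (Cycles k A n) (LinearMap.range (boundary k A n))

/-- The total Hochschild homology `HH_*(A, A)`. -/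
abbrev HHHomTot := DirectSum ℕ (HHHom k A)

/-- The part of degree `i` of the total Hochschild homology (zero for `i < 0`). -/
def HHHomTot.deg (i : ℤ) : Submodule k (HHHomTot k A) :=
  ⨆ (n : ℕ) (_ : (n : ℤ) = i), LinearMap.range (DirectSum.lof k ℕ (HHHom k A) n)

variable {k A}

/-- The class of a cycle. -/
def homClass {n : ℕ} (z : Cycles k A n) : HHHomTot k A :=
  DirectSum.lof k ℕ (HHHom k A) n (Subquotient.mk z)

/-- The contraction of a chain of degree `d = m + n` with a cochain `f` of degree `n`:
`i_f(a_0 ⊗ … ⊗ a_d) = (-1)^n a_0 f(a_1, …, a_n) ⊗ a_{n+1} ⊗ … ⊗ a_d`. -/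
def contraction {m n d : ℕ} (h : m + n = d) (f : Cochain k A n) : Chain k A d →ₗ[k] Chain k A m :=
  (-1 : k) ^ n • PiTensorProduct.lift
    (insertion (p := d + 1) (pureTensor k A m)
      (insertion (p := n + 1) (mulCochain k A) f 1 (by omega) (by omega)) 0 (by omega) (by omega))

/-- The operation `B` on `HH_*(A, A)` is the one induced by the Connes operator. -/
def IsConnesOperator (B : HHHomTot k A →ₗ[k] HHHomTot k A) : Prop :=
  ∀ (n : ℕ) (z : Cycles k A n),
    ∃ h : connes k A n z.1 ∈ Cycles k A (n + 1), B (homClass z) = homClass ⟨_, h⟩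

/-- The isomorphism `D : HH_{d-*}(A, A) ≃ HH^*(A, A)` is the inverse of `f ↦ i_f c`, for a cycle `c`
of degree `d`. -/
def IsDualityIso {d : ℕ} (c : Cycles k A d) (D : HHHomTot k A ≃ₗ[k] HHCohTot k A) : Prop :=
  (∀ i : ℤ, ∀ x ∈ HHCohTot.deg k A i, D.symm x ∈ HHHomTot.deg k A (d - i)) ∧
  ∀ (m n : ℕ) (h : m + n = d) (f : Cocycles k A n),
    ∃ hz : contraction h f.1 c.1 ∈ Cycles k A m, D.symm (cohClass f) = homClass ⟨_, hz⟩

end Hochschild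

/-! ## The volume of a Calabi–Yau structure and the operator `Δ` -/

section Volume

variable {k : Type u} [Field k] {A : Type v} [Ring A] [Algebra k A]

attribute [local instance] TensorProduct.Algebra.module

/-- A morphism over `A` from the two-sided bar resolution `A ⊗ A^{⊗n} ⊗ A` to the resolution `P` by
bimodules, given by its values `map n (a_1, …, a_n)` on `1[a_1, …, a_n]1`. -/
structure BarComparison (P : FiniteProjectiveResolution (Env k A) A) where
  map : ∀ n : ℕ, MultilinearMap k (fun _ : Fin n => A)
    ((ModuleCat.restrictScalars (algebraMap k (Env k A))).obj (P.complex.X n))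
  augmentation_map : P.augmentation (map 0 ![]) = 1
  d_map : ∀ (n : ℕ) (a : Fin (n + 1) → A),
    (P.complex.d ((n + 1 : ℕ) : ℤ) (n : ℤ)).hom (map (n + 1) a) =
      ((a 0 ⊗ₜ 1 : Env k A) • (map n (Fin.tail a) : P.complex.X n) +
      ∑ i : Fin n, (-1 : ℤ) ^ (i.1 + 1) •
        (map n (insertArgs (mulCochain k A) i.1 i.2 (by omega) a) : P.complex.X n) +
      (-1 : ℤ) ^ (n + 1) • (1 ⊗ₜ MulOpposite.op (a (Fin.last n)) : Env k A) •
        (map n (Fin.init a) : P.complex.X n) : P.complex.X n)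

/-- The Hochschild cochain of degree `d` with values in `A^e` which represents the volume
`π = ψ(1)` of the Calabi–Yau structure `Ψ`. -/
def volume {d : ℕ} (Ψ : CalabiYauStructure k A d) (θ : BarComparison Ψ.resolution)
    (a : Fin d → A) : Env k A :=
  dualObj.toLin (flip k A) ((Ψ.ψ.f 0).hom (θ.map 0 ![]))
    ((Ψ.resolution.complex.XIsoOfEq (show (d : ℤ) = d - 0 by omega)).hom.hom (θ.map d a))

/-- The cycle `c` of degree `d` is dual to the volume of `Ψ`, so that its class is the one with
`D(c) = 1`: the pairing of the volume with `c`, given by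
`⟨x ⊗ y, a_0⟩ = y a_0 x` for `x ⊗ y = π(a_1, …, a_d)`, is `1`. -/
def IsFundamentalCycle {d : ℕ} (Ψ : CalabiYauStructure k A d) (c : Cycles k A d) : Prop :=
  ∃ (θ : BarComparison Ψ.resolution) (T : Chain k A d →ₗ[k] A),
    (∀ a : Fin (d + 1) → A,
      T (PiTensorProduct.tprod k a) = (flip k A).conj (volume Ψ θ (Fin.tail a)) • a 0) ∧
    T c.1 = 1

/-- The operator `Δ = D ∘ B ∘ D⁻¹` on `HH^*(A, A)`, where `D : HH_{d-*}(A, A) ≃ HH^*(A, A)` is the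
duality isomorphism of the Calabi–Yau structure `Ψ` and `B` the Connes operator. -/
def IsTransportedConnes {d : ℕ} (Ψ : CalabiYauStructure k A d)
    (Δ : HHCohTot k A →ₗ[k] HHCohTot k A) : Prop :=
  ∃ (c : Cycles k A d) (D : HHHomTot k A ≃ₗ[k] HHCohTot k A) (B : HHHomTot k A →ₗ[k] HHHomTot k A),
    IsFundamentalCycle Ψ c ∧ IsDualityIso c D ∧ IsConnesOperator B ∧
    Δ = D.toLinearMap ∘ₗ B ∘ₗ D.symm.toLinearMap

end Volume

/-! ## Batalin–Vilkovisky algebras -/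

/-- The sign `(-1)^i`. -/
abbrev sgn (i : ℤ) : ℤˣ := i.negOnePow

/-- Gerstenhaber algebras: a graded `k`-module with an associative, graded commutative product of
degree `0` and a bracket of degree `-1` which is a graded Lie bracket after a shift and a
derivation in each argument. -/
structure IsGerstenhaberAlgebra {k : Type u} [Field k] {H : Type w} [AddCommGroup H] [Module k H]
    (deg : ℤ → Submodule k H) (mul br : H →ₗ[k] H →ₗ[k] H) : Prop where
  internal : DirectSum.IsInternal deg
  mul_mem : ∀ i j, ∀ x ∈ deg i, ∀ y ∈ deg j, mul x y ∈ deg (i + j)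
  br_mem : ∀ i j, ∀ x ∈ deg i, ∀ y ∈ deg j, br x y ∈ deg (i + j - 1)
  assoc : ∀ x y z, mul (mul x y) z = mul x (mul y z)
  comm : ∀ i j, ∀ x ∈ deg i, ∀ y ∈ deg j, mul x y = sgn (i * j) • mul y x
  leibniz : ∀ i j l, ∀ x ∈ deg i, ∀ y ∈ deg j, ∀ z ∈ deg l,
    br x (mul y z) = mul (br x y) z + sgn ((i - 1) * j) • mul y (br x z)
  skew : ∀ i j, ∀ x ∈ deg i, ∀ y ∈ deg j, br x y = -(sgn ((i - 1) * (j - 1)) • br y x)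
  jacobi : ∀ i j l, ∀ x ∈ deg i, ∀ y ∈ deg j, ∀ z ∈ deg l,
    br (br x y) z = br x (br y z) - sgn ((i - 1) * (j - 1)) • br y (br x z)

/-- Batalin–Vilkovisky algebras: a Gerstenhaber algebra with an operator `Δ` of square zero which
changes the degree by the same amount as the bracket, and whose deviation from being a derivation is
the bracket. -/
structure IsBVAlgebra {k : Type u} [Field k] {H : Type w} [AddCommGroup H] [Module k H]
    (deg : ℤ → Submodule k H) (mul br : H →ₗ[k] H →ₗ[k] H) (Δ : H →ₗ[k] H) : Prop
    extends IsGerstenhaberAlgebra deg mul br where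
  Δ_mem : ∀ i, ∀ x ∈ deg i, Δ x ∈ deg (i - 1)
  Δ_sq : ∀ x, Δ (Δ x) = 0
  br_eq : ∀ i j, ∀ x ∈ deg i, ∀ y ∈ deg j,
    br x y = sgn i • Δ (mul x y) - sgn i • mul (Δ x) y - mul x (Δ y)

end

end CalabiYau

namespace CalabiYau

/-! ### Sums over splittings of words -/

section ListCalculus

variable {k : Type*} [Field k] {A : Type*} [Ring A] [Algebra k A]
  {W : Type*} [AddCommGroup W] [Module k W]

/-! All the calculus is done on words. A function `φ : List A → W` linear in every letter is a
functional on the tensor coalgebra, and `hat` precomposes it with the coderivation generated by a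
cochain. Composing two coderivations gives nested and disjoint insertions (`hat_hat`), and the
disjoint ones cancel in graded commutators. With the multiplication as one of the cochains, the
commutator is the Hochschild differential. This one identity therefore yields that the bracket
descends to cohomology and that the cup product is graded commutative there (`deltaWord_hat`).

Hochschild chains are seen through functions of words with a marked first letter. On them the Cartan
calculus holds up to explicit homotopies and signs: the Lie derivative `L_f` is the commutator of
`B` and `i_f` (`lieWord_eq_connes`), and the commutator of `L_f` with `i_g` is `i_[f,g]`
(`hochWord_sub_insideWord`). Hence `i_[f,g]` is the double commutator of `B` with `i_f` and `i_g`
(`capWord_bracketWord`). The formulas need normalized functions; these suffice because the bar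
resolution has an endomorphism homotopic to the identity which kills the degenerate words.

Now let `ψ` be any quasi-isomorphism from a finite projective resolution of `A` to its shifted dual;
moved to the bar resolution it is a sesquilinear pairing. The augmentation extends along `ψ` to a
functional on the dual, and finite projectivity represents this functional by a Hochschild cycle `c`
of degree `d` which pairs to `1` with the volume (`exists_cycle_of_functional`). Contracting the
pairing with `c` gives an endomorphism of the bar resolution over the identity of `A`, hence
homotopic to the identity. On Hochschild homology it is, up to sign, the composite of the map to
cohomology given by the pairing with `f ↦ i_f c`. The opposite composite comes from the transposed
pairing; its augmentation is a central element, and the first composite forces it to be `1`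
(`pairHom_self`). So `f ↦ i_f c` is an isomorphism, and homology and cohomology vanish above degree
`d`. The same value shows that `ψ` and its transpose agree on the functional. That functional
determines morphisms to the dual up to homotopy, so self-duality is automatic
(`exists_trace_eq_one`).

Under the duality isomorphism contractions become multiplications and `c` corresponds to the unit.
Thus multiplication by a bracket is the double commutator of `Δ` with two multiplications, and `Δ 1
= 0` because `B c` lies in `HH_{d+1} = 0`. The axioms are then formal (`isBVAlgebra_of_commutator`).

For `k[G]`, Poincaré duality gives a quasi-isomorphism from a resolution `P` of `k` to its shifted
dual (`FiniteProjectiveResolution.exists_duality`). Induction along `g ↦ g ⊗ g⁻¹` is exact, sends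
`k` to `k[G]`, and commutes with duals of finitely generated projectives. It therefore produces the
required quasi-isomorphism of bimodule complexes. -/

/-- The sum of `Φ u v` over all splittings `w = u ++ v`. -/
def cutSum {α W : Type*} [AddCommGroup W] : (List α → List α → W) → List α → W
  | Φ, [] => Φ [] []
  | Φ, a :: w => Φ [] (a :: w) + cutSum (fun u v => Φ (a :: u) v) w

@[simp] theorem cutSum_nil (Φ : List A → List A → W) : cutSum Φ [] = Φ [] [] := rfl

theorem cutSum_cons (Φ : List A → List A → W) (a : A) (w : List A) :
    cutSum Φ (a :: w) = Φ [] (a :: w) + cutSum (fun u v => Φ (a :: u) v) w := rfl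

theorem cutSum_congr {Φ Ψ : List A → List A → W} {w : List A}
    (h : ∀ u v, u ++ v = w → Φ u v = Ψ u v) : cutSum Φ w = cutSum Ψ w := by
  induction w generalizing Φ Ψ with
  | nil => exact h [] [] rfl
  | cons a w ih =>
    rw [cutSum_cons, cutSum_cons, h [] (a :: w) rfl, ih]
    intro u v huv
    exact h (a :: u) v (by rw [List.cons_append, huv])

theorem cutSum_add (Φ Ψ : List A → List A → W) (w : List A) :
    cutSum (fun u v => Φ u v + Ψ u v) w = cutSum Φ w + cutSum Ψ w := by
  induction w generalizing Φ Ψ with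
  | nil => rfl
  | cons a w ih => simp only [cutSum_cons, ih]; abel

theorem cutSum_map {W' : Type*} [AddCommGroup W'] (g : W →+ W') (Φ : List A → List A → W)
    (w : List A) : cutSum (fun u v => g (Φ u v)) w = g (cutSum Φ w) := by
  induction w generalizing Φ with
  | nil => rfl
  | cons a w ih => simp only [cutSum_cons, ih, map_add]

theorem cutSum_zero (w : List A) : cutSum (fun _ _ => (0 : W)) w = 0 := by
  induction w with
  | nil => rfl
  | cons a w ih => rw [cutSum_cons, ih, add_zero]

theorem cutSum_eq_zero {Φ : List A → List A → W} {w : List A}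
    (h : ∀ u v, u ++ v = w → Φ u v = 0) : cutSum Φ w = 0 := by
  rw [cutSum_congr h, cutSum_zero]

theorem cutSum_smul (c : k) (Φ : List A → List A → W) (w : List A) :
    cutSum (fun u v => c • Φ u v) w = c • cutSum Φ w :=
  cutSum_map (DistribSMul.toAddMonoidHom W c) Φ w

theorem cutSum_neg (Φ : List A → List A → W) (w : List A) :
    cutSum (fun u v => - Φ u v) w = - cutSum Φ w :=
  cutSum_map (-AddMonoidHom.id W) Φ w

theorem cutSum_sub (Φ Ψ : List A → List A → W) (w : List A) :
    cutSum (fun u v => Φ u v - Ψ u v) w = cutSum Φ w - cutSum Ψ w := by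
  simp only [sub_eq_add_neg, cutSum_add, cutSum_neg]

/-- A cut falls either before the marked letter or after it. Every computation around a marked
letter starts from this dichotomy. -/
theorem cutSum_append_cons (Φ : List A → List A → W) (x : List A) (a : A) (z : List A) :
    cutSum Φ (x ++ a :: z) = cutSum (fun u v => Φ u (v ++ a :: z)) x +
      cutSum (fun u v => Φ (x ++ a :: u) v) z := by
  induction x generalizing Φ with
  | nil => rfl
  | cons b x ih => simp only [List.cons_append, cutSum_cons, ih]; abel

theorem cutSum_concat (Φ : List A → List A → W) (w : List A) (a : A) :
    cutSum Φ (w ++ [a]) = cutSum (fun u v => Φ u (v ++ [a])) w + Φ (w ++ [a]) [] :=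
  cutSum_append_cons Φ w a []

/-- Coassociativity of deconcatenation: both sides run over the splittings into three words. -/
theorem cutSum_assoc (Ψ : List A → List A → List A → W) (w : List A) :
    cutSum (fun u v => cutSum (fun x y => Ψ x y v) u) w =
      cutSum (fun x r => cutSum (fun y v => Ψ x y v) r) w := by
  induction w generalizing Ψ with
  | nil => rfl
  | cons a w ih => simp only [cutSum_cons, cutSum_nil, cutSum_add, ih]; abel

/-- A sum over splittings in which only the left parts of length `n` contribute. -/
theorem cutSum_eq_of_length {Φ : List A → List A → W} {w : List A} (n : ℕ) (hn : n ≤ w.length)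
    (h : ∀ u v, u.length ≠ n → Φ u v = 0) : cutSum Φ w = Φ (w.take n) (w.drop n) := by
  induction w generalizing Φ n with
  | nil =>
    obtain rfl : n = 0 := by simpa using hn
    rfl
  | cons a w ih =>
    rw [cutSum_cons]
    cases n with
    | zero =>
      rw [cutSum_eq_zero, add_zero, List.take_zero, List.drop_zero]
      intro u v _
      exact h _ _ (by simp)
    | succ n =>
      rw [h [] _ (by simp), zero_add, ih n (by simpa using hn)]
      · rfl
      · intro u v hu
        exact h _ _ (by simpa using hu)

/-! ### Multilinear functions of words -/

variable (k) in
/-- Functions of words which are linear in every letter. -/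
structure IsMulti (φ : List A → W) : Prop where
  add : ∀ x a b z, φ (x ++ (a + b) :: z) = φ (x ++ a :: z) + φ (x ++ b :: z)
  smul : ∀ x (c : k) a z, φ (x ++ (c • a) :: z) = c • φ (x ++ a :: z)

namespace IsMulti

variable {φ ψ : List A → W}

theorem zero_letter (h : IsMulti k φ) (x z : List A) : φ (x ++ 0 :: z) = 0 := by
  have := h.smul x 0 0 z
  rwa [zero_smul, zero_smul] at this

/-- The linear map `a ↦ φ (x ++ a :: z)`. -/
def linear (h : IsMulti k φ) (x z : List A) : A →ₗ[k] W where
  toFun a := φ (x ++ a :: z)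
  map_add' a b := h.add x a b z
  map_smul' c a := h.smul x c a z

theorem head_zero (h : IsMulti k φ) (z : List A) : φ (0 :: z) = 0 := h.zero_letter [] z

theorem head_add (h : IsMulti k φ) (a b : A) (z : List A) :
    φ ((a + b) :: z) = φ (a :: z) + φ (b :: z) := h.add [] a b z

theorem head_smul (h : IsMulti k φ) (c : k) (a : A) (z : List A) :
    φ ((c • a) :: z) = c • φ (a :: z) := h.smul [] c a z

theorem append (h : IsMulti k φ) (x : List A) : IsMulti k fun l => φ (x ++ l) where
  add y a b z := by simpa using h.add (x ++ y) a b z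
  smul y c a z := by simpa using h.smul (x ++ y) c a z

theorem cons (h : IsMulti k φ) (a : A) : IsMulti k fun l => φ (a :: l) := h.append [a]

theorem append_right (h : IsMulti k φ) (r : List A) : IsMulti k fun l => φ (l ++ r) where
  add y a b z := by simpa using h.add y a b (z ++ r)
  smul y c a z := by simpa using h.smul y c a (z ++ r)

theorem sum_letter (h : IsMulti k φ) (x z w : List A) (F : List A → List A → A) :
    φ (x ++ cutSum F w :: z) = cutSum (fun u v => φ (x ++ F u v :: z)) w :=
  (cutSum_map (h.linear x z).toAddMonoidHom F w).symm

theorem zero : IsMulti k fun _ : List A => (0 : W) where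
  add _ _ _ _ := (add_zero 0).symm
  smul _ _ _ _ := (smul_zero _).symm

theorem fadd (h : IsMulti k φ) (h' : IsMulti k ψ) : IsMulti k fun l => φ l + ψ l where
  add x a b z := by rw [h.add, h'.add]; abel
  smul x c a z := by rw [h.smul, h'.smul, smul_add]

theorem map {W' : Type*} [AddCommGroup W'] [Module k W'] (h : IsMulti k φ) (g : W →ₗ[k] W') :
    IsMulti k fun l => g (φ l) where
  add x a b z := by rw [h.add, map_add]
  smul x c a z := by rw [h.smul, map_smul]

theorem fsmul (h : IsMulti k φ) (c : k) : IsMulti k fun l => c • φ l := h.map (c • LinearMap.id)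

theorem fneg (h : IsMulti k φ) : IsMulti k fun l => - φ l := h.map (-LinearMap.id)

theorem fsub (h : IsMulti k φ) (h' : IsMulti k ψ) : IsMulti k fun l => φ l - ψ l := by
  simpa only [sub_eq_add_neg] using h.fadd h'.fneg

theorem smul_length (h : IsMulti k φ) (c : ℕ → k) : IsMulti k fun l => c l.length • φ l where
  add x a b z := by simp only [List.length_append, List.length_cons]; rw [h.add, smul_add]
  smul x r a z := by simp only [List.length_append, List.length_cons]; rw [h.smul, smul_comm]

theorem letter (h : IsMulti k φ) {F : List A → A} (hF : IsMulti k F) (x z : List A) :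
    IsMulti k fun l => φ (x ++ F l :: z) := hF.map (h.linear x z)

theorem cutSum {Φ : List A → List A → W} (h₁ : ∀ v, IsMulti k fun u => Φ u v)
    (h₂ : ∀ u, IsMulti k (Φ u)) : IsMulti k (cutSum Φ) where
  add x a b z := by simp only [cutSum_append_cons, (h₂ _).add, (h₁ _).add, cutSum_add]; abel
  smul x c a z := by simp only [cutSum_append_cons, (h₂ _).smul, (h₁ _).smul, cutSum_smul, smul_add]

end IsMulti

/-! ### Coderivations -/

/-- Apply `F` to an initial part of the word. -/
def start (F : List A → A) (φ : List A → W) (l : List A) : W := cutSum (fun u v => φ (F u :: v)) l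

/-- The coderivation of the tensor coalgebra determined by `F`, with `e` the sign for passing a
letter: the sum of `e^|x| φ(x ++ F y :: z)` over all splittings `x ++ y ++ z` of a word. -/
def hat (e : k) (F : List A → A) (φ : List A → W) (l : List A) : W :=
  cutSum (fun x r => e ^ x.length • start F (fun l => φ (x ++ l)) r) l

variable (e : k) (F G : List A → A) (φ ψ : List A → W)

theorem hat_nil : hat e F φ [] = start F φ [] := by simp [hat]

theorem hat_cons (a : A) (l : List A) :
    hat e F φ (a :: l) = start F φ (a :: l) + e • hat e F (fun l => φ (a :: l)) l := by
  simp only [hat, cutSum_cons, List.length_nil, pow_zero, one_smul, List.nil_append,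
    List.length_cons, pow_succ', mul_smul, cutSum_smul, List.cons_append]

theorem start_nil : start F φ [] = φ [F []] := rfl

theorem start_cons (a : A) (l : List A) :
    start F φ (a :: l) = φ (F [] :: a :: l) + start (fun u => F (a :: u)) φ l := rfl

variable {F G φ ψ}

theorem IsMulti.start (hF : IsMulti k F) (hφ : IsMulti k φ) : IsMulti k (start F φ) :=
  IsMulti.cutSum (fun v => hφ.letter hF [] v) (fun _ => hφ.cons _)

theorem IsMulti.hat (hF : IsMulti k F) (hφ : IsMulti k φ) : IsMulti k (hat e F φ) := by
  refine IsMulti.cutSum (fun v => ?_) fun u => ?_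
  · refine IsMulti.smul_length (φ := fun u => CalabiYau.start F (fun l => φ (u ++ l)) v) ?_
      fun n => e ^ n
    constructor
    · intro x a b z
      simp only [CalabiYau.start, List.append_assoc, List.cons_append, hφ.add, cutSum_add]
    · intro x c a z
      simp only [CalabiYau.start, List.append_assoc, List.cons_append, hφ.smul, cutSum_smul]
  · exact (hF.start (hφ.append u)).fsmul _

theorem start_map {W' : Type*} [AddCommGroup W'] (g : W →+ W') (l : List A) :
    start F (fun l => g (φ l)) l = g (start F φ l) := cutSum_map g _ l

theorem hat_map {W' : Type*} [AddCommGroup W'] [Module k W'] (g : W →ₗ[k] W') (l : List A) :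
    hat e F (fun l => g (φ l)) l = g (hat e F φ l) := by
  induction l generalizing φ with
  | nil => simp only [hat_nil]; exact start_map g.toAddMonoidHom _
  | cons a l ih =>
    rw [hat_cons, hat_cons, ih, map_add, map_smul]
    congr 1
    exact start_map g.toAddMonoidHom _

theorem start_add (l : List A) :
    start F (fun l => φ l + ψ l) l = start F φ l + start F ψ l := cutSum_add _ _ l

theorem hat_add (l : List A) :
    hat e F (fun l => φ l + ψ l) l = hat e F φ l + hat e F ψ l := by
  simp only [hat, start_add, smul_add, cutSum_add]

theorem hat_smul (c : k) (l : List A) : hat e F (fun l => c • φ l) l = c • hat e F φ l :=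
  hat_map e (F := F) (φ := φ) (c • LinearMap.id) l

theorem hat_neg (l : List A) : hat e F (fun l => - φ l) l = - hat e F φ l :=
  hat_map e (F := F) (φ := φ) (-LinearMap.id) l

theorem hat_zero (l : List A) : hat e F (fun _ => (0 : W)) l = 0 := by
  simpa using hat_smul e (F := F) (φ := fun _ => (0 : W)) 0 l

theorem start_add_left (hφ : IsMulti k φ) (l : List A) :
    start (fun l => F l + G l) φ l = start F φ l + start G φ l := by
  simp only [start, hφ.head_add, cutSum_add]

theorem start_smul_left (hφ : IsMulti k φ) (c : k) (l : List A) :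
    start (fun l => c • F l) φ l = c • start F φ l := by
  simp only [start, hφ.head_smul, cutSum_smul]

theorem hat_add_left (hφ : IsMulti k φ) (l : List A) :
    hat e (fun l => F l + G l) φ l = hat e F φ l + hat e G φ l := by
  simp only [hat, fun x => start_add_left (F := F) (G := G) (hφ.append x), smul_add, cutSum_add]

theorem hat_smul_left (hφ : IsMulti k φ) (c : k) (l : List A) :
    hat e (fun l => c • F l) φ l = c • hat e F φ l := by
  simp only [hat, fun x => start_smul_left (F := F) (hφ.append x), smul_comm _ c, cutSum_smul]

/-- Coderivations are compatible with splitting words. -/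
theorem hat_cutSum (Φ : List A → List A → W) (w : List A) :
    hat e G (cutSum Φ) w = cutSum (fun u v => hat e G (fun u => Φ u v) u +
      e ^ u.length • hat e G (Φ u) v) w := by
  induction w generalizing Φ with
  | nil => simp [hat_nil, start_nil, cutSum_cons, add_comm]
  | cons a w ih =>
    have h := cutSum_assoc (fun y u v => Φ (G y :: u) v) (a :: w)
    rw [cutSum_cons] at h
    simp only [hat_cons, cutSum_cons, hat_nil, hat_add, ih, start, List.length_nil,
      List.length_cons, pow_zero, one_smul, cutSum_add, pow_succ', mul_smul, cutSum_smul,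
      smul_add, cutSum_nil] at h ⊢
    linear_combination (norm := module) (-1 : k) • h

/-- The part of the composition of two coderivations in which `F` and `G` are applied to disjoint
parts of the word. -/
def disjointPart (eF eG : k) (F G : List A → A) (φ : List A → W) (l : List A) : W :=
  cutSum (fun x r => (eF * eG) ^ x.length • cutSum (fun y z =>
    eG ^ y.length • hat eG G (fun z => φ (x ++ F y :: z)) z +
      eF • hat eF F (fun z => φ (x ++ G y :: z)) z) r) l

theorem disjointPart_nil (eF eG : k) : disjointPart eF eG F G φ [] =
    φ [F [], G []] + eF • φ [G [], F []] := by
  simp [disjointPart, hat_nil, start_nil]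

theorem disjointPart_cons (eF eG : k) (a : A) (l : List A) : disjointPart eF eG F G φ (a :: l) =
    cutSum (fun y z => eG ^ y.length • hat eG G (fun z => φ (F y :: z)) z +
      eF • hat eF F (fun z => φ (G y :: z)) z) (a :: l) +
    (eF * eG) • disjointPart eF eG F G (fun l => φ (a :: l)) l := by
  rw [disjointPart, cutSum_cons]
  simp only [List.length_nil, pow_zero, one_smul, List.nil_append, List.length_cons, pow_succ',
    mul_smul, cutSum_smul, List.cons_append]
  rfl

theorem hat_letter (hφ : IsMulti k φ) (z l : List A) :
    hat e G (fun u => φ (F u :: z)) l = φ (hat e G F l :: z) :=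
  hat_map e (hφ.linear [] z) l

/-- On the word, `G` acts before `F`. Its output is either one of the arguments of `F`, which gives
the coderivation of the nested insertion, or it stays outside the block of `F`, which gives
`disjointPart`. This is the pre-Lie structure behind the Gerstenhaber bracket. -/
theorem hat_hat (hφ : IsMulti k φ) (eF eG : k) (l : List A) :
    hat eG G (hat eF F φ) l = hat (eF * eG) (hat eG G F) φ l + disjointPart eF eG F G φ l := by
  induction l generalizing φ with
  | nil =>
    simp [hat_nil, start_nil, hat_cons, start_cons, disjointPart_nil]
    abel
  | cons a l ih =>
    rw [hat_cons eG]
    have h1 : ∀ l', hat eF F φ (a :: l') = start F φ (a :: l') +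
      eF • hat eF F (fun l => φ (a :: l)) l' := fun l' => hat_cons _ _ _ _ _
    simp only [h1, hat_add, hat_smul, ih (hφ.cons a), disjointPart_cons, hat_cons (eF * eG)]
    -- `start F φ` is itself a sum over cuts, so `G` acts either within the initial block consumed
    -- by `F` or within the remainder.
    have h2 := hat_cutSum eG (G := G) (fun u v => φ (F u :: v)) (a :: l)
    rw [hat_cons] at h2
    change start G (start F φ) (a :: l) + eG • hat eG G (fun l => start F φ (a :: l)) l = _ at h2
    simp only [hat_letter eG hφ, cutSum_add] at h2 ⊢
    have h3 : start G (hat eF F φ) (a :: l) = start G (start F φ) (a :: l) +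
        cutSum (fun y z => eF • hat eF F (fun z => φ (G y :: z)) z) (a :: l) := by
      simp only [start, ← cutSum_add]
      exact cutSum_congr fun u v _ => hat_cons _ _ _ _ _
    rw [h3]
    simp only [smul_add, smul_smul, mul_comm eG eF]
    rw [eq_sub_of_add_eq h2]
    simp only [start]
    abel

/-- Two disjoint insertions may be made in either order. The conditions on `κ` are exactly what is
needed for blocks of length `m` and `n`; blocks of any other length contribute zero. -/
theorem disjointPart_symm (hφ : IsMulti k φ) {m n : ℕ} (eF eG κ : k)
    (hF : ∀ l, l.length ≠ m → F l = 0) (hG : ∀ l, l.length ≠ n → G l = 0)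
    (h1 : eG ^ m = κ * eG) (h2 : κ * eF ^ n = eF) (l : List A) :
    disjointPart eF eG F G φ l = κ • disjointPart eG eF G F φ l := by
  simp only [disjointPart, ← cutSum_smul, mul_comm eG eF]
  refine cutSum_congr fun x r _ => ?_
  refine cutSum_congr fun y z _ => ?_
  rw [smul_comm κ]
  congr 1
  have key1 : eG ^ y.length • hat eG G (fun z => φ (x ++ F y :: z)) z =
      κ • eG • hat eG G (fun z => φ (x ++ F y :: z)) z := by
    by_cases hy : y.length = m
    · rw [hy, h1, mul_smul]
    · simp only [hF y hy, hφ.zero_letter, hat_zero, smul_zero]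
  have key2 : κ • eF ^ y.length • hat eF F (fun z => φ (x ++ G y :: z)) z =
      eF • hat eF F (fun z => φ (x ++ G y :: z)) z := by
    by_cases hy : y.length = n
    · rw [hy, smul_smul, h2]
    · simp only [hG y hy, hφ.zero_letter, hat_zero, smul_zero]
  rw [smul_add, key1, key2, add_comm]

end ListCalculus

end CalabiYau

namespace CalabiYau

/-! ### Hochschild differential, cup product and bracket on words -/

section ListCalculus

variable {k : Type*} [Field k] {A : Type*} [Ring A] [Algebra k A]
  {W : Type*} [AddCommGroup W] [Module k W]

/-- The projection of words to words of length one. -/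
def letter : List A → A
  | [a] => a
  | _ => 0

/-- The multiplication as a function of words of length two. -/
def mulWord : List A → A
  | [] => 0
  | a :: l => a * letter l

theorem letter_append_cons (x z : List A) (a : A) :
    letter (x ++ a :: z) = if x = [] ∧ z = [] then a else 0 := by
  rcases x with _ | ⟨b, x⟩
  · rcases z with _ | ⟨c, z⟩ <;> simp [letter]
  · rcases x with _ | ⟨c, x⟩ <;> simp [letter]

theorem letter_isMulti : IsMulti k (letter (A := A)) where
  add x a b z := by simp only [letter_append_cons]; split_ifs <;> simp
  smul x c a z := by simp only [letter_append_cons]; split_ifs <;> simp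

theorem letter_eq_zero {l : List A} (h : l.length ≠ 1) : letter l = 0 := by
  rcases l with _ | ⟨a, _ | ⟨b, l⟩⟩
  · rfl
  · simp at h
  · rfl

theorem IsMulti.mul_left {F : List A → A} (h : IsMulti k F) (a : A) :
    IsMulti k fun l => a * F l := h.map (LinearMap.mulLeft k a)

theorem IsMulti.mul_right {F : List A → A} (h : IsMulti k F) (a : A) :
    IsMulti k fun l => F l * a := h.map (LinearMap.mulRight k a)

theorem mulWord_isMulti : IsMulti k (mulWord (A := A)) where
  add x a b z := by
    rcases x with _ | ⟨c, x⟩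
    · simp [mulWord, add_mul]
    · exact ((letter_isMulti (k := k)).mul_left c).add x a b z
  smul x r a z := by
    rcases x with _ | ⟨c, x⟩
    · simp [mulWord]
    · exact ((letter_isMulti (k := k)).mul_left c).smul x r a z

theorem mulWord_eq_zero {l : List A} (h : l.length ≠ 2) : mulWord l = 0 := by
  rcases l with _ | ⟨a, l⟩
  · rfl
  · rw [mulWord, letter_eq_zero (by simpa using h), mul_zero]

/-- A sum over splittings whose left part must be a single letter. -/
theorem cutSum_letter_cons {Φ : A → List A → W} (h : ∀ v, Φ 0 v = 0) (a : A) (w : List A) :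
    cutSum (fun u v => Φ (letter u) v) (a :: w) = Φ a w := by
  rw [cutSum_eq_of_length 1 (by simp) fun u v hu => by rw [letter_eq_zero hu, h]]
  rfl

theorem cutSum_letter_concat {Φ : List A → A → W} (h : ∀ u, Φ u 0 = 0) (w : List A) (a : A) :
    cutSum (fun u v => Φ u (letter v)) (w ++ [a]) = Φ w a := by
  rw [cutSum_concat]
  change _ + Φ _ 0 = _
  rw [h, add_zero]
  induction w generalizing Φ with
  | nil => rfl
  | cons b w ih =>
    rw [cutSum_cons, letter_eq_zero (by simp), h, zero_add]
    exact ih (Φ := fun u x => Φ (b :: u) x) fun u => h _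

variable (k) in
/-- The differential of the bar construction: the coderivation of the multiplication. -/
abbrev barWord (φ : List A → W) : List A → W := hat (-1 : k) mulWord φ

variable {φ : List A → W}

theorem barWord_nil (hφ : IsMulti k φ) : barWord k φ [] = 0 := by
  rw [barWord, hat_nil, start_nil]
  exact hφ.head_zero _

theorem barWord_cons (hφ : IsMulti k φ) (a : A) (l : List A) : barWord k φ (a :: l) =
    cutSum (fun u v => φ (a * letter u :: v)) l - barWord k (fun l => φ (a :: l)) l := by
  rw [barWord, hat_cons, start, cutSum_cons, mulWord, hφ.head_zero, zero_add, neg_one_smul,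
    sub_eq_add_neg]
  rfl

theorem IsMulti.barWord (hφ : IsMulti k φ) : IsMulti k (barWord k φ) := mulWord_isMulti.hat _ hφ

/-- A product of neighbours lies to the left of `a`, involves `a` with its left or with its right
neighbour, or lies to the right of `a`. -/
theorem barWord_append_cons (hφ : IsMulti k φ) (v : List A) (a : A) (u : List A) :
    barWord k φ (v ++ a :: u) = barWord k (fun x => φ (x ++ a :: u)) v +
      cutSum (fun x y => (-1 : k) ^ x.length • φ (x ++ letter y * a :: u)) v +
      (-1 : k) ^ v.length • (cutSum (fun x y => φ (v ++ a * letter x :: y)) u -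
        barWord k (fun l => φ (v ++ a :: l)) u) := by
  induction v generalizing φ with
  | nil =>
    rw [barWord_nil (hφ.append_right _)]
    simp [barWord_cons hφ, letter, hφ.head_zero]
  | cons b v ih =>
    rw [List.cons_append, barWord_cons hφ, ih (hφ.cons b), barWord_cons (hφ.append_right _)]
    rw [cutSum_append_cons, cutSum_cons]
    simp only [List.length_cons, pow_succ', neg_one_mul, neg_smul, cutSum_neg, List.length_nil,
      pow_zero, one_smul, List.nil_append, List.cons_append, letter_append_cons]
    -- The letter `b` meets `a` only if nothing separates them; this product belongs to the middle
    -- sum of the claim, where `h2` finds it again.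
    have h1 : cutSum (fun u_1 v_1 => φ (b * (if v = [] ∧ u_1 = [] then a else 0) :: v_1)) u =
        if v = [] then φ (b * a :: u) else 0 := by
      rcases u with _ | ⟨c, u⟩
      · by_cases hv : v = [] <;> simp [hv, hφ.head_zero]
      · rw [cutSum_cons, cutSum_eq_zero, add_zero]
        · by_cases hv : v = [] <;> simp [hv, hφ.head_zero]
        · intro _ _ _; simp [hφ.head_zero]
    have h2 : φ (letter (b :: v) * a :: u) = if v = [] then φ (b * a :: u) else 0 := by
      rcases v with _ | ⟨c, v⟩
      · simp [letter]
      · simp [letter, hφ.head_zero]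
    rw [h1, h2]
    abel

section Supported

variable {e : k} {F G : List A → A} {m n : ℕ}

/-- Inserting a map of arity `m` shortens a word by `m - 1`. Since `c * c = 1`, the exponent may be
shifted by `m + 1` instead, which avoids subtraction. -/
theorem hat_smul_pow_length {c : k} (hc : c * c = 1) (hφ : IsMulti k φ)
    (hF : ∀ l, l.length ≠ m → F l = 0) (l : List A) :
    hat e F (fun l => c ^ l.length • φ l) l = c ^ (l.length + m + 1) • hat e F φ l := by
  simp only [hat, start, ← cutSum_smul]
  refine cutSum_congr fun x r hx => ?_
  refine cutSum_congr fun y z hy => ?_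
  rw [smul_comm _ (e ^ x.length)]
  congr 1
  by_cases h : y.length = m
  · subst hy hx h
    simp only [List.length_append, List.length_cons]
    rw [show x.length + (y.length + z.length) + y.length + 1 =
      x.length + (z.length + 1) + y.length * 2 by ring, pow_add c _ (y.length * 2), pow_mul',
      pow_two, hc, one_pow, mul_one]
  · rw [hF y h, hφ.zero_letter, smul_zero, smul_zero]

theorem hat_cutSum_param {Ψ : List A → List A → List A → W} (v l : List A) :
    hat e F (fun u => cutSum (fun x y => Ψ x y u) v) l =
      cutSum (fun x y => hat e F (Ψ x y) l) v := by
  induction v generalizing Ψ with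
  | nil => rfl
  | cons a v ih =>
    simp only [cutSum_cons, hat_add]
    rw [ih (Ψ := fun x y u => Ψ (a :: x) y u)]

/-- The two coderivations act on different words, so they commute without a sign. -/
theorem hat_comm_param {e' : k} {Φ : List A → List A → W} (v l : List A) :
    hat e F (fun u => hat e' G (fun x => Φ x u) v) l =
      hat e' G (fun x => hat e F (Φ x) l) v := by
  change hat e F (fun u => cutSum (fun x r => e' ^ x.length •
    cutSum (fun y z => Φ (x ++ G y :: z) u) r) v) l = cutSum (fun x r => e' ^ x.length •
    cutSum (fun y z => hat e F (Φ (x ++ G y :: z)) l) r) v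
  simp only [hat_cutSum_param, hat_smul]

/-- A coderivation is determined by its projection to cogenerators, and `letter` is that projection:
an insertion leaves a single letter only if it consumes the whole word. -/
theorem hat_letter_eq (l : List A) : hat e F letter l = F l := by
  induction l with
  | nil => rw [hat_nil]; rfl
  | cons a l ih =>
    have h : hat e F (fun l => letter (a :: l)) l = 0 := by
      rw [hat]
      refine cutSum_eq_zero fun x r _ => ?_
      rw [start, cutSum_eq_zero, smul_zero]
      intro y z _
      exact letter_eq_zero (by simp)
    rw [hat_cons, h, smul_zero, add_zero, start, ← List.append_nil (a :: l)]
    have : ∀ l : List A, cutSum (fun u v => letter (F u :: v)) l = F l := by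
      intro l
      induction l using List.reverseRecOn with
      | nil => rfl
      | append_singleton l b _ =>
        rw [cutSum_concat, cutSum_eq_zero, zero_add]
        · rfl
        · intro u v _
          exact letter_eq_zero (by simp)
    exact this _

theorem cutSum_smul_self (c : k) (Φ : List A → List A → A) (w : List A) :
    cutSum (fun u v => c • Φ u v) w = c • cutSum Φ w := cutSum_smul c Φ w

/-- The cup product without sign. -/
def cupWord (F G : List A → A) (l : List A) : A := cutSum (fun u v => F u * G v) l

/-- Two letters remain after an insertion only if the block of `F` omits exactly the last or exactly
the first letter. -/
theorem hat_mulWord (l : List A) :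
    hat e F mulWord l = cupWord F letter l + e • cupWord letter F l := by
  rcases l with _ | ⟨a, l⟩
  · simp [hat_nil, start_nil, cupWord, mulWord, letter]
  · rw [hat_cons]
    congr 1
    change e • hat e F (fun l => LinearMap.mulLeft k a (letter l)) l = _
    rw [hat_map, hat_letter_eq]
    congr 1
    exact (cutSum_letter_cons (Φ := fun x v => x * F v) (fun v => zero_mul _) a l).symm

/-- Words functions which are cochains of arity `n`. -/
structure IsCochain (k : Type*) [Field k] {A : Type*} [Ring A] [Algebra k A] (n : ℕ)
    (F : List A → A) : Prop where
  multi : IsMulti k F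
  supp : ∀ l, l.length ≠ n → F l = 0

/-- The Hochschild differential of a cochain of arity `n`. -/
def deltaWord (k : Type*) [Field k] {A : Type*} [Ring A] [Algebra k A] (n : ℕ) (F : List A → A)
    (l : List A) : A :=
  cupWord letter F l - barWord k F l + (-1 : k) ^ (n + 1) • cupWord F letter l

structure IsCocycle (k : Type*) [Field k] {A : Type*} [Ring A] [Algebra k A] (n : ℕ)
    (F : List A → A) : Prop extends IsCochain k n F where
  closed : ∀ l, deltaWord k n F l = 0

theorem sign_sq (n : ℕ) : (-1 : k) ^ n * (-1) ^ n = 1 := by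
  rw [← mul_pow, neg_one_mul, neg_neg, one_pow]

/-- The Hochschild differential is the commutator with the multiplication. In this form cocycles are
the cochains whose coderivation commutes, up to sign, with the bar differential. -/
theorem deltaWord_eq_hat (l : List A) : deltaWord k n F l =
    (-1 : k) ^ (n + 1) • hat ((-1 : k) ^ (n + 1)) F mulWord l - barWord k F l := by
  rw [hat_mulWord, smul_add, smul_smul, sign_sq, one_smul, deltaWord]
  abel

theorem IsCocycle.hat_mulWord_eq (hF : IsCocycle k n F) (l : List A) :
    hat ((-1 : k) ^ (n + 1)) F mulWord l = (-1 : k) ^ (n + 1) • barWord k F l := by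
  have h := hF.closed l
  rw [deltaWord_eq_hat, sub_eq_zero] at h
  rw [← h, smul_smul, sign_sq, one_smul]

theorem cupWord_assoc {H : List A → A} (l : List A) :
    cupWord (cupWord F G) H l = cupWord F (cupWord G H) l := by
  have h1 : ∀ (l : List A) (x : A), cutSum (fun u v => F u * G v) l * x =
      cutSum (fun u v => F u * G v * x) l := fun l x =>
    (cutSum_map (AddMonoidHom.mulRight x) _ l).symm
  have h2 : ∀ (l : List A) (x : A), x * cutSum (fun u v => G u * H v) l =
      cutSum (fun u v => x * (G u * H v)) l := fun l x =>
    (cutSum_map (AddMonoidHom.mulLeft x) _ l).symm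
  simp only [cupWord, h1, h2, ← mul_assoc]
  exact cutSum_assoc (fun x y v => F x * G y * H v) l

theorem IsCochain.cup (hF : IsCochain k m F) (hG : IsCochain k n G) :
    IsCochain k (m + n) (cupWord F G) where
  multi := IsMulti.cutSum (fun v => hF.multi.mul_right (G v)) fun u => hG.multi.mul_left (F u)
  supp l hl := cutSum_eq_zero fun u v huv => by
    by_cases hu : u.length = m
    · rw [hG.supp v, mul_zero]
      rintro rfl
      apply hl
      rw [← huv, List.length_append, hu]
    · rw [hF.supp u hu, zero_mul]

theorem barWord_cupWord (hF : IsCochain k m F) (l : List A) :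
    barWord k (cupWord F G) l =
      cupWord (barWord k F) G l + (-1 : k) ^ m • cupWord F (barWord k G) l := by
  have h := hat_cutSum (-1 : k) (G := mulWord) (fun u v => F u * G v) l
  change barWord k (cupWord F G) l = _ at h
  rw [h, cutSum_add, cupWord, cupWord, ← cutSum_smul_self]
  congr 1
  · refine cutSum_congr fun u v _ => ?_
    exact hat_map (-1 : k) (LinearMap.mulRight k (G v)) u
  · refine cutSum_congr fun u v _ => ?_
    rw [show hat (-1 : k) mulWord (fun v => F u * G v) v = F u * barWord k G v from
      hat_map (-1 : k) (LinearMap.mulLeft k (F u)) v]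
    by_cases hu : u.length = m
    · rw [hu]
    · rw [hF.supp u hu, zero_mul, smul_zero, smul_zero]

theorem cupWord_add_left {F' : List A → A} (l : List A) :
    cupWord (fun l => F l + F' l) G l = cupWord F G l + cupWord F' G l := by
  simp only [cupWord, add_mul, cutSum_add]

theorem cupWord_sub_left {F' : List A → A} (l : List A) :
    cupWord (fun l => F l - F' l) G l = cupWord F G l - cupWord F' G l := by
  simp only [cupWord, sub_mul, cutSum_sub]

theorem cupWord_smul_left (c : k) (l : List A) :
    cupWord (fun l => c • F l) G l = c • cupWord F G l := by
  simp only [cupWord, smul_mul_assoc, cutSum_smul_self]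

theorem cupWord_add_right {G' : List A → A} (l : List A) :
    cupWord F (fun l => G l + G' l) l = cupWord F G l + cupWord F G' l := by
  simp only [cupWord, mul_add, cutSum_add]

theorem cupWord_sub_right {G' : List A → A} (l : List A) :
    cupWord F (fun l => G l - G' l) l = cupWord F G l - cupWord F G' l := by
  simp only [cupWord, mul_sub, cutSum_sub]

theorem cupWord_smul_right (c : k) (l : List A) :
    cupWord F (fun l => c • G l) l = c • cupWord F G l := by
  simp only [cupWord, mul_smul_comm, cutSum_smul_self]

/-- The summands with a single letter between `F` and `G` occur in both terms on the right with
opposite signs and cancel. -/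
theorem deltaWord_cupWord (hF : IsCochain k m F) (l : List A) :
    deltaWord k (m + n) (cupWord F G) l =
      cupWord (deltaWord k m F) G l + (-1 : k) ^ m • cupWord F (deltaWord k n G) l := by
  have h1 : cupWord (deltaWord k m F) G l = cupWord (cupWord letter F) G l -
      cupWord (barWord k F) G l + (-1 : k) ^ (m + 1) • cupWord (cupWord F letter) G l := by
    rw [← cupWord_smul_left, ← cupWord_sub_left, ← cupWord_add_left]; rfl
  have h2 : cupWord F (deltaWord k n G) l = cupWord F (cupWord letter G) l -
      cupWord F (barWord k G) l + (-1 : k) ^ (n + 1) • cupWord F (cupWord G letter) l := by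
    rw [← cupWord_smul_right, ← cupWord_sub_right, ← cupWord_add_right]; rfl
  rw [h1, h2, deltaWord, barWord_cupWord hF]
  simp only [cupWord_assoc]
  module

theorem IsCocycle.cup (hF : IsCocycle k m F) (hG : IsCocycle k n G) :
    IsCocycle k (m + n) (cupWord F G) where
  toIsCochain := hF.toIsCochain.cup hG.toIsCochain
  closed l := by
    rw [deltaWord_cupWord hF.toIsCochain, funext hF.closed, funext hG.closed]
    simp only [cupWord, zero_mul, mul_zero, cutSum_zero, smul_zero, add_zero]

/-! ### The bracket -/

/-- Apply `hat_hat` to `F` and the multiplication in both orders. The disjoint parts agree up to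
sign, and the two nested parts combine to the Hochschild differential of `F`. -/
theorem hat_barWord (hF : IsCochain k n F) (hφ : IsMulti k φ) (l : List A) :
    hat ((-1 : k) ^ (n + 1)) F (barWord k φ) l =
      (-1 : k) ^ (n + 1) • barWord k (hat ((-1 : k) ^ (n + 1)) F φ) l +
      (-1 : k) ^ (n + 1) • hat ((-1 : k) ^ n) (deltaWord k n F) φ l := by
  have hee := sign_sq (k := k) (n + 1)
  have h1 := hat_hat (F := mulWord) (G := F) hφ (-1 : k) ((-1 : k) ^ (n + 1)) l
  have h2 := hat_hat (F := F) (G := mulWord) hφ ((-1 : k) ^ (n + 1)) (-1 : k) l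
  rw [disjointPart_symm (F := mulWord) (m := 2) (n := n) hφ (-1 : k) ((-1 : k) ^ (n + 1)) ((-1 : k) ^ (n + 1))
    (fun _ h => mulWord_eq_zero h) hF.supp (pow_two _)
    (by rw [pow_succ, mul_comm, ← mul_assoc, sign_sq, one_mul])] at h1
  have hs : ((-1 : k) ^ (n + 1) * -1) = (-1) ^ n := by rw [pow_succ]; ring
  rw [mul_comm, hs] at h1
  rw [hs] at h2
  change barWord k (hat ((-1 : k) ^ (n + 1)) F φ) l =
    hat ((-1 : k) ^ n) (barWord k F) φ l + _ at h2
  have h3 : hat ((-1 : k) ^ n) (deltaWord k n F) φ l = (-1 : k) ^ (n + 1) •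
      hat ((-1 : k) ^ n) (hat ((-1 : k) ^ (n + 1)) F mulWord) φ l -
        hat ((-1 : k) ^ n) (barWord k F) φ l := by
    rw [← hat_smul_left _ hφ, sub_eq_add_neg, ← neg_one_smul k (hat _ (barWord k F) φ l),
      ← hat_smul_left _ hφ, ← hat_add_left _ hφ]
    congr 1
    funext l
    rw [deltaWord_eq_hat, neg_one_smul, sub_eq_add_neg]
  rw [h3, h1, h2]
  linear_combination (norm := module) (-hee) • (hat ((-1 : k) ^ n) (hat ((-1 : k) ^ (n + 1)) F mulWord) φ l)

theorem IsCocycle.hat_barWord (hF : IsCocycle k n F) (hφ : IsMulti k φ) (l : List A) :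
    hat ((-1 : k) ^ (n + 1)) F (barWord k φ) l =
      (-1 : k) ^ (n + 1) • barWord k (hat ((-1 : k) ^ (n + 1)) F φ) l := by
  rw [CalabiYau.hat_barWord hF.toIsCochain hφ, funext hF.closed]
  have := hat_smul_left (F := fun _ : List A => (0 : A)) ((-1 : k) ^ n) hφ 0 l
  simp only [smul_zero, zero_smul] at this
  rw [this, smul_zero, add_zero]

variable (k) in
/-- The Gerstenhaber bracket of functions of words of arities `m` and `n`. -/
def bracketWord (m n : ℕ) (F G : List A → A) (l : List A) : A := hat ((-1 : k) ^ (n + 1)) G F l -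
    (-1 : k) ^ ((m + 1) * (n + 1)) • hat ((-1 : k) ^ (m + 1)) F G l

theorem hat_supp (hF : IsCochain k m F) (hG : IsCochain k n G) {p : ℕ}
    (hp : p + 1 = m + n) (l : List A) (hl : l.length ≠ p) : hat e G F l = 0 := by
  refine cutSum_eq_zero fun x r hx => ?_
  rw [start, cutSum_eq_zero, smul_zero]
  intro y z hy
  by_cases h : y.length = n
  · rw [hF.supp]
    subst hy hx
    simp only [List.length_append, List.length_cons] at hl ⊢
    omega
  · rw [hG.supp y h, hF.multi.zero_letter]

theorem IsCochain.bracket (hF : IsCochain k m F) (hG : IsCochain k n G) {p : ℕ}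
    (hp : p + 1 = m + n) : IsCochain k p (bracketWord k m n F G) where
  multi := (hG.multi.hat _ hF.multi).fsub ((hF.multi.hat _ hG.multi).fsmul _)
  supp l hl := by
    rw [bracketWord, hat_supp hF hG hp l hl, hat_supp hG hF (by omega) l hl, smul_zero, sub_zero]

theorem disjointPart_symm_of_cochain (hF : IsCochain k m F) (hG : IsCochain k n G)
    (hφ : IsMulti k φ) (l : List A) :
    disjointPart ((-1 : k) ^ (m + 1)) ((-1 : k) ^ (n + 1)) F G φ l = (-1 : k) ^ ((m + 1) * (n + 1)) •
      disjointPart ((-1 : k) ^ (n + 1)) ((-1 : k) ^ (m + 1)) G F φ l := by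
  refine disjointPart_symm hφ _ _ _ hF.supp hG.supp ?_ ?_ l
  · rw [← pow_mul, ← pow_add]
    apply neg_one_pow_congr
    simp only [Nat.even_add, Nat.even_mul, Nat.even_add_one]; tauto
  · rw [← pow_mul, ← pow_add]
    apply neg_one_pow_congr
    simp only [Nat.even_add, Nat.even_mul, Nat.even_add_one]; tauto

/-- A graded commutator of coderivations is again a coderivation: the disjoint parts of the two
composites cancel, and the nested ones form the bracket. -/
theorem hat_bracketWord (hF : IsCochain k m F) (hG : IsCochain k n G)
    (hφ : IsMulti k φ) (l : List A) :
    hat ((-1 : k) ^ (m + 1) * (-1 : k) ^ (n + 1)) (bracketWord k m n F G) φ l =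
      hat ((-1 : k) ^ (n + 1)) G (hat ((-1 : k) ^ (m + 1)) F φ) l -
      (-1 : k) ^ ((m + 1) * (n + 1)) •
        hat ((-1 : k) ^ (m + 1)) F (hat ((-1 : k) ^ (n + 1)) G φ) l := by
  rw [hat_hat hφ, hat_hat hφ, disjointPart_symm_of_cochain hF hG hφ, mul_comm ((-1 : k) ^ (n + 1))]
  have : hat ((-1 : k) ^ (m + 1) * (-1 : k) ^ (n + 1)) (bracketWord k m n F G) φ l =
      hat ((-1 : k) ^ (m + 1) * (-1 : k) ^ (n + 1)) (hat ((-1 : k) ^ (n + 1)) G F) φ l -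
      (-1 : k) ^ ((m + 1) * (n + 1)) • hat ((-1 : k) ^ (m + 1) * (-1 : k) ^ (n + 1))
        (hat ((-1 : k) ^ (m + 1)) F G) φ l := by
    rw [← hat_smul_left _ hφ, sub_eq_add_neg, ← neg_one_smul k (hat _ (fun l => _ • _) φ l),
      ← hat_smul_left _ hφ, ← hat_add_left _ hφ]
    congr 1
    funext l
    rw [bracketWord, neg_one_smul, sub_eq_add_neg]
  rw [this, smul_add]
  abel

theorem sign_add {p : ℕ} (hp : p + 1 = m + n) :
    (-1 : k) ^ (m + 1) * (-1 : k) ^ (n + 1) = (-1) ^ (p + 1) := by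
  rw [← pow_add, hp]
  apply neg_one_pow_congr
  simp only [Nat.even_add, Nat.even_add_one]; tauto

/-- Each of the two coderivations commutes up to sign with the one of the multiplication, hence so
does their commutator. -/
theorem IsCocycle.bracket (hF : IsCocycle k m F) (hG : IsCocycle k n G) {p : ℕ}
    (hp : p + 1 = m + n) : IsCocycle k p (bracketWord k m n F G) where
  toIsCochain := hF.toIsCochain.bracket hG.toIsCochain hp
  closed l := by
    have hb : barWord k (bracketWord k m n F G) l = barWord k (CalabiYau.hat ((-1 : k) ^ (n + 1)) G F) l -
        (-1 : k) ^ ((m + 1) * (n + 1)) • barWord k (CalabiYau.hat ((-1 : k) ^ (m + 1)) F G) l := by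
      rw [← hat_smul, sub_eq_add_neg, ← hat_neg, ← hat_add]
      rw [barWord]
      congr 1
      funext l
      rw [bracketWord, sub_eq_add_neg]
    rw [deltaWord_eq_hat, ← sign_add hp, hat_bracketWord hF.toIsCochain hG.toIsCochain
      mulWord_isMulti, funext hF.hat_mulWord_eq, funext hG.hat_mulWord_eq, hat_smul, hat_smul,
      hF.hat_barWord hG.multi, hG.hat_barWord hF.multi, hb]
    have h1 := sign_sq (k := k) (m + 1)
    have h2 := sign_sq (k := k) (n + 1)
    generalize (-1 : k) ^ (m + 1) = a at *
    generalize (-1 : k) ^ (n + 1) = b at *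
    have h3 : (a * b) * (a * b) = 1 := by linear_combination b * b * h1 + h2
    simp only [smul_sub, smul_smul]
    linear_combination (norm := module) h3 • barWord k (CalabiYau.hat b G F) l -
      ((-1 : k) ^ ((m + 1) * (n + 1)) * h3) • barWord k (CalabiYau.hat a F G) l

/-- With `H` not closed, the error term of `hat_barWord` for `H` is exactly the insertion of its
differential into `G`. This makes the bracket of an exact with a closed cochain exact. -/
theorem bracketWord_deltaWord {H : List A → A} (hH : IsCochain k m H)
    (hG : IsCocycle k n G) (l : List A) {p : ℕ} (hp : p + 1 = m + n) :
    bracketWord k (m + 1) n (deltaWord k m H) G l =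
      (-1 : k) ^ (n + 1) • deltaWord k p (bracketWord k m n H G) l := by
  have h1 := CalabiYau.hat_barWord hH hG.multi l
  have h2 : hat ((-1 : k) ^ (n + 1)) G (deltaWord k m H) l = (-1 : k) ^ (m + 1) •
      hat ((-1 : k) ^ (n + 1)) G (hat ((-1 : k) ^ (m + 1)) H mulWord) l -
      (-1 : k) ^ (n + 1) • barWord k (hat ((-1 : k) ^ (n + 1)) G H) l := by
    rw [← hG.hat_barWord hH.multi, ← hat_smul, sub_eq_add_neg, ← hat_neg, ← hat_add]
    congr 1
    funext l
    rw [deltaWord_eq_hat, sub_eq_add_neg]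
  have h3 : barWord k G = fun l => (-1 : k) ^ (n + 1) • hat ((-1 : k) ^ (n + 1)) G mulWord l := by
    funext l
    rw [hG.hat_mulWord_eq, smul_smul, sign_sq, one_smul]
  have h4 : barWord k (bracketWord k m n H G) l = barWord k (hat ((-1 : k) ^ (n + 1)) G H) l -
      (-1 : k) ^ ((m + 1) * (n + 1)) • barWord k (hat ((-1 : k) ^ (m + 1)) H G) l := by
    rw [← hat_smul, sub_eq_add_neg, ← hat_neg, ← hat_add, barWord]
    congr 1
    funext l
    rw [bracketWord, sub_eq_add_neg]
  rw [h3, hat_smul] at h1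
  rw [bracketWord, h2, deltaWord_eq_hat, ← sign_add hp, hat_bracketWord hH hG.toIsCochain
    mulWord_isMulti, h4, show (-1 : k) ^ (m + 1 + 1) = (-1) ^ m by rw [pow_succ, pow_succ]; ring,
    show (-1 : k) ^ ((m + 1 + 1) * (n + 1)) = (-1) ^ ((m + 1) * (n + 1)) * (-1) ^ (n + 1) by
      rw [← pow_add]; congr 1; ring]
  have ha := sign_sq (k := k) (m + 1)
  have hb := sign_sq (k := k) (n + 1)
  have h5 := congrArg (fun x => (-1 : k) ^ (m + 1) • x) h1
  simp only [smul_add, smul_smul, ha, one_smul] at h5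
  rw [eq_sub_of_add_eq' h5.symm]
  generalize (-1 : k) ^ (m + 1) = a at *
  generalize (-1 : k) ^ (n + 1) = b at *
  generalize (-1 : k) ^ ((m + 1) * (n + 1)) = c at *
  linear_combination (norm := module) (-a * hb) • hat b G (hat a H mulWord) l +
    (c * (a * hb)) • (hat a H (hat b G mulWord) l) - (c * (a * hb)) • (hat a H (hat b G mulWord) l)

/-- The multiplication sees words of length two only, so nothing is left over besides the two
outputs. -/
theorem disjointPart_mulWord {eF eG : k} (l : List A) :
    disjointPart eF eG F G mulWord l =
      cutSum (fun y z => eG ^ y.length • (F y * G z) + eF • (G y * F z)) l := by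
  have key : ∀ (e : k) (F : List A → A) (x : List A) (a : A) (z : List A),
      hat e F (fun z => mulWord (x ++ a :: z)) z = if x = [] then a * F z else 0 := by
    intro e F x a z
    split_ifs with h
    · subst h
      change hat e F (fun z => LinearMap.mulLeft k a (letter z)) z = _
      rw [hat_map, hat_letter_eq]; rfl
    · rw [hat]
      refine cutSum_eq_zero fun x' r _ => ?_
      rw [start, cutSum_eq_zero, smul_zero]
      intro y z _
      have := List.length_pos_of_ne_nil h
      exact mulWord_eq_zero (by simp; omega)
  simp only [disjointPart, key]
  rcases l with _ | ⟨a, l⟩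
  · simp
  · rw [cutSum_cons, cutSum_eq_zero (w := l), add_zero]
    · simp
    · intro x r _
      rw [cutSum_eq_zero, smul_zero]
      intro y z _
      simp

/-- Graded commutativity of the cup product up to a coboundary. -/
theorem deltaWord_hat (hF : IsCocycle k m F) (hG : IsCocycle k n G) (l : List A)
    {p : ℕ} (hp : p + 1 = m + n) :
    deltaWord k p (hat ((-1 : k) ^ (n + 1)) G F) l =
      (-1 : k) ^ (n + 1) • ((-1 : k) ^ (m * n) • cupWord F G l - cupWord G F l) := by
  -- Composed with the multiplication, the disjoint part is the commutator of cup products, and the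
  -- nested part is the first half of the differential of the insertion of `G` into `F`.
  have h := hat_hat (F := F) (G := G) (φ := mulWord) mulWord_isMulti ((-1 : k) ^ (m + 1))
    ((-1 : k) ^ (n + 1)) l
  rw [funext hF.hat_mulWord_eq, hat_smul, hG.hat_barWord hF.multi, disjointPart_mulWord,
    cutSum_add, cutSum_smul_self] at h
  have h1 : cutSum (fun y z => ((-1 : k) ^ (n + 1)) ^ y.length • (F y * G z)) l =
      ((-1 : k) ^ (n + 1)) ^ m • cupWord F G l := by
    rw [cupWord, ← cutSum_smul_self]
    refine cutSum_congr fun u v _ => ?_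
    by_cases hu : u.length = m
    · rw [hu]
    · rw [hF.supp u hu, zero_mul, smul_zero, smul_zero]
  rw [h1, ← pow_mul, show (-1 : k) ^ ((n + 1) * m) = (-1) ^ (m * n) * (-1) ^ m by
    rw [← pow_add]; congr 1; ring] at h
  rw [deltaWord_eq_hat, ← sign_add hp]
  rw [sign_add hp] at h ⊢
  rw [eq_comm, ← eq_sub_iff_add_eq] at h
  rw [h, ← sign_add hp, show cupWord G F l = cutSum (fun y z => G y * F z) l from rfl]
  have ha := sign_sq (k := k) m
  have hb := sign_sq (k := k) (n + 1)
  rw [pow_succ _ m]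
  generalize (-1 : k) ^ m = a at *
  generalize (-1 : k) ^ (n + 1) = b at *
  linear_combination (norm := module) (b * b * ha + hb) • barWord k (hat b G F) l + (b * (-1) ^ (m * n) * ha) • cupWord F G l - (b * ha) • cutSum (fun y z => G y * F z) l

end Supported

end ListCalculus

end CalabiYau

namespace CalabiYau

/-! ### Functions of cyclic words: contraction, Lie derivative, rotations -/

section ChainCalculus

variable {k : Type*} [Field k] {A : Type*} [Ring A] [Algebra k A]
  {W : Type*} [AddCommGroup W] [Module k W]

theorem IsMulti.of_cons {χ : List A → W} (h₁ : ∀ a, IsMulti k fun w => χ (a :: w))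
    (h₂ : ∀ a b w, χ ((a + b) :: w) = χ (a :: w) + χ (b :: w))
    (h₃ : ∀ (c : k) a w, χ ((c • a) :: w) = c • χ (a :: w)) : IsMulti k χ where
  add x a b z := by
    rcases x with _ | ⟨y, x⟩
    · exact h₂ a b z
    · exact (h₁ y).add x a b z
  smul x c a z := by
    rcases x with _ | ⟨y, x⟩
    · exact h₃ c a z
    · exact (h₁ y).smul x c a z

/-- A sum over splittings in which only the splitting with empty right part contributes. -/
theorem cutSum_right_nil {Φ : List A → List A → W} (h : ∀ u a v, Φ u (a :: v) = 0)
    (w : List A) : cutSum Φ w = Φ w [] := by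
  induction w generalizing Φ with
  | nil => rfl
  | cons a w ih => rw [cutSum_cons, h, zero_add, ih fun u => h _]

/-- The Hochschild differential of functions of cyclic words. -/
def hochWord (k : Type*) [Field k] {A : Type*} [Ring A] [Algebra k A] {W : Type*}
    [AddCommGroup W] [Module k W] (φ : List A → W) : List A → W
  | [] => 0
  | a :: w => cutSum (fun u v => φ (a * letter u :: v)) w - barWord k (fun l => φ (a :: l)) w +
      cutSum (fun u v => (-1 : k) ^ (u.length + 1) • φ (letter v * a :: u)) w

/-- The contraction with `F`, without sign. -/
def capWord (F : List A → A) (φ : List A → W) : List A → W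
  | [] => 0
  | a :: w => cutSum (fun u v => φ (a * F u :: v)) w

/-- The sign for moving `p` letters past `q + 1` letters. -/
def rotSign (k : Type*) [Field k] (p q : ℕ) : k := (-1 : k) ^ (p * (q + 1))

/-- The signed sum over the cyclic rotations `v ++ a :: u` of `a :: u ++ v`. -/
def rotSum (k : Type*) [Field k] {A : Type*} {W : Type*} [AddCommGroup W] [Module k W]
    (Ψ : List A → A → List A → W) : List A → W
  | [] => 0
  | a :: w => cutSum (fun u v => rotSign k v.length u.length • Ψ v a u) w

/-- The norm operator. -/
abbrev normWord (k : Type*) [Field k] {A : Type*} {W : Type*} [AddCommGroup W] [Module k W]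
    (φ : List A → W) : List A → W := rotSum k fun v a u => φ (v ++ a :: u)

/-- The Connes operator on functions which vanish on degenerate words. -/
abbrev connesWord (k : Type*) [Field k] {A : Type*} [Ring A] {W : Type*} [AddCommGroup W]
    [Module k W] (φ : List A → W) : List A → W := rotSum k fun v a u => φ (1 :: (v ++ a :: u))

/-- The Lie derivative. -/
def lieWord (k : Type*) [Field k] {A : Type*} [Ring A] [Algebra k A] {W : Type*}
    [AddCommGroup W] [Module k W] (m : ℕ) (F : List A → A) (φ : List A → W) : List A → W
  | [] => 0
  | a :: w => (-1 : k) ^ (m + 1) • hat ((-1 : k) ^ (m + 1)) F (fun l => φ (a :: l)) w +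
      rotSum k (fun v a u => start (fun l => F (v ++ a :: l)) φ u) (a :: w)

/-- Sum over the rotations in which `F` is applied to the right of the marked letter. -/
def afterWord (k : Type*) [Field k] {A : Type*} [Ring A] [Algebra k A] {W : Type*}
    [AddCommGroup W] [Module k W] (m : ℕ) (F : List A → A) (φ : List A → W) : List A → W :=
  rotSum k fun v a u => ((-1 : k) ^ (m + 1)) ^ (v.length + 1) •
    hat ((-1 : k) ^ (m + 1)) F (fun l => φ (v ++ a :: l)) u

/-- The homotopy for the commutator of a Lie derivative with a contraction. -/
def insideWord (k : Type*) [Field k] {A : Type*} [Ring A] [Algebra k A] {W : Type*}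
    [AddCommGroup W] [Module k W] (n : ℕ) (F G : List A → A) (φ : List A → W) : List A → W :=
  rotSum k fun v a u => ((-1 : k) ^ (n + 1)) ^ (v.length + 1) •
    start (hat ((-1 : k) ^ (n + 1)) G fun l => F (v ++ a :: l)) φ u

variable {F G : List A → A} {φ : List A → W} {m n : ℕ}

section Multi

theorem IsMulti.hoch (hφ : IsMulti k φ) : IsMulti k (hochWord k φ) := by
  refine IsMulti.of_cons (fun a => ?_) (fun a b w => ?_) fun c a w => ?_
  · refine ((IsMulti.cutSum (fun v => ?_) fun u => ?_).fsub (hφ.cons a).barWord).fadd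
      (IsMulti.cutSum (fun v => ?_) fun u => ?_)
    · exact hφ.letter (letter_isMulti.mul_left a) [] v
    · exact hφ.cons _
    · exact (hφ.cons _).smul_length fun n => (-1 : k) ^ (n + 1)
    · exact (hφ.letter (letter_isMulti.mul_right a) [] u).fsmul _
  · simp only [hochWord, add_mul, mul_add, hφ.head_add, cutSum_add, smul_add, hat_add]
    abel
  · simp only [hochWord, smul_mul_assoc, mul_smul_comm, hφ.head_smul, smul_comm _ c, cutSum_smul,
      hat_smul]
    module

theorem IsMulti.cap (hF : IsMulti k F) (hφ : IsMulti k φ) : IsMulti k (capWord F φ) := by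
  refine IsMulti.of_cons (fun a => ?_) (fun a b w => ?_) fun c a w => ?_
  · exact IsMulti.cutSum (fun v => hφ.letter (hF.mul_left a) [] v) fun u => hφ.cons _
  · simp only [capWord, add_mul, hφ.head_add, cutSum_add]
  · simp only [capWord, smul_mul_assoc, hφ.head_smul, cutSum_smul]

theorem IsMulti.rot {Ψ : List A → A → List A → W} (h₁ : ∀ a u, IsMulti k fun v => Ψ v a u)
    (h₂ : ∀ v a, IsMulti k (Ψ v a))
    (h₃ : ∀ v a b u, Ψ v (a + b) u = Ψ v a u + Ψ v b u)
    (h₄ : ∀ v (c : k) a u, Ψ v (c • a) u = c • Ψ v a u) : IsMulti k (rotSum k Ψ) := by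
  refine IsMulti.of_cons (fun a => ?_) (fun a b w => ?_) fun c a w => ?_
  · refine IsMulti.cutSum (fun v => ?_) fun u => ?_
    · exact (h₂ v a).smul_length fun n => rotSign k v.length n
    · exact (h₁ a u).smul_length fun n => rotSign k n u.length
  · simp only [rotSum, h₃, smul_add, cutSum_add]
  · simp only [rotSum, h₄, smul_comm _ c, cutSum_smul]

theorem IsMulti.norm (hφ : IsMulti k φ) : IsMulti k (normWord k φ) :=
  IsMulti.rot (fun a u => hφ.append_right (a :: u)) (fun v a => (hφ.append v).cons a)
    (fun v a b u => hφ.add v a b u) fun v c a u => hφ.smul v c a u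

theorem IsMulti.connes (hφ : IsMulti k φ) : IsMulti k (connesWord k φ) := (hφ.cons 1).norm

theorem hat_isMulti_param {e : k} {X : Type*} [AddCommGroup X] [Module k X]
    {Φ : List A → List A → X} (h : ∀ u, IsMulti k fun v => Φ v u) (l : List A) :
    IsMulti k fun v => hat e F (Φ v) l where
  add x a b z := by
    rw [← hat_add]
    exact congrArg (fun φ => hat e F φ l) (funext fun u => (h u).add x a b z)
  smul x c a z := by
    rw [← hat_smul]
    exact congrArg (fun φ => hat e F φ l) (funext fun u => (h u).smul x c a z)

theorem start_isMulti_param {Φ : List A → List A → A} (hφ : IsMulti k φ)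
    (h : ∀ u, IsMulti k fun v => Φ v u) (l : List A) :
    IsMulti k fun v => start (Φ v) φ l where
  add x a b z := by
    rw [← start_add_left hφ]
    exact congrArg (fun F => CalabiYau.start F φ l) (funext fun u => (h u).add x a b z)
  smul x c a z := by
    rw [← start_smul_left hφ]
    exact congrArg (fun F => CalabiYau.start F φ l) (funext fun u => (h u).smul x c a z)

theorem IsMulti.after (hF : IsMulti k F) (hφ : IsMulti k φ) : IsMulti k (afterWord k m F φ) :=
  IsMulti.rot
    (fun a u => IsMulti.smul_length (hat_isMulti_param (fun y => hφ.append_right (a :: y)) u)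
      fun n => ((-1 : k) ^ (m + 1)) ^ (n + 1))
    (fun v a => (hF.hat _ ((hφ.append v).cons a)).fsmul _)
    (fun v a b u => by simp only [hφ.add, hat_add, smul_add])
    fun v c a u => by simp only [hφ.smul, hat_smul]; module

theorem IsMulti.inside (hF : IsMulti k F) (hG : IsMulti k G) (hφ : IsMulti k φ) :
    IsMulti k (insideWord k n F G φ) :=
  IsMulti.rot
    (fun a u => IsMulti.smul_length (start_isMulti_param hφ (fun y =>
      hat_isMulti_param (fun z => hF.append_right (a :: z)) y) u)
      fun j => ((-1 : k) ^ (n + 1)) ^ (j + 1))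
    (fun v a => ((hG.hat _ ((hF.append v).cons a)).start hφ).fsmul _)
    (fun v a b u => by
      rw [← smul_add, ← start_add_left hφ]
      simp only [hF.add, ← hat_add])
    fun v c a u => by
      have : CalabiYau.hat ((-1 : k) ^ (n + 1)) G (fun l => F (v ++ (c • a) :: l)) = fun l =>
          c • CalabiYau.hat ((-1 : k) ^ (n + 1)) G (fun l => F (v ++ a :: l)) l := by
        funext l
        rw [← hat_smul]
        exact congrArg (fun φ => CalabiYau.hat _ G φ l) (funext fun u => hF.smul v c a u)
      rw [this, start_smul_left hφ, smul_comm c]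

end Multi

/-- The marked letter is multiplied on the right first by a value of `G` and then by one of `F`, so
contractions compose to the contraction with a product. -/
theorem capWord_capWord (hφ : IsMulti k φ) (l : List A) :
    capWord G (capWord F φ) l = capWord (cupWord G F) φ l := by
  rcases l with _ | ⟨a, w⟩
  · rfl
  · simp only [capWord, cupWord]
    rw [← cutSum_assoc (fun x y v => φ (a * G x * F y :: v))]
    refine cutSum_congr fun u v _ => ?_
    have : a * cutSum (fun u v => G u * F v) u = cutSum (fun x y => a * G x * F y) u := by
      simp only [mul_assoc]
      exact (cutSum_map (AddMonoidHom.mulLeft a) (fun u v => G u * F v) u).symm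
    rw [this]
    exact (hφ.sum_letter [] v u _).symm

theorem capWord_add_left (hφ : IsMulti k φ) (l : List A) :
    capWord (fun l => F l + G l) φ l = capWord F φ l + capWord G φ l := by
  rcases l with _ | ⟨a, w⟩
  · simp [capWord]
  · simp only [capWord, mul_add, hφ.head_add, cutSum_add]

theorem capWord_smul_left (hφ : IsMulti k φ) (c : k) (l : List A) :
    capWord (fun l => c • F l) φ l = c • capWord F φ l := by
  rcases l with _ | ⟨a, w⟩
  · simp [capWord]
  · simp only [capWord, mul_smul_comm, hφ.head_smul, cutSum_smul]

theorem capWord_zero_left (hφ : IsMulti k φ) (l : List A) :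
    capWord (fun _ => 0) φ l = 0 := by
  rcases l with _ | ⟨a, w⟩
  · rfl
  · simp only [capWord, mul_zero, hφ.head_zero, cutSum_zero]

theorem capWord_add (ψ : List A → W) (l : List A) :
    capWord F (fun l => φ l + ψ l) l = capWord F φ l + capWord F ψ l := by
  rcases l with _ | ⟨a, w⟩
  · simp [capWord]
  · simp only [capWord, cutSum_add]

theorem capWord_smul (c : k) (l : List A) :
    capWord F (fun l => c • φ l) l = c • capWord F φ l := by
  rcases l with _ | ⟨a, w⟩
  · simp [capWord]
  · simp only [capWord, cutSum_smul]

/-- The contraction with a cochain and the Hochschild differentials. -/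
theorem hochWord_capWord (hF : IsCochain k m F) (hφ : IsMulti k φ) (l : List A) :
    hochWord k (capWord F φ) l =
      capWord (deltaWord k m F) φ l + (-1 : k) ^ m • capWord F (hochWord k φ) l := by
  rcases l with _ | ⟨a, w⟩
  · simp [hochWord, capWord]
  have h0 : capWord (deltaWord k m F) φ (a :: w) = capWord (cupWord letter F) φ (a :: w) +
      ((-1 : k) • capWord (barWord k F) φ (a :: w) +
        (-1 : k) ^ (m + 1) • capWord (cupWord F letter) φ (a :: w)) := by
    rw [← capWord_smul_left hφ, ← capWord_smul_left hφ, ← capWord_add_left hφ,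
      ← capWord_add_left hφ]
    congr 1; funext l
    rw [deltaWord, neg_one_smul]; abel
  rw [h0, ← capWord_capWord hφ, ← capWord_capWord hφ]
  have h1 : barWord k (fun l => capWord F φ (a :: l)) w = capWord (barWord k F) φ (a :: w) +
      (-1 : k) ^ m • cutSum (fun u v => barWord k (fun l => φ (a * F u :: l)) v) w := by
    change hat (-1 : k) mulWord (cutSum fun u v => φ (a * F u :: v)) w = _
    rw [hat_cutSum, cutSum_add, ← cutSum_smul]
    congr 1
    · refine cutSum_congr fun u v _ => ?_
      exact hat_letter (F := fun l => a * F l) (-1 : k) hφ v u |>.trans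
        (congrArg (fun x => φ (x :: v)) (hat_map (-1 : k) (LinearMap.mulLeft k a) u))
    · refine cutSum_congr fun u v _ => ?_
      by_cases hu : u.length = m
      · rw [hu]
      · simp only [hF.supp u hu, mul_zero, hφ.head_zero, barWord, hat_zero, smul_zero]
  -- The letter that wraps around is cut off at the end; its sign changes by the `m` letters which
  -- `F` has already consumed.
  have h2 : cutSum (fun u v => (-1 : k) ^ (u.length + 1) • capWord F φ (letter v * a :: u)) w =
      (-1 : k) ^ m • cutSum (fun u v => cutSum (fun x y => (-1 : k) ^ (x.length + 1) •
        φ (letter y * (a * F u) :: x)) v) w := by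
    rw [← cutSum_assoc (fun u x y => (-1 : k) ^ (x.length + 1) • φ (letter y * (a * F u) :: x)),
      ← cutSum_smul]
    refine cutSum_congr fun r y _ => ?_
    rw [capWord, ← cutSum_smul, ← cutSum_smul]
    refine cutSum_congr fun u x hu => ?_
    rw [smul_smul, mul_assoc]
    by_cases h : u.length = m
    · rw [← h, ← hu, List.length_append, pow_succ, pow_add]; congr 1; ring
    · simp only [hF.supp u h, mul_zero, hφ.head_zero, smul_zero]
  rw [hochWord, h1, h2]
  simp only [capWord, hochWord, cutSum_add, cutSum_sub, smul_add, smul_sub, mul_assoc]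
  module

theorem start_append_cons (v : List A) (a : A) (u : List A) :
    start F φ (v ++ a :: u) = cutSum (fun x y => φ (F x :: (y ++ a :: u))) v +
      start (fun l => F (v ++ a :: l)) φ u := cutSum_append_cons _ v a u

theorem connesWord_capWord (l : List A) : connesWord k (capWord F φ) l =
    rotSum k (fun v a u => start F φ (v ++ a :: u)) l := by
  simp only [connesWord, capWord, one_mul]; rfl

/-- The cyclic operator. -/
def cycWord (k : Type*) [Field k] {A : Type*} [Ring A] {W : Type*} [AddCommGroup W] [Module k W]
    (φ : List A → W) (l : List A) : W :=
  cutSum (fun u v => (-1 : k) ^ u.length • φ (letter v :: u)) l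

theorem hat_eq_zero {e : k} {Θ : List A → W} (h : ∀ l, l ≠ [] → Θ l = 0) (l : List A) :
    hat e F Θ l = 0 := by
  refine cutSum_eq_zero fun x r _ => ?_
  rw [start, cutSum_eq_zero, smul_zero]
  intro y z _
  exact h _ (by simp)

/-- Rotation moves the last letter to the front. That letter is either untouched by `F`, or it is
the output of `F` applied to a final segment; the two cases are the two summands. -/
theorem hat_cycWord (hF : IsCochain k m F) (hφ : IsMulti k φ) (v : List A) (a : A)
    (u : List A) : hat ((-1 : k) ^ (m + 1)) F (fun l => cycWord k φ (v ++ a :: l)) u =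
      cutSum (fun p q => (-1 : k) ^ (v.length + p.length + m) •
        hat ((-1 : k) ^ (m + 1)) F (fun x => φ (letter q :: (v ++ a :: x))) p +
        (((-1 : k) ^ (m + 1)) ^ p.length * (-1) ^ (v.length + 1 + p.length)) •
          φ (F q :: (v ++ a :: p))) u := by
  have h1 : ∀ l, cycWord k φ (v ++ a :: l) =
      cutSum (fun x y => (-1 : k) ^ x.length • φ (letter (y ++ a :: l) :: x)) v +
      cutSum (fun x y => (-1 : k) ^ (v.length + 1 + x.length) •
        φ (letter y :: (v ++ a :: x))) l := by
    intro l
    rw [cycWord, cutSum_append_cons]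
    simp only [List.length_append, List.length_cons]
    congr 1
    refine cutSum_congr fun x y _ => ?_
    congr 2; ring
  simp only [h1, hat_add]
  -- Rotating a letter of `v` or `a` itself to the front requires an empty word to the right of `a`,
  -- but `F` has just placed a letter there.
  rw [hat_eq_zero, zero_add]
  swap
  · intro l hl
    refine cutSum_eq_zero fun x y _ => ?_
    rw [letter_append_cons, if_neg (by simp [hl]), hφ.head_zero, smul_zero]
  have h2 := hat_cutSum ((-1 : k) ^ (m + 1)) (G := F) (fun x y =>
    (-1 : k) ^ (v.length + 1 + x.length) • φ (letter y :: (v ++ a :: x))) u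
  refine h2.trans (cutSum_congr fun p q _ => ?_)
  congr 1
  · simp only [pow_add _ (v.length + 1), mul_smul, hat_smul]
    rw [hat_smul_pow_length (by ring) (((hφ.cons _).append v).cons a) hF.supp, smul_smul, ← pow_add]
    congr 1
    rw [show v.length + 1 + (p.length + m + 1) = v.length + p.length + m + 2 by ring, pow_add]
    simp
  · rw [hat_smul, hat_letter _ hφ, hat_letter_eq, smul_smul]

theorem sgn_congr {a b : ℕ} (h : Even a ↔ Even b) : (-1 : k) ^ a = (-1) ^ b := neg_one_pow_congr h

theorem cutSum_eq_single {Φ : List A → List A → W}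
    (h : ∀ u v, u.length ≠ 1 → Φ u v = 0) (w : List A) :
    cutSum Φ w = match w with
      | [] => 0
      | a :: w => Φ [a] w := by
  rcases w with _ | ⟨a, w⟩
  · exact h _ _ (by simp)
  · rw [cutSum_eq_of_length 1 (by simp) h]; rfl

/-- The difference of the two `afterWord` terms telescopes over the rotations. It leaves the
insertions of `F` away from the marked letter, together with terms that have an output of `F` in
front. The latter cancel the part of the Connes term in which `F` misses the marked letter, and the
rest of the Connes term is the rotation part of the Lie derivative. -/
theorem lieWord_eq (hF : IsCochain k m F) (hφ : IsMulti k φ) (l : List A) :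
    lieWord k m F φ l = connesWord k (capWord F φ) l + afterWord k m F φ l -
      afterWord k m F (cycWord k φ) l := by
  rcases l with _ | ⟨a, w⟩
  · simp [lieWord, rotSum, afterWord]
  rw [connesWord_capWord]
  simp only [lieWord, rotSum, afterWord, start_append_cons, smul_add, cutSum_add,
    hat_cycWord hF hφ, ← cutSum_smul]
  rw [← sub_eq_zero]
  have h1 : cutSum (fun u v => cutSum (fun x y => rotSign k v.length u.length •
        φ (F x :: (y ++ a :: u))) v) w =
      cutSum (fun u v => cutSum (fun p q => rotSign k v.length u.length •
        ((-1 : k) ^ (m + 1)) ^ (v.length + 1) • (((-1 : k) ^ (m + 1)) ^ p.length *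
        (-1) ^ (v.length + 1 + p.length)) • φ (F q :: (v ++ a :: p))) u) w := by
    have h := cutSum_assoc (fun p q v => (rotSign k v.length (p.length + q.length) *
        ((-1 : k) ^ (m + 1)) ^ (v.length + 1) * (((-1 : k) ^ (m + 1)) ^ p.length *
        (-1) ^ (v.length + 1 + p.length))) • φ (F q :: (v ++ a :: p))) w
    refine Eq.trans (cutSum_congr fun p r _ => cutSum_congr fun q v hr => ?_)
      (h.symm.trans (cutSum_congr fun u v _ => cutSum_congr fun p q hu => ?_))
    · by_cases hq : q.length = m
      · rw [← hr, List.length_append, hq]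
        congr 1
        simp only [rotSign, ← pow_mul, ← pow_add]
        exact sgn_congr (by simp only [Nat.even_add, Nat.even_mul, Nat.even_add_one]; tauto)
      · simp only [hF.supp q hq, hφ.head_zero, smul_zero]
    · rw [← hu, List.length_append, smul_smul, smul_smul]
  have h2 : (-1 : k) ^ (m + 1) • hat ((-1 : k) ^ (m + 1)) F (fun l => φ (a :: l)) w =
      cutSum (fun u v => rotSign k v.length u.length • ((-1 : k) ^ (m + 1)) ^ (v.length + 1) •
        hat ((-1 : k) ^ (m + 1)) F (fun l => φ (v ++ a :: l)) u) w -
      cutSum (fun u v => cutSum (fun p q => rotSign k v.length u.length •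
        ((-1 : k) ^ (m + 1)) ^ (v.length + 1) • (-1 : k) ^ (v.length + p.length + m) •
        hat ((-1 : k) ^ (m + 1)) F (fun x => φ (letter q :: (v ++ a :: x))) p) u) w := by
    have h := cutSum_assoc (fun p q v => (rotSign k v.length (p.length + q.length) *
        (((-1 : k) ^ (m + 1)) ^ (v.length + 1) * (-1) ^ (v.length + p.length + m))) •
        hat ((-1 : k) ^ (m + 1)) F (fun x => φ (letter q :: (v ++ a :: x))) p) w
    have h' : cutSum (fun u v => cutSum (fun p q => rotSign k v.length u.length •
        ((-1 : k) ^ (m + 1)) ^ (v.length + 1) • (-1 : k) ^ (v.length + p.length + m) •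
        hat ((-1 : k) ^ (m + 1)) F (fun x => φ (letter q :: (v ++ a :: x))) p) u) w = _ :=
      Eq.trans (cutSum_congr fun u v _ => cutSum_congr fun p q hu => by
        rw [← hu, List.length_append, smul_smul, smul_smul, mul_assoc]) h
    -- After regrouping, the summand with right part `b :: v` is cancelled by the rotation of the
    -- letter `b`. Only the empty right part survives, and it is the unrotated insertion.
    rw [h', ← cutSum_sub, cutSum_right_nil]
    · rw [cutSum_nil, show letter ([] : List A) = 0 from rfl]
      simp [rotSign, hφ.head_zero, hat_zero]
    · intro p b v
      rw [cutSum_eq_single, sub_eq_zero]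
      · simp only [letter, List.length_cons, smul_smul, List.length_nil, List.cons_append]
        congr 1
        simp only [rotSign, ← pow_mul, ← pow_add]
        exact sgn_congr (by simp only [Nat.even_add, Nat.even_mul, Nat.even_add_one]; tauto)
      · intro u v hu
        simp only [letter_eq_zero hu, hφ.head_zero, hat_zero, smul_zero]
  rw [h1, h2]
  abel

/-- Each product of cyclic neighbours in `a :: u ++ v` lies inside `v`, inside `u`, or involves `a`.
After rotation to `v ++ a :: u` these are the terms on the right. The weight `e` covers the norm (`e
= 1`) as well as the rotation sums with an insertion. -/
theorem hochWord_rotSum {S : List A → A → List A → W} {e : k} (he : e * e = 1)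
    (h₁ : ∀ a u, IsMulti k fun v => S v a u) (h₂ : ∀ v a, IsMulti k (S v a))
    (h₃ : ∀ v u, S v 0 u = 0) (a : A) (w : List A) :
    hochWord k (rotSum k fun v a u => e ^ (v.length + 1) • S v a u) (a :: w) =
      cutSum (fun u v => (rotSign k v.length u.length * e ^ (v.length + 1)) •
        (e • barWord k (fun x => S x a u) v +
          e • cutSum (fun x y => (-1 : k) ^ x.length • S x (letter y * a) u) v +
          (-1 : k) ^ v.length • (cutSum (fun p q => S v (a * letter p) q) u -
            barWord k (S v a) u))) w := by
  simp only [hochWord, smul_add, smul_sub, cutSum_add, cutSum_sub]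
  have h1 : cutSum (fun p r => rotSum k (fun v a u => e ^ (v.length + 1) • S v a u)
        (a * letter p :: r)) w =
      cutSum (fun u v => (rotSign k v.length u.length * e ^ (v.length + 1)) • (-1 : k) ^ v.length •
        cutSum (fun p q => S v (a * letter p) q) u) w := by
    simp only [rotSum, ← cutSum_smul]
    rw [← cutSum_assoc (fun p u v => rotSign k v.length u.length • e ^ (v.length + 1) •
      S v (a * letter p) u)]
    refine cutSum_congr fun u v _ => cutSum_congr fun p q hp => ?_
    by_cases h : p.length = 1
    · rw [← hp, List.length_append, h, smul_smul, smul_smul]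
      congr 1
      simp only [rotSign]
      rw [mul_right_comm, ← pow_add]
      congr 1
      exact sgn_congr (by simp only [Nat.even_add, Nat.even_mul, Nat.even_add_one]; tauto)
    · simp only [letter_eq_zero h, mul_zero, h₃, smul_zero]
  have h2 : barWord k (fun l => rotSum k (fun v a u => e ^ (v.length + 1) • S v a u) (a :: l)) w =
      cutSum (fun u v => (rotSign k v.length u.length * e ^ (v.length + 1)) • (-1 : k) ^ v.length •
        barWord k (S v a) u) w -
      cutSum (fun u v => (rotSign k v.length u.length * e ^ (v.length + 1)) • e •
        barWord k (fun x => S x a u) v) w := by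
    simp only [rotSum]
    refine (hat_cutSum (-1 : k) (G := mulWord) (fun u v => rotSign k v.length u.length •
      e ^ (v.length + 1) • S v a u) w).trans ?_
    rw [cutSum_add, sub_eq_add_neg, ← cutSum_neg]
    congr 1
    · refine cutSum_congr fun u v _ => ?_
      have : ∀ u : List A, rotSign k v.length u.length • e ^ (v.length + 1) • S v a u =
          ((-1 : k) ^ v.length * e ^ (v.length + 1)) • ((-1 : k) ^ v.length) ^ u.length • S v a u := by
        intro u
        rw [smul_smul, smul_smul, rotSign, mul_add, pow_add, pow_mul]
        congr 1; ring
      simp only [this, hat_smul]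
      rw [hat_smul_pow_length (sign_sq _) (h₂ v a) (fun _ h => mulWord_eq_zero h),
        smul_smul, smul_smul]
      congr 1
      rw [mul_right_comm, mul_right_comm (rotSign k _ _)]
      congr 1
      rw [rotSign, ← pow_mul, ← pow_add, ← pow_add]
      exact sgn_congr (by
        simp only [Nat.even_add, Nat.even_mul, Nat.even_add_one]; tauto)
    · refine cutSum_congr fun u v _ => ?_
      have : ∀ v : List A, rotSign k v.length u.length • e ^ (v.length + 1) • S v a u =
          e • ((-1 : k) ^ (u.length + 1) * e) ^ v.length • S v a u := by
        intro v
        rw [smul_smul, smul_smul, rotSign, mul_comm v.length, pow_mul, mul_pow]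
        congr 1; ring
      simp only [this, hat_smul]
      rw [hat_smul_pow_length (F := mulWord) (m := 2) _ (h₁ a u) (fun _ h => mulWord_eq_zero h),
        smul_smul, smul_smul, ← neg_smul, smul_smul]
      · congr 1
        rw [rotSign, mul_comm v.length, pow_mul, mul_pow]
        have h3 := sign_sq (k := k) (u.length)
        rw [pow_succ _ u.length]
        generalize (-1 : k) ^ u.length = b at *
        have h5 : (b * -1) ^ (v.length + 2 + 1) = (b * -1) ^ v.length * (-b) := by
          rw [pow_add, pow_add]; linear_combination (-(b * -1) ^ v.length * b) * h3
        have h6 : e ^ (v.length + 2 + 1) = e ^ v.length * e := by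
          rw [pow_add, pow_add]; linear_combination (e ^ v.length * e) * he
        rw [h5, h6, pow_succ e]
        linear_combination (-(b * -1) ^ v.length * e ^ v.length * e * e) * h3
      · have h3 := sign_sq (k := k) (u.length + 1)
        linear_combination e * e * h3 + he
  have h3 : cutSum (fun p q => (-1 : k) ^ (p.length + 1) •
        rotSum k (fun v a u => e ^ (v.length + 1) • S v a u) (letter q * a :: p)) w =
      cutSum (fun u v => (rotSign k v.length u.length * e ^ (v.length + 1)) • e •
        cutSum (fun x y => (-1 : k) ^ x.length • S x (letter y * a) u) v) w := by
    simp only [rotSum, ← cutSum_smul]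
    have h := cutSum_assoc (fun u x y => ((-1 : k) ^ (u.length + x.length + 1) *
      (rotSign k x.length u.length * e ^ (x.length + 1))) • S x (letter y * a) u) w
    refine Eq.trans (cutSum_congr fun p q _ => cutSum_congr fun u x hp => ?_)
      (h.trans (cutSum_congr fun u v _ => cutSum_congr fun x y hv => ?_))
    · rw [← hp, List.length_append, smul_smul, smul_smul, mul_assoc]
    · by_cases hy : y.length = 1
      · rw [← hv, List.length_append, hy, smul_smul, smul_smul]
        congr 1
        have h4 : (-1 : k) ^ (u.length + x.length + 1) * rotSign k x.length u.length =
            rotSign k (x.length + 1) u.length * (-1) ^ x.length := by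
          simp only [rotSign, ← pow_add]
          exact sgn_congr (by simp only [Nat.even_add, Nat.even_mul, Nat.even_add_one]; tauto)
        linear_combination e ^ (x.length + 1) * h4 -
          rotSign k (x.length + 1) u.length * (-1) ^ x.length * e ^ (x.length + 1) * he
      · simp only [letter_eq_zero hy, zero_mul, h₃, smul_zero]
  rw [h1, h2, h3]
  abel

/-- The insertion of a cocycle passes through the bar differential. Products that do not touch the
output of `F` at the marked letter reassemble to the Hochschild differential of `afterWord`; the
products `a * F x` form the contraction of the norm. -/
theorem afterWord_barWord (hF : IsCocycle k m F) (hφ : IsMulti k φ) (l : List A) :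
    afterWord k m F (barWord k φ) l = (-1 : k) ^ (m + 1) •
      (hochWord k (afterWord k m F φ) l + capWord F (normWord k φ) l) := by
  rcases l with _ | ⟨a, w⟩
  · simp [afterWord, rotSum, hochWord, capWord]
  have he := sign_sq (k := k) (m + 1)
  have h1 : ∀ u v, hat ((-1 : k) ^ (m + 1)) F (fun l => barWord k φ (v ++ a :: l)) u =
      barWord k (fun x => hat ((-1 : k) ^ (m + 1)) F (fun l => φ (x ++ a :: l)) u) v +
      cutSum (fun x y => (-1 : k) ^ x.length •
        hat ((-1 : k) ^ (m + 1)) F (fun l => φ (x ++ letter y * a :: l)) u) v +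
      (-1 : k) ^ v.length • (cutSum (fun x y => φ (v ++ a * F x :: y)) u +
        (-1 : k) ^ (m + 1) • (cutSum (fun x y =>
          hat ((-1 : k) ^ (m + 1)) F (fun l => φ (v ++ a * letter x :: l)) y) u -
        barWord k (hat ((-1 : k) ^ (m + 1)) F (fun l => φ (v ++ a :: l))) u)) := by
    intro u v
    simp only [barWord_append_cons hφ, hat_add, hat_smul, sub_eq_add_neg, hat_neg]
    rw [hF.hat_barWord ((hφ.append v).cons a)]
    have h2 := hat_cutSum ((-1 : k) ^ (m + 1)) (G := F)
      (fun x y => φ (v ++ a * letter x :: y)) u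
    have h3 : cutSum (fun x y => hat ((-1 : k) ^ (m + 1)) F
        (fun x => φ (v ++ a * letter x :: y)) x + ((-1 : k) ^ (m + 1)) ^ x.length •
        hat ((-1 : k) ^ (m + 1)) F (fun y => φ (v ++ a * letter x :: y)) y) u =
        cutSum (fun x y => φ (v ++ a * F x :: y)) u + (-1 : k) ^ (m + 1) •
        cutSum (fun x y => hat ((-1 : k) ^ (m + 1)) F
          (fun l => φ (v ++ a * letter x :: l)) y) u := by
      rw [← cutSum_smul, ← cutSum_add]
      refine cutSum_congr fun x y _ => ?_
      congr 1
      · have := hat_map ((-1 : k) ^ (m + 1)) (F := F) (φ := letter)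
          ((hφ.linear v y) ∘ₗ (LinearMap.mulLeft k a)) x
        rw [hat_letter_eq] at this
        exact this
      · by_cases hx : x.length = 1
        · rw [hx, pow_one]
        · simp only [letter_eq_zero hx, mul_zero, hφ.zero_letter, hat_zero, smul_zero]
    rw [h3] at h2
    have h4 := hat_comm_param (F := F) (G := mulWord) (e := (-1 : k) ^ (m + 1)) (e' := (-1 : k))
      (Φ := fun x l => φ (x ++ a :: l)) v u
    have h5 := hat_cutSum_param (F := F) (e := (-1 : k) ^ (m + 1))
      (Ψ := fun x y l => (-1 : k) ^ x.length • φ (x ++ letter y * a :: l)) v u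
    simp only [hat_smul] at h5
    rw [h4, h5]
    erw [h2]
    module
  have h2 := hochWord_rotSum (k := k) (e := (-1 : k) ^ (m + 1))
    (S := fun v a u => hat ((-1 : k) ^ (m + 1)) F (fun l => φ (v ++ a :: l)) u) he
    (fun a u => hat_isMulti_param (fun y => hφ.append_right (a :: y)) u)
    (fun v a => hF.multi.hat _ ((hφ.append v).cons a))
    (fun v u => by simp only [hφ.zero_letter, hat_zero]) a w
  have h3 : capWord F (normWord k φ) (a :: w) = (-1 : k) ^ (m + 1) • cutSum (fun u v =>
      (rotSign k v.length u.length * ((-1 : k) ^ (m + 1)) ^ (v.length + 1)) • (-1 : k) ^ v.length •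
        cutSum (fun x y => φ (v ++ a * F x :: y)) u) w := by
    simp only [capWord, rotSum, ← cutSum_smul]
    rw [← cutSum_assoc (fun p q v => rotSign k v.length q.length • φ (v ++ a * F p :: q))]
    refine cutSum_congr fun u v _ => cutSum_congr fun p q hu => ?_
    by_cases hp : p.length = m
    · rw [← hu, List.length_append, hp, smul_smul, smul_smul]
      congr 1
      simp only [rotSign, ← pow_mul, ← pow_add]
      exact sgn_congr (by simp only [Nat.even_add, Nat.even_mul, Nat.even_add_one]; tauto)
    · simp only [hF.supp p hp, mul_zero, hφ.zero_letter, smul_zero]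
  change cutSum _ w = _
  unfold afterWord at *
  rw [h2, h3, smul_add, smul_smul, he, one_smul, ← cutSum_smul, ← cutSum_add]
  refine cutSum_congr fun u v _ => ?_
  beta_reduce
  rw [h1]
  have : ∀ x : W, (-1 : k) ^ (m + 1) • (-1 : k) ^ (m + 1) • x = x := fun x => by
    rw [smul_smul, he, one_smul]
  generalize (-1 : k) ^ (m + 1) = e at *
  simp only [smul_smul, smul_add, smul_sub]
  have h5 : ∀ c : k, e * (c * e) = c := fun c => by linear_combination c * he
  simp only [← mul_assoc, mul_comm e _]
  simp only [mul_assoc, he, mul_one]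
  module

end ChainCalculus

end CalabiYau

namespace CalabiYau

/-! ### The commutator of a Lie derivative with a contraction -/

section LieContraction

variable {k : Type*} [Field k] {A : Type*} [Ring A] [Algebra k A]
  {W : Type*} [AddCommGroup W] [Module k W]
  {F G : List A → A} {φ : List A → W} {m n : ℕ}

theorem cutSum_comm (Ψ : List A → List A → List A → List A → W) (u v : List A) :
    cutSum (fun x y => cutSum (fun p q => Ψ x y p q) u) v =
      cutSum (fun p q => cutSum (fun x y => Ψ x y p q) v) u := by
  induction v generalizing Ψ with
  | nil => rfl
  | cons a v ih => rw [cutSum_cons, ih, ← cutSum_add]; rfl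

/-- `F` with a letter fixed in one of its slots and `G` inserted to the right of it. -/
abbrev insertAfter (k : Type*) [Field k] {A : Type*} [Ring A] [Algebra k A] (n : ℕ)
    (F G : List A → A) (v : List A) (a : A) : List A → A :=
  hat ((-1 : k) ^ (n + 1)) G fun y => F (v ++ a :: y)

theorem insertAfter_isMulti (hF : IsMulti k F) (hG : IsMulti k G) (v : List A) (a : A) :
    IsMulti k (insertAfter k n F G v a) := hG.hat _ ((hF.append v).cons a)

theorem insertAfter_supp (hF : IsCochain k m F) (hG : IsCochain k n G) (v : List A) (a : A)
    (u : List A) (hu : v.length + u.length + 2 ≠ m + n) : insertAfter k n F G v a u = 0 := by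
  refine cutSum_eq_zero fun x r hx => ?_
  rw [start, cutSum_eq_zero, smul_zero]
  intro y z hy
  beta_reduce
  by_cases h : y.length = n
  · rw [hF.supp]
    subst hy hx
    simp only [List.length_append, List.length_cons] at hu ⊢
    omega
  · rw [hG.supp y h, ← List.cons_append, ← List.append_assoc, hF.multi.zero_letter]

/-- Insertions of `F` away from both the marked letter and the block of `G` cancel between the two
composites, and `F` inside `G` is the second half of the bracket. What remains has `F` acting on the
marked letter, apart from `G` inserted into `F`. -/
theorem capWord_lieWord (hG : IsCochain k n G) (hφ : IsMulti k φ)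
    (a : A) (w : List A) : capWord G (lieWord k m F φ) (a :: w) -
        ((-1 : k) ^ (m + 1)) ^ n • lieWord k m F (capWord G φ) (a :: w) -
        capWord (bracketWord k m n F G) φ (a :: w) =
      cutSum (fun p r => cutSum (fun u v => rotSign k v.length u.length •
        start (fun l => F (v ++ a * G p :: l)) φ u) r) w -
      ((-1 : k) ^ (m + 1)) ^ n • cutSum (fun u v => rotSign k v.length u.length •
        start (fun l => F (v ++ a :: l)) (capWord G φ) u) w -
      capWord (hat ((-1 : k) ^ (n + 1)) G F) φ (a :: w) := by
  have h1 : hat ((-1 : k) ^ (m + 1)) F (fun l => capWord G φ (a :: l)) w =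
      capWord (hat ((-1 : k) ^ (m + 1)) F G) φ (a :: w) + ((-1 : k) ^ (m + 1)) ^ n •
        cutSum (fun x y => hat ((-1 : k) ^ (m + 1)) F (fun l => φ (a * G x :: l)) y) w := by
    refine (hat_cutSum ((-1 : k) ^ (m + 1)) (G := F) (fun x y => φ (a * G x :: y)) w).trans ?_
    rw [← cutSum_smul, cutSum_add]
    congr 1
    · refine cutSum_congr fun x y _ => ?_
      exact hat_map ((-1 : k) ^ (m + 1)) (F := F) (φ := G)
          ((hφ.linear [] y) ∘ₗ (LinearMap.mulLeft k a)) x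
    · refine cutSum_congr fun x y _ => ?_
      by_cases hx : x.length = n
      · rw [hx]
      · simp only [hG.supp x hx, mul_zero, hφ.head_zero, hat_zero, smul_zero]
  have h2 : capWord (bracketWord k m n F G) φ (a :: w) =
      capWord (hat ((-1 : k) ^ (n + 1)) G F) φ (a :: w) -
      (-1 : k) ^ ((m + 1) * (n + 1)) • capWord (hat ((-1 : k) ^ (m + 1)) F G) φ (a :: w) := by
    have : bracketWord k m n F G = fun l => hat ((-1 : k) ^ (n + 1)) G F l +
        (-(-1 : k) ^ ((m + 1) * (n + 1))) • hat ((-1 : k) ^ (m + 1)) F G l := by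
      funext l; rw [bracketWord, neg_smul, sub_eq_add_neg]
    rw [this, capWord_add_left hφ, capWord_smul_left hφ, neg_smul, sub_eq_add_neg]
  rw [h2]
  simp only [lieWord, h1, rotSum]
  simp only [capWord, lieWord, cutSum_add, cutSum_smul, rotSum]
  have he := sign_sq (k := k) (m + 1)
  have he' : ((-1 : k) ^ (m + 1)) ^ n * ((-1 : k) ^ (m + 1)) ^ n = 1 := by
    rw [← mul_pow, he, one_pow]
  rw [pow_mul (-1 : k) (m + 1) (n + 1), pow_succ ((-1 : k) ^ (m + 1)) n]
  generalize ((-1 : k) ^ (m + 1)) ^ n = c at *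
  generalize (-1 : k) ^ (m + 1) = e at *
  have h3 : ∀ x : W, c • e • c • x = e • x := fun x => by
    rw [smul_smul, smul_smul]; congr 1; linear_combination e * he'
  simp only [smul_add, h3]
  module

/-- First evaluation of this expression: the insertion of the cocycle `G` is moved past the bar
differential. `hat_barWord_of_cocycle` evaluates the same expression by the closedness of `F`, and
comparing the two produces the homotopy. -/
theorem hat_barWord_insertAfter (hF : IsCochain k m F) (hG : IsCocycle k n G)
    (v : List A) (a : A) (u : List A) :
    hat ((-1 : k) ^ (n + 1)) G (fun y => barWord k F (v ++ a :: y)) u =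
      barWord k (fun x => insertAfter k n F G x a u) v +
      cutSum (fun x y => (-1 : k) ^ x.length • insertAfter k n F G x (letter y * a) u) v +
      (-1 : k) ^ v.length • (cutSum (fun x y => F (v ++ a * G x :: y)) u +
        (-1 : k) ^ (n + 1) • (cutSum (fun x y => insertAfter k n F G v (a * letter x) y) u -
        barWord k (insertAfter k n F G v a) u)) := by
  have hφ := hF.multi
  simp only [barWord_append_cons hφ, hat_add, hat_smul, sub_eq_add_neg, hat_neg]
  rw [hG.hat_barWord ((hφ.append v).cons a)]
  have h2 := hat_cutSum ((-1 : k) ^ (n + 1)) (G := G)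
    (fun x y => F (v ++ a * letter x :: y)) u
  have h3 : cutSum (fun x y => hat ((-1 : k) ^ (n + 1)) G
      (fun x => F (v ++ a * letter x :: y)) x + ((-1 : k) ^ (n + 1)) ^ x.length •
      hat ((-1 : k) ^ (n + 1)) G (fun y => F (v ++ a * letter x :: y)) y) u =
      cutSum (fun x y => F (v ++ a * G x :: y)) u + (-1 : k) ^ (n + 1) •
      cutSum (fun x y => insertAfter k n F G v (a * letter x) y) u := by
    rw [← cutSum_smul_self, ← cutSum_add]
    refine cutSum_congr fun x y _ => ?_
    congr 1
    · have := hat_map ((-1 : k) ^ (n + 1)) (F := G) (φ := letter)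
        ((hφ.linear v y) ∘ₗ (LinearMap.mulLeft k a)) x
      rw [hat_letter_eq] at this
      exact this
    · by_cases hx : x.length = 1
      · rw [hx, pow_one]
      · simp only [insertAfter, letter_eq_zero hx, mul_zero, hφ.zero_letter, hat_zero, smul_zero]
  rw [h3] at h2
  have h4 := hat_comm_param (F := G) (G := mulWord) (e := (-1 : k) ^ (n + 1)) (e' := (-1 : k))
    (Φ := fun x l => F (x ++ a :: l)) v u
  have h5 := hat_cutSum_param (F := G) (e := (-1 : k) ^ (n + 1))
    (Ψ := fun x y l => (-1 : k) ^ x.length • F (x ++ letter y * a :: l)) v u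
  simp only [hat_smul] at h5
  rw [h4, h5]
  erw [h2]
  module

theorem IsCocycle.barWord_eq (hF : IsCocycle k m F) (l : List A) :
    barWord k F l = cupWord letter F l + (-1 : k) ^ (m + 1) • cupWord F letter l := by
  have := hF.closed l
  rw [deltaWord] at this
  linear_combination (norm := module) (-1 : k) • this

/-- Closedness of `F` replaces its bar differential by outer multiplications with a single letter;
`G` is then inserted to the right of `a` in each of them. -/
theorem hat_barWord_of_cocycle (hF : IsCocycle k m F) (v : List A) (a : A) (u : List A) :
    hat ((-1 : k) ^ (n + 1)) G (fun y => barWord k F (v ++ a :: y)) u =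
      cutSum (fun x r => letter x * insertAfter k n F G r a u) v +
      (if v = [] then a * hat ((-1 : k) ^ (n + 1)) G F u else 0) +
      (-1 : k) ^ (m + 1) • cutSum (fun p q => insertAfter k n F G v a p * letter q +
        ((-1 : k) ^ (n + 1)) ^ p.length • (F (v ++ a :: p) * G q)) u := by
  have h1 : ∀ y, barWord k F (v ++ a :: y) = cutSum (fun x r => letter x * F (r ++ a :: y)) v +
      (if v = [] then a * F y else 0) + (-1 : k) ^ (m + 1) •
      (cutSum (fun x r => F x * letter (r ++ a :: y)) v +
        cutSum (fun p q => F (v ++ a :: p) * letter q) y) := by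
    intro y
    rw [hF.barWord_eq, cupWord, cupWord, cutSum_append_cons, cutSum_append_cons]
    congr 2
    rcases y with _ | ⟨b, y⟩
    · rcases v with _ | ⟨c, _ | ⟨d, v⟩⟩ <;> simp [letter]
    · rw [cutSum_cons, cutSum_eq_zero]
      · rcases v with _ | ⟨c, _ | ⟨d, v⟩⟩ <;> simp [letter]
      · intro x z _
        rw [letter_eq_zero (by simp; omega), zero_mul]
  simp only [h1, hat_add, hat_smul]
  rw [hat_eq_zero (Θ := fun y => cutSum (fun x r => F x * letter (r ++ a :: y)) v), zero_add]
  · congr 1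
    · congr 1
      · rw [hat_cutSum_param]
        exact cutSum_congr fun x r _ =>
          hat_map ((-1 : k) ^ (n + 1)) (F := G) (LinearMap.mulLeft k (letter x)) u
      · split_ifs
        · exact hat_map ((-1 : k) ^ (n + 1)) (F := G) (LinearMap.mulLeft k a) u
        · exact hat_zero _ _
    · congr 1
      refine (hat_cutSum ((-1 : k) ^ (n + 1)) (G := G)
        (fun p q => F (v ++ a :: p) * letter q) u).trans (cutSum_congr fun p q _ => ?_)
      congr 1
      · exact hat_map ((-1 : k) ^ (n + 1)) (F := G) (φ := fun p => F (v ++ a :: p))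
          (LinearMap.mulRight k (letter q)) p
      · have := hat_map ((-1 : k) ^ (n + 1)) (F := G) (φ := letter)
          (LinearMap.mulLeft k (F (v ++ a :: p))) q
        rw [hat_letter_eq] at this
        exact congrArg _ this
  · intro y hy
    refine cutSum_eq_zero fun x r _ => ?_
    rw [letter_append_cons, if_neg (by simp [hy]), mul_zero]

/-- Products of letters consumed by `F` or `G` are collected with `hat_barWord_insertAfter`. Its
extra term, with `a * G x` inside `F`, and the products in the part of the word consumed by neither
are split off. -/
theorem hochWord_insideWord (hF : IsCochain k m F) (hG : IsCocycle k n G)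
    (hφ : IsMulti k φ) (a : A) (w : List A) :
    hochWord k (insideWord k n F G φ) (a :: w) =
      cutSum (fun u v => (rotSign k v.length u.length * ((-1 : k) ^ (n + 1)) ^ (v.length + 1)) •
        ((-1 : k) ^ (n + 1) • start (fun y =>
            hat ((-1 : k) ^ (n + 1)) G (fun y => barWord k F (v ++ a :: y)) y) φ u -
          ((-1 : k) ^ (n + 1) * (-1) ^ v.length) •
            start (cutSum fun x y => F (v ++ a * G x :: y)) φ u -
          (-1 : k) ^ (m + n) • cutSum (fun x y =>
            barWord k (fun l => φ (insertAfter k n F G v a x :: l)) y) u)) w := by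
  have he := sign_sq (k := k) (n + 1)
  rw [insideWord, hochWord_rotSum (S := fun v a u => start (insertAfter k n F G v a) φ u) he
    (fun a u => start_isMulti_param hφ (fun y => hat_isMulti_param
      (fun z => hF.multi.append_right (a :: z)) y) u)
    (fun v a => (insertAfter_isMulti hF.multi hG.multi v a).start hφ)
    (fun v u => by
      refine cutSum_eq_zero fun x y _ => ?_
      simp only [insertAfter, hF.multi.zero_letter, hat_zero, hφ.head_zero])]
  refine cutSum_congr fun u v _ => ?_
  congr 1
  have h1 : barWord k (start (insertAfter k n F G v a) φ) u =
      cutSum (fun x y => φ (barWord k (insertAfter k n F G v a) x :: y)) u +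
      (-1 : k) ^ (m + n + v.length) • cutSum (fun x y =>
        barWord k (fun l => φ (insertAfter k n F G v a x :: l)) y) u := by
    refine (hat_cutSum (-1 : k) (G := mulWord)
      (fun x y => φ (insertAfter k n F G v a x :: y)) u).trans ?_
    rw [cutSum_add, ← cutSum_smul]
    congr 1
    · exact cutSum_congr fun x y _ => hat_map (-1 : k) (hφ.linear [] y) x
    · refine cutSum_congr fun x y _ => ?_
      by_cases hx : v.length + x.length + 2 = m + n
      · congr 1
        rw [← hx]
        exact sgn_congr (by simp only [Nat.even_add, even_two]; tauto)
      · simp only [insertAfter_supp hF hG.toIsCochain v a x hx, hφ.head_zero, barWord, hat_zero,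
          smul_zero]
  have h2 : cutSum (fun p q => start (insertAfter k n F G v (a * letter p)) φ q) u =
      start (cutSum fun x y => insertAfter k n F G v (a * letter x) y) φ u := by
    refine (cutSum_assoc (fun p x y => φ (insertAfter k n F G v (a * letter p) x :: y)) u).symm.trans
      (cutSum_congr fun x y _ => ?_)
    exact (hφ.sum_letter [] y x _).symm
  have h3 : barWord k (fun x => start (insertAfter k n F G x a) φ u) v =
      start (fun y => barWord k (fun x => insertAfter k n F G x a y) v) φ u := by
    refine (hat_cutSum_param (e := (-1 : k)) (F := mulWord)
      (Ψ := fun x y z => φ (insertAfter k n F G z a x :: y)) u v).trans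
      (cutSum_congr fun x y _ => ?_)
    exact hat_map (-1 : k) (F := mulWord) (φ := fun z => insertAfter k n F G z a x)
      (hφ.linear [] y) v
  have h4 : cutSum (fun x y => (-1 : k) ^ x.length •
        start (insertAfter k n F G x (letter y * a)) φ u) v =
      start (fun z => cutSum (fun x y => (-1 : k) ^ x.length •
        insertAfter k n F G x (letter y * a) z) v) φ u := by
    have h5 : ∀ x y, (-1 : k) ^ x.length • start (insertAfter k n F G x (letter y * a)) φ u =
        cutSum (fun p q => φ (((-1 : k) ^ x.length • insertAfter k n F G x (letter y * a) p) :: q))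
          u := fun x y => by
      rw [start, ← cutSum_smul]
      exact cutSum_congr fun p q _ => (hφ.head_smul _ _ _).symm
    have h6 : ∀ (p q : List A), φ (cutSum (fun x y => (-1 : k) ^ x.length •
        insertAfter k n F G x (letter y * a) p) v :: q) = cutSum (fun x y => φ (((-1 : k) ^ x.length •
        insertAfter k n F G x (letter y * a) p) :: q)) v := fun p q => hφ.sum_letter [] q v _
    exact (cutSum_congr fun x y _ => h5 x y).trans ((cutSum_comm _ _ _).trans
      (cutSum_congr fun p q _ => (h6 p q).symm))
  rw [h1, h2, h3, h4]
  have h7 : ∀ f g : List A → A, start (fun l => f l - g l) φ u = start f φ u - start g φ u := by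
    intro f g
    exact (cutSum_congr fun x y _ => (hφ.linear [] y).map_sub _ _).trans (cutSum_sub _ _ _)
  have hfun := funext (hat_barWord_insertAfter hF hG v a)
  rw [hfun, start_add_left hφ, start_add_left hφ, start_smul_left hφ, start_add_left hφ,
    start_smul_left hφ, h7]
  have h8 := sign_sq (k := k) v.length
  rw [pow_add (-1 : k) (m + n) v.length]
  have h9 : start (fun y => barWord k (insertAfter k n F G v a) y) φ u =
    cutSum (fun x y => φ (barWord k (insertAfter k n F G v a) x :: y)) u := rfl
  rw [h9]
  generalize (-1 : k) ^ (n + 1) = e at *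
  generalize (-1 : k) ^ v.length = c at *
  generalize (-1 : k) ^ (m + n) = r at *
  have h10 : e * (c * e) = c := by linear_combination c * he
  have h11 : c * (r * c) = r := by linear_combination r * h8
  simp only [smul_add, smul_sub, smul_smul, h10, h11]
  module

-- `insideWord` sums the configurations with the marked letter and, to its right, an insertion of
-- `G` both inside `F`. Its boundary consists of the degenerations of such a configuration: `G`
-- adjacent to the marked letter, `G` leaving `F` at the right end, and the marked letter becoming
-- the first argument of `F`. These are the terms left by `capWord_lieWord`; all other degenerations
-- belong to the differential of `φ`.
set_option maxHeartbeats 600000 in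
theorem hochWord_sub_insideWord (hF : IsCocycle k m F) (hG : IsCocycle k n G)
    (hφ : IsMulti k φ) (l : List A) :
    capWord G (lieWord k m F φ) l - ((-1 : k) ^ (m + 1)) ^ n • lieWord k m F (capWord G φ) l -
      capWord (bracketWord k m n F G) φ l = (-1 : k) ^ (m + n) • insideWord k n F G (hochWord k φ) l -
        hochWord k (insideWord k n F G φ) l := by
  rcases l with _ | ⟨a, w⟩
  · simp [capWord, lieWord, insideWord, rotSum, hochWord]
  rw [capWord_lieWord hG.toIsCochain hφ, hochWord_insideWord hF.toIsCochain hG hφ]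
  set K := insertAfter k n F G with hK
  -- Closedness of `F` yields four outer multiplications: a letter of `v` on the left, the marked
  -- letter on the left when `v` is empty, a letter on the right, and a value of `G` on the right.
  have hE : ∀ u v, start (fun y => hat ((-1 : k) ^ (n + 1)) G
      (fun y => barWord k F (v ++ a :: y)) y) φ u =
      cutSum (fun x r => start (fun y => letter x * K r a y) φ u) v +
      (if v = [] then start (fun y => a * hat ((-1 : k) ^ (n + 1)) G F y) φ u else 0) +
      (-1 : k) ^ (m + 1) • (cutSum (fun p r =>
          cutSum (fun q y => φ (K v a p * letter q :: y)) r) u +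
        cutSum (fun p r => cutSum (fun q y => ((-1 : k) ^ (n + 1)) ^ p.length •
          φ (F (v ++ a :: p) * G q :: y)) r) u) := by
    intro u v
    simp only [hat_barWord_of_cocycle hF, start_add_left hφ, start_smul_left hφ]
    congr 1
    · congr 1
      · have : ∀ (p q : List A), φ (cutSum (fun x r => letter x * K r a p) v :: q) =
            cutSum (fun x r => φ (letter x * K r a p :: q)) v :=
          fun p q => hφ.sum_letter [] q v _
        exact (cutSum_congr fun p q _ => this p q).trans (cutSum_comm _ _ _)
      · split_ifs
        · rfl
        · exact cutSum_eq_zero fun _ _ _ => hφ.head_zero _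
    · congr 1
      have : start (cutSum fun p q => K v a p * letter q +
          ((-1 : k) ^ (n + 1)) ^ p.length • (F (v ++ a :: p) * G q)) φ u =
          cutSum (fun x y => cutSum (fun p q => φ (K v a p * letter q :: y) +
            ((-1 : k) ^ (n + 1)) ^ p.length • φ (F (v ++ a :: p) * G q :: y)) x) u := by
        refine cutSum_congr fun x y _ => (hφ.sum_letter [] y x _).trans
          (cutSum_congr fun p q _ => ?_)
        exact (hφ.head_add _ _ _).trans (congrArg _ (hφ.head_smul _ _ _))
      refine this.trans ?_
      rw [cutSum_assoc (fun p q y => φ (K v a p * letter q :: y) +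
            ((-1 : k) ^ (n + 1)) ^ p.length • φ (F (v ++ a :: p) * G q :: y)), ← cutSum_add]
      exact cutSum_congr fun _ _ _ => cutSum_add _ _ _
  have hH : insideWord k n F G (hochWord k φ) (a :: w) =
      cutSum (fun u v => (rotSign k v.length u.length * ((-1 : k) ^ (n + 1)) ^ (v.length + 1)) •
        (cutSum (fun p r => cutSum (fun q y => φ (K v a p * letter q :: y)) r) u -
          cutSum (fun x y => barWord k (fun l => φ (K v a x :: l)) y) u +
          cutSum (fun p r => cutSum (fun q y => (-1 : k) ^ (q.length + 1) •
            φ (letter y * K v a p :: q)) r) u)) w := by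
    refine cutSum_congr fun u v _ => ?_
    rw [mul_smul, ← cutSum_sub, ← cutSum_add]
    rfl
  -- These are the terms in which the marked letter has absorbed a value of `G` before entering `F`.
  have hY1 : cutSum (fun p r => cutSum (fun u v => rotSign k v.length u.length •
        start (fun l => F (v ++ a * G p :: l)) φ u) r) w =
      cutSum (fun u v => (rotSign k v.length u.length * ((-1 : k) ^ (n + 1)) ^ (v.length + 1)) •
        ((-1 : k) ^ (n + 1) * (-1) ^ v.length) •
          start (cutSum fun x y => F (v ++ a * G x :: y)) φ u) w := by
    rw [← cutSum_assoc (fun p u v => rotSign k v.length u.length •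
        start (fun l => F (v ++ a * G p :: l)) φ u)]
    refine cutSum_congr fun u v _ => ?_
    have h2 : start (cutSum fun x y => F (v ++ a * G x :: y)) φ u =
        cutSum (fun p q => start (fun l => F (v ++ a * G p :: l)) φ q) u :=
      (cutSum_congr fun x y _ => hφ.sum_letter [] y x _).trans (cutSum_assoc
        (fun p x y => φ (F (v ++ a * G p :: x) :: y)) u)
    rw [h2, ← cutSum_smul, ← cutSum_smul]
    refine cutSum_congr fun p q hu => ?_
    by_cases hp : p.length = n
    · rw [← hu, List.length_append, hp, smul_smul]
      congr 1
      simp only [rotSign, ← pow_mul, ← pow_add]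
      exact sgn_congr (by simp only [Nat.even_add, Nat.even_mul, Nat.even_add_one]; tauto)
    · have : start (fun l => F (v ++ a * G p :: l)) φ q = 0 := cutSum_eq_zero fun x y _ => by
        beta_reduce
        rw [hG.supp p hp, mul_zero, hF.multi.zero_letter, hφ.head_zero]
      rw [this, smul_zero, smul_zero, smul_zero]
  have hY2 : ((-1 : k) ^ (m + 1)) ^ n • cutSum (fun u v => rotSign k v.length u.length •
        start (fun l => F (v ++ a :: l)) (capWord G φ) u) w =
      cutSum (fun u v => (rotSign k v.length u.length * ((-1 : k) ^ (n + 1)) ^ (v.length + 1)) •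
        (-1 : k) ^ (n + 1) • (-1 : k) ^ (m + 1) • cutSum (fun p r => cutSum (fun q y =>
          ((-1 : k) ^ (n + 1)) ^ p.length • φ (F (v ++ a :: p) * G q :: y)) r) u) w := by
    rw [← cutSum_smul]
    refine cutSum_congr fun u v _ => ?_
    simp only [start, capWord, ← cutSum_smul]
    refine cutSum_congr fun p r _ => cutSum_congr fun q y _ => ?_
    by_cases hp : v.length + 1 + p.length = m
    · simp only [smul_smul]
      congr 1
      rw [mul_comm, mul_assoc]
      congr 1
      rw [← hp]
      simp only [← pow_mul, ← pow_add]
      exact sgn_congr (by simp only [Nat.even_add, Nat.even_mul, Nat.even_add_one]; tauto)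
    · rw [hF.supp _ (by simp; omega), zero_mul, hφ.head_zero]
      simp only [smul_zero]
  -- Multiplying the output of `F` on the left by the first letter of `v` is the wrap-around term of
  -- the differential of `φ`: before the rotation that letter follows `u`.
  have hA1 : cutSum (fun u v => (rotSign k v.length u.length *
        ((-1 : k) ^ (n + 1)) ^ (v.length + 1)) • (-1 : k) ^ (n + 1) •
        cutSum (fun x r => start (fun y => letter x * K r a y) φ u) v) w =
      (-1 : k) ^ (m + n) • cutSum (fun u v => (rotSign k v.length u.length *
        ((-1 : k) ^ (n + 1)) ^ (v.length + 1)) • cutSum (fun p r => cutSum (fun q y =>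
          (-1 : k) ^ (q.length + 1) • φ (letter y * K v a p :: q)) r) u) w := by
    have h1 := cutSum_assoc (fun u x r => (rotSign k (1 + r.length) u.length *
      ((-1 : k) ^ (n + 1)) ^ (r.length + 1)) • start (fun y => letter x * K r a y) φ u) w
    have he := sign_sq (k := k) (n + 1)
    refine Eq.trans (cutSum_congr fun u v _ => ?_) (h1.symm.trans ?_)
    · rw [smul_smul, ← cutSum_smul]
      refine cutSum_congr fun x r hv => ?_
      by_cases hx : x.length = 1
      · rw [← hv, List.length_append, hx]
        congr 1
        rw [mul_assoc, show 1 + r.length + 1 = r.length + 1 + 1 by ring, pow_succ _ (r.length + 1),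
          mul_assoc, he, mul_one, add_comm 1]
      · have : start (fun y => letter x * K r a y) φ u = 0 := cutSum_eq_zero fun p q _ => by
          beta_reduce
          rw [letter_eq_zero hx, zero_mul, hφ.head_zero]
        rw [this, smul_zero, smul_zero]
    · rw [← cutSum_smul]
      refine cutSum_congr fun u v _ => ?_
      have h2 := cutSum_assoc (fun p q x => (rotSign k (1 + v.length) (p.length + q.length) *
        ((-1 : k) ^ (n + 1)) ^ (v.length + 1)) • φ (letter x * K v a p :: q)) u
      simp only [start, ← cutSum_smul]
      refine Eq.trans (cutSum_congr fun p x _ => cutSum_congr fun p q hp => ?_)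
        (h2.trans (cutSum_congr fun p r hu => cutSum_congr fun q x hr => ?_))
      · rw [← hp, List.length_append]
      · by_cases hx : x.length = 1
        · by_cases hp : v.length + p.length + 2 = m + n
          · rw [← hu, ← hr, List.length_append, List.length_append, hx]
            simp only [smul_smul]
            congr 1
            rw [← hp]
            have hs : rotSign k (1 + v.length) (p.length + q.length) =
                (-1) ^ (v.length + p.length + 2) *
                  (rotSign k v.length (p.length + (q.length + 1)) * (-1) ^ (q.length + 1)) := by
              simp only [rotSign, ← pow_add]
              refine sgn_congr ?_
              simp only [Nat.even_add, Nat.even_mul, Nat.even_add_one, even_two, Nat.not_even_one]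
              by_cases h1 : Even v.length <;> by_cases h2 : Even p.length <;>
                by_cases h3 : Even q.length <;> simp only [h1, h2, h3] <;> decide
            rw [hs]
            ring
          · rw [hK, insertAfter_supp hF.toIsCochain hG.toIsCochain v a p hp, mul_zero, hφ.head_zero]
            simp only [smul_zero]
        · rw [letter_eq_zero hx, zero_mul, hφ.head_zero]
          simp only [smul_zero]
  -- With `v` empty the marked letter multiplies `F` from the left, which is the contraction with
  -- `G` inserted into `F`: the other half of the bracket.
  have hA2 : cutSum (fun u v => (rotSign k v.length u.length *
        ((-1 : k) ^ (n + 1)) ^ (v.length + 1)) • (-1 : k) ^ (n + 1) •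
        if v = [] then start (fun y => a * hat ((-1 : k) ^ (n + 1)) G F y) φ u else 0) w =
      capWord (hat ((-1 : k) ^ (n + 1)) G F) φ (a :: w) := by
    rw [cutSum_right_nil]
    · rw [if_pos rfl, smul_smul]
      have he := sign_sq (k := k) (n + 1)
      simp only [rotSign, List.length_nil, zero_mul, pow_zero, zero_add, one_mul, pow_one, he,
        one_smul]
      rfl
    · intro u b v
      rw [if_neg (by simp), smul_zero, smul_zero]
  rw [hH, hY1, hY2, ← hA2]
  have hs : (-1 : k) ^ (n + 1) * (-1) ^ (m + 1) = (-1) ^ (m + n) := by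
    rw [← pow_add]
    exact sgn_congr (by simp only [Nat.even_add, Nat.even_add_one]; tauto)
  have key : cutSum (fun u v => (rotSign k v.length u.length *
        ((-1 : k) ^ (n + 1)) ^ (v.length + 1)) •
        ((-1 : k) ^ (n + 1) • start (fun y =>
            hat ((-1 : k) ^ (n + 1)) G (fun y => barWord k F (v ++ a :: y)) y) φ u -
          ((-1 : k) ^ (n + 1) * (-1) ^ v.length) •
            start (cutSum fun x y => F (v ++ a * G x :: y)) φ u -
          (-1 : k) ^ (m + n) • cutSum (fun x y => barWord k (fun l => φ (K v a x :: l)) y) u)) w =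
      cutSum (fun u v => (rotSign k v.length u.length * ((-1 : k) ^ (n + 1)) ^ (v.length + 1)) •
        (-1 : k) ^ (n + 1) • cutSum (fun x r => start (fun y => letter x * K r a y) φ u) v) w +
      cutSum (fun u v => (rotSign k v.length u.length * ((-1 : k) ^ (n + 1)) ^ (v.length + 1)) •
        (-1 : k) ^ (n + 1) •
        if v = [] then start (fun y => a * hat ((-1 : k) ^ (n + 1)) G F y) φ u else 0) w +
      cutSum (fun u v => (rotSign k v.length u.length * ((-1 : k) ^ (n + 1)) ^ (v.length + 1)) •
        ((-1 : k) ^ (m + n) • cutSum (fun p r =>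
          cutSum (fun q y => φ (K v a p * letter q :: y)) r) u +
        ((-1 : k) ^ (n + 1) • (-1 : k) ^ (m + 1) • cutSum (fun p r => cutSum (fun q y =>
          ((-1 : k) ^ (n + 1)) ^ p.length • φ (F (v ++ a :: p) * G q :: y)) r) u) -
          ((-1 : k) ^ (n + 1) * (-1) ^ v.length) •
            start (cutSum fun x y => F (v ++ a * G x :: y)) φ u -
          (-1 : k) ^ (m + n) • cutSum (fun x y =>
            barWord k (fun l => φ (K v a x :: l)) y) u)) w := by
    rw [← cutSum_add, ← cutSum_add]
    refine cutSum_congr fun u v _ => ?_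
    rw [hE, ← hs]
    module
  rw [key, hA1]
  rw [sub_eq_iff_eq_add, sub_eq_iff_eq_add, ← cutSum_smul, ← cutSum_smul, ← sub_eq_zero]
  have : ∀ s h l i r q : W, s - (h - (l + i + r) + i + q) = s - h + l + r - q := by intros; abel
  rw [this, ← cutSum_sub, ← cutSum_add, ← cutSum_add, ← cutSum_sub]
  refine cutSum_eq_zero fun u v _ => ?_
  module

end LieContraction

end CalabiYau

namespace CalabiYau

/-! ### The Connes operator, normalization and Cartan's formula -/

section Connes

variable {k : Type*} [Field k] {A : Type*} [Ring A] [Algebra k A]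
  {W : Type*} [AddCommGroup W] [Module k W]
  {F G : List A → A} {φ : List A → W} {m n : ℕ}

/-- Transposed form of `N b = b' N`: the unweighted case of `hochWord_rotSum`, whose right side is
the bar differential of rotated words. -/
theorem hochWord_normWord (hφ : IsMulti k φ) (l : List A) :
    hochWord k (normWord k φ) l = normWord k (barWord k φ) l := by
  rcases l with _ | ⟨a, w⟩
  · rfl
  have h := hochWord_rotSum (k := k) (e := 1) (S := fun v a u => φ (v ++ a :: u)) (one_mul 1)
    (fun a u => hφ.append_right (a :: u)) (fun v a => (hφ.append v).cons a)
    (fun v u => hφ.zero_letter v u) a w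
  simp only [one_pow, one_smul, mul_one] at h
  refine h.trans (cutSum_congr fun u v _ => ?_)
  beta_reduce
  rw [barWord_append_cons hφ]

theorem cycWord_append_cons (hφ : IsMulti k φ) (v : List A) (a : A) (l : List A) :
    cycWord k φ (v ++ a :: l) = (if l = [] then (-1 : k) ^ v.length • φ (a :: v) else 0) +
      cutSum (fun x y => (-1 : k) ^ (v.length + 1 + x.length) •
        φ (letter y :: (v ++ a :: x))) l := by
  rw [cycWord, cutSum_append_cons]
  simp only [List.length_append, List.length_cons]
  congr 1
  · split_ifs with hl
    · subst hl
      rw [cutSum_right_nil]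
      · rfl
      · intro u b v
        rw [letter_append_cons, if_neg (by simp), hφ.head_zero, smul_zero]
    · refine cutSum_eq_zero fun x y _ => ?_
      rw [letter_append_cons, if_neg (by simp [hl]), hφ.head_zero, smul_zero]
  · refine cutSum_congr fun x y _ => ?_
    congr 2; ring

theorem cutSum_left_nil {Φ : List A → List A → W} (h : ∀ a u v, Φ (a :: u) v = 0)
    (w : List A) : cutSum Φ w = Φ [] w := by
  rcases w with _ | ⟨a, w⟩
  · rfl
  · rw [cutSum_cons, cutSum_eq_zero, add_zero]
    intro u v _
    exact h a u v

/-- Transposed form of `t N = N`: rotating permutes the summands of the norm, and the comparison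
telescopes. -/
theorem normWord_cycWord (hφ : IsMulti k φ) (l : List A) :
    normWord k (cycWord k φ) l = normWord k φ l := by
  rcases l with _ | ⟨a, w⟩
  · rfl
  simp only [normWord, rotSum, cycWord_append_cons hφ, smul_add, cutSum_add, ← cutSum_smul]
  have h1 : cutSum (fun u v => rotSign k v.length u.length •
      if u = [] then (-1 : k) ^ v.length • φ (a :: v) else 0) w = φ (a :: w) := by
    rw [cutSum_left_nil fun b u v => by rw [if_neg (by simp), smul_zero], if_pos rfl, smul_smul,
      rotSign]
    simp [sign_sq]
  have h2 := cutSum_assoc (fun p q v => (rotSign k v.length (p.length + q.length) *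
        (-1) ^ (v.length + 1 + p.length)) • φ (letter q :: (v ++ a :: p))) w
  have h3 : cutSum (fun u v => cutSum (fun p q => rotSign k v.length u.length •
      (-1 : k) ^ (v.length + 1 + p.length) • φ (letter q :: (v ++ a :: p))) u) w = _ :=
    Eq.trans (cutSum_congr fun u v _ => cutSum_congr fun p q hu => by
        rw [← hu, List.length_append, smul_smul]) h2
  rw [h1, h3, ← eq_sub_iff_add_eq, ← cutSum_sub, cutSum_right_nil]
  rotate_left
  · intro p b v
    rw [cutSum_eq_single, sub_eq_zero]
    · simp only [letter, List.length_cons, List.length_nil, List.cons_append]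
      congr 1
      simp only [rotSign, ← pow_add]
      exact sgn_congr (by simp only [Nat.even_add, Nat.even_mul, Nat.even_add_one]; tauto)
    · intro u v hu
      simp only [letter_eq_zero hu, hφ.head_zero, smul_zero]
  rw [cutSum_nil, show letter ([] : List A) = 0 from rfl, hφ.head_zero]
  simp [rotSign]

theorem mulWord_eq_cupWord (l : List A) : mulWord l = cupWord letter letter l := by
  rcases l with _ | ⟨a, l⟩
  · simp [mulWord, cupWord, letter]
  · exact (cutSum_letter_cons (Φ := fun a v => a * letter v) (fun v => zero_mul _) a l).symm

/-- Transposed form of `b (1 - t) = (1 - t) b'`. -/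
theorem hochWord_sub_cycWord (hφ : IsMulti k φ) (a : A) (w : List A) :
    hochWord k φ (a :: w) - cycWord k (hochWord k φ) (a :: w) =
      barWord k φ (a :: w) - barWord k (cycWord k φ) (a :: w) := by
  have h1 : barWord k (cycWord k φ) (a :: w) = cutSum (fun u v => (-1 : k) ^ (u.length + 1) •
      barWord k (fun l => φ (letter v :: l)) u + φ (mulWord v :: u)) (a :: w) := by
    refine (hat_cutSum (-1 : k) (G := mulWord) (fun u v => (-1 : k) ^ u.length •
      φ (letter v :: u)) (a :: w)).trans (cutSum_congr fun u v _ => ?_)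
    congr 1
    · rw [hat_smul_pow_length (by ring) (hφ.cons _) (fun _ h => mulWord_eq_zero h)]
      congr 1
      exact sgn_congr (by simp only [Nat.even_add_one]; tauto)
    · rw [hat_smul, smul_smul, sign_sq, one_smul, hat_letter _ hφ, hat_letter_eq]
  have h2 : cutSum (fun u v => φ (mulWord v :: u)) (a :: w) = cutSum (fun u v =>
      cutSum (fun x y => φ (letter y * letter v :: x)) u) (a :: w) := by
    rw [cutSum_assoc (fun x y v => φ (letter y * letter v :: x))]
    refine cutSum_congr fun u v _ => ?_
    rw [mulWord_eq_cupWord]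
    exact hφ.sum_letter [] u v _
  have h3 : cycWord k (hochWord k φ) (a :: w) = cutSum (fun u v => (-1 : k) ^ u.length •
      cutSum (fun x y => φ (letter v * letter x :: y)) u - (-1 : k) ^ u.length •
      barWord k (fun l => φ (letter v :: l)) u +
      cutSum (fun x y => φ (letter y * letter v :: x)) u) (a :: w) := by
    refine cutSum_congr fun u v _ => ?_
    rw [hochWord, smul_add, smul_sub, ← cutSum_smul _ (fun x y => _ • _)]
    congr 1
    refine cutSum_congr fun x y hu => ?_
    by_cases hy : y.length = 1
    · rw [← hu, List.length_append, hy, smul_smul, sign_sq, one_smul]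
    · rw [letter_eq_zero hy, zero_mul, hφ.head_zero, smul_zero, smul_zero]
  have h4 : cutSum (fun u v => (-1 : k) ^ u.length •
      cutSum (fun x y => φ (letter v * letter x :: y)) u) (a :: w) =
      cutSum (fun u v => (-1 : k) ^ (u.length + 1) • φ (letter v * a :: u)) w := by
    rw [cutSum_cons]
    rw [cutSum_nil, show letter ([] : List A) = 0 from rfl, mul_zero, hφ.head_zero, smul_zero,
      zero_add]
    refine cutSum_congr fun u v _ => ?_
    rw [cutSum_letter_cons (Φ := fun b y => φ (letter v * b :: y)) fun y => by
      rw [mul_zero, hφ.head_zero]]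
    rfl
  rw [h1, cutSum_add, h2, h3, cutSum_add, cutSum_sub, h4, hochWord, barWord_cons hφ]
  simp only [pow_succ, mul_neg_one, neg_smul, cutSum_neg]
  abel

/-- The Connes operator `(1 - t) s N`. -/
def fullConnesWord (k : Type*) [Field k] {A : Type*} [Ring A] {W : Type*} [AddCommGroup W]
    [Module k W] (φ : List A → W) : List A → W :=
  normWord k fun l => φ (1 :: l) - cycWord k φ (1 :: l)

theorem IsMulti.cyc (hφ : IsMulti k φ) : IsMulti k (cycWord k φ) :=
  IsMulti.cutSum (fun v => (hφ.cons (CalabiYau.letter v)).smul_length fun n => (-1 : k) ^ n)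
    fun u => (hφ.letter letter_isMulti [] u).fsmul _

theorem IsMulti.fullConnes (hφ : IsMulti k φ) : IsMulti k (fullConnesWord k φ) :=
  ((hφ.cons 1).fsub (hφ.cyc.cons 1)).norm

theorem normWord_congr {ψ : List A → W} (h : ∀ a l, φ (a :: l) = ψ (a :: l)) (l : List A) :
    normWord k φ l = normWord k ψ l := by
  rcases l with _ | ⟨a, w⟩
  · rfl
  refine cutSum_congr fun u v _ => ?_
  rcases v with _ | ⟨b, v⟩
  · simp only [List.nil_append, h]
  · simp only [List.cons_append, h]

theorem normWord_sub {ψ : List A → W} (l : List A) :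
    normWord k (fun l => φ l - ψ l) l = normWord k φ l - normWord k ψ l := by
  rcases l with _ | ⟨a, w⟩
  · simp [rotSum]
  · simp only [normWord, rotSum, smul_sub, cutSum_sub]

/-- Transposed form of `b' s + s b' = 1`: only the product of the new `1` with its neighbour is not
accounted for by the bar differential of the remaining word. -/
theorem barWord_one_cons (hφ : IsMulti k φ) (a : A) (l : List A) :
    barWord k φ (1 :: a :: l) = φ (a :: l) - barWord k (fun l => φ (1 :: l)) (a :: l) := by
  rw [barWord_cons hφ]
  simp only [one_mul]
  rw [cutSum_letter_cons (Φ := fun b y => φ (b :: y)) fun y => hφ.head_zero y]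

/-- The usual computation: `B b = (1 - t) s N b = (1 - t) s b' N = (1 - t)(1 - b' s) N = - b (1 - t)
s N`, since `(1 - t) N = 0`. -/
theorem hochWord_fullConnesWord (hφ : IsMulti k φ) (l : List A) :
    hochWord k (fullConnesWord k φ) l = - fullConnesWord k (hochWord k φ) l := by
  have hψ : IsMulti k fun l => φ l - cycWord k φ l := hφ.fsub hφ.cyc
  rw [fullConnesWord, hochWord_normWord (hψ.cons 1), fullConnesWord]
  rw [normWord_congr (ψ := fun l => (φ l - cycWord k φ l) -
    (hochWord k φ (1 :: l) - cycWord k (hochWord k φ) (1 :: l)))]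
  · rw [normWord_sub, normWord_sub, normWord_cycWord hφ, sub_self, zero_sub]
  · intro a l
    have h := barWord_one_cons hψ a l
    rw [hochWord_sub_cycWord hφ]
    have h2 : barWord k (fun l => φ l - cycWord k φ l) (1 :: a :: l) =
        barWord k φ (1 :: a :: l) - barWord k (cycWord k φ) (1 :: a :: l) := by
      simp only [barWord, sub_eq_add_neg, hat_add, hat_neg]
    rw [← h2, h]
    abel

/-! ### Normalized cochains -/

/-- Functions which vanish on words containing the letter `1`. -/
def IsNormalWord (φ : List A → W) : Prop := ∀ x y, φ (x ++ 1 :: y) = 0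

/-- Functions of cyclic words which vanish on words containing the letter `1`, except possibly in
the marked place. -/
def IsNormal (φ : List A → W) : Prop := ∀ a, IsNormalWord fun l => φ (a :: l)

theorem IsNormal.cap (hF : IsNormalWord F) (h : IsNormal φ) (hφ : IsMulti k φ) :
    IsNormal (capWord F φ) := by
  intro a x y
  beta_reduce
  rw [capWord, cutSum_append_cons, cutSum_eq_zero, cutSum_eq_zero, add_zero]
  · intro u v _
    rw [hF, mul_zero, hφ.head_zero]
  · intro u v _
    exact h _ _ _

/-- In the summand with the additional rotation the inserted `1` is no longer in the marked place,
where alone it is harmless. -/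
theorem IsNormal.fullConnes (h : IsNormal φ) (hφ : IsMulti k φ) (l : List A) :
    fullConnesWord k φ l = connesWord k φ l := by
  refine normWord_congr (φ := fun l => φ (1 :: l) - cycWord k φ (1 :: l))
    (ψ := fun l => φ (1 :: l)) (fun a l => ?_) l
  rw [sub_eq_self, cycWord, cutSum_cons, letter_eq_zero (by simp), hφ.head_zero, smul_zero,
    zero_add]
  refine cutSum_eq_zero fun u v _ => ?_
  rw [show φ (letter v :: 1 :: u) = 0 from h (letter v) [] u, smul_zero]

/-- After the first operator a further `1` lies outside the marked place, so the second one meets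
only words on which `φ` vanishes. -/
theorem IsNormal.fullConnes_fullConnes (h : IsNormal φ) (hφ : IsMulti k φ) (l : List A) :
    fullConnesWord k (fullConnesWord k φ) l = 0 := by
  have h0 : fullConnesWord k φ = connesWord k φ := funext (h.fullConnes hφ)
  have h1 : ∀ a x y, connesWord k φ (a :: (x ++ 1 :: y)) = 0 := by
    intro a x y
    refine cutSum_eq_zero fun u v huv => ?_
    rcases List.append_eq_append_iff.mp huv with ⟨s, hs, hs'⟩ | ⟨s, hs, hs'⟩
    · rw [hs']
      have : φ (1 :: (s ++ 1 :: (y ++ a :: u))) = 0 := h 1 s (y ++ a :: u)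
      simp only [List.append_assoc, List.cons_append]
      rw [this, smul_zero]
    · rcases s with _ | ⟨b, s⟩
      · simp only [List.nil_append] at hs'
        rw [← hs']
        have : φ (1 :: 1 :: (y ++ a :: u)) = 0 := h 1 [] (y ++ a :: u)
        simp only [List.cons_append]
        rw [this, smul_zero]
      · simp only [List.cons_append, List.cons.injEq] at hs'
        rw [hs, ← hs'.1]
        have : φ (1 :: ((v ++ a :: x) ++ 1 :: s)) = 0 := h 1 (v ++ a :: x) s
        simp only [List.append_assoc, List.cons_append] at this ⊢
        rw [this, smul_zero]
  have h2 : IsNormal (connesWord k φ) := fun a x y => h1 a x y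
  rw [h0, h2.fullConnes hφ.connes]
  rcases l with _ | ⟨a, w⟩
  · rfl
  refine cutSum_eq_zero fun u v _ => smul_eq_zero_of_right _ ?_
  change cutSum (fun u' v' => _ • φ (1 :: (v' ++ 1 :: u'))) _ = 0
  refine cutSum_eq_zero fun u' v' _ => ?_
  rw [show φ (1 :: (v' ++ 1 :: u')) = 0 from h 1 v' u', smul_zero]

theorem rotSum_sub {Ψ Ψ' : List A → A → List A → W} (l : List A) :
    rotSum k (fun v a u => Ψ v a u - Ψ' v a u) l = rotSum k Ψ l - rotSum k Ψ' l := by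
  rcases l with _ | ⟨a, w⟩
  · simp [rotSum]
  · simp only [rotSum, smul_sub, cutSum_sub]

/-- Cartan's formula up to homotopy. -/
theorem lieWord_eq_connes (hF : IsCocycle k m F) (hFn : IsNormalWord F) (hφ : IsMulti k φ)
    (hn : IsNormal φ) (h0 : ∀ l, hochWord k φ l = 0) (l : List A) :
    lieWord k m F φ l = fullConnesWord k (capWord F φ) l +
      (-1 : k) ^ (m + 1) • capWord F (fullConnesWord k φ) l +
      (-1 : k) ^ (m + 1) • hochWord k (afterWord k m F fun l => φ (1 :: l)) l := by
  have h1 := lieWord_eq hF.toIsCochain hφ l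
  have h2 := afterWord_barWord hF (hφ.cons 1) l
  have h3 : afterWord k m F φ l - afterWord k m F (cycWord k φ) l =
      afterWord k m F (barWord k fun l => φ (1 :: l)) l := by
    -- Closedness on the word `1 :: a :: l`: its three parts are `φ` itself, the bar differential
    -- and the rotated term. So on nonempty words `1 - t` becomes a bar differential, to which
    -- `afterWord_barWord` applies.
    have hc : ∀ a l, φ (a :: l) - cycWord k φ (a :: l) = barWord k (fun l => φ (1 :: l)) (a :: l) := by
      intro a l
      have := h0 (1 :: a :: l)
      rw [hochWord] at this
      simp only [one_mul, mul_one] at this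
      rw [cutSum_letter_cons (Φ := fun b y => φ (b :: y)) fun y => hφ.head_zero y] at this
      simp only [pow_succ, mul_neg_one, neg_smul, cutSum_neg] at this
      rw [sub_eq_iff_eq_add]
      rw [← sub_eq_zero, cycWord, ← this]
      abel
    rw [afterWord, afterWord, ← rotSum_sub]
    rcases l with _ | ⟨a, w⟩
    · rfl
    · refine cutSum_congr fun u v _ => ?_
      beta_reduce
      rw [← smul_sub]
      congr 2
      rw [sub_eq_add_neg, ← hat_neg, ← hat_add]
      have : ∀ l, φ (v ++ a :: l) + -cycWord k φ (v ++ a :: l) =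
          barWord k (fun l => φ (1 :: l)) (v ++ a :: l) := by
        intro l
        rcases v with _ | ⟨b, v⟩
        · rw [← sub_eq_add_neg]; exact hc _ _
        · rw [← sub_eq_add_neg]; exact hc _ _
      simp only [this]
  rw [(hn.cap hFn hφ).fullConnes (hF.multi.cap hφ), h1, add_sub_assoc, h3, h2, smul_add]
  have h4 : fullConnesWord k φ = normWord k fun l => φ (1 :: l) := funext (hn.fullConnes hφ)
  rw [h4]
  abel

theorem IsCocycle.hoch_cap (hF : IsCocycle k m F) (hφ : IsMulti k φ) (l : List A) :
    hochWord k (capWord F φ) l = (-1 : k) ^ m • capWord F (hochWord k φ) l := by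
  rw [hochWord_capWord hF.toIsCochain hφ, show deltaWord k m F = fun _ => 0 from
    funext hF.closed, capWord_zero_left hφ, zero_add]

theorem hochWord_add {ψ : List A → W} (l : List A) :
    hochWord k (fun l => φ l + ψ l) l = hochWord k φ l + hochWord k ψ l := by
  rcases l with _ | ⟨a, w⟩
  · simp [hochWord]
  · simp only [hochWord, smul_add, cutSum_add, barWord, hat_add]; abel

theorem hochWord_smul (c : k) (l : List A) :
    hochWord k (fun l => c • φ l) l = c • hochWord k φ l := by
  rcases l with _ | ⟨a, w⟩
  · simp [hochWord]
  · simp only [hochWord, smul_comm _ c, cutSum_smul, barWord, hat_smul, smul_add, smul_sub]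

theorem hochWord_zero (l : List A) : hochWord k (fun _ : List A => (0 : W)) l = 0 := by
  simpa using hochWord_smul (φ := fun _ : List A => (0 : W)) (0 : k) l

/-- The contraction with the Gerstenhaber bracket is, up to homotopy, the commutator of the Connes
operator with the contractions. -/
theorem capWord_bracketWord (hF : IsCocycle k m F) (hG : IsCocycle k n G)
    (hFn : IsNormalWord F) (hGn : IsNormalWord G) (hφ : IsMulti k φ) (hn : IsNormal φ)
    (h0 : ∀ l, hochWord k φ l = 0) : ∃ χ : List A → W, IsMulti k χ ∧ ∀ l,
      capWord (bracketWord k m n F G) φ l =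
        capWord G (fullConnesWord k (capWord F φ)) l +
        (-1 : k) ^ (m + 1) • capWord G (capWord F (fullConnesWord k φ)) l -
        (-1 : k) ^ ((m + 1) * n) • fullConnesWord k (capWord F (capWord G φ)) l -
        (-1 : k) ^ ((m + 1) * (n + 1)) • capWord F (fullConnesWord k (capWord G φ)) l +
        hochWord k χ l := by
  have hGφ := hG.multi.cap hφ
  have h1 := funext (lieWord_eq_connes hF hFn hφ hn h0)
  have h2 := lieWord_eq_connes hF hFn hGφ (hn.cap hGn hφ) fun l => by
    rw [hG.hoch_cap hφ, show hochWord k φ = fun _ => 0 from funext h0]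
    rcases l with _ | ⟨a, w⟩
    · simp [capWord]
    · simp [capWord, cutSum_zero]
  set α := afterWord k m F fun l => φ (1 :: l) with hα
  set β := afterWord k m F fun l => capWord G φ (1 :: l) with hβ
  have hαm : IsMulti k α := hF.multi.after (hφ.cons 1)
  have hβm : IsMulti k β := hF.multi.after (hGφ.cons 1)
  -- The homotopy has three sources: Cartan's formula for `φ`, contracted with `G`; Cartan's formula
  -- for the contraction of `φ` with `G`; and the commutator homotopy `insideWord`.
  refine ⟨fun l => ((-1 : k) ^ (m + 1) * (-1) ^ n) • capWord G α l +
    ((-(-1 : k) ^ ((m + 1) * n) * (-1) ^ (m + 1)) • β l + insideWord k n F G φ l),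
    ((hG.multi.cap hαm).fsmul _).fadd ((hβm.fsmul _).fadd (hF.multi.inside hG.multi hφ)),
    fun l => ?_⟩
  have h3 := hochWord_sub_insideWord hF hG hφ l
  have h4 : insideWord k n F G (hochWord k φ) l = 0 := by
    rw [show hochWord k φ = fun _ => 0 from funext h0]
    rcases l with _ | ⟨a, w⟩
    · rfl
    · refine cutSum_eq_zero fun u v _ => ?_
      beta_reduce
      rw [start, cutSum_zero, smul_zero, smul_zero]
  rw [h4, smul_zero, zero_sub, h2, h1, capWord_add, capWord_add, capWord_smul, capWord_smul] at h3
  have h5 := hG.hoch_cap hαm l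
  have hs := sign_sq (k := k) n
  rw [hochWord_add, hochWord_add, hochWord_smul, hochWord_smul, h5, ← sub_eq_zero]
  rw [← pow_mul] at h3
  rw [← sub_eq_zero] at h3
  simp only [smul_smul, mul_assoc, hs, mul_one]
  rw [show (m + 1) * (n + 1) = (m + 1) * n + (m + 1) by ring, pow_add (-1 : k) _ (m + 1)]
  linear_combination (norm := module) (-1 : k) • h3

end Connes

end CalabiYau

namespace CalabiYau

/-! ### Translation between words and multilinear maps or chains -/

section Bridge

variable {k : Type*} [Field k] {A : Type*} [Ring A] [Algebra k A]
  {W : Type*} [AddCommGroup W] [Module k W]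
  {F G : List A → A} {φ : List A → W} {m n p : ℕ}

theorem ofFn_update (a : Fin n → A) (i : Fin n) (x : A) :
    List.ofFn (Function.update a i x) = (List.ofFn a).take i ++ x :: (List.ofFn a).drop (i + 1) := by
  refine List.ext_getElem (by simp; omega) fun j h1 h2 => ?_
  simp only [List.getElem_ofFn, Function.update_apply, Fin.ext_iff]
  grind

/-- The multilinear map determined by a multilinear function of words. -/
def IsMulti.toMultilinear (hφ : IsMulti k φ) (n : ℕ) : MultilinearMap k (fun _ : Fin n => A) W :=
  MultilinearMap.mk' (fun a => φ (List.ofFn a))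
    (by intro a i x y; simp only [ofFn_update, hφ.add])
    (by intro a i c x; simp only [ofFn_update, hφ.smul])

/-- The function of words determined by a multilinear map. -/
def wordOf (f : MultilinearMap k (fun _ : Fin n => A) W) (l : List A) : W :=
  if h : l.length = n then f fun i => l[i.1] else 0

theorem wordOf_ofFn (f : MultilinearMap k (fun _ : Fin n => A) W) (a : Fin n → A) :
    wordOf f (List.ofFn a) = f a := by
  rw [wordOf, dif_pos (by simp)]
  congr 1; funext i; simp

theorem wordOf_supp (f : MultilinearMap k (fun _ : Fin n => A) W) {l : List A}
    (h : l.length ≠ n) : wordOf f l = 0 := dif_neg h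

theorem wordOf_isMulti (f : MultilinearMap k (fun _ : Fin n => A) W) : IsMulti k (wordOf f) := by
  have key : ∀ (x z : List A), (x.length + z.length + 1 = n) → ∃ (b : Fin n → A) (i : Fin n),
      ∀ a, wordOf f (x ++ a :: z) = f (Function.update b i a) := by
    intro x z h
    refine ⟨fun i => (x ++ 0 :: z)[i.1]'(by simp; omega), ⟨x.length, by omega⟩, fun a => ?_⟩
    rw [wordOf, dif_pos (by simp; omega)]
    congr 1
    funext i
    rw [Function.update_apply]
    split_ifs with hi
    · subst hi; simp
    · have : i.1 ≠ x.length := fun h => hi (Fin.ext h)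
      grind
  constructor
  · intro x a b z
    by_cases h : x.length + z.length + 1 = n
    · obtain ⟨b, i, hb⟩ := key x z h
      simp only [hb, f.map_update_add]
    · rw [wordOf_supp f, wordOf_supp f, wordOf_supp f, add_zero] <;> (simp; omega)
  · intro x c a z
    by_cases h : x.length + z.length + 1 = n
    · obtain ⟨b, i, hb⟩ := key x z h
      simp only [hb, f.map_update_smul]
    · rw [wordOf_supp f, wordOf_supp f, smul_zero] <;> (simp; omega)

theorem wordOf_isCochainWord (f : Cochain k A n) : IsCochain k n (wordOf f) :=
  ⟨wordOf_isMulti f, fun _ => wordOf_supp f⟩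

theorem exists_ofFn (l : List A) (h : l.length = n) : ∃ a : Fin n → A, List.ofFn a = l := by
  subst h
  exact ⟨l.get, List.ofFn_get l⟩

theorem wordOf_ext {f : MultilinearMap k (fun _ : Fin n => A) W}
    (hφ : ∀ l, l.length ≠ n → φ l = 0) (h : ∀ a, f a = φ (List.ofFn a)) : wordOf f = φ := by
  funext l
  by_cases hl : l.length = n
  · obtain ⟨a, rfl⟩ := exists_ofFn l hl
    rw [wordOf_ofFn, h]
  · rw [wordOf_supp f hl, hφ l hl]

theorem cutSum_eq_sum (Φ : List A → List A → W) (w : List A) :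
    cutSum Φ w = ∑ i ∈ Finset.range (w.length + 1), Φ (w.take i) (w.drop i) := by
  induction w generalizing Φ with
  | nil => simp
  | cons a w ih =>
    rw [cutSum_cons, ih, List.length_cons, Finset.sum_range_succ' _ (w.length + 1)]
    simp [add_comm]

/-- The arity fixes the length of the block, so an insertion is determined by its position;
positions with fewer than `n` letters left contribute zero. -/
theorem hat_eq_sum {e : k} (hF : ∀ l, l.length ≠ n → F l = 0) (hφ : IsMulti k φ) (w : List A)
    (h : w.length + 1 = m + n) : hat e F φ w = ∑ j : Fin m,
      e ^ j.1 • φ (w.take j ++ F ((w.drop j).take n) :: w.drop (j + n)) := by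
  have hs : ∀ x r : List A, r.length < n → start F (fun l => φ (x ++ l)) r = 0 := by
    intro x r hr
    refine cutSum_eq_zero fun y z hy => ?_
    beta_reduce
    rw [hF, hφ.zero_letter]
    have := congrArg List.length hy
    rw [List.length_append] at this
    omega
  rw [hat, cutSum_eq_sum, Fin.sum_univ_eq_sum_range (fun j =>
    e ^ j • φ (w.take j ++ F ((w.drop j).take n) :: w.drop (j + n)))]
  refine (Finset.sum_subset (Finset.range_subset_range.mpr (by omega)) fun i hi' hi => ?_).symm.trans
    (Finset.sum_congr rfl fun i hi => ?_)
  · rw [hs, smul_zero]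
    simp only [Finset.mem_range] at hi hi'
    rw [List.length_drop]
    omega
  · simp only [Finset.mem_range] at hi
    rw [List.length_take, min_eq_left (by omega), start, cutSum_eq_of_length n, List.drop_drop]
    · rw [List.length_drop]
      omega
    · intro u v hu
      rw [hF u hu, hφ.zero_letter]

theorem ofFn_insertArgs (g : (Fin n → A) → A) (j : ℕ) (hj : j < m) (h : p + 1 = m + n)
    (a : Fin p → A) : List.ofFn (insertArgs g j hj h a) = (List.ofFn a).take j ++
      g (fun l => a ⟨j + l.1, by omega⟩) :: (List.ofFn a).drop (j + n) := by
  refine List.ext_getElem (by simp; omega) fun i h1 h2 => ?_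
  rw [List.getElem_ofFn, insertArgs]
  dsimp only
  split_ifs with h3 h4
  · rw [List.getElem_append_left (by simp; omega)]
    simp
  · subst h4
    rw [List.getElem_append_right (by simp)]
    simp [show min i p = i by omega]
  · rw [List.getElem_append_right (by simp; omega), List.getElem_cons, dif_neg (by simp; omega)]
    simp only [List.getElem_drop, List.getElem_ofFn, List.length_take, List.length_ofFn]
    congr 2
    omega

theorem insertion_eq_word (f : MultilinearMap k (fun _ : Fin m => A) W) (g : Cochain k A n) (j : ℕ)
    (hj : j < m) (h : p + 1 = m + n) (a : Fin p → A) : insertion f g j hj h a =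
      wordOf f ((List.ofFn a).take j ++ wordOf g (((List.ofFn a).drop j).take n) ::
        (List.ofFn a).drop (j + n)) := by
  rw [insertion_apply, ← wordOf_ofFn f, ofFn_insertArgs]
  congr 3
  rw [← wordOf_ofFn g]
  congr 1
  refine List.ext_getElem (by simp; omega) fun i h1 h2 => ?_
  simp

theorem letter_singleton (a : A) : letter [a] = a := rfl

theorem mulWord_pair (a b : A) : mulWord [a, b] = a * b := rfl

theorem wordOf_mulCochain : wordOf (mulCochain k A) = mulWord := by
  refine wordOf_ext (fun l h => mulWord_eq_zero h) fun a => ?_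
  rw [mulCochain_apply]
  simp [List.ofFn_succ, mulWord, letter]

theorem wordOf_insertion (f : MultilinearMap k (fun _ : Fin m => A) W) (g : Cochain k A n) (j : ℕ)
    (hj : j < m) (h : p + 1 = m + n) (l : List A) (hl : l.length = p) :
    wordOf (insertion f g j hj h) l =
      wordOf f (l.take j ++ wordOf g ((l.drop j).take n) :: l.drop (j + n)) := by
  obtain ⟨a, rfl⟩ := exists_ofFn l hl
  rw [wordOf_ofFn, insertion_eq_word]

/-- The value of a sum of insertions. -/
theorem sum_insertion (f : MultilinearMap k (fun _ : Fin m => A) W) (g : Cochain k A n) (e : k)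
    (h : p + 1 = m + n) (a : Fin p → A) :
    ∑ j : Fin m, e ^ j.1 • insertion f g j.1 j.2 h a =
      hat e (wordOf g) (wordOf f) (List.ofFn a) := by
  rw [hat_eq_sum (m := m) (n := n) (fun _ => wordOf_supp g) (wordOf_isMulti f) _ (by simpa using h)]
  exact Finset.sum_congr rfl fun j _ => by rw [insertion_eq_word]

theorem wordOf_circ (f : Cochain k A m) (g : Cochain k A n) (h : p + 1 = m + n) :
    wordOf (circ f g h) = hat ((-1 : k) ^ (n + 1)) (wordOf g) (wordOf f) := by
  refine wordOf_ext (hat_supp (wordOf_isCochainWord f) (wordOf_isCochainWord g) h) fun a => ?_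
  rw [← sum_insertion f g _ h a, circ, sum_apply]
  simp only [smul_apply, pow_mul]

theorem wordOf_add (f g : MultilinearMap k (fun _ : Fin n => A) W) :
    wordOf (f + g) = fun l => wordOf f l + wordOf g l := by
  funext l; simp only [wordOf]; split_ifs <;> simp

theorem wordOf_smul (c : k) (f : MultilinearMap k (fun _ : Fin n => A) W) :
    wordOf (c • f) = fun l => c • wordOf f l := by
  funext l; simp only [wordOf]; split_ifs <;> simp

theorem wordOf_sub (f g : MultilinearMap k (fun _ : Fin n => A) W) :
    wordOf (f - g) = fun l => wordOf f l - wordOf g l := by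
  funext l; simp only [wordOf]; split_ifs <;> simp

theorem wordOf_zero : wordOf (0 : MultilinearMap k (fun _ : Fin n => A) W) = fun _ => 0 := by
  funext l; simp only [wordOf]; split_ifs <;> simp

theorem wordOf_injective {f g : MultilinearMap k (fun _ : Fin n => A) W} (h : wordOf f = wordOf g) :
    f = g := by
  ext a
  rw [← wordOf_ofFn f, h, wordOf_ofFn]

theorem wordOf_bracket (f : Cochain k A m) (g : Cochain k A n) (h : p + 1 = m + n) :
    wordOf (bracket f g h) = bracketWord k m n (wordOf f) (wordOf g) := by
  funext l
  rw [bracket, wordOf_sub, wordOf_smul, wordOf_circ, wordOf_circ]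
  rfl

theorem cutSum_mul_of_supp {F G : List A → A} (hF : ∀ l, l.length ≠ n → F l = 0) (w : List A)
    (h : n ≤ w.length) : cupWord F G w = F (w.take n) * G (w.drop n) :=
  cutSum_eq_of_length n h fun u v hu => by rw [hF u hu, zero_mul]

theorem wordOf_cup (f : Cochain k A m) (g : Cochain k A n) :
    wordOf (cup f g) = fun l => (-1 : k) ^ (m * n) • cupWord (wordOf f) (wordOf g) l := by
  refine wordOf_ext (fun l hl => ?_) fun a => ?_
  · rw [((wordOf_isCochainWord f).cup (wordOf_isCochainWord g)).supp l hl, smul_zero]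
  · rw [cutSum_mul_of_supp (fun l => wordOf_supp f) _ (by simp), cup, smul_apply,
      insertion_eq_word, wordOf_insertion _ _ _ _ _ _ (by simp), wordOf_mulCochain,
      List.take_of_length_le (l := List.drop m _) (by simp),
      List.drop_eq_nil_of_le (as := List.ofFn a) (i := m + n) (by simp)]
    simp [mulWord, letter_singleton]

theorem IsCochain.delta (hF : IsCochain k n F) :
    IsCochain k (n + 1) (deltaWord k n F) := by
  have hl : IsCochain k 1 (letter (A := A)) := ⟨letter_isMulti, fun _ => letter_eq_zero⟩
  have hm : IsCochain k 2 (mulWord (A := A)) := ⟨mulWord_isMulti, fun _ => mulWord_eq_zero⟩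
  refine ⟨((hl.cup hF).multi.fsub hF.multi.barWord).fadd ((hF.cup hl).multi.fsmul _), fun l h => ?_⟩
  rw [deltaWord, (hl.cup hF).supp l (by omega), (hF.cup hl).supp l h,
    barWord, hat_supp hF hm (p := n + 1) (by omega) l h]
  simp

theorem wordOf_delta (f : Cochain k A n) : wordOf (delta n f) = deltaWord k n (wordOf f) := by
  refine wordOf_ext (fun l hl => (wordOf_isCochainWord f).delta.supp l hl) fun a => ?_
  have h1 : insertion (mulCochain k A) f 1 (by omega) (by omega) a =
      cupWord letter (wordOf f) (List.ofFn a) := by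
    rw [insertion_eq_word, wordOf_mulCochain, List.ofFn_succ, cupWord, cutSum_letter_cons
      (Φ := fun a v => a * wordOf f v) fun v => zero_mul _,
      List.drop_eq_nil_of_le (i := 1 + n) (by simp [add_comm])]
    simp [mulWord, letter_singleton, List.take_of_length_le]
  have h2 : insertion (mulCochain k A) f 0 (by omega) (by omega) a =
      cupWord (wordOf f) letter (List.ofFn a) := by
    rw [insertion_eq_word, wordOf_mulCochain, cutSum_mul_of_supp (fun l => wordOf_supp f) _
      (by simp)]
    simp [mulWord]
  have h3 := sum_insertion f (mulCochain k A) (-1) (p := n + 1) (by omega) a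
  rw [wordOf_mulCochain] at h3
  change insertion (mulCochain k A) f 1 _ _ a + (∑ i : Fin n, (-1 : k) ^ (i.1 + 1) •
    insertion f (mulCochain k A) i.1 i.2 _) a + (-1 : k) ^ (n + 1) •
    insertion (mulCochain k A) f 0 _ _ a = _
  rw [h1, h2, deltaWord, barWord, ← h3, sum_apply]
  simp only [smul_apply, pow_succ, mul_neg_one, neg_smul, Finset.sum_neg_distrib]
  abel

theorem mem_cocycles_iff (f : Cochain k A n) :
    f ∈ Cocycles k A n ↔ IsCocycle k n (wordOf f) := by
  refine ⟨fun h => ⟨wordOf_isCochainWord f, fun l => ?_⟩, fun h => wordOf_injective ?_⟩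
  · rw [← wordOf_delta, show delta n f = 0 from h, wordOf_zero]
  · rw [wordOf_delta, wordOf_zero]
    exact funext h.closed

theorem IsCochain.wordOf_toMultilinear (hF : IsCochain k n F) :
    wordOf (hF.multi.toMultilinear n) = F := wordOf_ext hF.supp fun _ => rfl

/-! ### Chains -/

/-- The linear map on chains determined by a multilinear function of words. -/
noncomputable def IsMulti.eval (hφ : IsMulti k φ) (n : ℕ) : Chain k A n →ₗ[k] W :=
  PiTensorProduct.lift (hφ.toMultilinear (n + 1))

theorem IsMulti.eval_tprod (hφ : IsMulti k φ) (a : Fin (n + 1) → A) :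
    hφ.eval n (PiTensorProduct.tprod k a) = φ (List.ofFn a) :=
  PiTensorProduct.lift.tprod _

/-- The word of letters `l` as a chain. -/
noncomputable def chainWord (k : Type*) [Field k] {A : Type*} [Ring A] [Algebra k A] (n : ℕ) :
    List A → Chain k A n := wordOf (pureTensor k A n)

theorem chainWord_isMulti : IsMulti k (chainWord k (A := A) n) := wordOf_isMulti _

theorem eval_chainWord (hφ : IsMulti k φ) (l : List A) (hl : l.length = n + 1) :
    hφ.eval n (chainWord k n l) = φ l := by
  obtain ⟨a, rfl⟩ := exists_ofFn l hl
  rw [chainWord, wordOf_ofFn, hφ.eval_tprod]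

theorem eval_hat_comm (hφ : IsMulti k φ) {e : k} (w : List A) (hF : ∀ l, l.length ≠ p → F l = 0)
    (h : w.length + 1 = n + 1 + p) :
    hφ.eval n (hat e F (chainWord k n) w) = hat e F φ w := by
  rw [hat_eq_sum hF chainWord_isMulti w h, hat_eq_sum hF hφ w h, map_sum]
  refine Finset.sum_congr rfl fun j _ => ?_
  rw [map_smul, eval_chainWord]
  simp
  omega

theorem rotate_apply (f : MultilinearMap k (fun _ : Fin (n + 1) => A) W) (l : List A) (z : A)
    (hl : l.length = n) (a : Fin (n + 1) → A) (ha : List.ofFn a = l ++ [z]) :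
    rotate k A f a = wordOf f (z :: l) := by
  subst hl
  have h1 : rotate k A f a = f (fun i => a ((finRotate (l.length + 1)).symm i)) := rfl
  have h2 : ∀ i (hi : i < l.length + 1), a ⟨i, hi⟩ = (l ++ [z])[i]'(by simpa using hi) := by
    intro i hi
    simp only [← ha, List.getElem_ofFn]
  rw [h1, ← wordOf_ofFn f]
  congr 1
  refine List.ext_getElem (by simp) fun i h3 h4 => ?_
  rw [List.getElem_ofFn]
  rcases i with _ | i
  · have : (finRotate (l.length + 1)).symm ⟨0, by omega⟩ = Fin.last _ := by
      rw [Equiv.symm_apply_eq]; exact finRotate_last.symm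
    rw [this, Fin.last, h2]
    simp
  · have : (finRotate (l.length + 1)).symm ⟨i + 1, by simpa using h4⟩ =
        ⟨i, by simp at h4; omega⟩ := by
      rw [Equiv.symm_apply_eq]
      exact (finRotate_of_lt (by simpa using h4)).symm
    rw [this, h2]
    simp only [List.length_cons, add_lt_add_iff_right] at h4
    rw [List.getElem_append_left h4, List.getElem_cons_succ]

theorem eval_ext {f : Chain k A n →ₗ[k] W} (hφ : IsMulti k φ)
    (h : ∀ a, f (PiTensorProduct.tprod k a) = φ (List.ofFn a)) (z : Chain k A n) :
    f z = hφ.eval n z := by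
  have : f = hφ.eval n := PiTensorProduct.ext (MultilinearMap.ext fun a => by
    simp only [LinearMap.compMultilinearMap_apply, h, hφ.eval_tprod])
  rw [this]

theorem exists_concat (l : List A) (h : l.length = n + 1) : ∃ x z, l = x ++ [z] ∧ x.length = n := by
  rcases List.eq_nil_or_concat l with rfl | ⟨x, z, rfl⟩
  · simp at h
  · exact ⟨x, z, List.concat_eq_append, by simpa using h⟩

/-- This identifies `hochWord` as the transpose of the Hochschild boundary; the products of
neighbours come from `insertion`, and the wrap-around product from `rotate`. -/
theorem eval_boundary (hφ : IsMulti k φ) (z : Chain k A (n + 1)) :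
    hφ.eval n (boundary k A n z) = hφ.hoch.eval (n + 1) z := by
  refine eval_ext (f := hφ.eval n ∘ₗ boundary k A n) hφ.hoch (fun a => ?_) z
  have h3 := sum_insertion (pureTensor k A n) (mulCochain k A) (-1) (p := n + 2) (by omega) a
  obtain ⟨x, z, hx, hxl⟩ := exists_concat (List.ofFn a) (n := n + 1) (by simp)
  rw [LinearMap.comp_apply, boundary, PiTensorProduct.lift.tprod, add_apply, sum_apply, smul_apply]
  simp only [smul_apply]
  rw [h3, map_add, wordOf_mulCochain, rotate_apply _ x z hxl a hx,
    wordOf_insertion _ _ _ _ _ _ (by simpa using hxl), map_smul, wordOf_mulCochain]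
  erw [eval_hat_comm hφ _ (fun _ => mulWord_eq_zero) (by simp), eval_chainWord hφ _ (by simp [hxl])]
  obtain ⟨b, x, rfl⟩ : ∃ b y, x = b :: y := by
    rcases x with _ | ⟨b, y⟩
    · simp at hxl
    · exact ⟨b, y, rfl⟩
  rw [hx, List.cons_append, hochWord, cutSum_letter_concat (Φ := fun u c =>
    (-1 : k) ^ (u.length + 1) • φ (c * b :: u)) fun u => by rw [zero_mul, hφ.head_zero, smul_zero]]
  have hxl' : x.length = n := by simpa using hxl
  rw [hxl', ← barWord_cons hφ]
  simp [mulWord_pair]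

theorem eval_cyclic (hφ : IsMulti k φ) (z : Chain k A n) :
    hφ.eval n (cyclic k A n z) = hφ.cyc.eval n z := by
  refine eval_ext (f := hφ.eval n ∘ₗ cyclic k A n) hφ.cyc (fun a => ?_) z
  obtain ⟨x, z, hx, hxl⟩ := exists_concat (List.ofFn a) (n := n) (by simp)
  rw [LinearMap.comp_apply, cyclic, LinearMap.smul_apply, PiTensorProduct.lift.tprod,
    rotate_apply _ x z hxl a hx, map_smul]
  erw [eval_chainWord hφ _ (by simp [hxl])]
  rw [hx, cycWord, cutSum_letter_concat (Φ := fun u c => (-1 : k) ^ u.length • φ (c :: u)) fun u => by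
    rw [hφ.head_zero, smul_zero], hxl]

theorem IsMulti.cyc_iterate (hφ : IsMulti k φ) (i : ℕ) : IsMulti k ((cycWord k)^[i] φ) := by
  induction i with
  | zero => exact hφ
  | succ i ih => rw [Function.iterate_succ_apply']; exact ih.cyc

theorem eval_cyclic_pow (hφ : IsMulti k φ) (i : ℕ) (z : Chain k A n) :
    hφ.eval n ((cyclic k A n ^ i) z) = (hφ.cyc_iterate i).eval n z := by
  induction i generalizing z with
  | zero => rfl
  | succ i ih =>
    rw [pow_succ, Module.End.mul_apply, ih, eval_cyclic]
    refine eval_ext _ (fun a => ?_) z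
    rw [IsMulti.eval_tprod, Function.iterate_succ_apply']

/-- Each rotation takes the last letter to the front, so as many rotations as `v` has letters
exchange the two blocks. -/
theorem cycWord_iterate (hφ : IsMulti k φ) (u v : List A) : (cycWord k)^[v.length] φ (u ++ v) =
    (-1 : k) ^ (v.length * (u.length + v.length + 1)) • φ (v ++ u) := by
  obtain ⟨i, hi⟩ : ∃ i, i = v.length := ⟨_, rfl⟩
  induction i generalizing u v with
  | zero =>
    obtain rfl : v = [] := List.length_eq_zero_iff.mp hi.symm
    simp
  | succ i ih =>
    obtain ⟨v, z, rfl, hv⟩ := exists_concat v hi.symm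
    rw [← hi, Function.iterate_succ_apply', ← List.append_assoc, cycWord, cutSum_letter_concat
      (Φ := fun u c => (-1 : k) ^ u.length • (cycWord k)^[i] φ (c :: u))
      (fun u => by rw [(hφ.cyc_iterate i).head_zero, smul_zero])]
    have := ih (z :: u) v hv.symm
    rw [hv, List.cons_append] at this
    rw [this, smul_smul, List.append_assoc]
    congr 1
    rw [← pow_add, List.length_append, hv]
    refine sgn_congr ?_
    simp only [List.length_cons, Nat.even_add, Nat.even_mul, Nat.even_add_one]
    tauto

theorem eval_sum_cyclic (hφ : IsMulti k φ) (z : Chain k A n) :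
    hφ.eval n ((∑ i ∈ Finset.range (n + 1), cyclic k A n ^ i) z) = hφ.norm.eval n z := by
  refine eval_ext (f := hφ.eval n ∘ₗ (∑ i ∈ Finset.range (n + 1), cyclic k A n ^ i)) hφ.norm
    (fun a => ?_) z
  rw [LinearMap.comp_apply, LinearMap.sum_apply, map_sum]
  simp only [eval_cyclic_pow, IsMulti.eval_tprod]
  generalize hl : List.ofFn a = l
  have hl' : l.length = n + 1 := by rw [← hl]; simp
  obtain ⟨b, w, rfl⟩ : ∃ b w, l = b :: w := by
    rcases l with _ | ⟨b, y⟩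
    · simp at hl'
    · exact ⟨b, y, rfl⟩
  have hw : w.length = n := by simpa using hl'
  -- The number of rotations is the length of the right part, whereas cuts are indexed by the left
  -- part; hence the sum is reversed.
  rw [normWord, rotSum, cutSum_eq_sum, hw, ← Finset.sum_range_reflect]
  refine Finset.sum_congr rfl fun i hi => ?_
  have hi' : i ≤ n := by simpa [Nat.lt_succ_iff] using hi
  have h1 := cycWord_iterate hφ (b :: w.take i) (w.drop i)
  rw [List.cons_append, List.take_append_drop, List.length_drop, hw] at h1
  rw [show n + 1 - 1 - i = n - i by omega, h1, List.length_drop, List.length_cons, List.length_take,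
    hw, min_eq_left hi', rotSign]
  congr 1
  refine sgn_congr ?_
  generalize n - i = q
  simp only [Nat.even_add, Nat.even_mul, Nat.even_add_one]
  tauto

theorem eval_connes (hφ : IsMulti k φ) (z : Chain k A n) :
    hφ.eval (n + 1) (connes k A n z) = hφ.fullConnes.eval n z := by
  have h1 : ∀ z : Chain k A (n + 1), hφ.eval (n + 1) ((1 - cyclic k A (n + 1)) z) =
      (hφ.fsub hφ.cyc).eval (n + 1) z := by
    intro z
    rw [LinearMap.sub_apply, map_sub, eval_cyclic]
    exact eval_ext (f := hφ.eval (n + 1) - hφ.cyc.eval (n + 1)) _ (fun a => by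
      rw [LinearMap.sub_apply, IsMulti.eval_tprod, IsMulti.eval_tprod]) z
  have h2 : ∀ (ψ : List A → W) (hψ : IsMulti k ψ) (z : Chain k A n), hψ.eval (n + 1)
      (PiTensorProduct.lift ((pureTensor k A (n + 1)).curryLeft 1) z) =
      (hψ.cons 1).eval n z := by
    intro ψ hψ z
    refine eval_ext (f := hψ.eval (n + 1) ∘ₗ PiTensorProduct.lift
      ((pureTensor k A (n + 1)).curryLeft 1)) (hψ.cons 1) (fun a => ?_) z
    rw [LinearMap.comp_apply, PiTensorProduct.lift.tprod, MultilinearMap.curryLeft_apply]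
    erw [hψ.eval_tprod]
    rw [List.ofFn_succ]
    simp
  rw [connes, LinearMap.comp_apply, LinearMap.comp_apply, h1, h2, eval_sum_cyclic]
  rfl

theorem capWord_of_length (hF : ∀ l, l.length ≠ n → F l = 0) (hφ : IsMulti k φ) (a : A)
    (w : List A) (hw : n ≤ w.length) :
    capWord F φ (a :: w) = φ (a * F (w.take n) :: w.drop n) :=
  cutSum_eq_of_length n hw fun u v hu => by rw [hF u hu, mul_zero, hφ.head_zero]

theorem eval_contraction (hφ : IsMulti k φ) {d : ℕ} (h : m + n = d) (f : Cochain k A n)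
    (z : Chain k A d) : hφ.eval m (contraction h f z) =
      (-1 : k) ^ n • ((wordOf_isMulti f).cap hφ).eval d z := by
  rw [contraction, LinearMap.smul_apply, map_smul]
  congr 1
  refine eval_ext (f := hφ.eval m ∘ₗ PiTensorProduct.lift _) _ (fun a => ?_) z
  rw [LinearMap.comp_apply, PiTensorProduct.lift.tprod, insertion_eq_word]
  have ha : (List.ofFn a).length = d + 1 := by simp
  erw [eval_chainWord hφ _ (by simp; omega)]
  rw [wordOf_insertion _ _ _ _ _ _ (by simp; omega), wordOf_mulCochain, List.ofFn_succ,
    capWord_of_length (fun _ => wordOf_supp f) hφ _ _ (by simp; omega)]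
  have h3 : ∀ w : List A, w.length = n → List.drop (1 + n) (a 0 :: w) = [] := fun w hw =>
    List.drop_eq_nil_of_le (by simp [hw, add_comm])
  simp [mulWord, letter_singleton, List.take_of_length_le, add_comm 1 n]

end Bridge

end CalabiYau

namespace CalabiYau

/-! ### Chain maps and homotopies out of complexes of projectives -/

section Comparison

variable {R : Type*} [Ring R] {P N : ℕ → Type*} [∀ n, AddCommGroup (P n)] [∀ n, Module R (P n)]
  [∀ n, AddCommGroup (N n)] [∀ n, Module R (N n)]
  {dP : ∀ n, P (n + 1) →ₗ[R] P n} {dN : ∀ n, N (n + 1) →ₗ[R] N n}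

/-- Lifting of a map from a projective module through an exact pair. -/
theorem exists_lift_of_exact {P M N L : Type*} [AddCommGroup P] [Module R P] [Module.Projective R P]
    [AddCommGroup M] [Module R M] [AddCommGroup N] [Module R N] [AddCommGroup L] [Module R L]
    (f : M →ₗ[R] N) (g : N →ₗ[R] L) (hfg : Function.Exact f g) (φ : P →ₗ[R] N)
    (hφ : ∀ x, g (φ x) = 0) : ∃ χ : P →ₗ[R] M, ∀ x, f (χ x) = φ x := by
  have hφ' : ∀ x, φ x ∈ LinearMap.range f := fun x => (hfg _).mp (hφ x)
  obtain ⟨χ, hχ⟩ := Module.projective_lifting_property f.rangeRestrict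
    (φ.codRestrict (LinearMap.range f) hφ') f.surjective_rangeRestrict
  exact ⟨χ, fun x => congrArg Subtype.val (LinearMap.congr_fun hχ x)⟩

theorem exists_lift_range {P M N : Type*} [AddCommGroup P] [Module R P] [Module.Projective R P]
    [AddCommGroup M] [Module R M] [AddCommGroup N] [Module R N]
    (f : M →ₗ[R] N) (φ : P →ₗ[R] N)
    (hφ : ∀ x, φ x ∈ LinearMap.range f) : ∃ χ : P →ₗ[R] M, ∀ x, f (χ x) = φ x := by
  obtain ⟨χ, hχ⟩ := Module.projective_lifting_property f.rangeRestrict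
    (φ.codRestrict (LinearMap.range f) hφ) f.surjective_rangeRestrict
  exact ⟨χ, fun x => congrArg Subtype.val (LinearMap.congr_fun hχ x)⟩

/-- A map in degree zero from a complex of projectives extends to an exact complex. -/
theorem exists_chainMap (hP : ∀ n, Module.Projective R (P n)) (hd : ∀ n x, dP n (dP (n + 1) x) = 0)
    (hN : ∀ n, Function.Exact (dN (n + 1)) (dN n)) (f₀ : P 0 →ₗ[R] N 0)
    (h₀ : ∀ x, f₀ (dP 0 x) ∈ LinearMap.range (dN 0)) :
    ∃ f : ∀ n, P n →ₗ[R] N n, f 0 = f₀ ∧ ∀ n x, dN n (f (n + 1) x) = f n (dP n x) := by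
  obtain ⟨f₁, h₁⟩ := exists_lift_range (dN 0) (f₀ ∘ₗ dP 0) h₀
  -- The recursion carries two consecutive components with their commuting square, since the next
  -- component can be lifted only once the preceding square commutes.
  let S : ℕ → Type _ := fun n => { p : (P n →ₗ[R] N n) × (P (n + 1) →ₗ[R] N (n + 1)) //
    ∀ x, dN n (p.2 x) = p.1 (dP n x) }
  have step : ∀ n (p : S n), ∃ q : S (n + 1), q.1.1 = p.1.2 := by
    intro n p
    obtain ⟨χ, hχ⟩ := exists_lift_of_exact (dN (n + 1)) (dN n) (hN n) (p.1.2 ∘ₗ dP (n + 1))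
      (fun x => by rw [LinearMap.comp_apply, p.2, hd, map_zero])
    exact ⟨⟨(p.1.2, χ), hχ⟩, rfl⟩
  choose next hnext using step
  let s : ∀ n, S n := fun n => Nat.rec ⟨(f₀, f₁), h₁⟩ (fun n p => next n p) n
  have hs : ∀ n, (s (n + 1)).1.1 = (s n).1.2 := fun n => hnext n (s n)
  refine ⟨fun n => (s n).1.1, rfl, fun n x => ?_⟩
  change dN n ((s (n + 1)).1.1 x) = _
  rw [hs, (s n).2]

/-- A morphism from a complex of projectives to an exact complex is homotopic to zero, if it is so
in degree zero. -/
theorem exists_homotopy (hP : ∀ n, Module.Projective R (P n))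
    (hd : ∀ n x, dP n (dP (n + 1) x) = 0)
    (hN : ∀ n, Function.Exact (dN (n + 1)) (dN n)) (f : ∀ n, P n →ₗ[R] N n)
    (hf : ∀ n x, dN n (f (n + 1) x) = f n (dP n x)) (h₀ : ∀ x, f 0 x ∈ LinearMap.range (dN 0)) :
    ∃ h : ∀ n, P n →ₗ[R] N (n + 1), (∀ x, f 0 x = dN 0 (h 0 x)) ∧
      ∀ n x, f (n + 1) x = dN (n + 1) (h (n + 1) x) + h n (dP n x) := by
  obtain ⟨t₀, ht₀⟩ := exists_lift_range (dN 0) (f 0) h₀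
  -- The property carried along is the homotopy equation restricted to boundaries, which is exactly
  -- what makes the next difference a cycle.
  let S : ℕ → Type _ := fun n => { h : P n →ₗ[R] N (n + 1) // ∀ x, dN n (h (dP n x)) = f n (dP n x) }
  have step : ∀ n (p : S n), ∃ q : S (n + 1), ∀ x,
      f (n + 1) x = dN (n + 1) (q.1 x) + p.1 (dP n x) := by
    intro n p
    obtain ⟨χ, hχ⟩ := exists_lift_of_exact (dN (n + 1)) (dN n) (hN n) (f (n + 1) - p.1 ∘ₗ dP n)
      (fun x => by rw [LinearMap.sub_apply, map_sub, LinearMap.comp_apply, p.2, hf, sub_self])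
    refine ⟨⟨χ, fun x => ?_⟩, fun x => ?_⟩
    · rw [hχ, LinearMap.sub_apply, LinearMap.comp_apply, hd, map_zero, sub_zero]
    · rw [hχ, LinearMap.sub_apply, LinearMap.comp_apply, sub_add_cancel]
  choose next hnext using step
  let s : ∀ n, S n := fun n => Nat.rec ⟨t₀, fun x => ht₀ _⟩ (fun n p => next n p) n
  exact ⟨fun n => (s n).1, fun x => (ht₀ x).symm, fun n x => hnext n (s n) x⟩

end Comparison

end CalabiYau

namespace CalabiYau

noncomputable section

/-! ### Functions of words with values in bimodules -/

section BimoduleWords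

variable {k : Type*} [Field k] {A : Type*} [Ring A] [Algebra k A]

/-- Left multiplication by `a`, as an element of the enveloping algebra. -/
def leftAct (k : Type*) [Field k] {A : Type*} [Ring A] [Algebra k A] : A →ₗ[k] Env k A :=
  (TensorProduct.mk k A Aᵐᵒᵖ).flip 1

/-- Right multiplication by `a`, as an element of the enveloping algebra. -/
def rightAct (k : Type*) [Field k] {A : Type*} [Ring A] [Algebra k A] : A →ₗ[k] Env k A :=
  (TensorProduct.mk k A Aᵐᵒᵖ 1) ∘ₗ (MulOpposite.opLinearEquiv k).toLinearMap

theorem leftAct_eq (a : A) : leftAct k a = a ⊗ₜ 1 := rfl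

theorem rightAct_eq (a : A) : rightAct k a = 1 ⊗ₜ MulOpposite.op a := rfl

theorem leftAct_mul (a b : A) : leftAct k (a * b) = leftAct k a * leftAct k b := by
  simp [leftAct_eq]

theorem rightAct_mul (a b : A) : rightAct k (a * b) = rightAct k b * rightAct k a := by
  simp [rightAct_eq]

theorem leftAct_mul_rightAct (a b : A) :
    leftAct k a * rightAct k b = a ⊗ₜ MulOpposite.op b := by
  simp [leftAct_eq, rightAct_eq]

theorem rightAct_mul_leftAct (a b : A) :
    rightAct k b * leftAct k a = leftAct k a * rightAct k b := by
  simp [leftAct_eq, rightAct_eq]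

theorem leftAct_one : leftAct k (1 : A) = 1 := rfl

theorem rightAct_one : rightAct k (1 : A) = 1 := rfl

theorem leftAct_zero_smul {N : Type*} [AddCommGroup N] [Module (Env k A) N] (x : N) :
    leftAct k (0 : A) • x = 0 := by
  rw [(leftAct k).map_zero]; exact zero_smul (Env k A) x

theorem rightAct_zero_smul {N : Type*} [AddCommGroup N] [Module (Env k A) N] (x : N) :
    rightAct k (0 : A) • x = 0 := by
  rw [(rightAct k).map_zero]; exact zero_smul (Env k A) x

theorem conj_leftAct (a : A) : (flip k A).conj (leftAct k a) = rightAct k a := by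
  change (flipHom k A (a ⊗ₜ MulOpposite.op 1)).unop = _
  rw [flipHom_tmul]; rfl

theorem conj_rightAct (a : A) : (flip k A).conj (rightAct k a) = leftAct k a := by
  change (flipHom k A (1 ⊗ₜ MulOpposite.op a)).unop = _
  rw [flipHom_tmul]; rfl

theorem env_induction {p : Env k A → Prop} (h₁ : ∀ a b, p (leftAct k a * rightAct k b))
    (h₂ : ∀ r s, p r → p s → p (r + s)) (r : Env k A) : p r := by
  induction r using TensorProduct.induction_on with
  | zero => simpa using h₁ 0 0
  | tmul x y => rw [← MulOpposite.op_unop y, ← leftAct_mul_rightAct]; exact h₁ _ _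
  | add x y hx hy => exact h₂ _ _ hx hy

variable {N : Type*} [AddCommGroup N] [Module k N] [Module (Env k A) N] [IsScalarTower k (Env k A) N]
  {N' : Type*} [AddCommGroup N'] [Module k N'] [Module (Env k A) N']
  [IsScalarTower k (Env k A) N'] {θ : List A → N} {n : ℕ}

theorem env_smul_comm (c : k) (r : Env k A) (x : N) : r • c • x = c • r • x := by
  rw [← algebraMap_smul (Env k A) c, ← algebraMap_smul (Env k A) c, smul_smul, smul_smul,
    Algebra.commutes]

theorem IsMulti.env_smul (h : IsMulti k θ) (r : Env k A) : IsMulti k fun l => r • θ l :=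
  h.map (Algebra.lsmul k k N r)

theorem map_isMulti (h : IsMulti k θ) (f : N →ₗ[Env k A] N') : IsMulti k fun l => f (θ l) :=
  h.map (f.restrictScalars k)

/-- The differential of functions of words with values in a bimodule. -/
def bimodDelta (k : Type*) [Field k] {A : Type*} [Ring A] [Algebra k A] {N : Type*}
    [AddCommGroup N] [Module k N] [Module (Env k A) N] (θ : List A → N) (l : List A) : N :=
  cutSum (fun u v => leftAct k (letter u) • θ v) l - barWord k θ l +
    cutSum (fun u v => (-1 : k) ^ (u.length + 1) • rightAct k (letter v) • θ u) l

theorem letterAct_isMulti (f : A →ₗ[k] Env k A) (x : N) :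
    IsMulti k fun l => f (letter l) • x :=
  letter_isMulti.map (((LinearMap.toSpanSingleton (Env k A) N x).restrictScalars k) ∘ₗ f)

theorem IsMulti.bimodDelta (h : IsMulti k θ) : IsMulti k (bimodDelta k θ) :=
  ((IsMulti.cutSum (fun v => letterAct_isMulti (leftAct k) (θ v)) fun _ => h.env_smul _).fsub
    h.barWord).fadd (IsMulti.cutSum (fun v => (h.env_smul (rightAct k (CalabiYau.letter v))).smul_length
      fun n => (-1 : k) ^ (n + 1)) fun u => (letterAct_isMulti (rightAct k) (θ u)).fsmul _)

theorem map_bimodDelta (f : N →ₗ[Env k A] N') (l : List A) :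
    f (bimodDelta k θ l) = bimodDelta k (fun l => f (θ l)) l := by
  have h1 : ∀ (Φ : List A → List A → N), f (cutSum Φ l) = cutSum (fun u v => f (Φ u v)) l :=
    fun Φ => (cutSum_map f.toAddMonoidHom Φ l).symm
  have h2 : f (barWord k θ l) = barWord k (fun l => f (θ l)) l :=
    (hat_map (-1 : k) (f.restrictScalars k) l).symm
  have h3 : ∀ (c : k) x, f (c • x) = c • f x := fun c x => (f.restrictScalars k).map_smul c x
  simp only [bimodDelta, map_add, map_sub, h1, h2, h3, map_smul]

theorem bimodDelta_cons (h : IsMulti k θ) (x : A) (l : List A) : bimodDelta k θ (x :: l) =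
    leftAct k x • θ l - cutSum (fun u v => θ (x * letter u :: v)) l +
      barWord k (fun l => θ (x :: l)) l - rightAct k (letter (x :: l)) • θ [] +
      cutSum (fun u v => (-1 : k) ^ u.length • rightAct k (letter v) • θ (x :: u)) l := by
  rw [bimodDelta, cutSum_letter_cons (Φ := fun a v => leftAct k a • θ v) fun v =>
    leftAct_zero_smul _, barWord_cons h, cutSum_cons]
  simp only [List.length_nil, List.length_cons, pow_succ, mul_neg_one, pow_zero, neg_neg,
    neg_smul, one_smul]
  abel

end BimoduleWords

section EnvOnA

attribute [local instance] TensorProduct.Algebra.module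

variable {k : Type*} [Field k] {A : Type*} [Ring A] [Algebra k A] {n : ℕ}

theorem leftAct_smul (a b : A) : leftAct k a • b = a * b := by
  rw [leftAct_eq, TensorProduct.Algebra.smul_def]; simp

theorem rightAct_smul (a b : A) : rightAct k a • b = b * a := by
  rw [rightAct_eq, TensorProduct.Algebra.smul_def]; simp

instance : IsScalarTower k (Env k A) A where
  smul_assoc c r a := by
    induction r using TensorProduct.induction_on with
    | zero =>
      have h : (0 : Env k A) • a = 0 := zero_smul (Env k A) a
      rw [smul_zero]
      exact h.trans ((congrArg (c • ·) h).trans (smul_zero c)).symm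
    | tmul x y => rw [TensorProduct.smul_tmul', TensorProduct.Algebra.smul_def,
        TensorProduct.Algebra.smul_def, smul_assoc]
    | add x y hx hy => rw [smul_add, add_smul, add_smul, smul_add, hx, hy]

theorem bimodDelta_eq_delta (F : List A → A) (l : List A) (hl : l.length = n + 1) :
    bimodDelta k F l = deltaWord k n F l := by
  rw [bimodDelta, deltaWord]
  congr 1
  · congr 1
    exact cutSum_congr fun u v _ => leftAct_smul _ _
  · rw [cupWord, ← cutSum_smul_self]
    refine cutSum_congr fun u v hu => ?_
    rw [rightAct_smul]
    by_cases h1 : v.length = 1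
    · have := congrArg List.length hu
      rw [List.length_append] at this
      rw [show u.length = n by omega]
    · rw [letter_eq_zero h1, mul_zero, smul_zero, smul_zero]

end EnvOnA

end

end CalabiYau

namespace CalabiYau

noncomputable section

/-! ### The bar resolution -/

section Bar

variable (k : Type*) [Field k] (A : Type*) [Ring A] [Algebra k A]

/-- This is `A ⊗ A^{⊗n} ⊗ A` with the two outer factors gathered into the enveloping algebra; in
this form it is visibly a base change from the field, hence projective. -/
def Bar (n : ℕ) := Env k A ⊗[k] (⨂[k] (_ : Fin n), A)

variable (n : ℕ)

instance : AddCommGroup (Bar k A n) :=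
  inferInstanceAs (AddCommGroup (Env k A ⊗[k] (⨂[k] (_ : Fin n), A)))

instance : Module k (Bar k A n) := inferInstanceAs (Module k (Env k A ⊗[k] (⨂[k] (_ : Fin n), A)))

instance : Module (Env k A) (Bar k A n) :=
  TensorProduct.leftModule (R := k) (M := Env k A) (N := ⨂[k] (_ : Fin n), A)

instance : IsScalarTower k (Env k A) (Bar k A n) :=
  TensorProduct.isScalarTower_left (R := k) (M := Env k A) (N := ⨂[k] (_ : Fin n), A)

instance : Module.Projective (Env k A) (Bar k A n) :=
  inferInstanceAs (Module.Projective (Env k A) (Env k A ⊗[k] (⨂[k] (_ : Fin n), A)))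

variable {k A n}

/-- The universal multilinear map into the bar resolution. -/
def barTensor (k : Type*) [Field k] (A : Type*) [Ring A] [Algebra k A] (n : ℕ) :
    MultilinearMap k (fun _ : Fin n => A) (Bar k A n) :=
  ((TensorProduct.mk k (Env k A) (⨂[k] (_ : Fin n), A)) 1).compMultilinearMap
    (PiTensorProduct.tprod k)

theorem smul_barTensor (r : Env k A) (a : Fin n → A) :
    r • barTensor k A n a =
      (show Bar k A n from r ⊗ₜ[k] (PiTensorProduct.tprod k a : ⨂[k] (_ : Fin n), A)) := by
  change (r • (1 : Env k A)) ⊗ₜ[k] (PiTensorProduct.tprod k a : ⨂[k] (_ : Fin n), A) = _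
  rw [smul_eq_mul, mul_one]

/-- The generators of the bar resolution. -/
def barGen (k : Type*) [Field k] {A : Type*} [Ring A] [Algebra k A] (n : ℕ) : List A → Bar k A n :=
  wordOf (barTensor k A n)

theorem barGen_isMulti : IsMulti k (barGen k (A := A) n) := wordOf_isMulti (barTensor k A n)

theorem barGen_supp {l : List A} (h : l.length ≠ n) : barGen k n l = 0 := wordOf_supp _ h

theorem bar_induction {p : Bar k A n → Prop}
    (h₁ : ∀ (x y : A) (l : List A), l.length = n → p ((leftAct k x * rightAct k y) • barGen k n l))
    (h₂ : ∀ b c, p b → p c → p (b + c)) (b : Bar k A n) : p b := by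
  have h0 : p 0 := by
    have h := h₁ 0 0 (List.replicate n 0) (by simp)
    rwa [mul_smul, leftAct_zero_smul] at h
  suffices h : ∀ b : Env k A ⊗[k] (⨂[k] (_ : Fin n), A), p b from h b
  intro b
  refine TensorProduct.induction_on b h0 (fun r v => ?_) h₂
  induction r using env_induction with
  | h₁ x y =>
    induction v using PiTensorProduct.induction_on with
    | smul_tprod c a =>
      have h := h₁ (c • x) y (List.ofFn a) (by simp)
      rw [barGen, wordOf_ofFn, smul_barTensor, map_smul, smul_mul_assoc] at h
      rw [← TensorProduct.smul_tmul]
      exact h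
    | add v w hv hw => rw [TensorProduct.tmul_add]; exact h₂ _ _ hv hw
  | h₂ r s hr hs =>
    rw [TensorProduct.add_tmul]; exact h₂ _ _ hr hs

/-- Adding a letter in front, for fixed letters. -/
def consLin {W : Type*} [AddCommGroup W] [Module k W] (φ : List A → W) (hφ : IsMulti k φ) (n : ℕ) :
    A →ₗ[k] (⨂[k] (_ : Fin n), A) →ₗ[k] W :=
  (PiTensorProduct.lift).toLinearMap ∘ₗ (hφ.toMultilinear (n + 1)).curryLeft

theorem consLin_tprod {W : Type*} [AddCommGroup W] [Module k W] (φ : List A → W) (hφ : IsMulti k φ) (x : A) (a : Fin n → A) :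
    consLin φ hφ n x (PiTensorProduct.tprod k a) = φ (x :: List.ofFn a) := by
  rw [consLin, LinearMap.comp_apply]
  refine (PiTensorProduct.lift.tprod _).trans ?_
  change φ (List.ofFn (Fin.cons x a)) = _
  rw [List.ofFn_cons]

variable {N : Type*} [AddCommGroup N] [Module k N] [Module (Env k A) N] [IsScalarTower k (Env k A) N]
  {θ : List A → N}

/-- The morphism out of the bar resolution with given values on the generators. -/
def liftBar (h : IsMulti k θ) (n : ℕ) : Bar k A n →ₗ[Env k A] N :=
  TensorProduct.AlgebraTensorModule.lift
    (LinearMap.toSpanSingleton (Env k A) ((⨂[k] (_ : Fin n), A) →ₗ[k] N)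
      (PiTensorProduct.lift (h.toMultilinear n)))

theorem liftBar_gen (h : IsMulti k θ) {l : List A} (hl : l.length = n) :
    liftBar h n (barGen k n l) = θ l := by
  obtain ⟨a, rfl⟩ := exists_ofFn l hl
  rw [barGen, wordOf_ofFn]
  refine (TensorProduct.AlgebraTensorModule.lift_tmul _ _ _).trans ?_
  rw [LinearMap.toSpanSingleton_apply, one_smul]
  exact PiTensorProduct.lift.tprod _

theorem bar_hom_ext {f g : Bar k A n →ₗ[Env k A] N}
    (h : ∀ l, l.length = n → f (barGen k n l) = g (barGen k n l)) : f = g := by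
  ext b
  induction b using bar_induction with
  | h₁ x y l hl => rw [map_smul, map_smul, h l hl]
  | h₂ b c hb hc => rw [map_add, map_add, hb, hc]

variable (k A n)

/-- On generators this is `bimodDelta` of the tautological word function, so for a bimodule map `f`
the composite `f ∘ barD` is `bimodDelta` of the word function of `f`. -/
def barD : Bar k A (n + 1) →ₗ[Env k A] Bar k A n :=
  liftBar (barGen_isMulti (k := k) (A := A) (n := n)).bimodDelta (n + 1)

variable {k A n}

theorem barD_gen {l : List A} (hl : l.length = n + 1) :
    barD k A n (barGen k (n + 1) l) = bimodDelta k (barGen k n) l := liftBar_gen _ hl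

theorem map_barD_gen (f : Bar k A n →ₗ[Env k A] N) {l : List A} (hl : l.length = n + 1) :
    f (barD k A n (barGen k (n + 1) l)) = bimodDelta k (fun l => f (barGen k n l)) l := by
  rw [barD_gen hl, map_bimodDelta]

attribute [local instance] TensorProduct.Algebra.module

/-- The function of words which is `1` on the empty word. -/
def unitWord : List A → A
  | [] => 1
  | _ :: _ => 0

theorem unitWord_isMulti : IsMulti k (unitWord (A := A)) where
  add x a b z := by rcases x with _ | ⟨c, x⟩ <;> simp [unitWord]
  smul x c a z := by rcases x with _ | ⟨c, x⟩ <;> simp [unitWord]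

variable (k A) in
/-- The augmentation of the bar resolution. -/
def barAug : Bar k A 0 →ₗ[Env k A] A := liftBar (unitWord_isMulti (k := k) (A := A)) 0

theorem barAug_gen : barAug k A (barGen k 0 []) = 1 := liftBar_gen _ rfl

variable (k A n) in
/-- The contracting homotopy of the bar resolution. -/
def barS : Bar k A n →ₗ[k] Bar k A (n + 1) :=
  TensorProduct.lift (R := k) (M := Env k A) (N := ⨂[k] (_ : Fin n), A) (TensorProduct.lift
    (LinearMap.mk₂ k (fun x y => Algebra.lsmul k k _ (rightAct k y.unop) ∘ₗ
        consLin (barGen k (n + 1)) barGen_isMulti n x)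
      (fun x x' y => by rw [map_add, LinearMap.comp_add])
      (fun c x y => by rw [map_smul, LinearMap.comp_smul])
      (fun x y y' => by rw [MulOpposite.unop_add, map_add, map_add, LinearMap.add_comp])
      (fun c x y => by rw [MulOpposite.unop_smul, map_smul, map_smul, LinearMap.smul_comp])))

/-- In bar notation `x[l]y ↦ 1[x, l]y`: the left coefficient becomes the first letter. The homotopy
is thus linear for the right structure only. -/
theorem barS_gen (x y : A) (l : List A) :
    barS k A n ((leftAct k x * rightAct k y) • barGen k n l) =
      rightAct k y • barGen k (n + 1) (x :: l) := by
  by_cases hl : l.length = n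
  · obtain ⟨a, rfl⟩ := exists_ofFn l hl
    rw [leftAct_mul_rightAct, barGen, wordOf_ofFn, smul_barTensor, barS]
    refine (TensorProduct.lift.tmul _ _).trans ?_
    rw [TensorProduct.lift.tmul]
    exact congrArg (fun z : Bar k A (n + 1) => rightAct k y • z)
      (consLin_tprod (k := k) _ barGen_isMulti x a)
  · rw [barGen_supp hl, barGen_supp (by simpa using hl), smul_zero, smul_zero, map_zero]

theorem barS_smul_gen (x y a b : A) (l : List A) :
    barS k A n ((leftAct k x * rightAct k y) • leftAct k a • rightAct k b • barGen k n l) =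
      (rightAct k y * rightAct k b) • barGen k (n + 1) (x * a :: l) := by
  have h : leftAct k x * rightAct k y * (leftAct k a * rightAct k b) =
      leftAct k x * leftAct k a * (rightAct k y * rightAct k b) := by
    rw [mul_assoc, ← mul_assoc (rightAct k y), rightAct_mul_leftAct]
    simp only [mul_assoc]
  rw [smul_smul (leftAct k a), smul_smul, ← rightAct_mul, ← barS_gen, leftAct_mul, rightAct_mul, h]

/-- The first term of the differential of `[x, l]` returns `x[l]`; each other term is matched with
opposite sign by the homotopy applied to a term of the differential of `[l]`. -/
theorem barD_barS_succ (b : Bar k A (n + 1)) :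
    barD k A (n + 1) (barS k A (n + 1) b) + barS k A n (barD k A n b) = b := by
  induction b using bar_induction with
  | h₂ b c hb hc => simp only [map_add]; rw [← add_add_add_comm, hb, hc]
  | h₁ x y l hl =>
    rw [barS_gen, map_smul, barD_gen (by simpa using hl), bimodDelta_cons barGen_isMulti, map_smul,
      barD_gen hl, bimodDelta, barGen_supp (l := []) (n := n + 1) (by simp), smul_zero, sub_zero]
    have h1 : ∀ z, (barS k A n) ((leftAct k x * rightAct k y) • z) =
        (barS k A n ∘ₗ Algebra.lsmul k k _ (leftAct k x * rightAct k y)) z := fun z => rfl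
    have h2 : barS k A n ((leftAct k x * rightAct k y) •
        cutSum (fun u v => leftAct k (letter u) • barGen k n v) l) =
        rightAct k y • cutSum (fun u v => barGen k (n + 1) (x * letter u :: v)) l := by
      rw [h1, ← LinearMap.toAddMonoidHom_coe, ← cutSum_map]
      have := cutSum_map (Algebra.lsmul k k (Bar k A (n + 1)) (rightAct k y)).toAddMonoidHom
        (fun u v => barGen k (n + 1) (x * letter u :: v)) l
      refine Eq.trans (cutSum_congr fun u v _ => ?_) this
      have := barS_smul_gen (k := k) (n := n) x y (letter u) 1 v
      rw [rightAct_one, one_smul, mul_one] at this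
      exact this
    have h3 : barS k A n ((leftAct k x * rightAct k y) • barWord k (barGen k n) l) =
        rightAct k y • barWord k (fun l => barGen k (n + 1) (x :: l)) l := by
      rw [h1, ← hat_map]
      have := hat_map (-1 : k) (F := mulWord) (φ := fun l => barGen k (n + 1) (x :: l))
        (Algebra.lsmul k k (Bar k A (n + 1)) (rightAct k y)) l
      refine Eq.trans ?_ this
      exact congrArg (fun φ => hat (-1 : k) mulWord φ l) (funext fun l => barS_gen x y l)
    have h4 : barS k A n ((leftAct k x * rightAct k y) •
        cutSum (fun u v => (-1 : k) ^ (u.length + 1) • rightAct k (letter v) • barGen k n u) l) =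
        - rightAct k y • cutSum (fun u v => (-1 : k) ^ u.length • rightAct k (letter v) •
          barGen k (n + 1) (x :: u)) l := by
      rw [h1, ← LinearMap.toAddMonoidHom_coe, ← cutSum_map]
      have := cutSum_map (-Algebra.lsmul k k (Bar k A (n + 1)) (rightAct k y)).toAddMonoidHom
        (fun u v => (-1 : k) ^ u.length • rightAct k (letter v) •
          barGen k (n + 1) (x :: u)) l
      rw [neg_smul]
      refine Eq.trans (cutSum_congr fun u v _ => ?_) this
      have := barS_smul_gen (k := k) (n := n) x y 1 (letter v) u
      rw [leftAct_one, one_smul, mul_one] at this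
      change barS k A n ((leftAct k x * rightAct k y) • _) = - (rightAct k y • _)
      rw [env_smul_comm, env_smul_comm, map_smul, this, pow_succ, mul_neg_one, neg_smul, mul_smul]
    simp only [smul_add, smul_sub, map_add, map_sub]
    rw [h2, h3, h4, smul_smul, rightAct_mul_leftAct, neg_smul]
    abel

theorem barD_barS_zero (b : Bar k A 0) :
    barD k A 0 (barS k A 0 b) + rightAct k (barAug k A b) • barGen k 0 [] = b := by
  induction b using bar_induction with
  | h₂ b c hb hc => simp only [map_add, add_smul]; rw [← add_add_add_comm, hb, hc]
  | h₁ x y l hl =>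
    obtain rfl := List.length_eq_zero_iff.mp hl
    rw [barS_gen, map_smul, barD_gen rfl, bimodDelta_cons barGen_isMulti, map_smul, barAug_gen,
      barWord_nil (barGen_isMulti.cons x)]
    simp only [cutSum_nil, barGen_supp (k := k) (n := 0) (l := x :: []) (by simp), smul_zero,
      mul_smul, rightAct_smul, leftAct_smul, one_mul, letter_singleton, add_zero,
      barGen_supp (k := k) (n := 0) (l := _ :: []) (by simp : ([x * letter []] : List A).length ≠ 0)]
    rw [rightAct_mul, sub_zero, mul_smul, smul_sub, sub_add_cancel, smul_smul, smul_smul,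
      rightAct_mul_leftAct]

theorem barAug_barD (b : Bar k A 1) : barAug k A (barD k A 0 b) = 0 := by
  have : barAug k A ∘ₗ barD k A 0 = 0 := by
    refine bar_hom_ext fun l hl => ?_
    obtain ⟨x, rfl⟩ := List.length_eq_one_iff.mp hl
    rw [LinearMap.comp_apply, barD_gen rfl, bimodDelta_cons barGen_isMulti,
      barWord_nil (barGen_isMulti.cons x)]
    simp [barGen_supp (k := k) (n := 0) (A := A), barAug_gen, leftAct_smul, rightAct_smul,
      letter_singleton]
  exact LinearMap.congr_fun this b

/-- Every generator is in the image of `barS`, and `d s = 1 - s d` moves the claim for `s b` down by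
one degree. The induction therefore rests on the homotopy formula alone and ends at the
augmentation. -/
theorem barD_barD (b : Bar k A (n + 2)) : barD k A n (barD k A (n + 1) b) = 0 := by
  have key : ∀ m, (∀ b : Bar k A (m + 1), barD k A m (barD k A (m + 1) (barS k A (m + 1) b)) = 0) →
      ∀ b : Bar k A (m + 2), barD k A m (barD k A (m + 1) b) = 0 := by
    intro m h b
    have : barD k A m ∘ₗ barD k A (m + 1) = 0 := by
      refine bar_hom_ext fun l hl => ?_
      obtain ⟨x, l, rfl⟩ : ∃ x y, l = x :: y := by
        rcases l with _ | ⟨x, l⟩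
        · simp at hl
        · exact ⟨x, l, rfl⟩
      have := barS_gen (k := k) (n := m + 1) x 1 l
      rw [rightAct_one, one_smul, mul_one] at this
      rw [LinearMap.comp_apply, ← this, h]
      rfl
    exact LinearMap.congr_fun this b
  induction n with
  | zero =>
    refine key 0 (fun b => ?_) b
    have h1 := barD_barS_succ b
    have h2 := barD_barS_zero (barD k A 0 b)
    rw [barAug_barD, rightAct_zero_smul, add_zero] at h2
    rw [← sub_eq_iff_eq_add.mpr h1.symm, map_sub, h2, sub_self]
  | succ n ih =>
    refine key (n + 1) (fun b => ?_) b
    have h1 := barD_barS_succ b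
    have h2 := barD_barS_succ (barD k A (n + 1) b)
    rw [ih, map_zero, add_zero] at h2
    rw [← sub_eq_iff_eq_add.mpr h1.symm, map_sub, h2, sub_self]

theorem bar_exact (n : ℕ) : Function.Exact (barD k A (n + 1)) (barD k A n) := by
  intro b
  constructor
  · intro h
    have h1 := barD_barS_succ b
    rw [h, map_zero, add_zero] at h1
    exact ⟨_, h1⟩
  · rintro ⟨c, rfl⟩
    exact barD_barD c

theorem bar_exact_aug : Function.Exact (barD k A 0) (barAug k A) := by
  intro b
  constructor
  · intro h
    have h1 := barD_barS_zero b
    rw [h, rightAct_zero_smul, add_zero] at h1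
    exact ⟨_, h1⟩
  · rintro ⟨c, rfl⟩
    exact barAug_barD c

theorem barAug_surjective : Function.Surjective (barAug k A) := fun a =>
  ⟨leftAct k a • barGen k 0 [], by rw [map_smul, barAug_gen, leftAct_smul, mul_one]⟩

end Bar

end

end CalabiYau

namespace CalabiYau

noncomputable section

attribute [local instance] TensorProduct.Algebra.module

/-! ### Normalization of cochains and of functions of cyclic words -/

section Normalization

variable {k : Type*} [Field k] {A : Type*} [Ring A] [Algebra k A]

section Degenerate

variable {W : Type*} [AddCommGroup W] [Module k W] {φ : List A → W}

theorem cutSum_letter_normal {Φ : A → List A → W} (h : ∀ v, Φ 0 v = 0)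
    (hn : ∀ a x y, Φ a (x ++ 1 :: y) = 0) (x y : List A) :
    cutSum (fun u v => Φ (letter u) v) (x ++ 1 :: y) = if x = [] then Φ 1 y else 0 := by
  rcases x with _ | ⟨a, x⟩
  · rw [List.nil_append, cutSum_letter_cons h, if_pos rfl]
  · rw [List.cons_append, cutSum_letter_cons h, hn, if_neg (by simp)]

/-- Only the products of `1` with its two neighbours remove the offending letter. They give the same
word with opposite signs, and one of them is missing at either end. -/
theorem barWord_normal (hφ : IsMulti k φ) (hn : IsNormalWord φ) (x y : List A) :
    barWord k φ (x ++ 1 :: y) = (if y = [] then 0 else (-1 : k) ^ x.length • φ (x ++ y)) -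
      if x = [] then 0 else (-1 : k) ^ x.length • φ (x ++ y) := by
  induction x generalizing φ with
  | nil =>
    rw [List.nil_append, barWord_cons hφ, show (fun l => φ (1 :: l)) = fun _ => 0 from
      funext fun l => hn [] l, barWord, hat_zero]
    simp only [one_mul]
    rcases y with _ | ⟨b, y⟩
    · simp [hφ.head_zero, letter]
    · rw [cutSum_letter_cons (Φ := fun b v => φ (b :: v)) fun v => hφ.head_zero v]
      simp
  | cons a x ih =>
    rw [List.cons_append, barWord_cons hφ, ih (hφ.cons a) fun u v => hn (a :: u) v,
      cutSum_letter_normal (Φ := fun b v => φ (a * b :: v))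
        (fun v => by rw [mul_zero, hφ.head_zero]) (fun b u v => hn (a * b :: u) v), mul_one]
    rcases x with _ | ⟨b, x⟩
    · by_cases hy : y = [] <;> simp [hy]
    · by_cases hy : y = [] <;> simp [hy, pow_succ]

variable {N : Type*} [AddCommGroup N] [Module k N] [Module (Env k A) N] [IsScalarTower k (Env k A) N]
  {θ : List A → N}

/-- The end terms left over by `barWord_normal` are cancelled by the outer actions, in which `1`
acts as the identity. -/
theorem bimodDelta_normal (hθ : IsMulti k θ) (hn : IsNormalWord θ) (x y : List A) :
    bimodDelta k θ (x ++ 1 :: y) = 0 := by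
  have h3 : cutSum (fun u v => (-1 : k) ^ (u.length + 1) • rightAct k (letter v) • θ u)
      (x ++ 1 :: y) = if y = [] then (-1 : k) ^ (x.length + 1) • θ x else 0 := by
    rcases List.eq_nil_or_concat y with rfl | ⟨y, b, rfl⟩
    · rw [cutSum_letter_concat (Φ := fun u b => (-1 : k) ^ (u.length + 1) • rightAct k b • θ u)
        fun u => by rw [rightAct_zero_smul, smul_zero], rightAct_one, one_smul, if_pos rfl]
    · rw [List.concat_eq_append, ← List.cons_append, ← List.append_assoc,
        cutSum_letter_concat (Φ := fun u b => (-1 : k) ^ (u.length + 1) • rightAct k b • θ u)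
        fun u => by rw [rightAct_zero_smul, smul_zero], hn, smul_zero, smul_zero, if_neg (by simp)]
  rw [bimodDelta, h3, barWord_normal hθ hn, cutSum_letter_normal (Φ := fun b v => leftAct k b • θ v)
      (fun v => leftAct_zero_smul _) (fun b u v => by rw [hn, smul_zero]), leftAct_one, one_smul]
  rcases x with _ | ⟨b, x⟩
  · by_cases hy : y = [] <;> simp [hy]
  · by_cases hy : y = [] <;> simp [hy, pow_succ]

end Degenerate

/-! ### The trace of the bar resolution -/

section Trace

variable {W : Type*} [AddCommGroup W] [Module k W] {φ ψ : List A → W} {n : ℕ}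

/-- The action of the enveloping algebra on `a`, with the inner and the outer structure exchanged. -/
def conjAct (k : Type*) [Field k] {A : Type*} [Ring A] [Algebra k A] (a : A) : Env k A →ₗ[k] A :=
  (LinearMap.toSpanSingleton (Env k A) A a).restrictScalars k ∘ₗ
    (MulOpposite.opLinearEquiv k).symm.toLinearMap ∘ₗ (flipHom k A).toLinearMap

theorem conjAct_apply (a : A) (r : Env k A) : conjAct k a r = (flip k A).conj r • a := rfl

/-- The functional on the bar resolution which is `φ (a :: l)` on the generators. -/
def barTrace (hφ : IsMulti k φ) (a : A) (n : ℕ) : Bar k A n →ₗ[k] W :=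
  TensorProduct.lift (R := k) (M := Env k A) (N := ⨂[k] (_ : Fin n), A)
    (consLin φ hφ n ∘ₗ conjAct k a)

theorem barTrace_smul_gen (hφ : IsMulti k φ) (a : A) (r : Env k A) {l : List A}
    (hl : l.length = n) :
    barTrace hφ a n (r • barGen k n l) = φ ((flip k A).conj r • a :: l) := by
  obtain ⟨v, rfl⟩ := exists_ofFn l hl
  rw [barGen, wordOf_ofFn, smul_barTensor, barTrace]
  refine (TensorProduct.lift.tmul _ _).trans ?_
  rw [LinearMap.comp_apply, consLin_tprod, conjAct_apply]

theorem barTrace_gen (hφ : IsMulti k φ) (a : A) {l : List A} (hl : l.length = n) :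
    barTrace hφ a n (barGen k n l) = φ (a :: l) := by
  have := barTrace_smul_gen hφ a 1 hl
  rwa [one_smul, ← leftAct_one, conj_leftAct, rightAct_smul, mul_one] at this

theorem bar_induction' {p : Bar k A n → Prop}
    (h₁ : ∀ (r : Env k A) (l : List A), l.length = n → p (r • barGen k n l))
    (h₂ : ∀ b c, p b → p c → p (b + c)) (b : Bar k A n) : p b :=
  bar_induction (fun _ _ l hl => h₁ _ l hl) h₂ b

theorem barTrace_smul (hφ : IsMulti k φ) (a : A) (r : Env k A) (b : Bar k A n) :
    barTrace hφ a n (r • b) = barTrace hφ ((flip k A).conj r • a) n b := by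
  induction b using bar_induction' with
  | h₁ s l hl =>
    rw [smul_smul, barTrace_smul_gen hφ _ _ hl, barTrace_smul_gen hφ _ _ hl,
      AntiInvolution.conj_mul, mul_smul]
  | h₂ b c hb hc => rw [smul_add, map_add, map_add, hb, hc]

theorem barTrace_add (hφ : IsMulti k φ) (a a' : A) (b : Bar k A n) :
    barTrace hφ (a + a') n b = barTrace hφ a n b + barTrace hφ a' n b := by
  induction b using bar_induction' with
  | h₁ s l hl =>
    rw [barTrace_smul_gen hφ _ _ hl, barTrace_smul_gen hφ _ _ hl, barTrace_smul_gen hφ _ _ hl,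
      smul_add, hφ.head_add]
  | h₂ b c hb hc => rw [map_add, map_add, map_add, hb, hc]; abel

theorem barTrace_smul_left (hφ : IsMulti k φ) (c : k) (a : A) (b : Bar k A n) :
    barTrace hφ (c • a) n b = c • barTrace hφ a n b := by
  induction b using bar_induction' with
  | h₁ s l hl =>
    rw [barTrace_smul_gen hφ _ _ hl, barTrace_smul_gen hφ _ _ hl, env_smul_comm, hφ.head_smul]
  | h₂ b c hb hc => rw [map_add, map_add, smul_add, hb, hc]

theorem hochWord_singleton (hφ : IsMulti k φ) (a : A) : hochWord k φ [a] = 0 := by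
  simp only [hochWord, cutSum_nil, barWord_nil (hφ.cons a)]
  simp [letter, hφ.head_zero]

/-- `barTrace` regards functions of cyclic words as functionals on `A ⊗_{A^e} Bar`, and on this
tensor product the bar differential induces the Hochschild boundary. -/
theorem barTrace_barD (hφ : IsMulti k φ) (a : A) (b : Bar k A (n + 1)) :
    barTrace hφ a n (barD k A n b) = barTrace hφ.hoch a (n + 1) b := by
  induction b using bar_induction' with
  | h₂ b c hb hc => rw [map_add, map_add, map_add, hb, hc]
  | h₁ r w hw =>
    rw [map_smul, barTrace_smul, barTrace_smul, barTrace_gen _ _ hw, barD_gen hw]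
    generalize (flip k A).conj r • a = a'
    have h1 : barTrace hφ a' n (cutSum (fun u v => leftAct k (letter u) • barGen k n v) w) =
        cutSum (fun u v => φ (a' * letter u :: v)) w := by
      refine (cutSum_map (barTrace hφ a' n).toAddMonoidHom _ w).symm.trans
        (cutSum_congr fun u v huv => ?_)
      change barTrace hφ a' n _ = _
      by_cases hu : u.length = 1
      · have := congrArg List.length huv
        rw [List.length_append] at this
        rw [barTrace_smul_gen hφ _ _ (by omega), conj_leftAct, rightAct_smul]
      · rw [letter_eq_zero hu, leftAct_zero_smul, map_zero, mul_zero, hφ.head_zero]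
    have h3 : barTrace hφ a' n (cutSum (fun u v => (-1 : k) ^ (u.length + 1) •
        rightAct k (letter v) • barGen k n u) w) =
        cutSum (fun u v => (-1 : k) ^ (u.length + 1) • φ (letter v * a' :: u)) w := by
      refine (cutSum_map (barTrace hφ a' n).toAddMonoidHom _ w).symm.trans
        (cutSum_congr fun u v huv => ?_)
      change barTrace hφ a' n _ = _
      rw [map_smul]
      by_cases hu : v.length = 1
      · have := congrArg List.length huv
        rw [List.length_append] at this
        rw [barTrace_smul_gen hφ _ _ (by omega), conj_rightAct, leftAct_smul]
      · rw [letter_eq_zero hu, rightAct_zero_smul, map_zero, zero_mul, hφ.head_zero]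
    have h2 : barTrace hφ a' n (barWord k (barGen k n) w) =
        barWord k (fun l => φ (a' :: l)) w := by
      rw [barWord, barWord, ← hat_map, hat_eq_sum (m := n) (fun _ => mulWord_eq_zero)
        (barGen_isMulti.map (barTrace hφ a' n)) w (by omega),
        hat_eq_sum (m := n) (fun _ => mulWord_eq_zero) (hφ.cons a') w (by omega)]
      refine Finset.sum_congr rfl fun j _ => ?_
      rw [barTrace_gen]
      simp
      omega
    rw [bimodDelta, map_add, map_sub, h1, h2, h3]
    rfl

/-- The pull-back of functions of cyclic words along a family of maps of the bar resolution. -/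
def pullWord (s : ℕ) (f : ∀ n, Bar k A n →ₗ[Env k A] Bar k A (n + s)) (hφ : IsMulti k φ) :
    List A → W
  | [] => 0
  | a :: w => barTrace hφ a _ (f w.length (barGen k w.length w))

theorem IsMulti.pull (s : ℕ) (f : ∀ n, Bar k A n →ₗ[Env k A] Bar k A (n + s)) (hφ : IsMulti k φ) :
    IsMulti k (pullWord s f hφ) := by
  refine IsMulti.of_cons (fun a => ?_) (fun a b w => barTrace_add _ _ _ _)
    fun c a w => barTrace_smul_left _ _ _ _
  have h : ∀ n, IsMulti k fun w => barTrace hφ a _ (f n (barGen k n w)) := fun n =>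
    (map_isMulti barGen_isMulti (f n)).map (barTrace hφ a _)
  have key : ∀ n w, w.length = n →
      pullWord s f hφ (a :: w) = barTrace hφ a _ (f n (barGen k n w)) := by
    rintro _ w rfl; rfl
  constructor
  · intro x b c z
    rw [key (x.length + (z.length + 1)) _ (by simp), key (x.length + (z.length + 1)) _ (by simp),
      key (x.length + (z.length + 1)) _ (by simp), (h _).add]
  · intro x c b z
    rw [key (x.length + (z.length + 1)) _ (by simp), key (x.length + (z.length + 1)) _ (by simp),
      (h _).smul]

theorem barTrace_pull (s : ℕ) (f : ∀ n, Bar k A n →ₗ[Env k A] Bar k A (n + s)) (hφ : IsMulti k φ)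
    (a : A) (b : Bar k A n) : barTrace (hφ.pull s f) a n b = barTrace hφ a _ (f n b) := by
  induction b using bar_induction' with
  | h₁ r l hl =>
    subst hl
    rw [barTrace_smul, map_smul, barTrace_smul, barTrace_gen _ _ rfl]
    rfl
  | h₂ b c hb hc => rw [map_add, map_add, map_add, hb, hc]

theorem hochWord_pull (f : ∀ n, Bar k A n →ₗ[Env k A] Bar k A n)
    (hf : ∀ n b, barD k A n (f (n + 1) b) = f n (barD k A n b)) (hφ : IsMulti k φ) (l : List A) :
    hochWord k (pullWord 0 f hφ) l = pullWord 0 f hφ.hoch l := by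
  rcases l with _ | ⟨a, w⟩
  · rfl
  · rcases w with _ | ⟨b, w⟩
    · rw [hochWord_singleton (hφ.pull 0 f)]
      -- In degree zero there is no boundary to compare with; every value is one of the differential
      -- of `φ` on a word of length one, and these vanish.
      refine (bar_induction' (p := fun b => barTrace hφ.hoch a 0 b = 0) (fun r l hl => ?_)
        (fun b c hb hc => ?_) (f 0 (barGen k 0 []))).symm
      · obtain rfl := List.length_eq_zero_iff.mp hl
        rw [barTrace_smul_gen _ _ _ hl, hochWord_singleton hφ]
      · rw [map_add, hb, hc, add_zero]
    · rw [← barTrace_gen (n := w.length + 1) (hφ.pull 0 f).hoch a rfl, ← barTrace_barD (hφ.pull 0 f),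
        barTrace_pull]
      change barTrace hφ a _ _ = barTrace hφ.hoch a _ _
      rw [← hf]
      exact barTrace_barD hφ a _

/-- A homotopy of the bar resolution, tensored with `A` over `A^e` and transposed, is a homotopy of
functions of cyclic words. -/
theorem pullWord_homotopy (f g : ∀ n, Bar k A n →ₗ[Env k A] Bar k A n)
    (h : ∀ n, Bar k A n →ₗ[Env k A] Bar k A (n + 1))
    (h₀ : ∀ b, f 0 b - g 0 b = barD k A 0 (h 0 b))
    (h₁ : ∀ n b, f (n + 1) b - g (n + 1) b = barD k A (n + 1) (h (n + 1) b) + h n (barD k A n b))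
    (hφ : IsMulti k φ) (l : List A) :
    pullWord 0 f hφ l = pullWord 0 g hφ l + pullWord 1 h hφ.hoch l +
      hochWord k (pullWord 1 h hφ) l := by
  rcases l with _ | ⟨a, w⟩
  · simp [pullWord, hochWord]
  · rcases w with _ | ⟨b, w⟩
    · rw [hochWord_singleton (hφ.pull 1 h), add_zero]
      change barTrace hφ a 0 (f 0 (barGen k 0 [])) = barTrace hφ a 0 (g 0 (barGen k 0 [])) +
        barTrace hφ.hoch a 1 (h 0 (barGen k 0 []))
      rw [← barTrace_barD hφ, ← h₀, map_sub]
      abel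
    · rw [← barTrace_gen (n := w.length + 1) (hφ.pull 1 h).hoch a rfl, ← barTrace_barD (hφ.pull 1 h),
        barTrace_pull]
      change barTrace hφ a _ (f (w.length + 1) (barGen k (w.length + 1) (b :: w))) =
        barTrace hφ a _ (g (w.length + 1) (barGen k (w.length + 1) (b :: w))) +
        barTrace hφ.hoch a _ (h (w.length + 1) (barGen k (w.length + 1) (b :: w))) + _
      rw [← barTrace_barD hφ]
      rw [add_assoc, ← map_add, ← h₁, map_sub]
      exact (add_sub_cancel _ _).symm

end Trace

/-! ### The normalization map -/

variable (k A)

/-- A chain endomorphism of the bar resolution which is homotopic to the identity and vanishes on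
the degenerate words. -/
def barNormal : ∀ n, Bar k A n →ₗ[Env k A] Bar k A n
  | 0 => LinearMap.id
  | n + 1 => liftBar (barGen_isMulti.map (barS k A n ∘ₗ (barNormal n).restrictScalars k ∘ₗ
      (barD k A n).restrictScalars k)) (n + 1)

variable {k A}

theorem barNormal_gen {n : ℕ} {l : List A} (hl : l.length = n + 1) :
    barNormal k A (n + 1) (barGen k (n + 1) l) =
      barS k A n (barNormal k A n (barD k A n (barGen k (n + 1) l))) := liftBar_gen _ hl

/-- By induction: `d s = 1 - s d`, and the correction involves the differential of the normalized
boundary, which by the previous case is the normalization of `d d = 0`. -/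
theorem barD_barNormal (n : ℕ) (b : Bar k A (n + 1)) :
    barD k A n (barNormal k A (n + 1) b) = barNormal k A n (barD k A n b) := by
  suffices h : ∀ n, barD k A n ∘ₗ barNormal k A (n + 1) = barNormal k A n ∘ₗ barD k A n from
    LinearMap.congr_fun (h n) b
  clear b n
  intro n
  induction n with
  | zero =>
    refine bar_hom_ext fun l hl => ?_
    have := barD_barS_zero (barNormal k A 0 (barD k A 0 (barGen k 1 l)))
    rw [LinearMap.comp_apply, barNormal_gen hl, eq_sub_of_add_eq this]
    change _ - rightAct k (barAug k A (barD k A 0 (barGen k 1 l))) • _ = _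
    rw [barAug_barD, rightAct_zero_smul, sub_zero]
    rfl
  | succ n ih =>
    refine bar_hom_ext fun l hl => ?_
    have := barD_barS_succ (barNormal k A (n + 1) (barD k A (n + 1) (barGen k (n + 2) l)))
    rw [LinearMap.comp_apply, barNormal_gen hl, eq_sub_of_add_eq this, LinearMap.comp_apply,
      show barD k A n (barNormal k A (n + 1) (barD k A (n + 1) (barGen k (n + 2) l))) =
        barNormal k A n (barD k A n (barD k A (n + 1) (barGen k (n + 2) l))) from
        LinearMap.congr_fun ih _, barD_barD, map_zero, map_zero, sub_zero]

/-- The value on a generator depends only on the normalized boundary of that generator, and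
`bimodDelta` preserves vanishing on degenerate words. -/
theorem barNormal_isNormalWord (n : ℕ) : IsNormalWord fun l => barNormal k A n (barGen k n l) := by
  induction n with
  | zero =>
    intro x y
    beta_reduce
    rw [barGen_supp (by simp), map_zero]
  | succ n ih =>
    intro x y
    beta_reduce
    by_cases hl : (x ++ 1 :: y).length = n + 1
    · rw [barNormal_gen hl, map_barD_gen _ hl,
        bimodDelta_normal (map_isMulti barGen_isMulti _) ih, map_zero]
    · rw [barGen_supp hl, map_zero]

theorem exists_homotopy_barNormal : ∃ h : ∀ n, Bar k A n →ₗ[Env k A] Bar k A (n + 1),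
    (∀ b, barNormal k A 0 b - b = barD k A 0 (h 0 b)) ∧ ∀ n b, barNormal k A (n + 1) b - b =
      barD k A (n + 1) (h (n + 1) b) + h n (barD k A n b) :=
  exists_homotopy (P := Bar k A) (N := Bar k A) (dP := barD k A) (dN := barD k A)
    (fun _ => inferInstance) (fun _ => barD_barD) bar_exact
    (fun n => barNormal k A n - LinearMap.id)
    (fun n x => by simp only [LinearMap.sub_apply, map_sub, barD_barNormal, LinearMap.id_apply])
    (fun x => by
      rw [show barNormal k A 0 - LinearMap.id = 0 from sub_self _]
      exact zero_mem _)

/-- Every closed function of cyclic words is cohomologous to a normalized one. -/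
theorem exists_isNormal {W : Type*} [AddCommGroup W] [Module k W] {φ : List A → W}
    (hφ : IsMulti k φ) (h0 : ∀ l, hochWord k φ l = 0) : ∃ φ' χ : List A → W, IsMulti k φ' ∧
      IsNormal φ' ∧ (∀ l, hochWord k φ' l = 0) ∧ IsMulti k χ ∧
      ∀ a l, φ' (a :: l) = φ (a :: l) + hochWord k χ (a :: l) := by
  obtain ⟨h, hh₀, hh₁⟩ := exists_homotopy_barNormal (k := k) (A := A)
  have hz : ∀ (a : A) n (b : Bar k A n), barTrace hφ.hoch a n b = 0 := by
    intro a n b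
    induction b using bar_induction' with
    | h₁ r l hl => rw [barTrace_smul_gen _ _ _ hl, h0]
    | h₂ b c hb hc => rw [map_add, hb, hc, add_zero]
  refine ⟨pullWord 0 (barNormal k A) hφ, pullWord 1 h hφ, hφ.pull 0 _, fun a x y => ?_, fun l => ?_,
    hφ.pull 1 h, fun a l => ?_⟩
  · change barTrace hφ a _ _ = 0
    rw [show barNormal k A _ (barGen k _ (x ++ 1 :: y)) = 0 from barNormal_isNormalWord _ x y,
      map_zero]
  · rw [hochWord_pull _ barD_barNormal]
    rcases l with _ | ⟨a, w⟩
    · rfl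
    · exact hz _ _ _
  · rw [pullWord_homotopy (barNormal k A) (fun _ => LinearMap.id) h hh₀ hh₁ hφ]
    congr 1
    rw [show pullWord 1 h hφ.hoch (a :: l) = 0 from hz _ _ _, add_zero]
    exact barTrace_gen hφ a rfl

/-- Read the cocycle as a bimodule map on the bar resolution and compose it with `barNormal`.
Composing with the homotopy to the identity gives the primitive of the difference; in degree zero
the composition changes nothing. -/
theorem IsCocycle.exists_isNormalWord {F : List A → A} {n : ℕ} (hF : IsCocycle k n F) :
    ∃ F' : List A → A, IsCocycle k n F' ∧ IsNormalWord F' ∧ (n = 0 → F' = F) ∧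
      ∀ m, n = m + 1 → ∃ H, IsCochain k m H ∧ ∀ l, F' l = F l + deltaWord k m H l := by
  have hFm := hF.multi
  have hlift : ∀ l, liftBar hFm n (barGen k n l) = F l := by
    intro l
    by_cases hl : l.length = n
    · exact liftBar_gen _ hl
    · rw [barGen_supp hl, map_zero, hF.supp l hl]
  have hcl : ∀ b, liftBar hFm n (barD k A n b) = 0 := by
    intro b
    suffices h : liftBar hFm n ∘ₗ barD k A n = 0 from LinearMap.congr_fun h b
    refine bar_hom_ext fun l hl => ?_
    rw [LinearMap.comp_apply, map_barD_gen _ hl, funext hlift, bimodDelta_eq_delta _ _ hl,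
      hF.closed]
    rfl
  have hcoch : ∀ {m} (f : Bar k A m →ₗ[Env k A] A), IsCochain k m fun l => f (barGen k m l) :=
    fun f => ⟨map_isMulti barGen_isMulti f, fun l hl => by rw [barGen_supp hl, map_zero]⟩
  have hF'c := hcoch (liftBar hFm n ∘ₗ barNormal k A n)
  refine ⟨fun l => (liftBar hFm n ∘ₗ barNormal k A n) (barGen k n l), ⟨hF'c, fun l => ?_⟩,
    fun x y => ?_, ?_, ?_⟩
  · by_cases hl : l.length = n + 1
    · rw [← bimodDelta_eq_delta _ _ hl, ← map_barD_gen _ hl, LinearMap.comp_apply,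
        ← barD_barNormal, hcl]
    · exact hF'c.delta.supp l hl
  · beta_reduce
    rw [LinearMap.comp_apply, show barNormal k A n (barGen k n (x ++ 1 :: y)) = 0 from
      barNormal_isNormalWord n x y, map_zero]
  · rintro rfl
    exact funext hlift
  · rintro m rfl
    obtain ⟨h, hh₀, hh₁⟩ := exists_homotopy_barNormal (k := k) (A := A)
    refine ⟨_, hcoch (liftBar hFm (m + 1) ∘ₗ h m), fun l => ?_⟩
    beta_reduce
    by_cases hl : l.length = m + 1
    · rw [← bimodDelta_eq_delta _ _ hl, ← map_barD_gen _ hl, LinearMap.comp_apply,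
        LinearMap.comp_apply, eq_add_of_sub_eq (hh₁ m _), map_add, map_add, hcl, zero_add, hlift,
        add_comm]
    · rw [(hcoch (liftBar hFm (m + 1) ∘ₗ h m)).delta.supp l hl, add_zero, hF'c.supp l hl,
        hF.supp l hl]

end Normalization

end

end CalabiYau

namespace CalabiYau

/-! ### From the double commutator to the Batalin–Vilkovisky axioms -/

section BatalinVilkovisky

variable {k : Type*} [Field k] {H : Type*} [AddCommGroup H] [Module k H]
  {deg : ℤ → Submodule k H} {mul br : H →ₗ[k] H →ₗ[k] H} {Δ : H →ₗ[k] H}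

theorem map_sign_smul {M N : Type*} [AddCommGroup M] [AddCommGroup N] [Module k M] [Module k N]
    (f : M →ₗ[k] N) (u : ℤˣ) (x : M) : f (u • x) = u • f x := by
  rcases Int.units_eq_one_or u with h | h <;> simp [h]

theorem sgn_eq_ite (a : ℤ) : sgn a = if Even a then 1 else -1 := by
  split_ifs with h
  · exact Int.negOnePow_even a h
  · exact Int.negOnePow_odd a (Int.not_even_iff_odd.mp h)

/-- A graded commutative algebra with an operator of square zero, in which the multiplication with
the bracket is the double commutator of the operator with multiplications. -/
theorem isBVAlgebra_of_commutator (one : H) (internal : DirectSum.IsInternal deg)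
    (mul_mem : ∀ i j, ∀ x ∈ deg i, ∀ y ∈ deg j, mul x y ∈ deg (i + j))
    (br_mem : ∀ i j, ∀ x ∈ deg i, ∀ y ∈ deg j, br x y ∈ deg (i + j - 1))
    (assoc : ∀ x y z, mul (mul x y) z = mul x (mul y z))
    (comm : ∀ i j, ∀ x ∈ deg i, ∀ y ∈ deg j, mul x y = sgn (i * j) • mul y x)
    (mul_one : ∀ x, mul x one = x) (Δ_one : Δ one = 0)
    (Δ_mem : ∀ i, ∀ x ∈ deg i, Δ x ∈ deg (i - 1)) (Δ_sq : ∀ x, Δ (Δ x) = 0)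
    (key : ∀ i j, ∀ x ∈ deg i, ∀ y ∈ deg j, ∀ z, mul (br x y) z =
      - mul x (Δ (mul y z)) + sgn i • Δ (mul x (mul y z)) +
        sgn ((i - 1) * j) • mul y (mul x (Δ z)) +
        sgn ((i - 1) * (j - 1)) • mul y (Δ (mul x z))) :
    IsBVAlgebra deg mul br Δ := by
  have hΔx : ∀ i j, ∀ x ∈ deg i, ∀ y ∈ deg j, mul y (Δ x) = sgn ((i - 1) * j) • mul (Δ x) y := by
    intro i j x hx y hy
    rw [comm j (i - 1) y hy _ (Δ_mem i x hx), mul_comm]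
  -- Evaluate the double commutator at the unit; the term with `Δ one` disappears.
  have br_eq : ∀ i j, ∀ x ∈ deg i, ∀ y ∈ deg j,
      br x y = sgn i • Δ (mul x y) - sgn i • mul (Δ x) y - mul x (Δ y) := by
    intro i j x hx y hy
    have h := key i j x hx y hy one
    rw [mul_one, mul_one, mul_one, Δ_one, map_zero, map_zero, smul_zero, add_zero,
      hΔx i j x hx y hy] at h
    rw [h]
    rcases Int.even_or_odd i with hi | hi <;> rcases Int.even_or_odd j with hj | hj <;>
      simp [sgn_eq_ite, Int.not_even_iff_odd.mpr, hi, hj, -Int.not_even_iff_odd] <;> abel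
  have swap : ∀ i j, ∀ x ∈ deg i, ∀ y ∈ deg j, ∀ z,
      mul y (mul x z) = sgn (i * j) • mul x (mul y z) := by
    intro i j x hx y hy z
    rw [← assoc, comm j i y hy x hx, mul_comm, ← assoc]
    rcases Int.units_eq_one_or (sgn (i * j)) with h | h <;> simp [h]
  -- Comparing `key` with the formula just obtained for the bracket gives the seven-term identity:
  -- `Δ` is an operator of second order.
  have triple : ∀ i j, ∀ x ∈ deg i, ∀ y ∈ deg j, ∀ z, mul (Δ (mul x y)) z =
      mul (Δ x) (mul y z) + sgn i • mul x (mul (Δ y) z) + sgn i • (- mul x (Δ (mul y z)) +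
        sgn i • Δ (mul x (mul y z)) + sgn ((i - 1) * j) • mul y (mul x (Δ z)) +
        sgn ((i - 1) * (j - 1)) • mul y (Δ (mul x z))) := by
    intro i j x hx y hy z
    rw [← key i j x hx y hy z, br_eq i j x hx y hy, ← assoc, ← assoc]
    rcases Int.units_eq_one_or (sgn i) with h | h <;> simp [h] <;> abel
  refine ⟨⟨internal, mul_mem, br_mem, assoc, comm, ?_, ?_, ?_⟩, Δ_mem, Δ_sq, br_eq⟩
  · intro i j l x hx y hy z hz
    rw [key i j x hx y hy z, br_eq i _ x hx _ (mul_mem j l y hy z hz), br_eq i l x hx z hz]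
    have h1 := swap (i - 1) j _ (Δ_mem i x hx) y hy z
    simp only [map_sub, map_sign_smul, h1]
    rcases Int.even_or_odd i with hi | hi <;> rcases Int.even_or_odd j with hj | hj <;>
      simp [sgn_eq_ite, Int.not_even_iff_odd.mpr, hi, hj, -Int.not_even_iff_odd] <;> abel
  · intro i j x hx y hy
    rw [br_eq i j x hx y hy, br_eq j i y hy x hx, comm j i y hy x hx, hΔx i j x hx y hy,
      hΔx j i y hy x hx]
    rcases Int.even_or_odd i with hi | hi <;> rcases Int.even_or_odd j with hj | hj <;>
      simp [sgn_eq_ite, Int.not_even_iff_odd.mpr, hi, hj, -Int.not_even_iff_odd] <;> abel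
  · intro i j l x hx y hy z hz
    -- Both sides of the Jacobi identity are expanded into operators acting on `z`. The identities
    -- `swap` and `triple` are prepared also with `Δ x` or `Δ y` in place of `x` or `y`, and `Δ ∘ Δ
    -- = 0` removes the remaining terms.
    have hΔ := Δ_mem i x hx
    have hΔy := Δ_mem j y hy
    have h1 := swap (i - 1) j _ hΔ y hy
    have h2 := swap (i - 1) (j - 1) _ hΔ _ hΔy
    have h3 := swap i j x hx y hy
    have h4 := swap i (j - 1) x hx _ hΔy
    have t1 := triple i j x hx y hy
    have t2 := triple (i - 1) j _ hΔ y hy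
    have t3 := triple i (j - 1) x hx _ hΔy
    rw [br_eq _ l _ (br_mem i j x hx y hy) z hz, br_eq i _ x hx _ (br_mem j l y hy z hz),
      br_eq j _ y hy _ (br_mem i l x hx z hz), key i j x hx y hy z, key i j x hx y hy (Δ z),
      br_eq i j x hx y hy, br_eq j l y hy z hz, br_eq i l x hx z hz]
    rcases Int.even_or_odd i with hi | hi <;> rcases Int.even_or_odd j with hj | hj <;>
      simp [sgn_eq_ite, Int.even_add, Int.odd_add, Int.not_even_iff_odd.mpr,
        Int.not_odd_iff_even.mpr, hi, hj, -Int.not_even_iff_odd, -Int.not_odd_iff_even] at h1 h2 h3 h4 t1 t2 t3 ⊢ <;>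
      simp only [h1, h2, h3, h4, t2, t3, Δ_sq, map_neg, map_zero,
        LinearMap.zero_apply] <;> abel

end BatalinVilkovisky

end CalabiYau

namespace CalabiYau

noncomputable section

/-! ### Graded subquotients and the operations on Hochschild cohomology -/

section Total

variable {k : Type*} [Field k]

section Lift

variable {M : ℕ → Type*} [∀ n, AddCommGroup (M n)] [∀ n, Module k (M n)]
  {Z B : ∀ n, Submodule k (M n)} {T : Type*} [AddCommGroup T] [Module k T]

/-- The class map of a subquotient. -/
def Subquotient.mkL {M : Type*} [AddCommGroup M] [Module k M] (Z B : Submodule k M) :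
    Z →ₗ[k] Subquotient Z B := (B.submoduleOf Z).mkQ

theorem Subquotient.mkL_eq_zero_iff {M : Type*} [AddCommGroup M] [Module k M] {Z B : Submodule k M}
    (z : Z) : Subquotient.mkL Z B z = 0 ↔ z.1 ∈ B :=
  (Submodule.Quotient.mk_eq_zero _).trans Submodule.mem_comap

theorem Subquotient.mkL_surjective {M : Type*} [AddCommGroup M] [Module k M] (Z B : Submodule k M) :
    Function.Surjective (Subquotient.mkL Z B) := Submodule.mkQ_surjective _

/-- The linear map on a subquotient with given values on the classes. -/
def Subquotient.lift {M T : Type*} [AddCommGroup M] [Module k M] [AddCommGroup T] [Module k T]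
    {Z B : Submodule k M} (f : Z →ₗ[k] T) (hf : ∀ z : Z, z.1 ∈ B → f z = 0) :
    Subquotient Z B →ₗ[k] T :=
  (B.submoduleOf Z).liftQ f fun z hz => hf z (Submodule.mem_comap.mp hz)

variable (Z B) in
/-- The class of an element in the direct sum of subquotients. -/
def totClass (n : ℕ) : Z n →ₗ[k] DirectSum ℕ fun n => Subquotient (Z n) (B n) :=
  DirectSum.lof k ℕ (fun n => Subquotient (Z n) (B n)) n ∘ₗ Subquotient.mkL (Z n) (B n)

/-- The linear map on a direct sum of subquotients with given values on the classes. -/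
def totLift (f : ∀ n, Z n →ₗ[k] T) (hf : ∀ n z, z.1 ∈ B n → f n z = 0) :
    (DirectSum ℕ fun n => Subquotient (Z n) (B n)) →ₗ[k] T :=
  DirectSum.toModule k ℕ T fun n => Subquotient.lift (f n) (hf n)

theorem totLift_totClass (f : ∀ n, Z n →ₗ[k] T) (hf : ∀ n z, z.1 ∈ B n → f n z = 0) (n : ℕ)
    (z : Z n) : totLift f hf (totClass Z B n z) = f n z := by
  rw [totLift, totClass, LinearMap.comp_apply, DirectSum.toModule_lof]
  rfl

theorem totClass_ext {F F' : (DirectSum ℕ fun n => Subquotient (Z n) (B n)) →ₗ[k] T}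
    (h : ∀ n z, F (totClass Z B n z) = F' (totClass Z B n z)) : F = F' := by
  refine DirectSum.linearMap_ext k fun n => ?_
  refine LinearMap.ext fun y => ?_
  obtain ⟨z, rfl⟩ := Subquotient.mkL_surjective _ _ y
  exact h n z

theorem totClass_eq_zero_iff (n : ℕ) (z : Z n) : totClass Z B n z = 0 ↔ z.1 ∈ B n := by
  rw [totClass, LinearMap.comp_apply]
  constructor
  · intro h
    have h1 : Subquotient.mkL (Z n) (B n) z = 0 :=
      DirectSum.of_injective (β := fun n => Subquotient (Z n) (B n)) n
        (h.trans (map_zero (DirectSum.of (fun n => Subquotient (Z n) (B n)) n)).symm)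
    exact (Subquotient.mkL_eq_zero_iff z).mp h1
  · intro h
    rw [(Subquotient.mkL_eq_zero_iff z).mpr h, map_zero]

theorem totClass_eq_iff (n : ℕ) (z z' : Z n) :
    totClass Z B n z = totClass Z B n z' ↔ z.1 - z'.1 ∈ B n := by
  rw [← sub_eq_zero, ← map_sub, totClass_eq_zero_iff]
  rfl

variable {M' : ℕ → Type*} [∀ n, AddCommGroup (M' n)] [∀ n, Module k (M' n)]
  {Z' B' : ∀ n, Submodule k (M' n)}

/-- Existence of a bilinear map on direct sums of subquotients with given values on the classes. -/
theorem exists_totBilin (f : ∀ m n, Z m →ₗ[k] Z' n →ₗ[k] T)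
    (h₁ : ∀ m n z z', z.1 ∈ B m → f m n z z' = 0) (h₂ : ∀ m n z z', z'.1 ∈ B' n → f m n z z' = 0) :
    ∃ F : (DirectSum ℕ fun n => Subquotient (Z n) (B n)) →ₗ[k]
      (DirectSum ℕ fun n => Subquotient (Z' n) (B' n)) →ₗ[k] T, ∀ m n z z',
      F (totClass Z B m z) (totClass Z' B' n z') = f m n z z' := by
  refine ⟨totLift (fun m =>
    { toFun := fun z => totLift (fun n => f m n z) (h₂ m · z)
      map_add' := fun z w => totClass_ext fun n z' => by
        rw [LinearMap.add_apply]
        simp only [totLift_totClass, map_add, LinearMap.add_apply]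
      map_smul' := fun c z => totClass_ext fun n z' => by
        rw [LinearMap.smul_apply]
        simp only [totLift_totClass, map_smul, LinearMap.smul_apply, RingHom.id_apply] })
    (fun m z hz => totClass_ext fun n z' => ?_), fun m n z z' => ?_⟩
  · refine (totLift_totClass (fun n => f m n z) (h₂ m · z) n z').trans ?_
    rw [h₁ m n z z' hz]
    rfl
  · rw [totLift_totClass]
    exact totLift_totClass _ _ n z'

/-- The part of given degree of a direct sum of subquotients. -/
theorem exists_totClass {i : ℤ} {x : DirectSum ℕ fun n => Subquotient (Z n) (B n)}
    (hx : x ∈ (⨆ (n : ℕ) (_ : (n : ℤ) = i),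
      LinearMap.range (DirectSum.lof k ℕ (fun n => Subquotient (Z n) (B n)) n) :
        Submodule k (DirectSum ℕ fun n => Subquotient (Z n) (B n)))) :
    x = 0 ∨ ∃ (n : ℕ) (z : Z n), (n : ℤ) = i ∧ x = totClass Z B n z := by
  rcases lt_or_ge i 0 with hi | hi
  · left
    rw [show (⨆ (n : ℕ) (_ : (n : ℤ) = i), LinearMap.range
      (DirectSum.lof k ℕ (fun n => Subquotient (Z n) (B n)) n)) = ⊥ from
      iSup_eq_bot.mpr fun n => iSup_eq_bot.mpr fun hn => by omega] at hx
    exact (Submodule.mem_bot k).mp hx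
  · obtain ⟨n, rfl⟩ := Int.eq_ofNat_of_zero_le hi
    rw [show (⨆ (m : ℕ) (_ : (m : ℤ) = n), LinearMap.range
      (DirectSum.lof k ℕ (fun n => Subquotient (Z n) (B n)) m)) =
      LinearMap.range (DirectSum.lof k ℕ (fun n => Subquotient (Z n) (B n)) n) by
      simp only [Nat.cast_inj, iSup_iSup_eq_left]] at hx
    obtain ⟨y, rfl⟩ := hx
    obtain ⟨z, rfl⟩ := Subquotient.mkL_surjective _ _ y
    exact Or.inr ⟨n, z, rfl, rfl⟩

theorem totClass_mem (n : ℕ) (z : Z n) {i : ℤ} (h : (n : ℤ) = i) :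
    totClass Z B n z ∈ (⨆ (n : ℕ) (_ : (n : ℤ) = i),
      LinearMap.range (DirectSum.lof k ℕ (fun n => Subquotient (Z n) (B n)) n) :
        Submodule k (DirectSum ℕ fun n => Subquotient (Z n) (B n))) :=
  Submodule.mem_iSup_of_mem n (Submodule.mem_iSup_of_mem h ⟨_, rfl⟩)

theorem tot_isInternal : DirectSum.IsInternal fun i : ℤ => (⨆ (n : ℕ) (_ : (n : ℤ) = i),
    LinearMap.range (DirectSum.lof k ℕ (fun n => Subquotient (Z n) (B n)) n) :
      Submodule k (DirectSum ℕ fun n => Subquotient (Z n) (B n))) := by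
  have hlof : ∀ (i : ℤ) (x : DirectSum ℕ fun n => Subquotient (Z n) (B n)),
      x ∈ (⨆ (n : ℕ) (_ : (n : ℤ) = i),
        LinearMap.range (DirectSum.lof k ℕ (fun n => Subquotient (Z n) (B n)) n) :
        Submodule k (DirectSum ℕ fun n => Subquotient (Z n) (B n))) →
      ∀ m : ℕ, (m : ℤ) ≠ i → x m = 0 := by
    intro i x hx m hm
    rcases exists_totClass hx with rfl | ⟨n, z, hn, rfl⟩
    · rfl
    · exact DirectSum.of_eq_of_ne n m _ fun h => hm (by rw [h, hn])
  refine DirectSum.isInternal_submodule_of_iSupIndep_of_iSup_eq_top ?_ ?_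
  · rw [iSupIndep_def]
    intro i
    rw [Submodule.disjoint_def]
    intro x hx hx'
    refine DFinsupp.ext fun m => ?_
    by_cases hm : (m : ℤ) = i
    · have h1 : (⨆ (j : ℤ) (_ : j ≠ i), ⨆ (n : ℕ) (_ : (n : ℤ) = j),
          LinearMap.range (DirectSum.lof k ℕ (fun n => Subquotient (Z n) (B n)) n)) ≤
          LinearMap.ker (DirectSum.component k ℕ (fun n => Subquotient (Z n) (B n)) m) := by
        refine iSup_le fun j => iSup_le fun hj => fun y hy => ?_
        exact hlof j y hy m fun h => hj (by rw [← h, hm])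
      exact h1 hx'
    · exact hlof i x hx m hm
  · rw [eq_top_iff]
    intro x _
    induction x using DirectSum.induction_on with
    | zero => exact zero_mem _
    | of n y =>
      obtain ⟨z, rfl⟩ := Subquotient.mkL_surjective _ _ y
      exact Submodule.mem_iSup_of_mem (n : ℤ) (totClass_mem n z rfl)
    | add x y hx hy => exact add_mem (hx trivial) (hy trivial)

end Lift

variable {A : Type*} [Ring A] [Algebra k A]

/-! ### Operations on Hochschild cohomology -/

section Cohomology

variable {m n p : ℕ}

theorem cohClass_eq (f : Cocycles k A n) :
    cohClass f = totClass (Cocycles k A) (coboundaries k A) n f := rfl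

theorem homClass_eq (z : Cycles k A n) :
    homClass z = totClass (Cycles k A) (fun n => LinearMap.range (boundary k A n)) n z := rfl

theorem cohClass_eq_iff {f g : Cocycles k A n} :
    cohClass f = cohClass g ↔ f.1 - g.1 ∈ coboundaries k A n := totClass_eq_iff n f g

theorem mem_coboundaries_of_word {H : List A → A} (hH : IsCochain k n H) (hm : m = n + 1)
    {f : Cochain k A m} (h : ∀ l, wordOf f l = deltaWord k n H l) : f ∈ coboundaries k A m := by
  subst hm
  exact ⟨hH.multi.toMultilinear n, wordOf_injective (by
    rw [wordOf_delta, hH.wordOf_toMultilinear, funext h])⟩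

theorem exists_word_of_mem_coboundaries {f : Cochain k A n} (h : f ∈ coboundaries k A n) :
    f = 0 ∨ ∃ m H, n = m + 1 ∧ IsCochain k m H ∧ wordOf f = deltaWord k m H := by
  rcases n with _ | n
  · exact Or.inl h
  · obtain ⟨g, rfl⟩ := h
    exact Or.inr ⟨n, wordOf g, rfl, wordOf_isCochainWord g, wordOf_delta g⟩

/-- The cocycle given by a function of words. -/
def IsCocycle.toCocycle {F : List A → A} (hF : IsCocycle k n F) : Cocycles k A n :=
  ⟨hF.multi.toMultilinear n, (mem_cocycles_iff _).mpr (by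
    rwa [hF.toIsCochain.wordOf_toMultilinear])⟩

theorem IsCocycle.wordOf_toCocycle {F : List A → A} (hF : IsCocycle k n F) :
    wordOf hF.toCocycle.1 = F := hF.toIsCochain.wordOf_toMultilinear

theorem cocycleWord (f : Cocycles k A n) : IsCocycle k n (wordOf f.1) :=
  (mem_cocycles_iff f.1).mp f.2

theorem exists_normal_cocycle (f : Cocycles k A n) :
    ∃ f' : Cocycles k A n, cohClass f' = cohClass f ∧ IsNormalWord (wordOf f'.1) := by
  obtain ⟨F, hF, hn, h0, h1⟩ := (cocycleWord f).exists_isNormalWord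
  refine ⟨hF.toCocycle, cohClass_eq_iff.mpr ?_, by rwa [hF.wordOf_toCocycle]⟩
  rcases n with _ | n
  · rw [show hF.toCocycle.1 = f.1 from wordOf_injective (by rw [hF.wordOf_toCocycle, h0 rfl]),
      sub_self]
    exact zero_mem _
  · obtain ⟨H, hH, h⟩ := h1 n rfl
    refine mem_coboundaries_of_word hH rfl fun l => ?_
    rw [wordOf_sub, hF.wordOf_toCocycle]
    beta_reduce
    rw [h, add_sub_cancel_left]

theorem cup_add_left (f f' : Cochain k A m) (g : Cochain k A n) :
    cup (f + f') g = cup f g + cup f' g := wordOf_injective (funext fun l => by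
  simp only [wordOf_cup, wordOf_add, cupWord_add_left, smul_add])

theorem cup_smul_left (c : k) (f : Cochain k A m) (g : Cochain k A n) :
    cup (c • f) g = c • cup f g := wordOf_injective (funext fun l => by
  simp only [wordOf_cup, wordOf_smul, cupWord_smul_left, smul_comm c])

theorem cup_add_right (f : Cochain k A m) (g g' : Cochain k A n) :
    cup f (g + g') = cup f g + cup f g' := wordOf_injective (funext fun l => by
  simp only [wordOf_cup, wordOf_add, cupWord_add_right, smul_add])

theorem cup_smul_right (c : k) (f : Cochain k A m) (g : Cochain k A n) :
    cup f (c • g) = c • cup f g := wordOf_injective (funext fun l => by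
  simp only [wordOf_cup, wordOf_smul, cupWord_smul_right, smul_comm c])

theorem bracket_add_left (f f' : Cochain k A m) (g : Cochain k A n) (h : p + 1 = m + n) :
    bracket (f + f') g h = bracket f g h + bracket f' g h := wordOf_injective (funext fun l => by
  simp only [wordOf_bracket, wordOf_add, bracketWord, hat_add,
    hat_add_left _ (wordOf_isMulti g), smul_add]
  abel)

theorem bracket_smul_left (c : k) (f : Cochain k A m) (g : Cochain k A n) (h : p + 1 = m + n) :
    bracket (c • f) g h = c • bracket f g h := wordOf_injective (funext fun l => by
  simp only [wordOf_bracket, wordOf_smul, bracketWord, hat_smul,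
    hat_smul_left _ (wordOf_isMulti g), smul_sub, smul_comm c])

theorem bracket_skew (f : Cochain k A m) (g : Cochain k A n) (h : p + 1 = m + n) :
    bracket f g h = -((-1 : k) ^ ((m + 1) * (n + 1)) • bracket g f (by omega)) := by
  rw [bracket, bracket, smul_sub, mul_comm (n + 1), smul_smul, sign_sq, one_smul, neg_sub]

theorem bracket_add_right (f : Cochain k A m) (g g' : Cochain k A n) (h : p + 1 = m + n) :
    bracket f (g + g') h = bracket f g h + bracket f g' h := by
  rw [bracket_skew, bracket_add_left, smul_add, neg_add, ← bracket_skew, ← bracket_skew]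

theorem bracket_smul_right (c : k) (f : Cochain k A m) (g : Cochain k A n) (h : p + 1 = m + n) :
    bracket f (c • g) h = c • bracket f g h := by
  rw [bracket_skew, bracket_smul_left, smul_comm, bracket_skew f g, smul_neg]

theorem cup_mem_cocycles (f : Cocycles k A m) (g : Cocycles k A n) :
    cup f.1 g.1 ∈ Cocycles k A (m + n) := by
  have h := (cocycleWord f).cup (cocycleWord g)
  rw [show cup f.1 g.1 = (-1 : k) ^ (m * n) • h.toCocycle.1 from wordOf_injective (by
    rw [wordOf_cup, wordOf_smul, h.wordOf_toCocycle])]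
  exact Submodule.smul_mem _ _ h.toCocycle.2

theorem bracket_mem_cocycles (f : Cocycles k A m) (g : Cocycles k A n) (hp : p + 1 = m + n) :
    bracket f.1 g.1 hp ∈ Cocycles k A p := by
  rw [mem_cocycles_iff, wordOf_bracket]
  exact (cocycleWord f).bracket (cocycleWord g) hp

theorem cochainWord_smul {H : List A → A} (hH : IsCochain k n H) (c : k) :
    IsCochain k n fun l => c • H l :=
  ⟨hH.multi.fsmul c, fun l hl => by rw [hH.supp l hl, smul_zero]⟩

theorem deltaWord_smul (c : k) (H : List A → A) (l : List A) :
    deltaWord k n (fun l => c • H l) l = c • deltaWord k n H l := by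
  simp only [deltaWord, cupWord_smul_left, cupWord_smul_right, barWord, hat_smul, smul_add,
    smul_sub, smul_comm c]

theorem cup_mem_coboundaries_left {f : Cochain k A m} (hf : f ∈ coboundaries k A m)
    (g : Cocycles k A n) : cup f g.1 ∈ coboundaries k A (m + n) := by
  rcases exists_word_of_mem_coboundaries hf with rfl | ⟨p, H, rfl, hH, hw⟩
  · rw [show cup (0 : Cochain k A m) g.1 = 0 by simpa using cup_smul_left (0 : k) 0 g.1]
    exact zero_mem _
  · refine mem_coboundaries_of_word (cochainWord_smul
      (hH.cup (cocycleWord g).toIsCochain) ((-1 : k) ^ ((p + 1) * n))) (by omega) fun l => ?_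
    rw [wordOf_cup, deltaWord_smul, deltaWord_cupWord hH, funext (cocycleWord g).closed, hw]
    simp only [cupWord, mul_zero, cutSum_zero, smul_zero, add_zero]

theorem cup_mem_coboundaries_right (f : Cocycles k A m) {g : Cochain k A n}
    (hg : g ∈ coboundaries k A n) : cup f.1 g ∈ coboundaries k A (m + n) := by
  rcases exists_word_of_mem_coboundaries hg with rfl | ⟨p, H, rfl, hH, hw⟩
  · rw [show cup f.1 (0 : Cochain k A n) = 0 by simpa using cup_smul_right (0 : k) f.1 0]
    exact zero_mem _
  · refine mem_coboundaries_of_word (cochainWord_smul ((cocycleWord f).toIsCochain.cup hH)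
      ((-1 : k) ^ (m * (p + 1)) * (-1) ^ m)) (by omega) fun l => ?_
    rw [wordOf_cup, deltaWord_smul, deltaWord_cupWord (cocycleWord f).toIsCochain,
      funext (cocycleWord f).closed, hw, mul_smul, smul_add ((-1 : k) ^ m), smul_smul ((-1 : k) ^ m),
      sign_sq, one_smul]
    simp only [cupWord, zero_mul, cutSum_zero, smul_zero, zero_add]

/-- The cocycle condition in degree zero, read on a single letter, says that the element is central.
-/
theorem cocycle_zero_comm (f : Cocycles k A 0) (x : A) :
    x * wordOf f.1 [] = wordOf f.1 [] * x := by
  have h := (cocycleWord f).closed [x]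
  rw [deltaWord, barWord_cons (cocycleWord f).multi, barWord_nil ((cocycleWord f).multi.cons x)] at h
  have h1 : ∀ y : A, wordOf f.1 [y] = 0 := fun y => (cocycleWord f).supp _ (by simp)
  simp only [cupWord, cutSum_cons, cutSum_nil, letter_singleton, h1] at h
  simpa [letter, sub_eq_zero, ← sub_eq_add_neg] using h

theorem bracket_mem_coboundaries_left {f : Cochain k A m} (hf : f ∈ coboundaries k A m)
    (g : Cocycles k A n) (hp : p + 1 = m + n) : bracket f g.1 hp ∈ coboundaries k A p := by
  rcases exists_word_of_mem_coboundaries hf with rfl | ⟨q, H, rfl, hH, hw⟩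
  · rw [show bracket (0 : Cochain k A m) g.1 hp = 0 by
      simpa using bracket_smul_left (0 : k) 0 g.1 hp]
    exact zero_mem _
  · rcases p with _ | p
    -- In total degree zero there is no cochain of which the bracket could be the differential. Here
    -- the exact cochain is an inner derivation evaluated at a central element, so the bracket
    -- itself vanishes.
    · obtain rfl : q = 0 := by omega
      obtain rfl : n = 0 := by omega
      rw [show bracket f g.1 hp = 0 from ?_]
      · exact zero_mem _
      · ext a
        rw [← wordOf_ofFn (bracket f g.1 hp), wordOf_bracket, hw, List.ofFn_zero, bracketWord,
          hat_nil, hat_nil, start_nil, start_nil,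
          (cocycleWord g).supp [deltaWord k 0 H []] (by simp), smul_zero,
          sub_zero, deltaWord, barWord_cons hH.multi, barWord_nil (hH.multi.cons _)]
        have h1 : ∀ y : A, H [y] = 0 := fun y => hH.supp _ (by simp)
        simp [cupWord, cutSum_cons, h1, letter, cocycle_zero_comm g]
    · refine mem_coboundaries_of_word (cochainWord_smul
        (hH.bracket (cocycleWord g).toIsCochain (p := p) (by omega)) ((-1 : k) ^ (n + 1))) rfl
        fun l => ?_
      rw [wordOf_bracket, hw, bracketWord_deltaWord hH (cocycleWord g) l (p := p) (by omega),
        deltaWord_smul]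

theorem bracket_mem_coboundaries_right (f : Cocycles k A m) {g : Cochain k A n}
    (hg : g ∈ coboundaries k A n) (hp : p + 1 = m + n) : bracket f.1 g hp ∈ coboundaries k A p := by
  rw [bracket_skew]
  exact neg_mem (Submodule.smul_mem _ _ (bracket_mem_coboundaries_left hg f _))

theorem cohClass_congr {f : Cocycles k A m} {g : Cocycles k A n} (h : m = n)
    (hw : wordOf f.1 = wordOf g.1) : cohClass f = cohClass g := by
  subst h
  rw [show f = g from Subtype.ext (wordOf_injective hw)]

theorem cohClass_add (f g : Cocycles k A n) : cohClass (f + g) = cohClass f + cohClass g :=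
  map_add (totClass (Cocycles k A) (coboundaries k A) n) f g

theorem cohClass_smul (c : k) (f : Cocycles k A n) : cohClass (c • f) = c • cohClass f :=
  map_smul (totClass (Cocycles k A) (coboundaries k A) n) c f

theorem cohClass_eq_zero (f : Cocycles k A n) (h : f.1 ∈ coboundaries k A n) : cohClass f = 0 :=
  (totClass_eq_zero_iff n f).mpr h

theorem cohClass_eq_smul {f : Cocycles k A m} {F : List A → A} (hF : IsCocycle k n F)
    (h : m = n) (c : k) (hw : ∀ l, wordOf f.1 l = c • F l) :
    cohClass f = c • cohClass hF.toCocycle := by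
  subst h
  rw [cohClass_eq, cohClass_eq, ← map_smul]
  refine congrArg _ (Subtype.ext (wordOf_injective (funext fun l => ?_)))
  rw [SetLike.val_smul, wordOf_smul, hF.wordOf_toCocycle, hw]

/-- The insertion of `g` into `f` is a primitive of the graded commutator. In total degree zero
there is no room for one, but there the classes are central elements. -/
theorem cohClass_cup_comm (f : Cocycles k A m) (g : Cocycles k A n) :
    cohClass ⟨cup f.1 g.1, cup_mem_cocycles f g⟩ =
      (-1 : k) ^ (m * n) • cohClass ⟨cup g.1 f.1, cup_mem_cocycles g f⟩ := by
  have hF := cocycleWord f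
  have hG := cocycleWord g
  have h := hF.cup hG
  have h' : IsCocycle k (m + n) (cupWord (wordOf g.1) (wordOf f.1)) := add_comm n m ▸ hG.cup hF
  rw [cohClass_eq_smul h rfl ((-1 : k) ^ (m * n)) fun l => by rw [wordOf_cup],
    cohClass_eq_smul h' (add_comm n m) ((-1 : k) ^ (m * n)) fun l => by rw [wordOf_cup, mul_comm n],
    ← cohClass_smul, ← cohClass_smul, ← cohClass_smul, smul_smul, sign_sq, one_smul,
    cohClass_eq_iff]
  rcases Nat.eq_zero_or_pos (m + n) with h0 | h0
  · obtain rfl : m = 0 := by omega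
    obtain rfl : n = 0 := by omega
    rw [show ((-1 : k) ^ (0 * 0) • h.toCocycle : Cocycles k A _).1 - h'.toCocycle.1 = 0 from
      MultilinearMap.ext fun a => ?_]
    · exact zero_mem _
    · rw [← wordOf_ofFn (_ - _), wordOf_sub, SetLike.val_smul, wordOf_smul, h.wordOf_toCocycle,
        h'.wordOf_toCocycle]
      simp [cupWord, cocycle_zero_comm g]
  · obtain ⟨p, hp⟩ : ∃ p, p + 1 = m + n := ⟨m + n - 1, by omega⟩
    have hc : IsCochain k p (hat ((-1 : k) ^ (n + 1)) (wordOf g.1) (wordOf f.1)) :=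
      ⟨hG.multi.hat _ hF.multi, hat_supp hF.toIsCochain hG.toIsCochain hp⟩
    refine mem_coboundaries_of_word (cochainWord_smul hc ((-1 : k) ^ (n + 1))) hp.symm fun l => ?_
    rw [wordOf_sub, SetLike.val_smul, wordOf_smul, h.wordOf_toCocycle, h'.wordOf_toCocycle,
      deltaWord_smul, deltaWord_hat hF hG l hp, smul_smul, sign_sq, one_smul]

variable (k A) in
theorem exists_cupProduct : ∃ mul : HHCohTot k A →ₗ[k] HHCohTot k A →ₗ[k] HHCohTot k A,
    IsCupProduct mul := by
  obtain ⟨mul, h⟩ := exists_totBilin (Z := Cocycles k A) (B := coboundaries k A)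
    (Z' := Cocycles k A) (B' := coboundaries k A) (T := HHCohTot k A)
    (fun m n => LinearMap.mk₂ k (fun f g => cohClass ⟨cup f.1 g.1, cup_mem_cocycles f g⟩)
      (fun f f' g => by rw [← cohClass_add]; exact congrArg _ (Subtype.ext (cup_add_left _ _ _)))
      (fun c f g => by rw [← cohClass_smul]; exact congrArg _ (Subtype.ext (cup_smul_left _ _ _)))
      (fun f g g' => by rw [← cohClass_add]; exact congrArg _ (Subtype.ext (cup_add_right _ _ _)))
      (fun c f g => by rw [← cohClass_smul]; exact congrArg _ (Subtype.ext (cup_smul_right _ _ _))))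
    (fun m n f g hf => cohClass_eq_zero _ (cup_mem_coboundaries_left hf g))
    (fun m n f g hg => cohClass_eq_zero _ (cup_mem_coboundaries_right f hg))
  exact ⟨mul, fun m n f g => ⟨cup_mem_cocycles f g, h m n f g⟩⟩

variable (k A) in
theorem exists_gerstenhaberBracket :
    ∃ br : HHCohTot k A →ₗ[k] HHCohTot k A →ₗ[k] HHCohTot k A, IsGerstenhaberBracket br := by
  obtain ⟨br, h⟩ := exists_totBilin (Z := Cocycles k A) (B := coboundaries k A)
    (Z' := Cocycles k A) (B' := coboundaries k A) (T := HHCohTot k A)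
    -- With truncated subtraction the condition fails only for `m = n = 0`, where the bracket would
    -- have degree `-1` and is set to zero.
    (fun m n => if hp : m + n - 1 + 1 = m + n then
      LinearMap.mk₂ k (fun f g => cohClass ⟨bracket f.1 g.1 hp, bracket_mem_cocycles f g hp⟩)
      (fun f f' g => by
        rw [← cohClass_add]; exact congrArg _ (Subtype.ext (bracket_add_left _ _ _ _)))
      (fun c f g => by
        rw [← cohClass_smul]; exact congrArg _ (Subtype.ext (bracket_smul_left _ _ _ _)))
      (fun f g g' => by
        rw [← cohClass_add]; exact congrArg _ (Subtype.ext (bracket_add_right _ _ _ _)))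
      (fun c f g => by
        rw [← cohClass_smul]; exact congrArg _ (Subtype.ext (bracket_smul_right _ _ _ _)))
      else 0)
    (fun m n f g hf => by
      split_ifs with hp
      · exact cohClass_eq_zero _ (bracket_mem_coboundaries_left hf g hp)
      · rfl)
    (fun m n f g hg => by
      split_ifs with hp
      · exact cohClass_eq_zero _ (bracket_mem_coboundaries_right f hg hp)
      · rfl)
  refine ⟨br, fun m n p hp f g => ⟨bracket_mem_cocycles f g hp, ?_⟩, fun f g => ?_⟩
  · obtain rfl : p = m + n - 1 := by omega
    refine (h m n f g).trans ?_
    rw [dif_pos hp]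
    rfl
  · refine (h 0 0 f g).trans ?_
    rw [dif_neg (by omega)]
    rfl

end Cohomology

end Total

end

end CalabiYau

namespace CalabiYau

noncomputable section

/-! ### Detecting homology classes by closed functions of cyclic words -/

section Functionals

variable {k : Type*} [Field k] {A : Type*} [Ring A] [Algebra k A]
  {W : Type*} [AddCommGroup W] [Module k W] {φ ψ χ : List A → W} {F G : List A → A} {m n : ℕ}

/-- Functions of cyclic words which vanish on Hochschild boundaries. -/
structure IsClosedWord (k : Type*) [Field k] {A : Type*} [Ring A] [Algebra k A]
    {W : Type*} [AddCommGroup W] [Module k W] (φ : List A → W) : Prop where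
  multi : IsMulti k φ
  closed : ∀ l, hochWord k φ l = 0

theorem IsClosedWord.add (h : IsClosedWord k φ) (h' : IsClosedWord k ψ) :
    IsClosedWord k fun l => φ l + ψ l :=
  ⟨h.multi.fadd h'.multi, fun l => by rw [hochWord_add, h.closed, h'.closed, add_zero]⟩

theorem IsClosedWord.smul (h : IsClosedWord k φ) (c : k) : IsClosedWord k fun l => c • φ l :=
  ⟨h.multi.fsmul c, fun l => by rw [hochWord_smul, h.closed, smul_zero]⟩

theorem IsClosedWord.cap (h : IsClosedWord k φ) (hF : IsCocycle k n F) :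
    IsClosedWord k (capWord F φ) :=
  ⟨hF.multi.cap h.multi, fun l => by
    rw [hF.hoch_cap h.multi, funext h.closed]
    rcases l with _ | ⟨a, w⟩
    · simp [capWord]
    · simp [capWord, cutSum_zero]⟩

theorem IsClosedWord.fullConnes (h : IsClosedWord k φ) : IsClosedWord k (fullConnesWord k φ) :=
  ⟨h.multi.fullConnes, fun l => by
    rw [hochWord_fullConnesWord h.multi, funext h.closed, fullConnesWord]
    rcases l with _ | ⟨a, w⟩
    · simp [rotSum]
    · simp [rotSum, cycWord, cutSum_zero]⟩

/-- Chains are sums of nonempty words, so values at the empty word do not matter; this is why cyclic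
functions may be set to zero there. -/
theorem IsMulti.eval_congr (h : IsMulti k φ) (h' : IsMulti k ψ)
    (he : ∀ a l, φ (a :: l) = ψ (a :: l)) (z : Chain k A n) : h.eval n z = h'.eval n z :=
  eval_ext h' (fun a => by rw [h.eval_tprod, List.ofFn_succ, he]) z

theorem eval_fadd (h : IsMulti k φ) (h' : IsMulti k ψ) (z : Chain k A n) :
    (h.fadd h').eval n z = h.eval n z + h'.eval n z :=
  (eval_ext (f := h.eval n + h'.eval n) (h.fadd h') (fun a => by
    rw [LinearMap.add_apply, h.eval_tprod, h'.eval_tprod]) z).symm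

theorem eval_fsmul (h : IsMulti k φ) (c : k) (z : Chain k A n) :
    (h.fsmul c).eval n z = c • h.eval n z :=
  (eval_ext (f := c • h.eval n) (h.fsmul c) (fun a => by
    rw [LinearMap.smul_apply, h.eval_tprod]) z).symm

theorem eval_eq_zero (h : IsMulti k φ) (he : ∀ a l, l.length = n → φ (a :: l) = 0)
    (z : Chain k A n) : h.eval n z = 0 :=
  (eval_ext (f := 0) h (fun a => by rw [List.ofFn_succ, he _ _ (by simp)]; rfl) z).symm

theorem eval_hoch_cycle (h : IsMulti k φ) (z : Cycles k A n) : h.hoch.eval n z.1 = 0 := by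
  rcases n with _ | n
  · refine eval_eq_zero _ (fun a l hl => ?_) _
    obtain rfl := List.length_eq_zero_iff.mp hl
    exact hochWord_singleton h a
  · rw [← eval_boundary h, show boundary k A n z.1 = 0 from z.2, map_zero]

theorem eval_chainWord_self (z : Chain k A n) :
    (chainWord_isMulti (k := k) (A := A) (n := n)).eval n z = z :=
  (eval_ext (f := LinearMap.id) (chainWord_isMulti (k := k) (A := A) (n := n))
    (fun a => (wordOf_ofFn (pureTensor k A n) a).symm) z).symm

/-- The functional on Hochschild homology given by a closed function of cyclic words. -/
def totEval (h : IsClosedWord k φ) : HHHomTot k A →ₗ[k] W :=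
  totLift (fun n => h.multi.eval n ∘ₗ (Cycles k A n).subtype) fun n z hz => by
    obtain ⟨y, hy⟩ := hz
    change h.multi.eval n z.1 = 0
    rw [← hy, eval_boundary]
    exact eval_eq_zero _ (fun a l _ => h.closed _) _

theorem totEval_homClass (h : IsClosedWord k φ) (z : Cycles k A n) :
    totEval h (homClass z) = h.multi.eval n z.1 := totLift_totClass _ _ n z

theorem hom_ext {f g : HHHomTot k A →ₗ[k] W}
    (h : ∀ n (z : Cycles k A n), f (homClass z) = g (homClass z)) : f = g := totClass_ext h

theorem coh_ext {f g : HHCohTot k A →ₗ[k] W}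
    (h : ∀ n (z : Cocycles k A n), f (cohClass z) = g (cohClass z)) : f = g := totClass_ext h

/-- The differential of `χ` evaluates a boundary when paired with a cycle, hence cohomologous
functions define the same functional. -/
theorem totEval_congr (h : IsClosedWord k φ) (h' : IsClosedWord k ψ) (hχ : IsMulti k χ)
    (he : ∀ a l, φ (a :: l) = ψ (a :: l) + hochWord k χ (a :: l)) (y : HHHomTot k A) :
    totEval h y = totEval h' y := by
  refine LinearMap.congr_fun (hom_ext fun n z => ?_) y
  rw [totEval_homClass, totEval_homClass, h.multi.eval_congr (h'.multi.fadd hχ.hoch) he,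
    eval_fadd h'.multi hχ.hoch, eval_hoch_cycle hχ, add_zero]

theorem totEval_congr' (h : IsClosedWord k φ) (h' : IsClosedWord k ψ)
    (he : ∀ a l, φ (a :: l) = ψ (a :: l)) (y : HHHomTot k A) : totEval h y = totEval h' y := by
  refine totEval_congr h h' IsMulti.zero (fun a l => ?_) y
  rw [hochWord_zero, add_zero, he]

theorem totEval_add (h : IsClosedWord k φ) (h' : IsClosedWord k ψ) (y : HHHomTot k A) :
    totEval (h.add h') y = totEval h y + totEval h' y := by
  refine LinearMap.congr_fun (hom_ext (g := totEval h + totEval h') fun n z => ?_) y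
  rw [LinearMap.add_apply, totEval_homClass, totEval_homClass, totEval_homClass, eval_fadd]

theorem totEval_smul (h : IsClosedWord k φ) (c : k) (y : HHHomTot k A) :
    totEval (h.smul c) y = c • totEval h y := by
  refine LinearMap.congr_fun (hom_ext (g := c • totEval h) fun n z => ?_) y
  rw [LinearMap.smul_apply, totEval_homClass, totEval_homClass, eval_fsmul]

/-- The universal function of cyclic words which vanishes on boundaries of degree `q`. -/
def univWord (k : Type*) [Field k] {A : Type*} [Ring A] [Algebra k A] (q : ℕ) (l : List A) :
    Chain k A q ⧸ LinearMap.range (boundary k A q) :=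
  (LinearMap.range (boundary k A q)).mkQ (chainWord k q l)

theorem univWord_isMulti (q : ℕ) : IsMulti k (univWord k (A := A) q) := chainWord_isMulti.map _

theorem eval_univWord (q : ℕ) (z : Chain k A q) :
    (univWord_isMulti (k := k) (A := A) q).eval q z =
      (LinearMap.range (boundary k A q)).mkQ z :=
  (eval_ext (f := (LinearMap.range (boundary k A q)).mkQ) (univWord_isMulti (k := k) (A := A) q)
    (fun a => congrArg (LinearMap.range (boundary k A q)).mkQ
      (wordOf_ofFn (pureTensor k A q) a).symm) z).symm

theorem eval_univWord_of_ne {q : ℕ} (h : n ≠ q) (z : Chain k A n) :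
    (univWord_isMulti (k := k) (A := A) q).eval n z = 0 := by
  refine eval_eq_zero _ (fun a l hl => ?_) z
  rw [univWord, chainWord, wordOf_supp _ (by simp only [List.length_cons]; omega), map_zero]

theorem univWord_closed (q : ℕ) : IsClosedWord k (univWord k (A := A) q) := by
  refine ⟨univWord_isMulti q, fun l => ?_⟩
  rcases l with _ | ⟨a, _ | ⟨b, l⟩⟩
  · rfl
  · exact hochWord_singleton (univWord_isMulti q) a
  · rw [← eval_chainWord (univWord_isMulti (k := k) (A := A) q).hoch (n := l.length + 1)
      (a :: b :: l) rfl, ← eval_boundary (univWord_isMulti (k := k) (A := A) q)]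
    by_cases h : l.length = q
    · subst h
      rw [eval_univWord]
      exact (Submodule.Quotient.mk_eq_zero _).mpr ⟨_, rfl⟩
    · exact eval_univWord_of_ne (k := k) (A := A) h _

/-- The functionals given by closed functions of cyclic words separate homology classes. -/
theorem eq_zero_of_totEval {y : HHHomTot k A}
    (h : ∀ q, totEval (univWord_closed (k := k) (A := A) q) y = 0) : y = 0 := by
  -- Homology embeds into chains modulo boundaries, and `univWord` is the tautological functional
  -- with values there.
  let ι : ∀ q, HHHom k A q →ₗ[k] Chain k A q ⧸ LinearMap.range (boundary k A q) := fun q =>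
    Subquotient.lift ((LinearMap.range (boundary k A q)).mkQ ∘ₗ (Cycles k A q).subtype)
      fun z hz => (Submodule.Quotient.mk_eq_zero _).mpr hz
  have hι : ∀ q, totEval (univWord_closed (k := k) (A := A) q) =
      ι q ∘ₗ DirectSum.component k ℕ (HHHom k A) q := by
    intro q
    refine hom_ext fun n z => ?_
    rw [totEval_homClass, LinearMap.comp_apply]
    by_cases hn : n = q
    · subst hn
      rw [eval_univWord, show DirectSum.component k ℕ (HHHom k A) n (homClass z) =
        Subquotient.mk z from DirectSum.component.lof_self k n _]
      rfl
    · rw [eval_univWord_of_ne hn, show DirectSum.component k ℕ (HHHom k A) q (homClass z) = 0 from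
        DirectSum.of_eq_of_ne _ _ _ (Ne.symm hn), map_zero]
  refine DFinsupp.ext fun q => ?_
  have h1 := h q
  rw [hι] at h1
  obtain ⟨z, hz⟩ := Subquotient.mkL_surjective _ _ (y q)
  have h2 : ι q (y q) = 0 := h1
  rw [← hz] at h2
  rw [← hz]
  exact (Subquotient.mkL_eq_zero_iff z).mpr ((Submodule.Quotient.mk_eq_zero _).mp h2)

/-- The functionals given by normalized functions of cyclic words separate homology classes. -/
theorem eq_of_totEval {y y' : HHHomTot k A}
    (h : ∀ (q : ℕ) (φ : List A → Chain k A q ⧸ LinearMap.range (boundary k A q))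
      (hφ : IsClosedWord k φ), IsNormal φ → totEval hφ y = totEval hφ y') : y = y' := by
  rw [← sub_eq_zero]
  refine eq_zero_of_totEval fun q => ?_
  obtain ⟨φ, χ, hm, hn, h0, hχ, he⟩ :=
    exists_isNormal (univWord_isMulti (k := k) (A := A) q) (univWord_closed q).closed
  rw [← totEval_congr ⟨hm, h0⟩ (univWord_closed q) hχ he, map_sub, h q φ ⟨hm, h0⟩ hn, sub_self]

/-! ### The Connes operator on homology -/

/-- The identity for transposed operators, applied to the tautological function `chainWord`, becomes
an identity of operators on chains. -/
theorem boundary_connes (n : ℕ) (z : Cycles k A n) : boundary k A n (connes k A n z.1) = 0 := by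
  have hφ := chainWord_isMulti (k := k) (A := A) (n := n)
  have h1 : hφ.hoch.fullConnes.eval n z.1 = (hφ.fullConnes.hoch.fsmul (-1)).eval n z.1 :=
    IsMulti.eval_congr _ _
      (fun a l => by rw [hochWord_fullConnesWord hφ, neg_one_smul, neg_neg]) _
  rw [← eval_chainWord_self (boundary k A n _), eval_boundary hφ, eval_connes hφ.hoch, h1,
    eval_fsmul hφ.fullConnes.hoch, eval_hoch_cycle hφ.fullConnes, smul_zero]

theorem connes_boundary (n : ℕ) (y : Chain k A (n + 1)) :
    connes k A n (boundary k A n y) = - boundary k A (n + 1) (connes k A (n + 1) y) := by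
  have hφ := chainWord_isMulti (k := k) (A := A) (n := n + 1)
  have h1 : hφ.fullConnes.hoch.eval (n + 1) y = (hφ.hoch.fullConnes.fsmul (-1)).eval (n + 1) y :=
    IsMulti.eval_congr _ _
      (fun a l => by rw [hochWord_fullConnesWord hφ, neg_one_smul]) _
  rw [← eval_chainWord_self (connes k A n _), eval_connes hφ, eval_boundary hφ.fullConnes, h1,
    eval_fsmul hφ.hoch.fullConnes, ← eval_connes hφ.hoch, ← eval_boundary hφ, eval_chainWord_self, neg_one_smul]

variable (k A) in
/-- The Connes operator on cycles. -/
def connesCycles (n : ℕ) : Cycles k A n →ₗ[k] Cycles k A (n + 1) :=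
  (connes k A n ∘ₗ (Cycles k A n).subtype).codRestrict _ fun z => boundary_connes n z

variable (k A) in
theorem exists_connesOperator : ∃ B : HHHomTot k A →ₗ[k] HHHomTot k A, IsConnesOperator B := by
  have h0 : ∀ (n : ℕ) (z : Cycles k A n), z.1 ∈ LinearMap.range (boundary k A n) →
      (totClass (Cycles k A) (fun n => LinearMap.range (boundary k A n)) (n + 1) ∘ₗ
        connesCycles k A n) z = 0 := by
    intro n z hz
    obtain ⟨y, hy⟩ := hz
    rw [LinearMap.comp_apply]
    refine (totClass_eq_zero_iff _ _).mpr ⟨- connes k A (n + 1) y, ?_⟩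
    rw [map_neg, ← connes_boundary, hy]
    rfl
  exact ⟨totLift _ h0, fun n z => ⟨boundary_connes n z, totLift_totClass _ h0 n z⟩⟩

theorem totEval_connes {B : HHHomTot k A →ₗ[k] HHHomTot k A} (hB : IsConnesOperator B)
    (h : IsClosedWord k φ) (y : HHHomTot k A) : totEval h (B y) = totEval h.fullConnes y := by
  refine LinearMap.congr_fun (hom_ext (f := totEval h ∘ₗ B) fun n z => ?_) y
  obtain ⟨hz, he⟩ := hB n z
  rw [LinearMap.comp_apply, he, totEval_homClass, totEval_homClass, eval_connes]

end Functionals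

end

end CalabiYau

namespace CalabiYau

noncomputable section

/-! ### Transport of the Connes operator along the duality isomorphism -/

section Transport

variable {k : Type*} [Field k] {A : Type*} [Ring A] [Algebra k A]
  {W : Type*} [AddCommGroup W] [Module k W] {φ ψ χ : List A → W} {F G : List A → A} {m n d : ℕ}
  {c : Cycles k A d} {D : HHHomTot k A ≃ₗ[k] HHCohTot k A} {B : HHHomTot k A →ₗ[k] HHHomTot k A}
  {mul br : HHCohTot k A →ₗ[k] HHCohTot k A →ₗ[k] HHCohTot k A}

theorem coh_induction {P : HHCohTot k A → Prop} (h0 : P 0) (ha : ∀ x y, P x → P y → P (x + y))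
    (hc : ∀ n (f : Cocycles k A n), P (cohClass f)) (x : HHCohTot k A) : P x := by
  induction x using DirectSum.induction_on with
  | zero => exact h0
  | of n y =>
    obtain ⟨z, rfl⟩ := Subquotient.mkL_surjective _ _ y
    exact hc n z
  | add x y hx hy => exact ha x y hx hy

theorem unitWord_isCocycleWord : IsCocycle k 0 (unitWord (A := A)) := by
  refine ⟨⟨unitWord_isMulti, fun l hl => ?_⟩, fun l => ?_⟩
  · rcases l with _ | ⟨a, l⟩
    · simp at hl
    · rfl
  · have h1 : cupWord letter (unitWord (A := A)) l = letter l := by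
      rw [cupWord, cutSum_right_nil fun u a v => by rw [unitWord, mul_zero], unitWord, mul_one]
    have h2 : cupWord (unitWord (A := A)) letter l = letter l := by
      rcases l with _ | ⟨a, l⟩
      · simp [cupWord, letter]
      · simp [cupWord, cutSum_cons, unitWord, cutSum_zero]
    rw [deltaWord, h1, h2, barWord, hat_eq_zero]
    · simp
    · intro l hl
      rcases l with _ | ⟨a, l⟩
      · simp at hl
      · rfl

theorem cupWord_unitWord (l : List A) : cupWord F unitWord l = F l := by
  rw [cupWord, cutSum_right_nil fun u a v => by rw [unitWord, mul_zero], unitWord, mul_one]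

theorem capWord_unitWord (hφ : IsMulti k φ) (a : A) (l : List A) :
    capWord unitWord φ (a :: l) = φ (a :: l) := by
  rcases l with _ | ⟨b, l⟩
  · simp [capWord, unitWord]
  · simp [capWord, cutSum_cons, unitWord, hφ.head_zero, cutSum_zero]

theorem sgn_smul_eq {V : Type*} [AddCommGroup V] [Module k V] {i : ℤ} (h : Even i ↔ Even n)
    (x : V) : sgn i • x = (-1 : k) ^ n • x := by
  rw [sgn_eq_ite]
  by_cases hn : Even n
  · rw [if_pos (h.mpr hn), hn.neg_one_pow, one_smul, one_smul]
  · rw [if_neg fun h' => hn (h.mp h'), (Nat.not_even_iff_odd.mp hn).neg_one_pow, Units.neg_smul,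
      one_smul, neg_one_smul]

variable (hD : IsDualityIso c D)
include hD

theorem totEval_symm_cohClass (h : IsClosedWord k φ) (f : Cocycles k A n) :
    totEval h (D.symm (cohClass f)) =
      (-1 : k) ^ n • ((wordOf_isMulti f.1).cap h.multi).eval d c.1 := by
  rcases le_or_gt n d with hn | hn
  · obtain ⟨hz, he⟩ := hD.2 (d - n) n (Nat.sub_add_cancel hn) f
    rw [he, totEval_homClass, eval_contraction]
  -- Above degree `d` the contraction is not defined. The degree condition on `D` places the
  -- preimage in negative degree, hence it is zero, and the cochain cannot be fed from a chain of
  -- degree `d`.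
  · have h1 := hD.1 n (cohClass f) (totClass_mem n f rfl)
    rcases exists_totClass h1 with h2 | ⟨q, z, hq, _⟩
    · rw [h2, map_zero, eval_eq_zero, smul_zero]
      intro a l hl
      refine cutSum_eq_zero fun u v huv => ?_
      have := congrArg List.length huv
      rw [List.length_append] at this
      rw [wordOf_supp f.1 (by omega), mul_zero, h.multi.head_zero]
    · omega

/-- Duality turns multiplication by `f` into contraction with `f`. Since contractions compose to the
product in the opposite order, graded commutativity of the cup product is needed. -/
theorem totEval_symm_mul (hmul : IsCupProduct mul) (h : IsClosedWord k φ) (f : Cocycles k A m)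
    (x : HHCohTot k A) : totEval h (D.symm (mul (cohClass f) x)) =
      (-1 : k) ^ m • totEval (h.cap (cocycleWord f)) (D.symm x) := by
  refine LinearMap.congr_fun (coh_ext (f := totEval h ∘ₗ D.symm.toLinearMap ∘ₗ mul (cohClass f))
    (g := (-1 : k) ^ m • totEval (h.cap (cocycleWord f)) ∘ₗ D.symm.toLinearMap) fun n g => ?_) x
  obtain ⟨h1, h2⟩ := hmul m n f g
  simp only [LinearMap.comp_apply, LinearMap.smul_apply, LinearEquiv.coe_coe]
  rw [h2, cohClass_cup_comm, map_smul, map_smul, totEval_symm_cohClass hD, totEval_symm_cohClass hD]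
  have hC := ((cocycleWord g).multi.cap ((cocycleWord f).multi.cap h.multi))
  rw [IsMulti.eval_congr _ (hC.fsmul ((-1 : k) ^ (n * m))) fun a l => ?_, eval_fsmul hC]
  · simp only [smul_smul]
    congr 1
    have := sign_sq (k := k) (m * n)
    rw [pow_add, mul_comm n m]
    linear_combination ((-1 : k) ^ m * (-1) ^ n) * this
  · simp only [wordOf_cup]
    rw [capWord_smul_left h.multi, capWord_capWord h.multi]

theorem totEval_symm_conj (hB : IsConnesOperator B) (h : IsClosedWord k φ) (x : HHCohTot k A) :
    totEval h (D.symm ((D.toLinearMap ∘ₗ B ∘ₗ D.symm.toLinearMap) x)) =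
      totEval h.fullConnes (D.symm x) := by
  simp only [LinearMap.comp_apply, LinearEquiv.coe_coe, LinearEquiv.symm_apply_apply]
  exact totEval_connes hB h _

/-- Contraction with the unit does nothing, so the fundamental class corresponds to the unit of
cohomology. -/
theorem symm_unit :
    D.symm (cohClass (unitWord_isCocycleWord (k := k) (A := A)).toCocycle) = homClass c := by
  refine eq_of_totEval fun q φ hφ _ => ?_
  rw [totEval_symm_cohClass hD, pow_zero, one_smul, totEval_homClass]
  refine IsMulti.eval_congr _ _ (fun a l => ?_) _
  rw [IsCocycle.wordOf_toCocycle, capWord_unitWord hφ.multi]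

/-- Multiplication with the bracket is the double commutator with the transported Connes
operator. -/
theorem mul_bracket (hmul : IsCupProduct mul) (hbr : IsGerstenhaberBracket br)
    (hB : IsConnesOperator B) {Δ : HHCohTot k A →ₗ[k] HHCohTot k A}
    (hΔ : Δ = D.toLinearMap ∘ₗ B ∘ₗ D.symm.toLinearMap)
    (f : Cocycles k A m) (g : Cocycles k A n)
    (hf : IsNormalWord (wordOf f.1)) (hg : IsNormalWord (wordOf g.1)) (z : HHCohTot k A) :
    mul (br (cohClass f) (cohClass g)) z = - mul (cohClass f) (Δ (mul (cohClass g) z)) +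
      (-1 : k) ^ m • Δ (mul (cohClass f) (mul (cohClass g) z)) +
      (-1 : k) ^ ((m + 1) * n) • mul (cohClass g) (mul (cohClass f) (Δ z)) +
      (-1 : k) ^ ((m + 1) * (n + 1)) • mul (cohClass g) (Δ (mul (cohClass f) z)) := by
  refine D.symm.injective (eq_of_totEval fun q φ hφ hn => ?_)
  have hF := cocycleWord f
  have hG := cocycleWord g
  have e1 : totEval hφ (D.symm (mul (cohClass f) (Δ (mul (cohClass g) z)))) =
      (-1 : k) ^ m • (-1 : k) ^ n • totEval ((hφ.cap hF).fullConnes.cap hG) (D.symm z) := by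
    rw [totEval_symm_mul hD hmul, hΔ, totEval_symm_conj hD hB, totEval_symm_mul hD hmul]
  have e2 : totEval hφ (D.symm (Δ (mul (cohClass f) (mul (cohClass g) z)))) =
      (-1 : k) ^ m • (-1 : k) ^ n • totEval ((hφ.fullConnes.cap hF).cap hG) (D.symm z) := by
    rw [hΔ, totEval_symm_conj hD hB, totEval_symm_mul hD hmul, totEval_symm_mul hD hmul]
  have e3 : totEval hφ (D.symm (mul (cohClass g) (mul (cohClass f) (Δ z)))) =
      (-1 : k) ^ n • (-1 : k) ^ m • totEval ((hφ.cap hG).cap hF).fullConnes (D.symm z) := by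
    rw [totEval_symm_mul hD hmul, totEval_symm_mul hD hmul, hΔ, totEval_symm_conj hD hB]
  have e4 : totEval hφ (D.symm (mul (cohClass g) (Δ (mul (cohClass f) z)))) =
      (-1 : k) ^ n • (-1 : k) ^ m • totEval ((hφ.cap hG).fullConnes.cap hF) (D.symm z) := by
    rw [totEval_symm_mul hD hmul, hΔ, totEval_symm_conj hD hB, totEval_symm_mul hD hmul]
  obtain ⟨χ, hχ, he⟩ := capWord_bracketWord hF hG hf hg hφ.multi hn hφ.closed
  have c1 := (hφ.cap hF).fullConnes.cap hG
  have c2 := ((hφ.fullConnes.cap hF).cap hG).smul ((-1 : k) ^ (m + 1))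
  have c3 := ((hφ.cap hG).cap hF).fullConnes.smul (-(-1 : k) ^ ((m + 1) * n))
  have c4 := ((hφ.cap hG).fullConnes.cap hF).smul (-(-1 : k) ^ ((m + 1) * (n + 1)))
  have he' : ∀ a l, capWord (bracketWord k m n (wordOf f.1) (wordOf g.1)) φ (a :: l) = _ :=
    fun a l => (he (a :: l)).trans (congrArg (· + hochWord k χ (a :: l))
      (show _ = capWord (wordOf g.1) (fullConnesWord k (capWord (wordOf f.1) φ)) (a :: l) +
        (-1 : k) ^ (m + 1) • capWord (wordOf g.1) (capWord (wordOf f.1) (fullConnesWord k φ)) (a :: l) +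
        (-(-1 : k) ^ ((m + 1) * n)) •
          fullConnesWord k (capWord (wordOf f.1) (capWord (wordOf g.1) φ)) (a :: l) +
        (-(-1 : k) ^ ((m + 1) * (n + 1))) •
          capWord (wordOf f.1) (fullConnesWord k (capWord (wordOf g.1) φ)) (a :: l) by module))
  have hT : totEval (((c1.add c2).add c3).add c4) (D.symm z) =
      totEval c1 (D.symm z) +
      (-1 : k) ^ (m + 1) • totEval ((hφ.fullConnes.cap hF).cap hG) (D.symm z) +
      (-(-1 : k) ^ ((m + 1) * n)) • totEval ((hφ.cap hG).cap hF).fullConnes (D.symm z) +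
      (-(-1 : k) ^ ((m + 1) * (n + 1))) •
        totEval ((hφ.cap hG).fullConnes.cap hF) (D.symm z) := by
    rw [totEval_add ((c1.add c2).add c3) c4, totEval_add (c1.add c2) c3, totEval_add c1 c2,
      totEval_smul, totEval_smul, totEval_smul]
  -- The sign is the one of contracting with a cochain of degree `p = m + n - 1`.
  have e0 : totEval hφ (D.symm (mul (br (cohClass f) (cohClass g)) z)) =
      -((-1 : k) ^ m * (-1 : k) ^ n) • totEval (((c1.add c2).add c3).add c4) (D.symm z) := by
    rcases Nat.eq_zero_or_pos (m + n) with h0 | h0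
    -- For two classes of degree zero the bracket is zero by convention. The word bracket vanishes
    -- as well, since a cochain without arguments admits no insertion, so the combination on the
    -- right is exact.
    · obtain rfl : m = 0 := by omega
      obtain rfl : n = 0 := by omega
      have h1 : ∀ {F G : List A → A} {e : k}, (∀ l, l.length ≠ 0 → F l = 0) → ∀ l,
          hat e G F l = 0 := fun h l =>
        hat_eq_zero (fun l hl => h l (by rwa [Ne, List.length_eq_zero_iff])) l
      have h2 : totEval (hφ.smul 0) (D.symm z) =
          totEval (((c1.add c2).add c3).add c4) (D.symm z) := by
        refine totEval_congr (hφ.smul 0) _ hχ (fun a l => ?_) _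
        rw [← he', zero_smul]
        refine (cutSum_eq_zero fun u v _ => ?_).symm
        rw [bracketWord, h1 hF.supp, h1 hG.supp, smul_zero, sub_zero, mul_zero, hφ.multi.head_zero]
      rw [hbr.2, map_zero, LinearMap.zero_apply, map_zero, map_zero, ← h2, totEval_smul hφ,
        zero_smul, smul_zero]
    · obtain ⟨p, hp⟩ : ∃ p, p + 1 = m + n := ⟨m + n - 1, by omega⟩
      obtain ⟨h1, h2⟩ := hbr.1 m n p hp f g
      have h3 : totEval (hφ.cap (cocycleWord ⟨_, h1⟩)) (D.symm z) =
          totEval (((c1.add c2).add c3).add c4) (D.symm z) := by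
        refine totEval_congr _ _ hχ (fun a l => ?_) _
        rw [← he']
        simp only [wordOf_bracket]
      have h4 : (-1 : k) ^ p = -((-1) ^ m * (-1) ^ n) := by
        rw [← pow_add, ← hp, pow_succ, mul_neg_one, neg_neg]
      rw [h2, totEval_symm_mul hD hmul, h3, h4]
  simp only [map_add, map_neg, map_smul, e0, e1, e2, e3, e4, hT]
  rw [pow_succ (-1 : k) m]
  module

/-- The hypothesis `hBc` says `Δ 1 = 0`. The hypothesis `surj` supplies the degree of the image
under `D` of a homology class, which `IsDualityIso` controls only for the inverse of `D`. -/
theorem exists_isBVAlgebra (hB : IsConnesOperator B) (hBc : B (homClass c) = 0)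
    (surj : ∀ m (z : Cycles k A m), homClass z = 0 ∨
      ∃ n, ∃ _ : m + n = d, ∃ f : Cocycles k A n, D.symm (cohClass f) = homClass z) :
    ∃ mul br, IsCupProduct mul ∧ IsGerstenhaberBracket br ∧
      IsBVAlgebra (HHCohTot.deg k A) mul br (D.toLinearMap ∘ₗ B ∘ₗ D.symm.toLinearMap) := by
  obtain ⟨mul, hmul⟩ := exists_cupProduct k A
  obtain ⟨br, hbr⟩ := exists_gerstenhaberBracket k A
  refine ⟨mul, br, hmul, hbr, isBVAlgebra_of_commutator
    (cohClass (unitWord_isCocycleWord (k := k) (A := A)).toCocycle) tot_isInternal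
    ?_ ?_ ?_ ?_ ?_ ?_ ?_ ?_ ?_⟩
  · intro i j x hx y hy
    rcases exists_totClass hx with rfl | ⟨m, f, rfl, rfl⟩
    · simp
    rcases exists_totClass hy with rfl | ⟨n, g, rfl, rfl⟩
    · simp
    obtain ⟨h1, h2⟩ := hmul m n f g
    exact h2 ▸ totClass_mem _ _ (by push_cast; rfl)
  · intro i j x hx y hy
    rcases exists_totClass hx with rfl | ⟨m, f, rfl, rfl⟩
    · simp
    rcases exists_totClass hy with rfl | ⟨n, g, rfl, rfl⟩
    · simp
    rcases Nat.eq_zero_or_pos (m + n) with h0 | h0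
    · obtain rfl : m = 0 := by omega
      obtain rfl : n = 0 := by omega
      have h1 := hbr.2 f g
      exact h1 ▸ zero_mem _
    · obtain ⟨h1, h2⟩ := hbr.1 m n (m + n - 1) (by omega) f g
      exact h2 ▸ totClass_mem _ _ (by omega)
  · intro x y z
    induction x using coh_induction with
    | h0 => simp
    | ha x x' hx hx' => simp only [map_add, LinearMap.add_apply, hx, hx']
    | hc m f =>
      induction y using coh_induction with
      | h0 => simp
      | ha y y' hy hy' => simp only [map_add, LinearMap.add_apply, hy, hy']
      | hc n g =>
        induction z using coh_induction with
        | h0 => simp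
        | ha z z' hz hz' => simp only [map_add, hz, hz']
        | hc p h =>
          obtain ⟨h1, h2⟩ := hmul m n f g
          obtain ⟨h3, h4⟩ := hmul n p g h
          obtain ⟨h5, h6⟩ := hmul (m + n) p ⟨_, h1⟩ h
          obtain ⟨h7, h8⟩ := hmul m (n + p) f ⟨_, h3⟩
          rw [h2, h4, h6, h8]
          refine cohClass_congr (add_assoc m n p) (funext fun l => ?_)
          simp only [wordOf_cup, cupWord_smul_left, cupWord_smul_right, cupWord_assoc, smul_smul,
            ← pow_add]
          congr 2
          ring
  · intro i j x hx y hy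
    rcases exists_totClass hx with rfl | ⟨m, f, rfl, rfl⟩
    · simp
    rcases exists_totClass hy with rfl | ⟨n, g, rfl, rfl⟩
    · simp
    obtain ⟨h1, h2⟩ := hmul m n f g
    obtain ⟨h3, h4⟩ := hmul n m g f
    rw [← cohClass_eq, ← cohClass_eq, h2, h4, cohClass_cup_comm, sgn_smul_eq (k := k) (n := m * n)]
    rw [← Nat.cast_mul, Int.even_coe_nat]
  · intro x
    induction x using coh_induction with
    | h0 => simp
    | ha x x' hx hx' => simp only [map_add, LinearMap.add_apply, hx, hx']
    | hc m f =>
      obtain ⟨h1, h2⟩ := hmul m 0 f (unitWord_isCocycleWord (k := k) (A := A)).toCocycle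
      rw [h2]
      refine cohClass_congr (add_zero m) (funext fun l => ?_)
      simp only [wordOf_cup, IsCocycle.wordOf_toCocycle, mul_zero, pow_zero, one_smul,
        cupWord_unitWord]
  · rw [LinearMap.comp_apply, LinearMap.comp_apply, LinearEquiv.coe_coe, LinearEquiv.coe_coe,
      symm_unit hD, hBc, map_zero]
  · intro i x hx
    have h1 := hD.1 i x hx
    rcases exists_totClass h1 with h2 | ⟨q, z, hq, h2⟩
    · rw [LinearMap.comp_apply, LinearMap.comp_apply, LinearEquiv.coe_coe, LinearEquiv.coe_coe, h2]
      simp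
    · rw [LinearMap.comp_apply, LinearMap.comp_apply, LinearEquiv.coe_coe, LinearEquiv.coe_coe, h2,
        ← homClass_eq]
      obtain ⟨h3, h4⟩ := hB q z
      rw [h4]
      -- The cycle has degree `d - i + 1` here, so a preimage of complementary degree has degree `i
      -- - 1`.
      rcases surj _ ⟨_, h3⟩ with h5 | ⟨n, hn, f, h5⟩
      · rw [h5, map_zero]; exact zero_mem _
      · rw [← h5, LinearEquiv.apply_symm_apply]
        exact totClass_mem _ _ (by omega)
  · intro x
    refine D.symm.injective (eq_of_totEval fun q φ hφ hn => ?_)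
    -- Normalized functions suffice to detect homology classes, and on them the Connes operator has
    -- square zero at chain level.
    have h1 : totEval hφ.fullConnes.fullConnes (D.symm x) = totEval (hφ.smul 0) (D.symm x) :=
      totEval_congr' _ _ (fun a l => by rw [hn.fullConnes_fullConnes hφ.multi, zero_smul]) _
    rw [totEval_symm_conj hD hB, totEval_symm_conj hD hB, map_zero, map_zero, h1,
      totEval_smul hφ, zero_smul]
  · intro i j x hx y hy z
    rcases exists_totClass hx with rfl | ⟨m, f, rfl, rfl⟩
    · simp
    rcases exists_totClass hy with rfl | ⟨n, g, rfl, rfl⟩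
    · simp
    -- The Cartan homotopy was constructed for normalized cocycles, so representatives are
    -- normalized first.
    obtain ⟨f', hf, hfn⟩ := exists_normal_cocycle f
    obtain ⟨g', hg, hgn⟩ := exists_normal_cocycle g
    rw [← cohClass_eq, ← cohClass_eq, ← hf, ← hg, mul_bracket hD hmul hbr hB rfl f' g' hfn hgn z,
      sgn_smul_eq (k := k) (n := m), sgn_smul_eq (k := k) (n := (m + 1) * n),
      sgn_smul_eq (k := k) (n := (m + 1) * (n + 1))]
    · simp only [Int.even_mul, Int.even_sub_one, Nat.even_mul, Nat.even_add_one, Int.even_coe_nat]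
    · simp only [Int.even_mul, Int.even_sub_one, Nat.even_mul, Nat.even_add_one, Int.even_coe_nat]
    · rw [Int.even_coe_nat]

end Transport

end

end CalabiYau

namespace CalabiYau

noncomputable section

/-! ### Cyclic pairings and their Leibniz rule -/

section CyclicPairing

variable {k : Type*} [Field k] {A : Type*} [Ring A] [Algebra k A]
  {M : Type*} [AddCommGroup M] [Module k M] [Module (Env k A) M] [IsScalarTower k (Env k A) M]
  {N : Type*} [AddCommGroup N] [Module k N] [Module (Env k A) N] [IsScalarTower k (Env k A) N]
  {W : Type*} [AddCommGroup W] [Module k W] {W' : Type*} [AddCommGroup W'] [Module k W']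
  {β : A →ₗ[k] M →ₗ[k] N →ₗ[k] W} {g : List A → M} {θ : List A → N} {n d : ℕ}

/-- Trilinear maps which are balanced as functions on the cyclic tensor product. -/
structure IsCyclicPairing (β : A →ₗ[k] M →ₗ[k] N →ₗ[k] W) : Prop where
  mul_right : ∀ (a x : A) (m : M) (n : N), β (a * x) m n = β a (leftAct k x • m) n
  mul_left : ∀ (a y : A) (m : M) (n : N), β (y * a) m n = β a m (rightAct k y • n)
  middle : ∀ (a y : A) (m : M) (n : N), β a (rightAct k y • m) n = β a m (leftAct k y • n)

/-- The pairing of two functions of words, as a function of cyclic words. -/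
def capPair (β : A →ₗ[k] M →ₗ[k] N →ₗ[k] W) (g : List A → M) (θ : List A → N) : List A → W
  | [] => 0
  | a :: w => cutSum (fun u v => β a (g u) (θ v)) w

theorem IsMulti.capPair (hg : IsMulti k g) (hθ : IsMulti k θ) : IsMulti k (capPair β g θ) :=
  IsMulti.of_cons (fun a => IsMulti.cutSum (fun v => hg.map ((β a).flip (θ v)))
    fun u => hθ.map (β a (g u)))
    (fun a b w => by simp only [CalabiYau.capPair, map_add, LinearMap.add_apply, cutSum_add])
    fun c a w => by simp only [CalabiYau.capPair, map_smul, LinearMap.smul_apply, cutSum_smul]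

/-- The Leibniz rule for the pairing of functions of words. -/
theorem hochWord_capPair (hβ : IsCyclicPairing β) (hn : ∀ l, l.length ≠ n → g l = 0)
    (l : List A) : hochWord k (capPair β g θ) l = capPair β (bimodDelta k g) θ l +
      (-1 : k) ^ n • capPair β g (bimodDelta k θ) l := by
  rcases l with _ | ⟨a, w⟩
  · simp [hochWord, capPair]
  have e1 : ∀ (Φ : List A → List A → M) u v, β a (cutSum Φ u) (θ v) =
      cutSum (fun x y => β a (Φ x y) (θ v)) u := fun Φ u v =>
    (cutSum_map ((β a).flip (θ v)).toAddMonoidHom Φ u).symm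
  have e2 : ∀ (Φ : List A → List A → N) u v, β a (g u) (cutSum Φ v) =
      cutSum (fun x y => β a (g u) (Φ x y)) v := fun Φ u v =>
    (cutSum_map (β a (g u)).toAddMonoidHom Φ v).symm
  have h1 : cutSum (fun x r => capPair β g θ (a * letter x :: r)) w =
      cutSum (fun u v => β a (cutSum (fun x y => leftAct k (letter x) • g y) u) (θ v)) w := by
    simp only [capPair, e1, ← hβ.mul_right]
    exact (cutSum_assoc (fun x y v => β (a * letter x) (g y) (θ v)) w).symm
  have h2 : barWord k (fun l => capPair β g θ (a :: l)) w =
      cutSum (fun u v => β a (barWord k g u) (θ v)) w +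
      (-1 : k) ^ n • cutSum (fun u v => β a (g u) (barWord k θ v)) w := by
    change hat (-1 : k) mulWord (cutSum fun u v => β a (g u) (θ v)) w = _
    rw [hat_cutSum, cutSum_add, ← cutSum_smul]
    congr 1
    · exact cutSum_congr fun u v _ => hat_map (-1 : k) ((β a).flip (θ v)) u
    · refine cutSum_congr fun u v _ => ?_
      by_cases hu : u.length = n
      · rw [hu]; exact congrArg _ (hat_map (-1 : k) (β a (g u)) v)
      · simp only [hn u hu, map_zero, LinearMap.zero_apply, hat_zero, smul_zero]
  have h3 : cutSum (fun r y => (-1 : k) ^ (r.length + 1) • capPair β g θ (letter y * a :: r)) w =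
      (-1 : k) ^ n • cutSum (fun u v => β a (g u) (cutSum (fun x y =>
        (-1 : k) ^ (x.length + 1) • rightAct k (letter y) • θ x) v)) w := by
    simp only [e2, map_smul, ← hβ.mul_left]
    rw [← cutSum_assoc (fun u x y => (-1 : k) ^ (x.length + 1) • β (letter y * a) (g u) (θ x)),
      ← cutSum_smul]
    refine cutSum_congr fun r y _ => ?_
    rw [capPair, ← cutSum_smul, ← cutSum_smul]
    refine cutSum_congr fun u x hu => ?_
    rw [smul_smul]
    by_cases h : u.length = n
    · rw [← h, ← hu, List.length_append, pow_succ, pow_add]; congr 1; ring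
    · simp only [hn u h, map_zero, LinearMap.zero_apply, smul_zero]
  have h4 : cutSum (fun u v => β a (cutSum (fun x y =>
        (-1 : k) ^ (x.length + 1) • rightAct k (letter y) • g x) u) (θ v)) w =
      (-1 : k) ^ (n + 1) • cutSum (fun u v => β a (g u)
        (cutSum (fun x y => leftAct k (letter x) • θ y) v)) w := by
    simp only [e1, e2, map_smul, LinearMap.smul_apply, hβ.middle]
    rw [cutSum_assoc (fun x y v => (-1 : k) ^ (x.length + 1) • β a (g x) (leftAct k (letter y) • θ v)),
      ← cutSum_smul]
    refine cutSum_congr fun u v _ => ?_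
    rw [← cutSum_smul]
    refine cutSum_congr fun x y _ => ?_
    by_cases h : u.length = n
    · rw [h]
    · simp only [hn u h, map_zero, LinearMap.zero_apply, smul_zero]
  rw [hochWord, h1, h2, h3]
  simp only [capPair, bimodDelta, map_add, map_sub, LinearMap.add_apply, LinearMap.sub_apply,
    cutSum_add, cutSum_sub, h4]
  rw [pow_succ (-1 : k) n]
  module

/-- The anti-involution of the enveloping algebra as a linear map. -/
def conjLin (k : Type*) [Field k] (A : Type*) [Ring A] [Algebra k A] : Env k A →ₗ[k] Env k A :=
  (MulOpposite.opLinearEquiv k).symm.toLinearMap ∘ₗ (flipHom k A).toLinearMap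

theorem conjLin_apply (r : Env k A) : conjLin k A r = (flip k A).conj r := rfl

variable (k A N) in
/-- The cyclic pairing `a, r, x ↦ τ(r) • x • a`. -/
def rightPair : A →ₗ[k] Env k A →ₗ[k] N →ₗ[k] N :=
  (((LinearMap.mul k (Env k A)).flip ∘ₗ rightAct k).compl₂ (conjLin k A)).compr₂
    (Algebra.lsmul k k N).toLinearMap

theorem rightPair_apply (a : A) (r : Env k A) (x : N) :
    rightPair k A N a r x = (flip k A).conj r • rightAct k a • x := (smul_smul _ _ _).symm

variable (k A N) in
/-- The cyclic pairing `a, x, r ↦ τ(r) • a • x`. -/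
def leftPair : A →ₗ[k] N →ₗ[k] Env k A →ₗ[k] N :=
  LinearMap.lflip.toLinearMap ∘ₗ (((LinearMap.mul k (Env k A)).flip ∘ₗ leftAct k).compl₂ (conjLin k A)).compr₂
    (Algebra.lsmul k k N).toLinearMap

theorem leftPair_apply (a : A) (r : Env k A) (x : N) :
    leftPair k A N a x r = (flip k A).conj r • leftAct k a • x := (smul_smul _ _ _).symm

theorem rightPair_isCyclic : IsCyclicPairing (rightPair k A N) where
  mul_right a x m n := by
    rw [rightPair_apply, rightPair_apply, smul_eq_mul, AntiInvolution.conj_mul, conj_leftAct,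
      rightAct_mul, mul_smul, mul_smul]
  mul_left a y m n := by rw [rightPair_apply, rightPair_apply, rightAct_mul, mul_smul]
  middle a y m n := by
    rw [rightPair_apply, rightPair_apply, smul_eq_mul, AntiInvolution.conj_mul, conj_rightAct,
      mul_smul, smul_smul (leftAct k y), ← rightAct_mul_leftAct, mul_smul]

theorem leftPair_isCyclic : IsCyclicPairing (leftPair k A N) where
  mul_right a x m n := by rw [leftPair_apply, leftPair_apply, leftAct_mul, mul_smul]
  mul_left a y m n := by
    rw [leftPair_apply, leftPair_apply, smul_eq_mul, AntiInvolution.conj_mul, conj_rightAct,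
      leftAct_mul, mul_smul, mul_smul]
  middle a y m n := by
    rw [leftPair_apply, leftPair_apply, smul_eq_mul, AntiInvolution.conj_mul, conj_leftAct,
      mul_smul, smul_smul (rightAct k y), rightAct_mul_leftAct, mul_smul]

/-- The value at a chain of a linear family of functions of cyclic words. -/
def evalHom (Φ : M → List A → N) (hΦ : ∀ x, IsMulti k (Φ x))
    (hadd : ∀ x y l, Φ (x + y) l = Φ x l + Φ y l)
    (hsmul : ∀ (r : Env k A) x l, Φ (r • x) l = r • Φ x l) (c : Chain k A d) :
    M →ₗ[Env k A] N where
  toFun x := (hΦ x).eval d c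
  map_add' x y := by
    rw [← eval_fadd]
    exact IsMulti.eval_congr _ _ (fun a l => hadd x y _) c
  map_smul' r x := (eval_ext (f := Algebra.lsmul k k N r ∘ₗ (hΦ x).eval d) (hΦ (r • x))
    (fun a => by
      rw [LinearMap.comp_apply, IsMulti.eval_tprod, hsmul]
      rfl) c).symm

theorem IsMulti.eval_congr_length {φ ψ : List A → W} (h : IsMulti k φ) (h' : IsMulti k ψ)
    (he : ∀ a l, l.length = d → φ (a :: l) = ψ (a :: l)) (c : Chain k A d) :
    h.eval d c = h'.eval d c :=
  eval_ext h' (fun a => by rw [h.eval_tprod, List.ofFn_succ, he _ _ (by simp)]) c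

theorem eval_map {φ : List A → W} (h : IsMulti k φ) (f : W →ₗ[k] W') (c : Chain k A d) :
    f (h.eval d c) = (h.map f).eval d c :=
  eval_ext (f := f ∘ₗ h.eval d) (h.map f) (fun a => by rw [LinearMap.comp_apply, h.eval_tprod]) c

end CyclicPairing

section Unit

attribute [local instance] TensorProduct.Algebra.module

variable {k : Type*} [Field k] {A : Type*} [Ring A] [Algebra k A]

/-- The left and the right action of a single letter on `1` agree and cancel: the unit is a cocycle,
namely the augmentation of the bar resolution. -/
theorem bimodDelta_unitWord (l : List A) : bimodDelta k (unitWord (A := A)) l = 0 := by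
  have h1 : cutSum (fun u v => leftAct k (letter u) • unitWord (A := A) v) l = letter l := by
    rw [cutSum_right_nil fun u a v => by rw [unitWord, smul_zero], unitWord, leftAct_smul, mul_one]
  have h2 : cutSum (fun u v => (-1 : k) ^ (u.length + 1) • rightAct k (letter v) •
      unitWord (A := A) u) l = - letter l := by
    rcases l with _ | ⟨a, l⟩
    · simp [unitWord, rightAct_smul, letter]
    · rw [cutSum_cons, cutSum_eq_zero fun u v _ => by rw [unitWord, smul_zero, smul_zero]]
      simp [unitWord, rightAct_smul]
  rw [bimodDelta, h1, h2, barWord, hat_eq_zero, sub_zero, add_neg_cancel]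
  intro l hl
  rcases l with _ | ⟨a, l⟩
  · simp at hl
  · rfl

/-- The function `a :: l ↦ τ(g l) • a` of cyclic words. -/
def twistWord (g : List A → Env k A) : List A → A := capPair (rightPair k A A) g unitWord

theorem twistWord_cons (g : List A → Env k A) (a : A) (l : List A) :
    twistWord g (a :: l) = (flip k A).conj (g l) • a := by
  rw [twistWord, capPair, cutSum_right_nil]
  · rw [rightPair_apply, rightAct_smul, unitWord, one_mul]
  · intro u b v
    rw [unitWord, map_zero]

theorem IsMulti.twist {g : List A → Env k A} (hg : IsMulti k g) : IsMulti k (twistWord g) :=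
  hg.capPair unitWord_isMulti

end Unit

section UnitHoch

variable {k : Type*} [Field k] {A : Type*} [Ring A] [Algebra k A] {n : ℕ}

theorem hochWord_twistWord {g : List A → Env k A}
    (hn : ∀ l, l.length ≠ n → g l = 0) (l : List A) :
    hochWord k (twistWord g) l = twistWord (bimodDelta k g) l := by
  let _ := TensorProduct.Algebra.module (R := k) (A := A) (B := Aᵐᵒᵖ) (M := A)
  rw [twistWord, hochWord_capPair rightPair_isCyclic hn,
    funext (bimodDelta_unitWord (k := k) (A := A))]
  rcases l with _ | ⟨a, w⟩
  · simp [capPair, twistWord]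
  · simp [capPair, twistWord, cutSum_zero]

end UnitHoch

end

end CalabiYau

namespace CalabiYau

noncomputable section

/-! ### Contracting a pairing on the bar resolution with a cycle -/

section BarPairing

/-- A sesquilinear pairing of the bar resolution with itself which is compatible with the
differentials, that is, a morphism from the bar resolution to its `d`-shifted dual. -/
structure BarPairing (k : Type*) [Field k] (A : Type*) [Ring A] [Algebra k A] (d : ℕ) where
  left : ∀ m n, Bar k A m → Bar k A n →ₗ[Env k A] Env k A
  right : ∀ m n, Bar k A n → Bar k A m →ₗ[Env k A] Env k A
  conj_left : ∀ m n x y, (flip k A).conj (left m n x y) = right m n y x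
  comm : ∀ m n x y, m + n + 1 = d →
    left m (n + 1) (barD k A m x) y = (-1 : k) ^ m • left (m + 1) n x (barD k A n y)
  left_zero : ∀ x y, left d 0 (barD k A d x) y = 0
  right_zero : ∀ x y, left 0 d x (barD k A d y) = 0

variable {k : Type*} [Field k] {A : Type*} [Ring A] [Algebra k A] {d m n : ℕ}
  (L : BarPairing k A d)

namespace BarPairing

theorem conj_right (x : Bar k A m) (y : Bar k A n) :
    (flip k A).conj (L.right m n y x) = L.left m n x y := by
  rw [← L.conj_left, AntiInvolution.conj_conj]

theorem right_add (x : Bar k A m) (y y' : Bar k A n) :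
    L.right m n (y + y') x = L.right m n y x + L.right m n y' x := by
  rw [← L.conj_left, map_add, AntiInvolution.conj_add, L.conj_left, L.conj_left]

theorem left_add (x x' : Bar k A m) (y : Bar k A n) :
    L.left m n (x + x') y = L.left m n x y + L.left m n x' y := by
  rw [← L.conj_right, map_add, AntiInvolution.conj_add, L.conj_right, L.conj_right]

theorem left_smul (r : Env k A) (x : Bar k A m) (y : Bar k A n) :
    L.left m n (r • x) y = L.left m n x y * (flip k A).conj r := by
  rw [← L.conj_right, map_smul, smul_eq_mul, AntiInvolution.conj_mul, L.conj_right]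

theorem right_smul (r : Env k A) (x : Bar k A m) (y : Bar k A n) :
    L.right m n (r • y) x = L.right m n y x * (flip k A).conj r := by
  rw [← L.conj_left, map_smul, smul_eq_mul, AntiInvolution.conj_mul, L.conj_left]

theorem left_isMulti (x : Bar k A m) : IsMulti k fun l => L.left m n x (barGen k n l) :=
  map_isMulti barGen_isMulti _

theorem right_isMulti (y : Bar k A n) : IsMulti k fun l => L.right m n y (barGen k m l) :=
  map_isMulti barGen_isMulti _

theorem left_supp (x : Bar k A m) (l : List A) (h : l.length ≠ n) :
    L.left m n x (barGen k n l) = 0 := by rw [barGen_supp h, map_zero]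

theorem right_supp (y : Bar k A n) (l : List A) (h : l.length ≠ m) :
    L.right m n y (barGen k m l) = 0 := by rw [barGen_supp h, map_zero]

/-- The contraction of a chain `c` with the pairing, as an endomorphism of the bar resolution. -/
def capLeft (c : Chain k A d) (m n : ℕ) : Bar k A m →ₗ[Env k A] Bar k A m :=
  evalHom (fun x => capPair (rightPair k A (Bar k A m)) (fun l => L.left m n x (barGen k n l))
    (barGen k m)) (fun x => (L.left_isMulti x).capPair barGen_isMulti)
    (fun x y l => by
      rcases l with _ | ⟨a, w⟩
      · exact (add_zero 0).symm
      · simp only [capPair, L.left_add, map_add, LinearMap.add_apply, cutSum_add])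
    (fun r x l => by
      rcases l with _ | ⟨a, w⟩
      · exact (smul_zero r).symm
      · refine Eq.trans (cutSum_congr fun u v _ => ?_)
          (cutSum_map (Algebra.lsmul k k (Bar k A m) r).toAddMonoidHom _ w)
        change _ = Algebra.lsmul k k (Bar k A m) r _
        rw [Algebra.lsmul_coe, rightPair_apply, rightPair_apply]
        beta_reduce
        rw [L.left_smul, AntiInvolution.conj_mul, AntiInvolution.conj_conj, mul_smul])
    c

theorem capLeft_apply (c : Chain k A d) (x : Bar k A m) : L.capLeft c m n x =
    ((L.left_isMulti (n := n) x).capPair (β := rightPair k A (Bar k A m))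
      (barGen_isMulti (k := k) (n := m))).eval d c := rfl

/-- The contraction of a chain `c` with the transposed pairing, as an endomorphism of the bar
resolution. -/
def capRight (c : Chain k A d) (m n : ℕ) : Bar k A n →ₗ[Env k A] Bar k A n :=
  evalHom (fun y => capPair (leftPair k A (Bar k A n)) (barGen k n)
    (fun l => L.right m n y (barGen k m l)))
    (fun y => barGen_isMulti.capPair (L.right_isMulti y))
    (fun x y l => by
      rcases l with _ | ⟨a, w⟩
      · exact (add_zero 0).symm
      · simp only [capPair, L.right_add, map_add, cutSum_add])
    (fun r x l => by
      rcases l with _ | ⟨a, w⟩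
      · exact (smul_zero r).symm
      · refine Eq.trans (cutSum_congr fun u v _ => ?_)
          (cutSum_map (Algebra.lsmul k k (Bar k A n) r).toAddMonoidHom _ w)
        change _ = Algebra.lsmul k k (Bar k A n) r _
        rw [Algebra.lsmul_coe, leftPair_apply, leftPair_apply]
        beta_reduce
        rw [L.right_smul, AntiInvolution.conj_mul, AntiInvolution.conj_conj, mul_smul])
    c

theorem capRight_apply (c : Chain k A d) (y : Bar k A n) : L.capRight c m n y =
    ((barGen_isMulti (k := k) (n := n)).capPair (β := leftPair k A (Bar k A n))
      (L.right_isMulti (m := m) y)).eval d c := rfl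

theorem comm_right (x : Bar k A (m + 1)) (y : Bar k A (n + 1)) (h : m + n + 1 = d) :
    L.right m (n + 1) y (barD k A m x) = (-1 : k) ^ m • L.right (m + 1) n (barD k A n y) x := by
  rw [← L.conj_left, L.comm m n x y h, ← L.conj_left, ← conjLin_apply, map_smul, conjLin_apply]

/-- The Leibniz rule is evaluated at the cycle, where its left side vanishes. This equates the
differential applied to the output with the differential moved through the pairing onto the
argument. -/
theorem barD_capLeft (c : Cycles k A d) (x : Bar k A (m + 1)) (h : m + n + 1 = d) :
    barD k A m (L.capLeft c.1 (m + 1) n x) =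
      (-1 : k) ^ d • L.capLeft c.1 m (n + 1) (barD k A m x) := by
  have hm : IsMulti k (capPair (rightPair k A (Bar k A m)) (fun l => L.left (m + 1) n x (barGen k n l))
    (barGen k m)) := (L.left_isMulti x).capPair barGen_isMulti
  have hb : IsMulti k (capPair (rightPair k A (Bar k A m))
      (fun l => L.left (m + 1) n x (barGen k n l)) (bimodDelta k (barGen k m))) :=
    (L.left_isMulti x).capPair barGen_isMulti.bimodDelta
  have hl : IsMulti k (capPair (rightPair k A (Bar k A m))
      (fun l => L.left m (n + 1) (barD k A m x) (barGen k (n + 1) l)) (barGen k m)) :=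
    (L.left_isMulti _).capPair barGen_isMulti
  have h0 : hm.hoch.eval d c.1 =
      ((hl.fsmul ((-1 : k) ^ m)).fadd (hb.fsmul ((-1 : k) ^ n))).eval d c.1 := by
    refine IsMulti.eval_congr_length hm.hoch ((hl.fsmul ((-1 : k) ^ m)).fadd (hb.fsmul ((-1 : k) ^ n))) (fun a w hw => ?_) _
    rw [hochWord_capPair rightPair_isCyclic fun l hl => L.left_supp _ _ hl]
    congr 1
    refine (cutSum_congr fun u v huv => ?_).trans (cutSum_smul _ _ _)
    have := congrArg List.length huv
    rw [List.length_append] at this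
    by_cases hu : u.length = n + 1
    · rw [← map_barD_gen _ hu]
      beta_reduce
      rw [L.comm m n x _ h, map_smul, LinearMap.smul_apply, smul_smul, sign_sq, one_smul]
    · rw [barGen_supp (k := k) (n := m) (l := v) (by omega), map_zero, map_zero, smul_zero]
  rw [eval_hoch_cycle hm, eval_fadd (hl.fsmul ((-1 : k) ^ m)) (hb.fsmul ((-1 : k) ^ n)), eval_fsmul hl,
    eval_fsmul hb] at h0
  have h1 : barD k A m (L.capLeft c.1 (m + 1) n x) = hb.eval d c.1 := by
    refine (eval_map _ ((barD k A m).restrictScalars k) c.1).trans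
      (IsMulti.eval_congr_length _ hb (fun a w hw => ?_) _)
    refine (cutSum_map (barD k A m).toAddMonoidHom _ w).symm.trans
      (cutSum_congr fun u v huv => ?_)
    change barD k A m _ = _
    by_cases hv : v.length = m + 1
    · rw [rightPair_apply, map_smul, map_smul, rightPair_apply, barD_gen hv]
    · have := congrArg List.length huv
      rw [List.length_append] at this
      simp only [L.left_supp (n := n) x u (by omega), map_zero, LinearMap.zero_apply]
  rw [h1, capLeft_apply]
  have h2 := sign_sq (k := k) n
  subst h
  rw [pow_succ, pow_add]
  linear_combination (norm := skip) -(-1 : k) ^ n • h0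
  rw [smul_add, smul_smul _ _ (hb.eval _ _), neg_mul, h2]
  module

theorem barD_capRight (c : Cycles k A d) (y : Bar k A (n + 1)) (h : m + n + 1 = d) :
    barD k A n (L.capRight c.1 m (n + 1) y) =
      (-1 : k) ^ d • L.capRight c.1 (m + 1) n (barD k A n y) := by
  have hm : IsMulti k (capPair (leftPair k A (Bar k A n)) (barGen k n)
    (fun l => L.right m (n + 1) y (barGen k m l))) := barGen_isMulti.capPair (L.right_isMulti y)
  have hb : IsMulti k (capPair (leftPair k A (Bar k A n)) (bimodDelta k (barGen k n))
      (fun l => L.right m (n + 1) y (barGen k m l))) :=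
    barGen_isMulti.bimodDelta.capPair (L.right_isMulti y)
  have hl : IsMulti k (capPair (leftPair k A (Bar k A n)) (barGen k n)
      (fun l => L.right (m + 1) n (barD k A n y) (barGen k (m + 1) l))) :=
    barGen_isMulti.capPair (L.right_isMulti _)
  have h0 : hm.hoch.eval d c.1 =
      (hb.fadd ((hl.fsmul ((-1 : k) ^ m)).fsmul ((-1 : k) ^ n))).eval d c.1 := by
    refine IsMulti.eval_congr_length hm.hoch (hb.fadd ((hl.fsmul ((-1 : k) ^ m)).fsmul ((-1 : k) ^ n))) (fun a w hw => ?_) _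
    rw [hochWord_capPair leftPair_isCyclic fun l hl => barGen_supp hl]
    congr 2
    refine (cutSum_congr fun u v huv => ?_).trans (cutSum_smul _ _ _)
    have := congrArg List.length huv
    rw [List.length_append] at this
    by_cases hv : v.length = m + 1
    · rw [← map_barD_gen _ hv, L.comm_right _ y h, map_smul]
    · simp only [barGen_supp (k := k) (n := n) (l := u) (by omega), map_zero, LinearMap.zero_apply,
        smul_zero]
  rw [eval_hoch_cycle hm, eval_fadd hb ((hl.fsmul ((-1 : k) ^ m)).fsmul ((-1 : k) ^ n)), eval_fsmul (hl.fsmul ((-1 : k) ^ m)), eval_fsmul hl] at h0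
  have h1 : barD k A n (L.capRight c.1 m (n + 1) y) = hb.eval d c.1 := by
    refine (eval_map _ ((barD k A n).restrictScalars k) c.1).trans
      (IsMulti.eval_congr_length _ hb (fun a w hw => ?_) _)
    refine (cutSum_map (barD k A n).toAddMonoidHom _ w).symm.trans
      (cutSum_congr fun u v huv => ?_)
    change barD k A n _ = _
    by_cases hu : u.length = n + 1
    · rw [leftPair_apply, map_smul, map_smul, leftPair_apply, barD_gen hu]
    · have := congrArg List.length huv
      rw [List.length_append] at this
      simp only [L.right_supp (m := m) y v (by omega), map_zero]
  rw [h1, capRight_apply]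
  subst h
  rw [pow_succ, pow_add]
  linear_combination (norm := module) - h0

theorem capLeft_barD (c : Chain k A d) (x : Bar k A (d + 1)) :
    L.capLeft c d 0 (barD k A d x) = 0 := by
  have h : ∀ y, L.left d 0 (barD k A d x) y = 0 := L.left_zero x
  generalize barD k A d x = z at h
  rw [capLeft_apply]
  refine eval_eq_zero _ (fun a w _ => ?_) c
  rw [capPair]
  exact cutSum_eq_zero fun u v _ => by rw [h, map_zero, LinearMap.zero_apply]

theorem capRight_barD (c : Chain k A d) (y : Bar k A (d + 1)) :
    L.capRight c 0 d (barD k A d y) = 0 := by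
  have h : ∀ x, L.right 0 d (barD k A d y) x = 0 := fun x => by
    rw [← L.conj_left, L.right_zero, ← conjLin_apply, map_zero]
  generalize barD k A d y = z at h
  rw [capRight_apply]
  refine eval_eq_zero _ (fun a w _ => ?_) c
  rw [capPair]
  exact cutSum_eq_zero fun u v _ => by rw [h, map_zero]

/-- The contraction with the pairing as a chain map. -/
def capLeftMap (c : Chain k A d) (m : ℕ) : Bar k A m →ₗ[Env k A] Bar k A m :=
  if m ≤ d then (-1 : k) ^ (d * m) • L.capLeft c m (d - m) else 0

/-- The contraction with the transposed pairing as a chain map, up to a global sign. -/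
def capRightMap (c : Chain k A d) (n : ℕ) : Bar k A n →ₗ[Env k A] Bar k A n :=
  if n ≤ d then (-1 : k) ^ (d * n + d) • L.capRight c (d - n) n else 0

end BarPairing

end BarPairing

end

end CalabiYau

namespace CalabiYau

noncomputable section

attribute [local instance] TensorProduct.Algebra.module

/-! ### Endomorphisms of the bar resolution over the identity -/

section Endomorphisms

variable {k : Type*} [Field k] {A : Type*} [Ring A] [Algebra k A] {m n d : ℕ}
  {W : Type*} [AddCommGroup W] [Module k W] {φ : List A → W}

theorem homWord_isCochainWord (Φ : Bar k A n →ₗ[Env k A] A) :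
    IsCochain k n fun l => Φ (barGen k n l) :=
  ⟨map_isMulti barGen_isMulti Φ, fun l hl => by rw [barGen_supp hl, map_zero]⟩

theorem homWord_barD (Φ : Bar k A n →ₗ[Env k A] A) (l : List A) :
    Φ (barD k A n (barGen k (n + 1) l)) = deltaWord k n (fun l => Φ (barGen k n l)) l := by
  by_cases hl : l.length = n + 1
  · rw [map_barD_gen _ hl, bimodDelta_eq_delta _ _ hl]
  · rw [barGen_supp hl, map_zero, map_zero, (homWord_isCochainWord Φ).delta.supp l hl]

theorem liftBar_gen' {F : List A → A} (hF : IsCochain k n F) (l : List A) :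
    liftBar hF.multi n (barGen k n l) = F l := by
  by_cases hl : l.length = n
  · exact liftBar_gen _ hl
  · rw [barGen_supp hl, map_zero, hF.supp l hl]

theorem liftBar_barD {F : List A → A} (hF : IsCocycle k n F) (b : Bar k A (n + 1)) :
    liftBar hF.multi n (barD k A n b) = 0 := by
  have : liftBar hF.multi n ∘ₗ barD k A n = 0 := bar_hom_ext fun l _ => by
    rw [LinearMap.comp_apply, homWord_barD, funext (liftBar_gen' hF.toIsCochain), hF.closed,
      LinearMap.zero_apply]
  exact LinearMap.congr_fun this b

theorem barWord_supp {θ : List A → W} (h : IsMulti k θ) (hs : ∀ l, l.length ≠ n → θ l = 0) (l : List A)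
    (hl : l.length ≠ n + 1) : barWord k θ l = 0 := by
  refine cutSum_eq_zero fun x r hx => ?_
  rw [start, cutSum_eq_zero, smul_zero]
  intro y z hy
  by_cases h2 : y.length = 2
  · refine hs _ ?_
    have h3 := congrArg List.length hx
    have h4 := congrArg List.length hy
    simp only [List.length_append, List.length_cons] at h3 h4 ⊢
    omega
  · rw [mulWord_eq_zero h2]
    exact (h.linear x z).map_zero

theorem bimodDelta_supp {N : Type*} [AddCommGroup N] [Module k N] [Module (Env k A) N]
    [IsScalarTower k (Env k A) N] {θ : List A → N} (h : IsMulti k θ)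
    (hs : ∀ l, l.length ≠ n → θ l = 0) (l : List A) (hl : l.length ≠ n + 1) :
    bimodDelta k θ l = 0 := by
  rw [bimodDelta, barWord_supp h hs l hl, cutSum_eq_zero, cutSum_eq_zero, sub_zero, add_zero]
  · intro u v huv
    have h3 := congrArg List.length huv
    rw [List.length_append] at h3
    by_cases hv : v.length = 1
    · rw [hs u (by omega), smul_zero, smul_zero]
    · rw [letter_eq_zero hv, rightAct_zero_smul, smul_zero]
  · intro u v huv
    have h3 := congrArg List.length huv
    rw [List.length_append] at h3
    by_cases hu : u.length = 1
    · rw [hs v (by omega), smul_zero]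
    · rw [letter_eq_zero hu, map_zero]
      exact zero_smul (Env k A) (θ v)

theorem smul_mul_of_central {x : A} (hx : ∀ a, a * x = x * a) (r : Env k A) (a : A) :
    r • (a * x) = (r • a) * x := by
  induction r using TensorProduct.induction_on with
  | zero => rw [zero_smul (Env k A) a, zero_smul (Env k A) (a * x), zero_mul]
  | tmul b c =>
    rw [TensorProduct.Algebra.smul_def, TensorProduct.Algebra.smul_def, MulOpposite.smul_eq_mul_unop,
      MulOpposite.smul_eq_mul_unop, smul_eq_mul, smul_eq_mul, mul_assoc a, ← hx, mul_assoc, mul_assoc]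
  | add r s hr hs => rw [add_smul, add_smul, hr, hs, add_mul]

variable {G : ∀ n, Bar k A n →ₗ[Env k A] Bar k A n}
  (hG : ∀ n b, barD k A n (G (n + 1) b) = G n (barD k A n b))
  (h₀ : barAug k A (G 0 (barGen k 0 [])) = 1)
include hG h₀

/-- The endomorphism induces the identity of `A`, because it does so on the generator in degree
zero; the comparison theorem gives the homotopy. -/
theorem exists_homotopy_id : ∃ h : ∀ n, Bar k A n →ₗ[Env k A] Bar k A (n + 1),
    (∀ b, G 0 b - b = barD k A 0 (h 0 b)) ∧
    ∀ n b, G (n + 1) b - b = barD k A (n + 1) (h (n + 1) b) + h n (barD k A n b) := by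
  have ha : barAug k A ∘ₗ (G 0 - LinearMap.id) = 0 := bar_hom_ext fun l hl => by
    obtain rfl := List.length_eq_zero_iff.mp hl
    rw [LinearMap.comp_apply, LinearMap.sub_apply, map_sub, h₀, LinearMap.id_apply, barAug_gen,
      sub_self, LinearMap.zero_apply]
  exact exists_homotopy (P := Bar k A) (N := Bar k A) (dP := barD k A) (dN := barD k A)
    (fun n => inferInstance) (fun n => barD_barD) bar_exact (fun n => G n - LinearMap.id)
    (fun n b => by rw [LinearMap.sub_apply, map_sub, hG]; rfl)
    fun b => (bar_exact_aug _).mp (LinearMap.congr_fun ha b)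

/-- Pulling back along a map homotopic to the identity changes a closed function by an exact one,
which is invisible on cycles. -/
theorem eval_pull_of_homotopy (hφ : IsClosedWord k φ) (w : Cycles k A m) :
    (hφ.multi.pull 0 G).eval m w.1 = hφ.multi.eval m w.1 := by
  obtain ⟨h, h0, h1⟩ := exists_homotopy_id hG h₀
  have he : ∀ a l, pullWord 0 G hφ.multi (a :: l) =
      φ (a :: l) + hochWord k (pullWord 1 h hφ.multi) (a :: l) := fun a l => by
    rw [pullWord_homotopy G (fun _ => LinearMap.id) h h0 h1]
    congr 1
    have h2 : pullWord 1 h hφ.multi.hoch (a :: l) = 0 := by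
      have : ∀ n (b : Bar k A n), barTrace hφ.multi.hoch a n b = 0 := fun n b => by
        induction b using bar_induction' with
        | h₁ r l hl => rw [barTrace_smul_gen _ _ _ hl, hφ.closed]
        | h₂ b c hb hc => rw [map_add, hb, hc, add_zero]
      exact this _ _
    rw [h2, add_zero]
    exact barTrace_gen _ _ rfl
  have hm := hφ.multi.pull 1 h
  rw [IsMulti.eval_congr _ (hφ.multi.fadd hm.hoch) he, eval_fadd hφ.multi hm.hoch,
    eval_hoch_cycle hm, add_zero]

theorem cohClass_eq_of_homotopy (f f' : Cocycles k A n) (hf : ∀ l, wordOf f'.1 l =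
    liftBar (wordOf_isMulti f.1) n (G n (barGen k n l))) : cohClass f' = cohClass f := by
  obtain ⟨h, h0, h1⟩ := exists_homotopy_id hG h₀
  rw [cohClass_eq_iff]
  have hF := cocycleWord f
  have hs : ∀ l, wordOf (f'.1 - f.1) l =
      liftBar hF.multi n (G n (barGen k n l) - barGen k n l) := fun l => by
    rw [wordOf_sub, map_sub, liftBar_gen' hF.toIsCochain]
    beta_reduce
    rw [hf]
  rcases n with _ | n
  · have : f'.1 - f.1 = 0 := wordOf_injective (funext fun l => by
      rw [hs, h0, liftBar_barD hF, wordOf_zero])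
    rw [this]
    exact zero_mem _
  · refine mem_coboundaries_of_word (homWord_isCochainWord (liftBar hF.multi (n + 1) ∘ₗ h n)) rfl
      fun l => ?_
    rw [hs, h1, map_add, liftBar_barD hF, zero_add]
    exact homWord_barD (liftBar hF.multi (n + 1) ∘ₗ h n) l

end Endomorphisms

/-! ### The duality isomorphism between homology and cohomology -/

namespace BarPairing

variable {k : Type*} [Field k] {A : Type*} [Ring A] [Algebra k A] {d m n : ℕ}
  {W : Type*} [AddCommGroup W] [Module k W] {φ : List A → W}
  (L : BarPairing k A d)

theorem capLeftMap_eq (c : Chain k A d) (h : m + n = d) (x : Bar k A m) :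
    L.capLeftMap c m x = (-1 : k) ^ (d * m) • L.capLeft c m n x := by
  obtain rfl : n = d - m := by omega
  rw [capLeftMap, if_pos (by omega), LinearMap.smul_apply]

theorem capRightMap_eq (c : Chain k A d) (h : m + n = d) (x : Bar k A n) :
    L.capRightMap c n x = (-1 : k) ^ (d * n + d) • L.capRight c m n x := by
  obtain rfl : m = d - n := by omega
  rw [capRightMap, if_pos (by omega), LinearMap.smul_apply]

theorem env_map_smul {M N : Type*} [AddCommGroup M] [Module k M] [Module (Env k A) M]
    [IsScalarTower k (Env k A) M] [AddCommGroup N] [Module k N] [Module (Env k A) N]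
    [IsScalarTower k (Env k A) N] (f : M →ₗ[Env k A] N) (c : k) (x : M) : f (c • x) = c • f x :=
  (f.restrictScalars k).map_smul c x

/-- The factor `(-1)^(d m)` absorbs the sign `(-1)^d` by which the contraction fails to commute with
the differential. Above degree `d` the map is zero, and `left_zero` makes the last square commute.
-/
theorem barD_capLeftMap (c : Cycles k A d) (m : ℕ) (x : Bar k A (m + 1)) :
    barD k A m (L.capLeftMap c.1 (m + 1) x) = L.capLeftMap c.1 m (barD k A m x) := by
  rcases lt_trichotomy m d with h | rfl | h
  · obtain ⟨n, rfl⟩ := Nat.exists_eq_add_of_lt h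
    rw [L.capLeftMap_eq c.1 (m := m + 1) (n := n) (by omega), L.capLeftMap_eq c.1 (m := m) (n := n + 1)
      (by omega), env_map_smul, L.barD_capLeft c x rfl, smul_smul, mul_add, pow_add, mul_one, mul_assoc,
      sign_sq, mul_one]
  · rw [L.capLeftMap_eq c.1 (m := m) (n := 0) rfl, capLeft_barD, smul_zero, capLeftMap,
      if_neg (by omega), LinearMap.zero_apply, map_zero]
  · rw [capLeftMap, if_neg (by omega), capLeftMap, if_neg (by omega), LinearMap.zero_apply, map_zero,
      LinearMap.zero_apply]

theorem barD_capRightMap (c : Cycles k A d) (n : ℕ) (y : Bar k A (n + 1)) :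
    barD k A n (L.capRightMap c.1 (n + 1) y) = L.capRightMap c.1 n (barD k A n y) := by
  rcases lt_trichotomy n d with h | rfl | h
  · obtain ⟨m, rfl⟩ := Nat.exists_eq_add_of_lt h
    rw [L.capRightMap_eq c.1 (m := m) (n := n + 1) (by omega), L.capRightMap_eq c.1 (m := m + 1) (n := n)
      (by omega), env_map_smul, L.barD_capRight c y (by omega), smul_smul]
    congr 1
    have := sign_sq (k := k) (n + m + 1)
    rw [mul_add, mul_one, pow_add, pow_add]
    linear_combination (-1 : k) ^ ((n + m + 1) * n) * (-1 : k) ^ (n + m + 1) * this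
  · rw [L.capRightMap_eq c.1 (m := 0) (n := n) (by omega), capRight_barD, smul_zero, capRightMap,
      if_neg (by omega), LinearMap.zero_apply, map_zero]
  · rw [capRightMap, if_neg (by omega), capRightMap, if_neg (by omega), LinearMap.zero_apply, map_zero,
      LinearMap.zero_apply]

variable (m n) in
/-- The morphism from the bar resolution to `A` which is obtained from a Hochschild chain by
pairing. -/
def pairHom (w : Chain k A m) : Bar k A n →ₗ[Env k A] A :=
  evalHom (fun y => twistWord fun l => L.right m n y (barGen k m l))
    (fun y => (L.right_isMulti y).twist)
    (fun x y l => by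
      rcases l with _ | ⟨a, l⟩
      · exact (add_zero 0).symm
      · rw [twistWord_cons, twistWord_cons, twistWord_cons, L.right_add, AntiInvolution.conj_add,
          add_smul])
    (fun r x l => by
      rcases l with _ | ⟨a, l⟩
      · exact (smul_zero r).symm
      · rw [twistWord_cons, twistWord_cons, L.right_smul, AntiInvolution.conj_mul,
          AntiInvolution.conj_conj, mul_smul])
    w

theorem pairHom_apply (w : Chain k A m) (y : Bar k A n) : L.pairHom m n w y =
    (L.right_isMulti (m := m) y).twist.eval m w := rfl

theorem pairHom_add (w w' : Chain k A m) (y : Bar k A n) :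
    L.pairHom m n (w + w') y = L.pairHom m n w y + L.pairHom m n w' y := by
  rw [pairHom_apply, map_add]; rfl

theorem pairHom_smul (c : k) (w : Chain k A m) (y : Bar k A n) :
    L.pairHom m n (c • w) y = c • L.pairHom m n w y := by
  rw [pairHom_apply, map_smul]; rfl

theorem hoch_twist_right (y : Bar k A n) (a : A) {l : List A} (hl : l.length = m + 1) :
    hochWord k (twistWord fun l => L.right m n y (barGen k m l)) (a :: l) =
      (flip k A).conj (L.right m n y (barD k A m (barGen k (m + 1) l))) • a := by
  rw [hochWord_twistWord fun l hl => L.right_supp y l hl, twistWord_cons, map_barD_gen _ hl]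

theorem conj_smul (c : k) (r : Env k A) : (flip k A).conj (c • r) = c • (flip k A).conj r := by
  rw [← conjLin_apply, map_smul, conjLin_apply]

/-- The pairing moves the differential from the argument to the twisted function of words, which is
then evaluated at a cycle. -/
theorem pairHom_barD (w : Cycles k A m) (h : m + n = d) (y : Bar k A (n + 1)) :
    L.pairHom m n w.1 (barD k A n y) = 0 := by
  rcases m with _ | m
  · obtain rfl : n = d := by omega
    refine eval_eq_zero _ (fun a l _ => ?_) _
    beta_reduce
    rw [twistWord_cons, L.conj_right, L.right_zero, zero_smul (Env k A) a]
  · have hm := (L.right_isMulti (m := m) y).twist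
    rw [pairHom_apply, IsMulti.eval_congr_length _ (hm.hoch.fsmul ((-1 : k) ^ m)) (fun a l hl => ?_),
      eval_fsmul hm.hoch, eval_hoch_cycle hm, smul_zero]
    rw [twistWord_cons, L.hoch_twist_right y a hl, L.comm_right _ y (by omega), conj_smul,
      smul_assoc, smul_smul, sign_sq, one_smul]

/-- Together with `pairHom_barD` this makes the pairing descend to a map from homology to
cohomology. -/
theorem pairHom_boundary (z : Chain k A (m + 1)) (h : m + n + 1 = d) (y : Bar k A (n + 1)) :
    L.pairHom m (n + 1) (boundary k A m z) y =
      (-1 : k) ^ m • L.pairHom (m + 1) n z (barD k A n y) := by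
  have hm := (L.right_isMulti (m := m) y).twist
  have h1 := (L.right_isMulti (m := m + 1) (barD k A n y)).twist
  rw [pairHom_apply, pairHom_apply, eval_boundary,
    IsMulti.eval_congr_length hm.hoch (h1.fsmul ((-1 : k) ^ m)) (fun a l hl => ?_), eval_fsmul h1]
  rw [twistWord_cons, L.hoch_twist_right y a hl, L.comm_right _ y h, conj_smul, smul_assoc]

theorem pairHom_boundary_zero (z : Chain k A (d + 1)) (y : Bar k A 0) :
    L.pairHom d 0 (boundary k A d z) y = 0 := by
  have hm := (L.right_isMulti (m := d) y).twist
  rw [pairHom_apply, eval_boundary]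
  refine eval_eq_zero hm.hoch (fun a l hl => ?_) z
  rw [L.hoch_twist_right y a hl, L.conj_right, L.left_zero, zero_smul (Env k A) a]

theorem pairWord_isCocycle (w : Cycles k A m) (h : m + n = d) :
    IsCocycle k n fun l => L.pairHom m n w.1 (barGen k n l) :=
  ⟨homWord_isCochainWord _, fun l => by rw [← homWord_barD, L.pairHom_barD w h]⟩

/-- The cocycle which is obtained from a Hochschild cycle by pairing. -/
def pairCocycle (h : m + n = d) : Cycles k A m →ₗ[k] Cocycles k A n where
  toFun w := (L.pairWord_isCocycle w h).toCocycle
  map_add' w w' := Subtype.ext (wordOf_injective (by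
    refine (IsCocycle.wordOf_toCocycle _).trans ?_
    simp only [Submodule.coe_add, wordOf_add, IsCocycle.wordOf_toCocycle, pairHom_add]))
  map_smul' c w := Subtype.ext (wordOf_injective (by
    refine (IsCocycle.wordOf_toCocycle _).trans ?_
    simp only [RingHom.id_apply, Submodule.coe_smul, wordOf_smul, IsCocycle.wordOf_toCocycle,
      pairHom_smul]))

theorem wordOf_pairCocycle (h : m + n = d) (w : Cycles k A m) (l : List A) :
    wordOf (L.pairCocycle h w).1 l = L.pairHom m n w.1 (barGen k n l) :=
  congrFun (L.pairWord_isCocycle w h).wordOf_toCocycle l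

theorem pairCocycle_of_boundary (h : m + n = d) (w : Cycles k A m)
    (hw : w.1 ∈ LinearMap.range (boundary k A m)) :
    (L.pairCocycle h w).1 ∈ coboundaries k A n := by
  obtain ⟨z, hz⟩ := hw
  rcases n with _ | n
  · obtain rfl : m = d := h
    have : (L.pairCocycle rfl w).1 = 0 := wordOf_injective (funext fun l => by
      rw [wordOf_pairCocycle, ← hz, L.pairHom_boundary_zero, wordOf_zero])
    rw [this]
    exact zero_mem _
  · refine mem_coboundaries_of_word
      (homWord_isCochainWord ((-1 : k) ^ m • L.pairHom (m + 1) n z)) rfl fun l => ?_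
    rw [← homWord_barD, wordOf_pairCocycle, ← hz, L.pairHom_boundary z h]
    rfl

/-- The contraction of `c` with the cocycle which is obtained from `w` by pairing. -/
theorem eval_cap_pairHom (hφ : IsMulti k φ) (h : m + n = d) (c : Chain k A d) (w : Chain k A m) :
    ((map_isMulti barGen_isMulti (L.pairHom m n w)).cap hφ).eval d c =
      (-1 : k) ^ (d * m) • (hφ.pull 0 (L.capLeftMap c)).eval m w := by
  have hF : ∀ w, IsMulti k fun l => L.pairHom m n w (barGen k n l) := fun w =>
    map_isMulti barGen_isMulti (L.pairHom m n w)
  have hp := hφ.pull 0 (L.capLeftMap c)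
  rw [← eval_fsmul hp]
  -- Both sides are linear in `w`, so a pure tensor suffices; for it the map obtained by pairing is
  -- the value of the pairing at one generator, acting on the marked letter.
  refine eval_ext (f := { toFun := fun w => ((hF w).cap hφ).eval d c
                          map_add' := fun w w' => ?_
                          map_smul' := fun r w => ?_ }) (hp.fsmul _) (fun a => ?_) w
  · rw [← eval_fadd ((hF w).cap hφ) ((hF w').cap hφ)]
    refine IsMulti.eval_congr _ _ (fun a l => ?_) c
    rw [← capWord_add_left hφ]
    simp only [L.pairHom_add]
  · rw [RingHom.id_apply, ← eval_fsmul ((hF w).cap hφ)]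
    refine IsMulti.eval_congr _ _ (fun a l => ?_) c
    rw [← capWord_smul_left hφ]
    simp only [L.pairHom_smul]
  · change ((hF _).cap hφ).eval d c = _
    rw [List.ofFn_succ]
    obtain ⟨v, hv⟩ : ∃ v, v = List.ofFn fun i : Fin m => a i.succ := ⟨_, rfl⟩
    have hvm : v.length = m := by rw [hv, List.length_ofFn]
    have hpair : ∀ y, L.pairHom m n (PiTensorProduct.tprod k a) y =
        L.left m n (barGen k m v) y • a 0 := fun y => by
      rw [pairHom_apply, IsMulti.eval_tprod, List.ofFn_succ, ← hv, twistWord_cons, L.conj_right]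
    rw [← hv]
    subst hvm
    change _ = _ • barTrace hφ (a 0) _ (L.capLeftMap c v.length (barGen k v.length v))
    have hcap : IsMulti k (capPair (rightPair k A (Bar k A v.length))
      (fun l => L.left v.length n (barGen k v.length v) (barGen k n l)) (barGen k v.length)) :=
      (L.left_isMulti _).capPair barGen_isMulti
    rw [L.capLeftMap_eq c h, map_smul, smul_smul, sign_sq, one_smul]
    refine (IsMulti.eval_congr_length _ (hcap.map (barTrace hφ (a 0) v.length)) (fun b l hl => ?_)
      c).trans (eval_map hcap (barTrace hφ (a 0) v.length) c).symm
    refine (cutSum_congr fun x y hxy => ?_).trans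
      (cutSum_map (barTrace hφ (a 0) v.length).toAddMonoidHom _ l)
    change _ = barTrace hφ (a 0) v.length _
    have := congrArg List.length hxy
    rw [List.length_append] at this
    beta_reduce
    rw [rightPair_apply, hpair, barTrace_smul, AntiInvolution.conj_conj, barTrace_smul,
      conj_rightAct]
    by_cases hy : y.length = v.length
    · rw [barTrace_gen _ _ hy, leftAct_smul]
    · rw [barGen_supp hy, map_zero, barGen_supp (k := k) (n := n) (l := x) (by omega), map_zero, zero_smul (Env k A) (a 0), mul_zero,
        hφ.head_zero]

/-- The cocycle which is obtained by pairing from the contraction of `c` with a cochain. -/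
theorem pairHom_contraction (h : m + n = d) (f : Cochain k A n) (c : Chain k A d) (y : Bar k A n) :
    L.pairHom m n (contraction h f c) y = (-1 : k) ^ (n + d * n + d) •
      liftBar (wordOf_isMulti f) n (L.capRightMap c n y) := by
  have hr := (L.right_isMulti (m := m) y).twist
  have hcap : IsMulti k (capPair (leftPair k A (Bar k A n)) (barGen k n)
      (fun l => L.right m n y (barGen k m l))) := barGen_isMulti.capPair (L.right_isMulti y)
  rw [L.capRightMap_eq c h, env_map_smul, smul_smul, add_assoc, pow_add _ n, mul_assoc,
    sign_sq, mul_one, pairHom_apply, eval_contraction]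
  congr 1
  refine (IsMulti.eval_congr_length _ (hcap.map ((liftBar (wordOf_isMulti f) n).restrictScalars k))
    (fun a l hl => ?_) c).trans
    (eval_map hcap ((liftBar (wordOf_isMulti f) n).restrictScalars k) c).symm
  refine (cutSum_congr fun u v huv => ?_).trans
    (cutSum_map (liftBar (wordOf_isMulti f) n).toAddMonoidHom _ l)
  change _ = liftBar (wordOf_isMulti f) n _
  rw [twistWord_cons, leftPair_apply, map_smul, map_smul, liftBar_gen' (wordOf_isCochainWord f),
    leftAct_smul]

/-- The pairing of the volume with a chain. -/
def trace (c : Chain k A d) : A := (L.left_isMulti (n := d) (barGen k 0 [])).twist.eval d c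

/-- The augmentation sees only the term in which the volume consumes all letters of the chain, and
this term is the pairing with the volume. -/
theorem barAug_capLeftMap (c : Chain k A d) :
    barAug k A (L.capLeftMap c 0 (barGen k 0 [])) = L.trace c := by
  have hcap : IsMulti k (capPair (rightPair k A (Bar k A 0))
      (fun l => L.left 0 d (barGen k 0 []) (barGen k d l)) (barGen k 0)) :=
      (L.left_isMulti _).capPair barGen_isMulti
  rw [L.capLeftMap_eq c (zero_add d), mul_zero, pow_zero, one_smul]
  refine (eval_map hcap ((barAug k A).restrictScalars k) c).trans
    (IsMulti.eval_congr_length _ _ (fun a l hl => ?_) c)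
  refine (cutSum_map (barAug k A).toAddMonoidHom _ l).symm.trans ?_
  rw [twistWord_cons, cutSum_right_nil]
  · rw [LinearMap.toAddMonoidHom_coe, rightPair_apply, map_smul, map_smul, barAug_gen, rightAct_smul, one_mul]
  · intro u b v
    rw [LinearMap.toAddMonoidHom_coe, barGen_supp (l := b :: v) (by simp), map_zero, map_zero]

theorem barAug_capRightMap (c : Chain k A d) :
    barAug k A (L.capRightMap c 0 (barGen k 0 [])) =
      (-1 : k) ^ d • L.pairHom d 0 c (barGen k 0 []) := by
  have hcap : IsMulti k (capPair (leftPair k A (Bar k A 0)) (barGen k 0)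
      (fun l => L.right d 0 (barGen k 0 []) (barGen k d l))) :=
      barGen_isMulti.capPair (L.right_isMulti _)
  rw [L.capRightMap_eq c (add_zero d), mul_zero, zero_add, env_map_smul]
  congr 1
  refine (eval_map hcap ((barAug k A).restrictScalars k) c).trans
    (IsMulti.eval_congr_length _ _ (fun a l hl => ?_) c)
  refine (cutSum_map (barAug k A).toAddMonoidHom _ l).symm.trans ?_
  beta_reduce
  rw [twistWord_cons, cutSum_left_nil]
  · rw [LinearMap.toAddMonoidHom_coe, leftPair_apply, map_smul, map_smul, barAug_gen, leftAct_smul, mul_one]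
  · intro b u v
    rw [LinearMap.toAddMonoidHom_coe, barGen_supp (l := b :: u) (by simp), map_zero, LinearMap.zero_apply, map_zero]

variable {c : Cycles k A d} (hc : L.trace c.1 = 1)

theorem volume_isClosed : IsClosedWord k (twistWord fun l => L.left 0 d (barGen k 0 []) (barGen k d l)) :=
  ⟨(L.left_isMulti _).twist, fun l => by
    rcases l with _ | ⟨a, l⟩
    · simp [hochWord]
    rw [hochWord_twistWord fun l hl => L.left_supp _ l hl, twistWord_cons]
    by_cases hl : l.length = d + 1
    · rw [← map_barD_gen _ hl, L.right_zero, ← conjLin_apply, map_zero, zero_smul (Env k A) a]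
    · rw [bimodDelta_supp (L.left_isMulti _) (fun l hl => L.left_supp _ l hl) l hl, ← conjLin_apply,
        map_zero, zero_smul (Env k A) a]⟩

include hc

/-- Since the trace is `1`, the endomorphism `capLeftMap` lies over the identity and does not change
values on cycles. So passing from homology to cohomology and back is the identity up to sign. -/
theorem eval_capPair_cycle (hφ : IsClosedWord k φ) (h : m + n = d) (w : Cycles k A m) :
    ((map_isMulti barGen_isMulti (L.pairHom m n w.1)).cap hφ.multi).eval d c.1 =
      (-1 : k) ^ (d * m) • hφ.multi.eval m w.1 := by
  rw [L.eval_cap_pairHom hφ.multi h, eval_pull_of_homotopy (L.barD_capLeftMap c)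
    ((L.barAug_capLeftMap c.1).trans hc) hφ]

/-- The element `κ` obtained by pairing `c` with itself is central, being a cocycle of degree zero.
Contracting `c` with `κ` and then pairing with the volume gives `κ` times the trace; by the
one-sided inverse property it is also the trace up to sign. As the trace is `1`, this determines
`κ`, with no use of a symmetry of the pairing. -/
theorem pairHom_self : L.pairHom d 0 c.1 (barGen k 0 []) = (-1 : k) ^ d • (1 : A) := by
  have h1 := L.eval_capPair_cycle hc L.volume_isClosed (add_zero d) c
  have hp := L.pairWord_isCocycle c (add_zero d)
  set κ := L.pairHom d 0 c.1 (barGen k 0 []) with hκ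
  -- Closedness on one letter is centrality.
  have hcomm : ∀ x, x * κ = κ * x := fun x => by
    have h2 := hp.closed [x]
    rw [deltaWord, barWord_cons hp.multi, barWord_nil (hp.multi.cons x), cutSum_nil,
      hp.supp _ (by simp)] at h2
    simp only [cupWord, cutSum_cons, cutSum_nil, letter, zero_mul, mul_zero, zero_add,
      add_zero, sub_zero, pow_one, neg_one_smul, ← sub_eq_add_neg] at h2
    exact sub_eq_zero.mp h2
  have hm := (L.left_isMulti (n := d) (barGen k 0 [])).twist
  -- Multiplying the marked letter by the central element `κ` commutes with the action of the
  -- enveloping algebra, so `κ` can be taken out of the trace.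
  have h2 : L.trace c.1 * κ = (-1 : k) ^ (d * d) • L.trace c.1 := by
    refine Eq.trans ?_ h1
    refine (eval_map hm (LinearMap.mulRight k κ) c.1).trans
      (IsMulti.eval_congr_length _ (hp.multi.cap hm) (fun a l hl => ?_) c.1)
    rw [capWord, cutSum_left_nil, twistWord_cons, twistWord_cons, LinearMap.mulRight_apply,
      smul_mul_of_central hcomm]
    intro b u v
    rw [hp.supp _ (by simp), mul_zero, hm.head_zero]
  rw [hc, one_mul] at h2
  rw [h2]
  congr 1
  rcases neg_one_pow_eq_or k d with h | h <;> rw [pow_mul, h] <;> simp [h]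

theorem barAug_capRightMap_eq_one : barAug k A (L.capRightMap c.1 0 (barGen k 0 [])) = 1 := by
  rw [barAug_capRightMap, L.pairHom_self hc, smul_smul, sign_sq, one_smul]

/-- The identity is homotopic to `capLeftMap`, which is zero in these degrees. -/
theorem homClass_eq_zero_of_lt (h : d < m) (w : Cycles k A m) : homClass w = 0 := by
  refine eq_of_totEval fun q φ hφ _ => ?_
  rw [totEval_homClass, map_zero, ← eval_pull_of_homotopy (L.barD_capLeftMap c)
    ((L.barAug_capLeftMap c.1).trans hc) hφ]
  refine eval_eq_zero _ (fun a l hl => ?_) _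
  change barTrace hφ.multi a _ (L.capLeftMap c.1 l.length (barGen k l.length l)) = 0
  rw [capLeftMap, if_neg (by omega), LinearMap.zero_apply, map_zero]

theorem cohClass_eq_zero_of_lt (h : d < n) (f : Cocycles k A n) : cohClass f = 0 := by
  rw [← cohClass_eq_of_homotopy (L.barD_capRightMap c) (L.barAug_capRightMap_eq_one hc) f 0
    fun l => ?_]
  · exact map_zero (totClass (Cocycles k A) (coboundaries k A) n)
  · rw [capRightMap, if_neg (by omega), LinearMap.zero_apply, map_zero]
    exact congrFun wordOf_zero l

omit hc in
theorem contraction_mem_cycles (h : m + n = d) (f : Cocycles k A n) (c : Cycles k A d) :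
    contraction h f.1 c.1 ∈ Cycles k A m := by
  rcases m with _ | m
  · exact Submodule.mem_top
  · change boundary k A m _ = 0
    have hm := chainWord_isMulti (k := k) (A := A) (n := m)
    have hF := cocycleWord f
    have hC := hF.multi.cap hm
    rw [← eval_chainWord_self (boundary k A m _), eval_boundary, eval_contraction,
      IsMulti.eval_congr _ (hC.hoch.fsmul ((-1 : k) ^ n)) fun a l => ?_, eval_fsmul hC.hoch,
      eval_hoch_cycle hC, smul_zero, smul_zero]
    rw [hF.hoch_cap hm, smul_smul, sign_sq, one_smul]

omit hc in
variable (c) in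
def contractionMap (h : m + n = d) : Cocycles k A n →ₗ[k] Cycles k A m where
  toFun f := ⟨contraction h f.1 c.1, contraction_mem_cycles h f c⟩
  map_add' f g := Subtype.ext (by
    have hm := chainWord_isMulti (k := k) (A := A) (n := m)
    have hF := (cocycleWord f).multi.cap hm
    have hG := (cocycleWord g).multi.cap hm
    change contraction h _ c.1 = contraction h _ c.1 + contraction h _ c.1
    rw [← eval_chainWord_self (contraction h _ c.1), ← eval_chainWord_self (contraction h f.1 c.1),
      ← eval_chainWord_self (contraction h g.1 c.1), eval_contraction, eval_contraction,
      eval_contraction, ← smul_add, ← eval_fadd hF hG]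
    refine congrArg _ (IsMulti.eval_congr _ _ (fun a l => ?_) _)
    rw [← capWord_add_left hm, Submodule.coe_add, wordOf_add])
  map_smul' r f := Subtype.ext (by
    have hm := chainWord_isMulti (k := k) (A := A) (n := m)
    have hF := (cocycleWord f).multi.cap hm
    change contraction h _ c.1 = r • contraction h _ c.1
    rw [← eval_chainWord_self (contraction h _ c.1), ← eval_chainWord_self (contraction h f.1 c.1),
      eval_contraction, eval_contraction, smul_comm, ← eval_fsmul hF]
    refine congrArg _ (IsMulti.eval_congr _ _ (fun a l => ?_) _)
    rw [← capWord_smul_left hm, Submodule.coe_smul, wordOf_smul])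

theorem homClass_contraction_pairCocycle (h : m + n = d) (w : Cycles k A m) :
    homClass (contractionMap c h (L.pairCocycle h w)) = (-1 : k) ^ (n + d * m) • homClass w := by
  refine eq_of_totEval fun q φ hφ _ => ?_
  rw [map_smul, totEval_homClass, totEval_homClass]
  change hφ.multi.eval m (contraction h _ c.1) = _
  rw [eval_contraction, pow_add, mul_smul, ← L.eval_capPair_cycle hc hφ h w]
  congr 1
  refine IsMulti.eval_congr _ _ (fun a l => ?_) _
  rw [show wordOf (L.pairCocycle h w).1 = _ from funext (L.wordOf_pairCocycle h w)]

/-- The opposite composite is induced by `capRightMap`, which lies over the identity by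
`pairHom_self`. -/
theorem cohClass_pairCocycle_contraction (h : m + n = d) (f : Cocycles k A n) :
    cohClass (L.pairCocycle h (contractionMap c h f)) = (-1 : k) ^ (n + d * n + d) • cohClass f := by
  have h1 := cohClass_eq_of_homotopy (L.barD_capRightMap c) (L.barAug_capRightMap_eq_one hc) f
    ((-1 : k) ^ (n + d * n + d) • L.pairCocycle h (contractionMap c h f)) fun l => by
      rw [Submodule.coe_smul, wordOf_smul]
      beta_reduce
      rw [wordOf_pairCocycle]
      change _ • L.pairHom m n (contraction h f.1 c.1) _ = _
      rw [L.pairHom_contraction, smul_smul, sign_sq, one_smul]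
  rw [← h1, ← cohClass_smul, smul_smul, sign_sq, one_smul]

omit hc in
theorem homClass_contraction_coboundary (h : m + n = d) (f : Cocycles k A n)
    (hf : f.1 ∈ coboundaries k A n) : homClass (contractionMap c h f) = 0 := by
  refine eq_of_totEval fun q φ hφ _ => ?_
  rw [totEval_homClass, map_zero]
  change hφ.multi.eval m (contraction h f.1 c.1) = 0
  rw [eval_contraction]
  rcases exists_word_of_mem_coboundaries hf with h0 | ⟨p, H, rfl, hH, hfH⟩
  · rw [eval_eq_zero, smul_zero]
    intro a l _
    exact cutSum_eq_zero fun u v _ => by rw [h0, wordOf_zero, mul_zero, hφ.multi.head_zero]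
  · have hC := hH.multi.cap hφ.multi
    rw [IsMulti.eval_congr _ hC.hoch (fun a l => ?_), eval_hoch_cycle hC, smul_zero]
    rw [hochWord_capWord hH hφ.multi, funext hφ.closed, hfH]
    simp [capWord, cutSum_zero]

omit hc in
theorem homClass_smul (r : k) (w : Cycles k A m) : homClass (r • w) = r • homClass w :=
  (totClass (Cycles k A) (fun n => LinearMap.range (boundary k A n)) m).map_smul r w

/-- Contraction with `c` and pairing are inverse to each other up to signs in degrees at most `d`,
and above `d` both homology and cohomology vanish. The second conclusion records that every class
comes from complementary degree. -/
theorem exists_dualityIso : ∃ D : HHHomTot k A ≃ₗ[k] HHCohTot k A, IsDualityIso c D ∧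
    ∀ m (z : Cycles k A m), homClass z = 0 ∨
      ∃ n, ∃ _ : m + n = d, ∃ f : Cocycles k A n, D.symm (cohClass f) = homClass z := by
  let Ξ : HHCohTot k A →ₗ[k] HHHomTot k A := totLift (fun n => if h : n ≤ d then
      totClass (Cycles k A) (fun n => LinearMap.range (boundary k A n)) (d - n) ∘ₗ
        contractionMap c (Nat.sub_add_cancel h) else 0) fun n f hf => by
    split_ifs with h
    · exact homClass_contraction_coboundary _ f hf
    · rfl
  -- The sign is the one of `homClass_contraction_pairCocycle`, so that `Ξ ∘ Υ` is the identity on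
  -- the nose.
  let Υ : HHHomTot k A →ₗ[k] HHCohTot k A := totLift (fun m => if h : m ≤ d then
      (-1 : k) ^ (d - m + d * m) • totClass (Cocycles k A) (coboundaries k A) (d - m) ∘ₗ
        L.pairCocycle (Nat.add_sub_cancel' h) else 0) fun m w hw => by
    split_ifs with h
    · rw [LinearMap.smul_apply, LinearMap.comp_apply,
        (totClass_eq_zero_iff _ _).mpr (L.pairCocycle_of_boundary _ w hw), smul_zero]
    · rfl
  have hΞ : ∀ m n (h : m + n = d) f, Ξ (cohClass f) = homClass (contractionMap c h f) := by
    intro m n h f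
    obtain rfl : m = d - n := by omega
    refine (totLift_totClass _ _ n f).trans ?_
    rw [dif_pos (by omega)]
    rfl
  have hΥ : ∀ m n (h : m + n = d) w, Υ (homClass w) =
      (-1 : k) ^ (n + d * m) • cohClass (L.pairCocycle h w) := by
    intro m n h w
    obtain rfl : n = d - m := by omega
    refine (totLift_totClass _ _ m w).trans ?_
    rw [dif_pos (by omega)]
    rfl
  have h1 : Ξ ∘ₗ Υ = LinearMap.id := hom_ext fun m w => by
    rw [LinearMap.comp_apply, LinearMap.id_apply]
    rcases le_or_gt m d with h | h
    · have h' : m + (d - m) = d := by omega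
      rw [hΥ m _ h', map_smul, hΞ _ _ h', L.homClass_contraction_pairCocycle hc, smul_smul,
        sign_sq, one_smul]
    · rw [L.homClass_eq_zero_of_lt hc h w, map_zero, map_zero]
  have h2 : Υ ∘ₗ Ξ = LinearMap.id := coh_ext fun n f => by
    rw [LinearMap.comp_apply, LinearMap.id_apply]
    rcases le_or_gt n d with h | h
    · have h' : d - n + n = d := by omega
      rw [hΞ _ n h', hΥ _ _ h', L.cohClass_pairCocycle_contraction hc, ← cohClass_smul, ← cohClass_smul,
        smul_smul, ← pow_add]
      obtain ⟨m, rfl⟩ := Nat.exists_eq_add_of_le h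
      rw [Even.neg_one_pow, one_smul]
      rw [Nat.add_sub_cancel_left]
      have := Nat.even_mul_succ_self (n + m)
      -- For `d = n + m` the signs of the two composites agree, because the product of two
      -- consecutive integers is even.
      have e : n + (n + m) * m + (n + (n + m) * n + (n + m)) = 2 * n + (n + m) * (n + m + 1) := by ring
      rw [e]
      exact (even_two_mul n).add this
    · rw [L.cohClass_eq_zero_of_lt hc h f, map_zero, map_zero]
  refine ⟨(LinearEquiv.ofLinearMap Ξ Υ h1 h2).symm, ⟨fun i x hx => ?_, fun m n h f => ⟨_, hΞ m n h f⟩⟩,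
    fun m z => ?_⟩
  · rcases exists_totClass hx with rfl | ⟨n, f, rfl, rfl⟩
    · rw [map_zero]; exact zero_mem _
    · change Ξ (cohClass f) ∈ _
      rcases le_or_gt n d with h | h
      · rw [hΞ (d - n) n (by omega)]
        exact totClass_mem (Z := Cycles k A) (B := fun n => LinearMap.range (boundary k A n)) _ _ (by omega)
      · rw [L.cohClass_eq_zero_of_lt hc h f, map_zero]
        exact zero_mem _
  · rcases le_or_gt m d with h | h
    · have h' : m + (d - m) = d := by omega
      refine Or.inr ⟨d - m, h', (-1 : k) ^ (d - m + d * m) • L.pairCocycle h' z, ?_⟩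
      change Ξ _ = _
      rw [hΞ m _ h', map_smul, homClass_smul, L.homClass_contraction_pairCocycle hc, smul_smul,
        sign_sq, one_smul]
    · exact Or.inl (L.homClass_eq_zero_of_lt hc h z)

theorem exists_isBVAlgebra : ∃ (D : HHHomTot k A ≃ₗ[k] HHCohTot k A)
    (B : HHHomTot k A →ₗ[k] HHHomTot k A) (mul br : HHCohTot k A →ₗ[k] HHCohTot k A →ₗ[k] HHCohTot k A),
    IsDualityIso c D ∧ IsConnesOperator B ∧ IsCupProduct mul ∧ IsGerstenhaberBracket br ∧
    IsBVAlgebra (HHCohTot.deg k A) mul br (D.toLinearMap ∘ₗ B ∘ₗ D.symm.toLinearMap) := by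
  obtain ⟨D, hD, hs⟩ := L.exists_dualityIso hc
  obtain ⟨B, hB⟩ := exists_connesOperator k A
  -- The Connes operator raises the degree of `c` to `d + 1`, where homology vanishes.
  have hBc : B (homClass c) = 0 := by
    obtain ⟨h, e⟩ := hB d c
    rw [e, L.homClass_eq_zero_of_lt hc (Nat.lt_succ_self d)]
  obtain ⟨mul, br, h1, h2, h3⟩ := CalabiYau.exists_isBVAlgebra hD hB hBc hs
  exact ⟨D, B, mul, br, hD, hB, h1, h2, h3⟩

end BarPairing

end

end CalabiYau

namespace CalabiYau

noncomputable section

/-! ### Homology and quasi-isomorphisms in terms of elements -/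

section ElementwiseHomology

universe u

variable {R : Type u} [Ring R] {K L : ChainComplex (ModuleCat.{u} R) ℤ} {i j l : ℤ}

theorem d_apply_d (K : ChainComplex (ModuleCat.{u} R) ℤ) (i j l : ℤ) (x : K.X i) :
    (K.d j l).hom ((K.d i j).hom x) = 0 :=
  LinearMap.congr_fun (congrArg ModuleCat.Hom.hom (K.d_comp_d i j l)) x

theorem f_apply_d (f : K ⟶ L) (i j : ℤ) (x : K.X i) :
    (f.f j).hom ((K.d i j).hom x) = (L.d i j).hom ((f.f i).hom x) :=
  (LinearMap.congr_fun (congrArg ModuleCat.Hom.hom (f.comm i j)) x).symm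

def toCycle (K : ChainComplex (ModuleCat.{u} R) ℤ) (h : j + 1 = i) :
    LinearMap.ker (K.d i j).hom →ₗ[R] K.cycles i :=
  (K.liftCycles (ModuleCat.ofHom (LinearMap.ker (K.d i j).hom).subtype) j
    (ComplexShape.next_eq' _ h) (by ext x; exact x.2)).hom

theorem iCycles_toCycle (h : j + 1 = i) (x : LinearMap.ker (K.d i j).hom) :
    (K.iCycles i).hom (toCycle K h x) = x.1 :=
  LinearMap.congr_fun (congrArg ModuleCat.Hom.hom (K.liftCycles_i
    (ModuleCat.ofHom (LinearMap.ker (K.d i j).hom).subtype) j (ComplexShape.next_eq' _ h)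
    (by ext x; exact x.2))) x

theorem iCycles_injective : Function.Injective (K.iCycles i).hom :=
  (ModuleCat.mono_iff_injective (K.iCycles i)).mp inferInstance

/-- The homology class of a cycle. -/
def homologyClass (K : ChainComplex (ModuleCat.{u} R) ℤ) (h : j + 1 = i) :
    LinearMap.ker (K.d i j).hom →ₗ[R] K.homology i := (K.homologyπ i).hom ∘ₗ toCycle K h

theorem homologyClass_surjective (h : j + 1 = i) : Function.Surjective (homologyClass K h) := by
  intro y
  obtain ⟨c, rfl⟩ := (ModuleCat.epi_iff_surjective (K.homologyπ i)).mp inferInstance y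
  refine ⟨⟨(K.iCycles i).hom c, LinearMap.congr_fun (congrArg ModuleCat.Hom.hom (K.iCycles_d i j)) c⟩, ?_⟩
  exact congrArg (K.homologyπ i).hom (iCycles_injective (iCycles_toCycle h _))

theorem homologyClass_eq_zero_iff (h : j + 1 = i) (hl : i + 1 = l) (x : LinearMap.ker (K.d i j).hom) :
    homologyClass K h x = 0 ↔ ∃ y, x.1 = (K.d l i).hom y := by
  have htc : ∀ y, (K.iCycles i).hom ((K.toCycles l i).hom y) = (K.d l i).hom y :=
    LinearMap.congr_fun (congrArg ModuleCat.Hom.hom (K.toCycles_i l i))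
  have hex := ShortComplex.exact_of_g_is_cokernel
    (ShortComplex.mk _ _ (K.toCycles_comp_homologyπ l i))
    (K.homologyIsCokernel l i (ComplexShape.prev_eq' _ hl))
  rw [ShortComplex.moduleCat_exact_iff] at hex
  constructor
  · intro h0
    obtain ⟨y, hy⟩ := hex _ h0
    exact ⟨y, by
      rw [← iCycles_toCycle h, ← htc]
      exact congrArg (K.iCycles i).hom hy.symm⟩
  · rintro ⟨y, hy⟩
    have : toCycle K h x = (K.toCycles l i).hom y :=
      iCycles_injective (by rw [iCycles_toCycle, htc, hy])
    refine (congrArg (K.homologyπ i).hom this).trans ?_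
    exact LinearMap.congr_fun (congrArg ModuleCat.Hom.hom (K.toCycles_comp_homologyπ l i)) y

theorem homologyMap_homologyClass (f : K ⟶ L) (h : j + 1 = i) (x : LinearMap.ker (K.d i j).hom) :
    (HomologicalComplex.homologyMap f i).hom (homologyClass K h x) =
      homologyClass L h ⟨(f.f i).hom x.1, by
        rw [LinearMap.mem_ker, ← f_apply_d, x.2, map_zero]⟩ := by
  refine (LinearMap.congr_fun (congrArg ModuleCat.Hom.hom
    (HomologicalComplex.homologyπ_naturality f i)) _).trans ?_
  refine congrArg (L.homologyπ i).hom (iCycles_injective ?_)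
  refine (LinearMap.congr_fun (congrArg ModuleCat.Hom.hom
    (HomologicalComplex.cyclesMap_i f i)) _).trans ?_
  refine (congrArg (f.f i).hom (iCycles_toCycle h x)).trans ?_
  rw [iCycles_toCycle]

theorem exactAt_iff_elementwise (hj : j + 1 = i) (hl : i + 1 = l) :
    K.ExactAt i ↔ ∀ x, (K.d i j).hom x = 0 → ∃ y, x = (K.d l i).hom y := by
  rw [K.exactAt_iff' l i j (ComplexShape.prev_eq' _ hl) (ComplexShape.next_eq' _ hj),
    ShortComplex.moduleCat_exact_iff]
  exact forall₂_congr fun x _ => exists_congr fun y => eq_comm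

/-- Quasi-isomorphisms in terms of elements. -/
def IsElementwiseQuasiIso (f : K ⟶ L) : Prop := ∀ i j l, j + 1 = i → i + 1 = l →
    (∀ x y, (K.d i j).hom x = 0 → (f.f i).hom x = (L.d l i).hom y → ∃ z, x = (K.d l i).hom z) ∧
    ∀ y, (L.d i j).hom y = 0 → ∃ x z, (K.d i j).hom x = 0 ∧ y = (f.f i).hom x + (L.d l i).hom z

/-- The two halves are injectivity and surjectivity on homology, written with representatives. -/
theorem quasiIso_iff_elementwise (f : K ⟶ L) : QuasiIso f ↔ IsElementwiseQuasiIso f := by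
  rw [quasiIso_iff]
  constructor
  · intro hf i j l hj hl
    have hf := (quasiIsoAt_iff_isIso_homologyMap f i).mp (hf i)
    have hinj := (ModuleCat.mono_iff_injective (HomologicalComplex.homologyMap f i)).mp inferInstance
    have hsur := (ModuleCat.epi_iff_surjective (HomologicalComplex.homologyMap f i)).mp inferInstance
    refine ⟨fun x y hx hxy => ?_, fun y hy => ?_⟩
    · refine (homologyClass_eq_zero_iff hj hl ⟨x, hx⟩).mp (hinj ?_)
      refine (homologyMap_homologyClass f hj ⟨x, hx⟩).trans (Eq.trans ?_ (map_zero _).symm)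
      exact (homologyClass_eq_zero_iff hj hl _).mpr ⟨y, hxy⟩
    · obtain ⟨c, hc⟩ := hsur (homologyClass L hj ⟨y, hy⟩)
      obtain ⟨⟨x, hx⟩, rfl⟩ := homologyClass_surjective hj c
      have h1 := (homologyMap_homologyClass f hj ⟨x, hx⟩).symm.trans hc
      rw [← sub_eq_zero, ← map_sub] at h1
      obtain ⟨z, hz⟩ := (homologyClass_eq_zero_iff hj hl _).mp h1
      refine ⟨x, -z, hx, ?_⟩
      change (f.f i).hom x - y = _ at hz
      rw [map_neg, ← hz]
      abel
  · intro hf i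
    rw [quasiIsoAt_iff_isIso_homologyMap]
    obtain ⟨h1, h2⟩ := hf i (i - 1) (i + 1) (by omega) rfl
    have hj : i - 1 + 1 = i := by omega
    have hm : Mono (HomologicalComplex.homologyMap f i) := by
      rw [ModuleCat.mono_iff_injective, injective_iff_map_eq_zero]
      intro c hc
      obtain ⟨x, rfl⟩ := homologyClass_surjective hj c
      obtain ⟨y, hy⟩ := (homologyClass_eq_zero_iff hj rfl _).mp
        ((homologyMap_homologyClass f hj x).symm.trans hc)
      exact (homologyClass_eq_zero_iff hj rfl x).mpr (h1 x.1 y x.2 hy)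
    have he : Epi (HomologicalComplex.homologyMap f i) := by
      rw [ModuleCat.epi_iff_surjective]
      intro c
      obtain ⟨⟨y, hy⟩, rfl⟩ := homologyClass_surjective hj c
      obtain ⟨x, z, hx, hxz⟩ := h2 y hy
      refine ⟨homologyClass K hj ⟨x, hx⟩, (homologyMap_homologyClass f hj ⟨x, hx⟩).trans ?_⟩
      rw [← sub_eq_zero, ← map_sub, homologyClass_eq_zero_iff hj rfl]
      refine ⟨-z, ?_⟩
      change (f.f i).hom x - y = _
      rw [hxz, map_neg]
      abel
    exact isIso_of_mono_of_epi _

variable (hK : ∀ n : ℤ, n < 0 → Subsingleton (K.X n))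
include hK

/-- The source vanishes in negative degrees, so the only additional square is the one leaving degree
zero; this is the condition `h₀`. -/
theorem exists_hom_of_nat (f : ∀ n : ℕ, K.X n →ₗ[R] L.X n)
    (h : ∀ n x, (L.d ((n + 1 : ℕ) : ℤ) n).hom (f (n + 1) x) = f n ((K.d ((n + 1 : ℕ) : ℤ) n).hom x))
    (h₀ : ∀ x, (L.d 0 (-1)).hom (f 0 x) = 0) : ∃ F : K ⟶ L, ∀ n : ℕ, (F.f n).hom = f n := by
  let g : ∀ n : ℤ, K.X n ⟶ L.X n
    | .ofNat n => ModuleCat.ofHom (f n)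
    | .negSucc n => 0
  refine ⟨⟨g, fun i j hij => ?_⟩, fun n => rfl⟩
  obtain rfl : j + 1 = i := hij
  rcases j with n | n
  · ext x
    exact h n x
  · have h1 : K.d (Int.negSucc n + 1) (Int.negSucc n) = 0 := by
      have := hK (Int.negSucc n) (Int.negSucc_lt_zero n)
      ext x
      exact Subsingleton.elim _ _
    rw [h1, Limits.zero_comp]
    rcases n with _ | n
    · ext x
      exact h₀ x
    · exact Limits.zero_comp

theorem exists_homotopy_of_nat (F F' : K ⟶ L) (h : ∀ n : ℕ, K.X n →ₗ[R] L.X ((n + 1 : ℕ) : ℤ))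
    (h₀ : ∀ x, (F.f 0).hom x - (F'.f 0).hom x = (L.d ((0 + 1 : ℕ) : ℤ) ((0 : ℕ) : ℤ)).hom (h 0 x))
    (h₁ : ∀ (n : ℕ) x, (F.f ((n + 1 : ℕ) : ℤ)).hom x - (F'.f ((n + 1 : ℕ) : ℤ)).hom x =
      (L.d ((n + 1 + 1 : ℕ) : ℤ) ((n + 1 : ℕ) : ℤ)).hom (h (n + 1) x) +
        h n ((K.d ((n + 1 : ℕ) : ℤ) n).hom x)) : Nonempty (Homotopy F F') := by
  let g : ∀ n : ℤ, K.X n ⟶ L.X (n + 1)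
    | .ofNat n => ModuleCat.ofHom (h n)
    | .negSucc n => 0
  let G : ∀ i j : ℤ, K.X i ⟶ L.X j := fun i j =>
    if hij : i + 1 = j then g i ≫ (L.XIsoOfEq hij).hom else 0
  have hG : ∀ i, G i (i + 1) = g i := fun i => by
    dsimp only [G]
    rw [dif_pos rfl, HomologicalComplex.XIsoOfEq_rfl, Iso.refl_hom, Category.comp_id]
  refine ⟨⟨G, fun i j hij => dif_neg hij, fun i => ?_⟩⟩
  rw [prevD_eq G (j := i) (j' := i + 1) rfl, hG]
  rcases i with n | n
  · rcases n with _ | n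
    · have h1 : dNext (Int.ofNat 0) G = 0 := by
        rw [dNext_eq G (i := Int.ofNat 0) (i' := -1) (show (-1 : ℤ) + 1 = 0 from rfl)]
        have := hK (-1) (by omega)
        have h2 : K.d (Int.ofNat 0) (-1) = 0 := by
          ext x
          exact Subsingleton.elim _ _
        rw [h2, Limits.zero_comp]
      rw [h1, zero_add]
      ext x
      exact sub_eq_iff_eq_add.mp (h₀ x)
    · rw [dNext_eq G (i := Int.ofNat (n + 1)) (i' := Int.ofNat n) rfl]
      have h2 : G (Int.ofNat n) (Int.ofNat (n + 1)) = g (Int.ofNat n) := hG (Int.ofNat n)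
      rw [h2]
      ext x
      refine (sub_eq_iff_eq_add.mp (h₁ n x)).trans ?_
      rw [add_comm ((L.d _ _).hom _)]
      rfl
  · have := hK (Int.negSucc n) (Int.negSucc_lt_zero n)
    ext x
    rw [Subsingleton.elim x 0, map_zero, map_zero]

omit hK in
/-- In a complex of projectives which is exact in negative degrees and bounded below, the cycles of
degree zero are a direct summand. -/
theorem exists_cycle_projection (hp : ∀ n, Module.Projective R (L.X n)) (N : ℕ)
    (hN : ∀ n : ℤ, n < -N → Subsingleton (L.X n))
    (hL : ∀ i j : ℤ, i < 0 → j + 1 = i → ∀ x, (L.d i j).hom x = 0 → ∃ y, x = (L.d (i + 1) i).hom y) :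
    ∃ p : L.X 0 →ₗ[R] L.X 0, (∀ x, (L.d 0 (-1)).hom (p x) = 0) ∧
      ∀ x, (L.d 0 (-1)).hom x = 0 → p x = x := by
  -- The induction climbs from degree `-N - 1`, where the complex vanishes, and splits off the
  -- cycles one degree at a time.
  have key : ∀ n : ℤ, -N - 1 ≤ n → n ≤ 0 → ∃ p : L.X n →ₗ[R] L.X n, ∀ j : ℤ, j + 1 = n →
      (∀ x, (L.d n j).hom (p x) = 0) ∧ ∀ x, (L.d n j).hom x = 0 → p x = x := by
    intro n hn
    induction n, hn using Int.leInduction with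
    | base =>
      intro _
      have := hN (-N - 1) (by omega)
      exact ⟨0, fun j _ => ⟨fun x => by rw [LinearMap.zero_apply, map_zero],
        fun x _ => Subsingleton.elim _ _⟩⟩
    | succ n hn ih =>
      intro hn0
      obtain ⟨p, hpn⟩ := ih (by omega)
      obtain ⟨h1, h2⟩ := hpn (n - 1) (by omega)
      -- The cycles of degree `n` are boundaries, so their projection lifts through the
      -- differential; subtracting this lift from the identity projects onto the cycles of degree `n
      -- + 1`.
      obtain ⟨s, hs⟩ := exists_lift_range (L.d (n + 1) n).hom p fun x => by
        obtain ⟨y, hy⟩ := hL n (n - 1) (by omega) (by omega) (p x) (h1 x)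
        exact ⟨y, hy.symm⟩
      refine ⟨LinearMap.id - s ∘ₗ (L.d (n + 1) n).hom, fun j hj => ?_⟩
      obtain rfl : j = n := by omega
      refine ⟨fun x => ?_, fun x hx => ?_⟩
      · rw [LinearMap.sub_apply, map_sub, LinearMap.comp_apply, hs, h2 _ (d_apply_d L _ _ _ x),
          LinearMap.id_apply, sub_self]
      · rw [LinearMap.sub_apply, LinearMap.comp_apply, hx, map_zero, LinearMap.id_apply, sub_zero]
  obtain ⟨p, hp⟩ := key 0 (by omega) le_rfl
  exact ⟨p, hp (-1) rfl⟩

variable {M : Type*} [AddCommGroup M] [Module R M] {ε : K.X 0 →ₗ[R] M}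
  (hε : Function.Exact (K.d 1 0).hom ε) {ψ : K ⟶ L} (hψ : IsElementwiseQuasiIso ψ)
include hε hψ

/-- The augmentation extends along a quasi-isomorphism to a bounded complex of projectives. -/
theorem exists_augmentation (hp : ∀ n, Module.Projective R (L.X n)) (N : ℕ)
    (hN : ∀ n : ℤ, n < -N → Subsingleton (L.X n)) : ∃ z : L.X 0 →ₗ[R] M,
    (∀ y, z ((L.d 1 0).hom y) = 0) ∧ ∀ q, z ((ψ.f 0).hom q) = ε q := by
  obtain ⟨p, h1, h2⟩ := exists_cycle_projection hp N hN fun i j hi hj x hx => by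
    obtain ⟨q, y, _, hy⟩ := (hψ i j (i + 1) hj rfl).2 x hx
    have := hK i hi
    exact ⟨y, by rw [hy, Subsingleton.elim q 0, map_zero, zero_add]⟩
  have hψ0 := hψ 0 (-1) 1 rfl rfl
  have hK0 : ∀ q : K.X 0, (K.d 0 (-1)).hom q = 0 := fun q => by
    have := hK (-1) (by omega)
    exact Subsingleton.elim _ _
  have hψc : ∀ q, (L.d 0 (-1)).hom ((ψ.f 0).hom q) = 0 := fun q => by
    rw [← f_apply_d, hK0, map_zero]
  -- Every cycle is the image of an element of `K` plus a boundary. Projectivity chooses such a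
  -- decomposition linearly for the projected element.
  obtain ⟨s, hs⟩ := exists_lift_range (LinearMap.coprod (ψ.f 0).hom (L.d 1 0).hom) p fun x => by
    obtain ⟨q, y, _, hy⟩ := hψ0.2 (p x) (h1 x)
    exact ⟨(q, y), hy.symm⟩
  -- The augmentation of the first component does not depend on the decomposition: two choices
  -- differ by an element which maps to a boundary, hence is itself one.
  have key : ∀ q y x, p x = (ψ.f 0).hom q + (L.d 1 0).hom y →
      ε (s x).1 = ε q := by
    intro q y x hx
    have h3 := hs x
    rw [LinearMap.coprod_apply, hx] at h3
    obtain ⟨w, hw⟩ := hψ0.1 ((s x).1 - q) (y - (s x).2) (hK0 _) (by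
      rw [map_sub, map_sub, sub_eq_sub_iff_add_eq_add, h3, add_comm])
    rw [← sub_eq_zero, ← map_sub, hw]
    exact (hε _).mpr ⟨w, rfl⟩
  refine ⟨ε ∘ₗ LinearMap.fst R _ _ ∘ₗ s, fun y => ?_, fun q => ?_⟩
  · refine (key 0 y _ ?_).trans (map_zero ε)
    rw [map_zero, zero_add, h2 _ (d_apply_d L _ _ _ y)]
  · refine key q 0 _ ?_
    rw [h2 _ (hψc q), map_zero, add_zero]

/-- A morphism to the target of a quasi-isomorphism is determined by its augmentation. -/
theorem homotopy_of_augmentation (hp : ∀ n, Module.Projective R (K.X n))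
    (hex : ∀ n : ℤ, 0 < n → K.ExactAt n) {z : L.X 0 →ₗ[R] M}
    (hz : ∀ y, z ((L.d 1 0).hom y) = 0) (hzψ : ∀ q, z ((ψ.f 0).hom q) = ε q) (F F' : K ⟶ L)
    (h : ∀ q, z ((F.f 0).hom q) = z ((F'.f 0).hom q)) : Nonempty (Homotopy F F') := by
  have hK0 : ∀ q : K.X 0, (K.d 0 (-1)).hom q = 0 := fun q => by
    have := hK (-1) (by omega)
    exact Subsingleton.elim _ _
  obtain ⟨t, h0, h1⟩ := exists_homotopy (P := fun n : ℕ => K.X n) (N := fun n : ℕ => L.X n)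
    (dP := fun n => (K.d ((n + 1 : ℕ) : ℤ) n).hom) (dN := fun n => (L.d ((n + 1 : ℕ) : ℤ) n).hom)
    (fun n => hp n) (fun n x => d_apply_d K _ _ _ x)
    (fun n y => ⟨fun hy => by
      obtain ⟨q, w, hq, hw⟩ := (hψ ((n + 1 : ℕ) : ℤ) n ((n + 1 + 1 : ℕ) : ℤ) rfl rfl).2 y hy
      obtain ⟨q', rfl⟩ := (exactAt_iff_elementwise (i := ((n + 1 : ℕ) : ℤ))
        (j := n) (l := ((n + 1 + 1 : ℕ) : ℤ)) rfl rfl).mp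
        (hex ((n + 1 : ℕ) : ℤ) (by omega)) q hq
      exact ⟨(ψ.f _).hom q' + w, by rw [map_add, ← f_apply_d, hw]⟩,
      fun ⟨w, hw⟩ => by rw [← hw]; exact d_apply_d L _ _ _ w⟩)
    (fun n => (F.f n).hom - (F'.f n).hom)
    (fun n x => by
      rw [LinearMap.sub_apply, LinearMap.sub_apply, map_sub]
      exact (congrArg₂ _ (f_apply_d F _ _ x) (f_apply_d F' _ _ x)).symm)
    (fun x => by
      have hc : (L.d 0 (-1)).hom ((F.f 0).hom x - (F'.f 0).hom x) = 0 := by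
        rw [map_sub, ← f_apply_d, ← f_apply_d, hK0, map_zero, map_zero, sub_self]
      -- The difference is a cycle, so it is `ψ q` plus a boundary. Since `z` kills the difference
      -- and every boundary, `q` has augmentation zero and is a boundary too.
      obtain ⟨q, y, _, hy⟩ := (hψ 0 (-1) 1 rfl rfl).2 _ hc
      have h3 : ε q = 0 := by
        rw [← hzψ, ← add_zero (z _), ← hz y, ← map_add, ← hy, map_sub, h, sub_self, hz]
      obtain ⟨q', rfl⟩ := (hε q).mp h3
      refine ⟨(ψ.f 1).hom q' + y, ?_⟩
      refine (map_add (L.d 1 0).hom _ _).trans ?_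
      rw [← f_apply_d, ← hy]
      rfl)
  exact exists_homotopy_of_nat hK F F' t h0 h1

end ElementwiseHomology

end

end CalabiYau

namespace CalabiYau

noncomputable section

/-! ### Duals of finitely generated projectives and sesquilinear pairings -/

section DualModules

universe u

variable {R : Type u} [Ring R]

theorem exists_dual_basis (P : Type*) [AddCommGroup P] [Module R P] [Module.Projective R P]
    [Module.Finite R P] : ∃ (N : ℕ) (e : Fin N → P) (φ : Fin N → P →ₗ[R] R),
      ∀ x, x = ∑ j, φ j x • e j := by
  obtain ⟨N, f, hf⟩ := Module.Finite.exists_fin' R P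
  obtain ⟨s, hs⟩ := Module.projective_lifting_property f LinearMap.id hf
  refine ⟨N, fun j => f (Pi.single j 1), fun j => LinearMap.proj j ∘ₗ s, fun x => ?_⟩
  refine (LinearMap.congr_fun hs x).symm.trans ?_
  change f (s x) = ∑ j, s x j • f (Pi.single j 1)
  simp only [← map_smul, ← map_sum]
  congr 1
  funext i
  simp [Finset.sum_apply, Pi.single_apply]

theorem projective_of_dual_basis {P : Type*} [AddCommGroup P] [Module R P] {N : ℕ} (e : Fin N → P)
    (φ : Fin N → P →ₗ[R] R) (h : ∀ x, x = ∑ j, φ j x • e j) :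
    Module.Projective R P ∧ Module.Finite R P := by
  have hs : (Fintype.linearCombination R e) ∘ₗ LinearMap.pi φ = LinearMap.id :=
    LinearMap.ext fun x => (h x).symm
  exact ⟨Module.Projective.of_split _ _ hs, Module.Finite.of_surjective (Fintype.linearCombination R e)
    (Function.RightInverse.surjective (LinearMap.congr_fun hs))⟩

variable (τ : AntiInvolution R)

theorem dualObj.toLin_sum {P : ModuleCat.{u} R} {J : Type*} (s : Finset J) (f : J → dualObj τ P)
    (x : P) : dualObj.toLin τ (∑ j ∈ s, f j) x = ∑ j ∈ s, dualObj.toLin τ (f j) x :=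
  map_sum (AddMonoidHom.mk' (fun f : dualObj τ P => dualObj.toLin τ f x) fun _ _ => rfl) f s

theorem dual_expansion {P : ModuleCat.{u} R} {N : ℕ} {e : Fin N → P}
    {φ : Fin N → P →ₗ[R] R} (h : ∀ x, x = ∑ j, φ j x • e j) (f : dualObj τ P) :
    f = ∑ j, τ.conj (dualObj.toLin τ f (e j)) • dualObj.ofLin τ (φ j) := by
  refine dualObj.ext fun x => ?_
  rw [dualObj.toLin_sum]
  refine (congrArg (dualObj.toLin τ f) (h x)).trans ?_
  rw [map_sum]
  refine Finset.sum_congr rfl fun j _ => ?_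
  rw [map_smul, dualObj.toLin_smul, τ.conj_conj]
  rfl

theorem dual_projective (P : ModuleCat.{u} R) [Module.Projective R P] [Module.Finite R P] :
    Module.Projective R (dualObj τ P) ∧ Module.Finite R (dualObj τ P) := by
  obtain ⟨N, e, φ, h⟩ := exists_dual_basis (R := R) P
  exact projective_of_dual_basis (fun j => dualObj.ofLin τ (φ j)) (fun j =>
    { toFun := fun f => τ.conj (dualObj.toLin τ f (e j))
      map_add' := fun f g => by rw [dualObj.toLin_add, τ.conj_add]
      map_smul' := fun r f => by
        rw [dualObj.toLin_smul, τ.conj_mul, τ.conj_conj]; rfl }) (dual_expansion τ h)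

variable {τ} {d : ℤ} {Q : ChainComplex (ModuleCat.{u} R) ℤ} (ψ : Q ⟶ dualShift τ d Q) {i j i' j' : ℤ}

theorem units_smul_apply {M N : ModuleCat.{u} R} (s : ℤˣ) (f : M ⟶ N) (x : M) :
    (s • f).hom x = s • f.hom x := by
  rcases Int.units_eq_one_or s with rfl | rfl <;> simp

theorem dualShift_d_apply (i j : ℤ) (f : (dualShift τ d Q).X i) :
    ((dualShift τ d Q).d i j).hom f =
      (i + 1).negOnePow • (dualMap τ (Q.d (d - j) (d - i))).hom f := units_smul_apply _ _ _

theorem units_smul_toLin {M : ModuleCat.{u} R} (s : ℤˣ) (f : dualObj τ M) (x : M) :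
    dualObj.toLin τ (s • f) x = s • dualObj.toLin τ f x := by
  rcases Int.units_eq_one_or s with rfl | rfl
  · simp
  · simp only [Units.neg_smul, one_smul]; rfl

/-- The sesquilinear pairing given by a morphism from a complex to its shifted dual. -/
def pairing (h : i + j = d) (x : Q.X i) : Q.X j →ₗ[R] R :=
  dualObj.toLin τ ((ψ.f i).hom x) ∘ₗ (Q.XIsoOfEq (show j = d - i by omega)).hom.hom

theorem pairing_add (h : i + j = d) (x x' : Q.X i) (y : Q.X j) :
    pairing ψ h (x + x') y = pairing ψ h x y + pairing ψ h x' y := by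
  rw [pairing, map_add]; rfl

theorem pairing_zero (h : i + j = d) (y : Q.X j) : pairing ψ h 0 y = 0 := by
  rw [pairing, map_zero]; rfl

theorem pairing_smul (h : i + j = d) (r : R) (x : Q.X i) (y : Q.X j) :
    pairing ψ h (r • x) y = pairing ψ h x y * τ.conj r := by
  rw [pairing, map_smul]; rfl

theorem pairing_comm (hi : i + 1 = i') (hj : j + 1 = j') (h : i + j' = d) (x : Q.X i') (y : Q.X j') :
    pairing ψ h ((Q.d i' i).hom x) y =
      i.negOnePow • pairing ψ (show i' + j = d by omega) x ((Q.d j' j).hom y) := by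
  obtain rfl : j' = d - i := by omega
  obtain rfl : j = d - i' := by omega
  have hs : (i' + 1).negOnePow = i.negOnePow := by
    rw [← hi, Int.negOnePow_succ, Int.negOnePow_succ, neg_neg]
  rw [pairing, pairing, f_apply_d, dualShift_d_apply, LinearMap.comp_apply, units_smul_toLin, hs]
  rfl

theorem pairing_transpose (h : i + j = d) (x : Q.X i) (y : Q.X j) :
    pairing (bidualShift τ d Q ≫ dualShiftMap τ d ψ) h x y =
      (i * j + d).negOnePow • τ.conj (pairing ψ (show j + i = d by omega) y x) := by
  obtain rfl : j = d - i := by omega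
  change dualObj.toLin τ ((dualMap τ (ψ.f (d - i))).hom (((i * (d - i) + d).negOnePow •
    ((Q.XIsoOfEq _).hom ≫ bidual τ (Q.X (d - (d - i))))).hom x)) y = _
  rw [units_smul_apply]
  exact units_smul_toLin (M := dualObj τ (Q.X (d - (d - i)))) _ _ _

end DualModules

end

end CalabiYau

namespace CalabiYau

noncomputable section

/-! ### Augmentations of the dual complex -/

section Augmentation

universe u

theorem exists_comparison {R : Type*} [Ring R] {P N : ℕ → Type*} [∀ n, AddCommGroup (P n)]
    [∀ n, Module R (P n)] [∀ n, AddCommGroup (N n)] [∀ n, Module R (N n)]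
    {dP : ∀ n, P (n + 1) →ₗ[R] P n} {dN : ∀ n, N (n + 1) →ₗ[R] N n} {M : Type*} [AddCommGroup M]
    [Module R M] (hP : ∀ n, Module.Projective R (P n)) (hd : ∀ n x, dP n (dP (n + 1) x) = 0)
    (hN : ∀ n, Function.Exact (dN (n + 1)) (dN n)) (εP : P 0 →ₗ[R] M) (hε : ∀ x, εP (dP 0 x) = 0)
    (εN : N 0 →ₗ[R] M) (hN₀ : Function.Exact (dN 0) εN) (hs : Function.Surjective εN) :
    ∃ f : ∀ n, P n →ₗ[R] N n, (∀ x, εN (f 0 x) = εP x) ∧ ∀ n x, dN n (f (n + 1) x) = f n (dP n x) := by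
  obtain ⟨f₀, h₀⟩ := Module.projective_lifting_property εN εP hs
  have h₀ : ∀ x, εN (f₀ x) = εP x := LinearMap.congr_fun h₀
  obtain ⟨f, rfl, hf⟩ := exists_chainMap hP hd hN f₀ fun x => (hN₀ _).mp (by rw [h₀, hε])
  exact ⟨f, h₀, hf⟩

variable {R : Type u} [Ring R] {M : Type*} [AddCommGroup M] [Module R M]
  (Q : FiniteProjectiveResolution R M) {τ : AntiInvolution R} {d : ℕ}

namespace FiniteProjectiveResolution

theorem subsingleton {n : ℤ} (h : n < 0) : Subsingleton (Q.complex.X n) := by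
  obtain ⟨N, hN⟩ := Q.bounded
  exact hN n (Or.inl h)

theorem exact (n : ℕ) : Function.Exact (Q.complex.d ((n + 1 + 1 : ℕ) : ℤ) ((n + 1 : ℕ) : ℤ)).hom
    (Q.complex.d ((n + 1 : ℕ) : ℤ) n).hom := fun x =>
  ⟨fun hx => by
    obtain ⟨y, hy⟩ := (exactAt_iff_elementwise (K := Q.complex) (j := n) (i := ((n + 1 : ℕ) : ℤ))
      (l := ((n + 1 + 1 : ℕ) : ℤ)) (by omega) (by omega)).mp (Q.exactAt _ (by omega)) x hx
    exact ⟨y, hy.symm⟩, by rintro ⟨y, rfl⟩; exact d_apply_d _ _ _ _ y⟩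

theorem dual_subsingleton : ∃ N : ℕ, ∀ n : ℤ, n < -N →
    Subsingleton ((dualShift τ d Q.complex).X n) := by
  obtain ⟨N, hN⟩ := Q.bounded
  refine ⟨N.toNat, fun n hn => ⟨fun f g => dualObj.ext fun x => ?_⟩⟩
  have := hN (d - n) (Or.inr (by omega))
  rw [Subsingleton.elim x 0, map_zero, map_zero]

end FiniteProjectiveResolution

/-- Modulo boundaries, which `z` kills, every element of degree zero is a multiple of `q₁`, so
agreement at `q₁` is enough. -/
theorem eq_of_augmentation {K L : ChainComplex (ModuleCat.{u} R) ℤ} {ε : K.X 0 →ₗ[R] M}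
    (hε : Function.Exact (K.d 1 0).hom ε) {z : L.X 0 →ₗ[R] M}
    (hz : ∀ y, z ((L.d 1 0).hom y) = 0) (F F' : K ⟶ L) {q₁ : K.X 0}
    (hq : ∀ m : M, ∃ r : R, r • ε q₁ = m) (h : z ((F.f 0).hom q₁) = z ((F'.f 0).hom q₁)) (q : K.X 0) :
    z ((F.f 0).hom q) = z ((F'.f 0).hom q) := by
  obtain ⟨r, hr⟩ := hq (ε q)
  obtain ⟨y, hy⟩ := (hε (q - r • q₁)).mp (by rw [map_sub, map_smul, hr, sub_self])
  obtain rfl : q = (K.d 1 0).hom y + r • q₁ := by rw [hy, sub_add_cancel]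
  rw [map_add, map_add, map_add, map_add, f_apply_d, f_apply_d, hz, hz, map_smul, map_smul, map_smul,
    map_smul, h]

/-- The augmentation extends along a quasi-isomorphism to the dual, and determines morphisms to the
dual up to homotopy. -/
theorem exists_dual_augmentation (ψ : Q.complex ⟶ dualShift τ d Q.complex) (hψ : QuasiIso ψ) :
    ∃ z : dualObj τ (Q.complex.X d) →ₗ[R] M,
      (∀ j : ℤ, j + 1 = d → ∀ f, z ((dualMap τ (Q.complex.d d j)).hom f) = 0) ∧
      (∀ q, z (dualObj.ofLin τ (pairing ψ (zero_add (d : ℤ)) q)) = Q.augmentation q) ∧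
      ∀ (F : Q.complex ⟶ dualShift τ d Q.complex) (q₁ : Q.complex.X 0),
        (∀ m : M, ∃ r : R, r • Q.augmentation q₁ = m) →
        z (dualObj.ofLin τ (pairing F (zero_add (d : ℤ)) q₁)) = Q.augmentation q₁ →
        Nonempty (Homotopy F ψ) := by
  obtain ⟨N, hN⟩ := Q.dual_subsingleton (τ := τ) (d := d)
  have hψ := (quasiIso_iff_elementwise ψ).mp hψ
  have := Q.projective
  have := Q.finite
  obtain ⟨z, hz, hzψ⟩ := exists_augmentation (fun n hn => Q.subsingleton hn) Q.exact_augmentation hψ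
    (fun n => (dual_projective τ (Q.complex.X (d - n))).1) N hN
  refine ⟨z, fun j hj f => ?_, hzψ, fun F q₁ hq h => ?_⟩
  · obtain rfl : j = d - 1 := by omega
    have h1 := (congrArg z (dualShift_d_apply (Q := Q.complex) 1 0 f)).symm.trans (hz f)
    rwa [show ((1 : ℤ) + 1).negOnePow = 1 from rfl, one_smul] at h1
  · exact homotopy_of_augmentation (fun n hn => Q.subsingleton hn) Q.exact_augmentation hψ Q.projective
      Q.exactAt hz hzψ F ψ (eq_of_augmentation Q.exact_augmentation hz F ψ hq (h.trans (hzψ q₁).symm))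

end Augmentation

section DualNaturality

universe u

variable {R : Type u} [Ring R] {τ : AntiInvolution R} {P P' : ModuleCat.{u} R} {N N' : ℕ}
  {e : Fin N → P} {φ : Fin N → P →ₗ[R] R} {e' : Fin N' → P'} {φ' : Fin N' → P' →ₗ[R] R}
  {M V W : Type*} [AddCommGroup M] [Module R M] [AddCommGroup V] [Module R V] [AddCommGroup W]

/-- The canonical element of `P ⊗ P^∨` is natural in `P`. -/
theorem sum_dual_naturality (h : ∀ x, x = ∑ j, φ j x • e j) (h' : ∀ x, x = ∑ j, φ' j x • e' j)
    (z : dualObj τ P →ₗ[R] M) (β : P ⟶ P') (g : P' →ₗ[R] V) (b : M →+ V →+ W)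
    (hb : ∀ m r v, b m (r • v) = b (τ.conj r • m) v) :
    ∑ j, b (z (dualObj.ofLin τ (φ j))) (g (β.hom (e j))) =
      ∑ i, b (z ((dualMap τ β).hom (dualObj.ofLin τ (φ' i)))) (g (e' i)) := by
  have h1 : ∀ i, z ((dualMap τ β).hom (dualObj.ofLin τ (φ' i))) =
      ∑ j, τ.conj (φ' i (β.hom (e j))) • z (dualObj.ofLin τ (φ j)) := fun i => by
    rw [dual_expansion τ h ((dualMap τ β).hom (dualObj.ofLin τ (φ' i))), map_sum]
    exact Finset.sum_congr rfl fun j _ => map_smul _ _ _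
  simp only [h1, map_sum, AddMonoidHom.finsetSum_apply, ← hb]
  rw [Finset.sum_comm]
  refine Finset.sum_congr rfl fun j _ => ?_
  conv_lhs => rw [h' (β.hom (e j)), map_sum, map_sum]
  simp only [map_smul]

end DualNaturality

end

end CalabiYau

namespace CalabiYau

noncomputable section

universe u v

/-! ### From a self-pairing of a finite resolution to a fundamental cycle -/

section BarTensor

variable {k : Type*} [Field k] {A : Type*} [Ring A] [Algebra k A]

theorem barGen_ofFn {n : ℕ} (a : Fin n → A) : barGen k n (List.ofFn a) = barTensor k A n a :=
  wordOf_ofFn _ _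

theorem barD_barTensor (n : ℕ) (a : Fin (n + 1) → A) :
    barD k A n (barTensor k A (n + 1) a) = leftAct k (a 0) • barTensor k A n (Fin.tail a) +
      ∑ i : Fin n, (-1 : ℤ) ^ (i.1 + 1) •
        barTensor k A n (insertArgs (mulCochain k A) i.1 i.2 (by omega) a) +
      (-1 : ℤ) ^ (n + 1) • rightAct k (a (Fin.last n)) • barTensor k A n (Fin.init a) := by
  have hz : ∀ (m : ℕ) (x : Bar k A n), (-1 : ℤ) ^ m • x = (-1 : k) ^ m • x := fun m x => by
    rcases neg_one_pow_eq_or ℤ m with h | h <;> rcases Nat.even_or_odd m with h' | h' <;>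
      simp_all [h'.neg_one_pow]
  have h3 := sum_insertion (barTensor k A n) (mulCochain k A) (-1) (p := n + 1) (by omega) a
  rw [wordOf_mulCochain] at h3
  simp only [insertion_apply] at h3
  rw [← barGen_ofFn, barD_gen (by simp), bimodDelta, barWord]
  congr 1
  · rw [sub_eq_add_neg]
    congr 1
    · rw [List.ofFn_succ, cutSum_letter_cons (Φ := fun b v => leftAct k b • barGen k n v)
        fun v => leftAct_zero_smul _, barGen_ofFn]
      rfl
    · refine (congrArg Neg.neg h3.symm).trans ?_
      rw [← Finset.sum_neg_distrib]
      exact Finset.sum_congr rfl fun i _ => by rw [hz, pow_succ, mul_neg_one, neg_smul]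
  · rw [List.ofFn_succ', List.concat_eq_append, cutSum_letter_concat
      (Φ := fun u b => (-1 : k) ^ (u.length + 1) • rightAct k b • barGen k n u)
      fun u => by rw [rightAct_zero_smul, smul_zero], barGen_ofFn, hz, List.length_ofFn]
    rfl

theorem eval_barTrace {W : Type*} [AddCommGroup W] [Module k W] {φ : List A → W}
    (hφ : IsMulti k φ) (n : ℕ) (a : A) (b : Bar k A n) :
    hφ.eval n (barTrace (chainWord_isMulti (k := k) (n := n)) a n b) = barTrace hφ a n b := by
  induction b using bar_induction' with
  | h₁ r l hl =>
    rw [barTrace_smul_gen _ _ _ hl, barTrace_smul_gen _ _ _ hl, eval_chainWord _ _ (by simp [hl])]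
  | h₂ b c hb hc => rw [map_add, map_add, map_add, hb, hc]

theorem boundary_barTrace (n : ℕ) (a : A) (b : Bar k A (n + 1)) :
    boundary k A n (barTrace (chainWord_isMulti (k := k) (n := n + 1)) a (n + 1) b) =
      barTrace (chainWord_isMulti (k := k) (n := n)) a n (barD k A n b) := by
  rw [← eval_chainWord_self (boundary k A n _), eval_boundary, eval_barTrace, barTrace_barD]

/-- `barTrace` as a biadditive map. -/
def barTraceHom {W : Type*} [AddCommGroup W] [Module k W] {φ : List A → W} (hφ : IsMulti k φ)
    (n : ℕ) : A →+ Bar k A n →+ W :=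
  AddMonoidHom.mk' (fun a => (barTrace hφ a n).toAddMonoidHom) fun a a' =>
    AddMonoidHom.ext fun b => barTrace_add hφ a a' b

end BarTensor

section Pairing

variable {k : Type u} [Field k] {A : Type v} [Ring A] [Algebra k A] {d : ℕ}
  {K : ChainComplex (ModuleCat.{v} (Env k A)) ℤ} (hK : Subsingleton (K.X (-1)))
  (θ : ∀ n : ℕ, Bar k A n →ₗ[Env k A] K.X (n : ℤ))
  (hθ : ∀ n x, (K.d ((n + 1 : ℕ) : ℤ) n).hom (θ (n + 1) x) = θ n (barD k A n x))
  (F : K ⟶ dualShift (flip k A) d K)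

theorem negOnePow_smul {V : Type*} [AddCommGroup V] [Module k V] (n : ℕ) (x : V) :
    (n : ℤ).negOnePow • x = (-1 : k) ^ n • x :=
  sgn_smul_eq (by simp) x

/-- The pairing of the bar resolution with itself which is induced by a pairing on `K`. -/
def barLeft (m n : ℕ) (x : Bar k A m) : Bar k A n →ₗ[Env k A] Env k A :=
  if h : (m : ℤ) + n = d then pairing F h (θ m x) ∘ₗ θ n else 0

theorem barLeft_eq {m n : ℕ} (h : (m : ℤ) + n = d) (x : Bar k A m) (y : Bar k A n) :
    barLeft θ F m n x y = pairing F h (θ m x) (θ n y) := by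
  rw [barLeft, dif_pos h, LinearMap.comp_apply]

include hK in
-- Moving the differential to the other argument lands in degree `-1`, where the complex is zero.
theorem pairing_d_eq_zero (q : K.X 0) (y : K.X ((d + 1 : ℕ) : ℤ)) :
    pairing F (zero_add (d : ℤ)) q ((K.d ((d + 1 : ℕ) : ℤ) d).hom y) = 0 := by
  have h := pairing_comm F (i := -1) (i' := 0) (j := d) (j' := ((d + 1 : ℕ) : ℤ)) rfl rfl
    (by push_cast; ring) q y
  rw [Subsingleton.elim ((K.d 0 (-1)).hom q) 0, pairing_zero] at h
  exact (smul_eq_zero_iff_eq _).mp h.symm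

/-- The pairing of the bar resolution with itself which is induced by a pairing on `K`. -/
def barPairing : BarPairing k A d where
  left := barLeft θ F
  right m n y :=
    { toFun := fun x => (flip k A).conj (barLeft θ F m n x y)
      map_add' := fun x x' => by
        unfold barLeft
        split_ifs with h
        · simp only [LinearMap.comp_apply, map_add, pairing_add, AntiInvolution.conj_add]
        · simp [AntiInvolution.conj]
      map_smul' := fun r x => by
        unfold barLeft
        split_ifs with h
        · simp only [LinearMap.comp_apply, map_smul, pairing_smul, AntiInvolution.conj_mul,
            AntiInvolution.conj_conj, RingHom.id_apply, smul_eq_mul]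
        · simp [AntiInvolution.conj] }
  conj_left _ _ _ _ := rfl
  comm m n x y h := by
    rw [barLeft_eq θ F (by omega), barLeft_eq θ F (by push_cast; omega), ← hθ, ← hθ,
      pairing_comm F (i := m) (j := n) (j' := ((n + 1 : ℕ) : ℤ)) (by push_cast; ring)
        (by push_cast; ring) (by omega), negOnePow_smul (k := k)]
  left_zero x y := by
    have h := pairing_comm F (i := d) (i' := ((d + 1 : ℕ) : ℤ)) (j := -1) (j' := 0) rfl rfl
      (add_zero _) (θ (d + 1) x) (θ 0 y)
    rw [Subsingleton.elim ((K.d 0 (-1)).hom _) 0, map_zero, smul_zero, hθ] at h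
    exact (barLeft_eq θ F (add_zero _) _ _).trans h
  right_zero x y := by rw [barLeft_eq θ F (zero_add _), ← hθ, pairing_d_eq_zero hK]

end Pairing

section Cycle

attribute [local instance] TensorProduct.Algebra.module

variable {k : Type u} [Field k] {A : Type v} [Ring A] [Algebra k A] {d : ℕ}

theorem barTrace_twist {n : ℕ} (F : Bar k A n →ₗ[Env k A] Env k A)
    (h : IsMulti k (twistWord fun l => F (barGen k n l))) (a : A) (b : Bar k A n) :
    barTrace h a n b = (flip k A).conj (F b) • a := by
  induction b using bar_induction' with
  | h₁ r l hl =>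
    rw [barTrace_smul_gen _ _ _ hl, twistWord_cons, map_smul, smul_eq_mul, AntiInvolution.conj_mul,
      mul_smul]
  | h₂ b c hb hc => rw [map_add, map_add, AntiInvolution.conj_add, add_smul, hb, hc]

/-- The homotopy is extracted in a single degree `n`. The degree `j` below is an integer so that `n
= 0` is included, with the lower term zero. -/
theorem FiniteProjectiveResolution.exists_homotopy_id {R : Type u} [Ring R] {M : Type*}
    [AddCommGroup M] [Module R M] (Q : FiniteProjectiveResolution R M)
    (f : ∀ n : ℕ, Q.complex.X n →ₗ[R] Q.complex.X n)
    (hf : ∀ n x, (Q.complex.d ((n + 1 : ℕ) : ℤ) n).hom (f (n + 1) x) =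
      f n ((Q.complex.d ((n + 1 : ℕ) : ℤ) n).hom x))
    (h₀ : ∀ x, Q.augmentation (f 0 x) = Q.augmentation x) (n : ℕ) :
    ∃ (j : ℤ) (_ : j + 1 = n) (s : Q.complex.X n →ₗ[R] Q.complex.X ((n + 1 : ℕ) : ℤ))
      (s' : Q.complex.X j →ₗ[R] Q.complex.X n), ∀ x, f n x =
        x + (Q.complex.d ((n + 1 : ℕ) : ℤ) n).hom (s x) + s' ((Q.complex.d n j).hom x) := by
  obtain ⟨h, h1, h2⟩ := exists_homotopy (P := fun n : ℕ => Q.complex.X n)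
    (N := fun n : ℕ => Q.complex.X n)
    (dP := fun n => (Q.complex.d ((n + 1 : ℕ) : ℤ) n).hom)
    (dN := fun n => (Q.complex.d ((n + 1 : ℕ) : ℤ) n).hom) (fun n => Q.projective n)
    (fun n x => d_apply_d _ _ _ _ x) Q.exact (fun n => f n - LinearMap.id)
    (fun n x => by simp only [LinearMap.sub_apply, map_sub, hf, LinearMap.id_apply])
    (fun x => (Q.exact_augmentation _).mp (by
      rw [LinearMap.sub_apply, map_sub, LinearMap.id_apply, h₀, sub_self]))
  rcases n with _ | n
  · exact ⟨-1, rfl, h 0, 0, fun x => by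
      rw [LinearMap.zero_apply, add_zero]
      exact eq_add_of_sub_eq' (h1 x)⟩
  · exact ⟨n, by push_cast; ring, h (n + 1), h n, fun x => by
      rw [add_assoc]
      exact eq_add_of_sub_eq' (h2 n x)⟩

variable (Q : FiniteProjectiveResolution (Env k A) A)

theorem exists_barMap : ∃ θ : ∀ n : ℕ, Bar k A n →ₗ[Env k A] Q.complex.X (n : ℤ),
    (∀ x, Q.augmentation (θ 0 x) = barAug k A x) ∧
    ∀ n x, (Q.complex.d ((n + 1 : ℕ) : ℤ) n).hom (θ (n + 1) x) = θ n (barD k A n x) :=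
  exists_comparison (P := Bar k A) (N := fun n : ℕ => Q.complex.X (n : ℤ))
    (dP := fun n => barD k A n) (dN := fun n => (Q.complex.d ((n + 1 : ℕ) : ℤ) n).hom)
    (fun _ => inferInstance) (fun _ => barD_barD) Q.exact (barAug k A) barAug_barD Q.augmentation
    Q.exact_augmentation Q.augmentation_surjective

theorem exists_toBar : ∃ ρ : ∀ n : ℕ, Q.complex.X (n : ℤ) →ₗ[Env k A] Bar k A n,
    (∀ x, barAug k A (ρ 0 x) = Q.augmentation x) ∧
    ∀ n x, barD k A n (ρ (n + 1) x) = ρ n ((Q.complex.d ((n + 1 : ℕ) : ℤ) n).hom x) :=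
  exists_comparison (N := Bar k A) (P := fun n : ℕ => Q.complex.X (n : ℤ))
    (dN := fun n => barD k A n) (dP := fun n => (Q.complex.d ((n + 1 : ℕ) : ℤ) n).hom)
    (fun n => Q.projective n) (fun _ x => d_apply_d _ _ _ _ x) bar_exact Q.augmentation
    (fun x => (Q.exact_augmentation _).mpr ⟨x, rfl⟩) (barAug k A) bar_exact_aug barAug_surjective

variable {Q} {θ : ∀ n : ℕ, Bar k A n →ₗ[Env k A] Q.complex.X (n : ℤ)}
  (hθ₀ : ∀ x, Q.augmentation (θ 0 x) = barAug k A x)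
  (hθ : ∀ n x, (Q.complex.d ((n + 1 : ℕ) : ℤ) n).hom (θ (n + 1) x) = θ n (barD k A n x))

include hθ₀ in
/-- A functional on the dual of the top of a resolution which vanishes on coboundaries defines a
Hochschild cycle. -/
theorem exists_cycle_of_functional (z : dualObj (flip k A) (Q.complex.X d) →ₗ[Env k A] A)
    (hz : ∀ j : ℤ, j + 1 = d → ∀ f, z ((dualMap (flip k A) (Q.complex.d d j)).hom f) = 0) :
    ∃ c : Cycles k A d, ∀ F : Q.complex ⟶ dualShift (flip k A) d Q.complex,
      (barPairing (Q.subsingleton (by decide)) θ hθ F).trace c.1 =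
        z (dualObj.ofLin (flip k A) (pairing F (zero_add (d : ℤ)) (θ 0 (barGen k 0 [])))) := by
  obtain ⟨ρ, hρ₀, hρ⟩ := exists_toBar Q
  have := Q.projective
  have := Q.finite
  obtain ⟨N, e, φ, h⟩ := exists_dual_basis (R := Env k A) (Q.complex.X d)
  have hb : ∀ {W : Type _} [AddCommGroup W] [Module k W] {χ : List A → W} (hχ : IsMulti k χ) (n : ℕ)
    (a : A) (r : Env k A) (b : Bar k A n), barTraceHom hχ n a (r • b) =
      barTraceHom hχ n ((flip k A).conj r • a) b := fun hχ n a r b => barTrace_smul hχ a r b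
  -- Apply `z` and the comparison with the bar resolution to the two factors of the canonical
  -- element `∑ φ j ⊗ e j` of the dual tensored with `Q_d`; the result lies in `A ⊗_{A^e} Bar`, that
  -- is, among Hochschild chains.
  refine ⟨⟨∑ j, barTrace (chainWord_isMulti (k := k) (n := d)) (z (dualObj.ofLin _ (φ j))) d
    (ρ d (e j)), ?_⟩, fun F => ?_⟩
  · rcases d with _ | n
    · trivial
    · obtain ⟨N', e', φ', h'⟩ := exists_dual_basis (R := Env k A) (Q.complex.X n)
      change boundary k A n _ = 0
      rw [map_sum]
      simp only [boundary_barTrace, hρ]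
      -- Naturality of the canonical element moves the differential of `Q` to the dual factor, where
      -- `z` vanishes on coboundaries. So the chain is a cycle.
      refine (sum_dual_naturality h h' z (Q.complex.d ((n + 1 : ℕ) : ℤ) n) (ρ n)
        (barTraceHom chainWord_isMulti n) (hb _ n)).trans (Finset.sum_eq_zero fun i _ => ?_)
      rw [hz n (by push_cast; ring), map_zero, AddMonoidHom.zero_apply]
  · set L := barPairing (Q.subsingleton (by decide)) θ hθ F with hL
    have ht := (L.left_isMulti (n := d) (barGen k 0 [])).twist
    obtain ⟨j, hj, s, s', hs⟩ := Q.exists_homotopy_id (fun n => θ n ∘ₗ ρ n)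
      (fun n x => by simp only [LinearMap.comp_apply, hθ, hρ])
      (fun x => by rw [LinearMap.comp_apply, hθ₀, hρ₀]) d
    set f := pairing F (zero_add (d : ℤ)) (θ 0 (barGen k 0 [])) with hf
    -- The composite `θ ∘ ρ` is homotopic to the identity. One term of the homotopy vanishes as the
    -- linear form is closed, and the other is a coboundary, so `z` does not see the passage through
    -- the bar resolution.
    have h1 : dualObj.ofLin (flip k A) f + (dualMap (flip k A) (Q.complex.d d j)).hom
        (dualObj.ofLin (flip k A) (f ∘ₗ s')) =
        dualObj.ofLin (flip k A) (L.left 0 d (barGen k 0 []) ∘ₗ ρ d) := dualObj.ext fun x => by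
      refine Eq.trans ?_ (barLeft_eq θ F (zero_add _) _ _).symm
      rw [← LinearMap.comp_apply (θ d), hs, map_add, map_add,
        pairing_d_eq_zero (Q.subsingleton (by decide)), add_zero]
      rfl
    have h2 : z (dualObj.ofLin (flip k A) f) =
        z (dualObj.ofLin (flip k A) (L.left 0 d (barGen k 0 []) ∘ₗ ρ d)) := by
      rw [← h1, map_add, hz j hj, add_zero]
    rw [h2, dual_expansion (flip k A) h (dualObj.ofLin (flip k A) (L.left 0 d _ ∘ₗ ρ d)), map_sum]
    change ht.eval d (∑ j, barTrace (chainWord_isMulti (k := k) (n := d))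
      (z (dualObj.ofLin _ (φ j))) d (ρ d (e j))) = _
    rw [map_sum]
    refine Finset.sum_congr rfl fun j _ => ?_
    rw [eval_barTrace, barTrace_twist, map_smul]
    rfl

/-- Every quasi-isomorphism to the shifted dual gives a fundamental cycle, and is self-dual. -/
theorem exists_trace_eq_one (Q : FiniteProjectiveResolution (Env k A) A)
    (ψ : Q.complex ⟶ dualShift (flip k A) d Q.complex) (hψ : QuasiIso ψ) :
    ∃ (θ : ∀ n : ℕ, Bar k A n →ₗ[Env k A] Q.complex.X (n : ℤ))
      (_ : ∀ x, Q.augmentation (θ 0 x) = barAug k A x)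
      (hθ : ∀ n x, (Q.complex.d ((n + 1 : ℕ) : ℤ) n).hom (θ (n + 1) x) = θ n (barD k A n x))
      (c : Cycles k A d), (barPairing (Q.subsingleton (by decide)) θ hθ ψ).trace c.1 = 1 ∧
      Nonempty (Homotopy (bidualShift (flip k A) d Q.complex ≫ dualShiftMap (flip k A) d ψ) ψ) := by
  obtain ⟨θ, hθ₀, hθ⟩ := exists_barMap Q
  obtain ⟨z, hz, hzψ, hF⟩ := exists_dual_augmentation Q ψ hψ
  obtain ⟨c, hc⟩ := exists_cycle_of_functional hθ₀ hθ z hz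
  have h1 : (barPairing (Q.subsingleton (by decide)) θ hθ ψ).trace c.1 = 1 := by
    rw [hc, hzψ, hθ₀, barAug_gen]
  -- By the determination of morphisms up to homotopy, self-duality only requires that `z` of the
  -- transpose at the generator be `1`, that is, that the transposed pairing also have trace `1` on
  -- `c`.
  refine ⟨θ, hθ₀, hθ, c, h1, hF _ (θ 0 (barGen k 0 [])) (fun m => ⟨leftAct k m, ?_⟩) ?_⟩
  · rw [hθ₀, barAug_gen, leftAct_smul, mul_one]
  · rw [← hc, hθ₀, barAug_gen]
    have h2 := (barPairing (Q.subsingleton (by decide)) θ hθ ψ).pairHom_self h1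
    set L := barPairing (Q.subsingleton (by decide)) θ hθ ψ with hL
    set L' := barPairing (Q.subsingleton (by decide)) θ hθ
      (bidualShift (flip k A) d Q.complex ≫ dualShiftMap (flip k A) d ψ) with hL'
    have h3 := (L.right_isMulti (m := d) (barGen k 0 [])).twist
    have h4 := (L'.left_isMulti (n := d) (barGen k 0 [])).twist
    change h4.eval d c.1 = 1
    -- The trace of the transpose is `(-1)^d` times the self-pairing of `c`, which equals `(-1)^d`
    -- by `pairHom_self`.
    have h5 : h4.eval d c.1 = (h3.fsmul ((-1 : k) ^ d)).eval d c.1 :=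
      IsMulti.eval_congr_length h4 (h3.fsmul _) (fun a l hl => ?_) _
    · rw [h5, eval_fsmul h3]
      refine (congrArg ((-1 : k) ^ d • ·) h2).trans ?_
      rw [smul_smul, sign_sq, one_smul]
    · rw [twistWord_cons, twistWord_cons, ← L.conj_left,
        show L'.left 0 d = barLeft θ _ 0 d from rfl, barLeft_eq θ _ (zero_add _), pairing_transpose,
        show L.left d 0 = barLeft θ _ d 0 from rfl, barLeft_eq θ _ (add_zero _),
        show ((0 : ℕ) : ℤ) * d + d = d by simp, negOnePow_smul (k := k), BarPairing.conj_smul, smul_assoc]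

/-- The comparison with the bar resolution in terms of multilinear maps. -/
def barComparison : BarComparison Q where
  map n :=
    { toFun := fun a => θ n (barTensor k A n a)
      map_update_add' := fun a i x y => by rw [MultilinearMap.map_update_add, map_add]; rfl
      map_update_smul' := fun a i c x => by
        rw [MultilinearMap.map_update_smul, ← algebraMap_smul (Env k A) c, map_smul]; rfl }
  augmentation_map := by
    refine (hθ₀ _).trans ?_
    rw [← barGen_ofFn]; exact barAug_gen
  d_map n a := by
    refine (hθ n _).trans ?_
    rw [barD_barTensor]
    simp only [map_add, map_smul, map_sum, map_zsmul]
    rfl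

/-- The Hochschild cohomology of a Calabi–Yau algebra is a Batalin–Vilkovisky algebra. -/
theorem CalabiYauStructure.exists_isBVAlgebra (Ψ : CalabiYauStructure k A d) :
    ∃ (mul br : HHCohTot k A →ₗ[k] HHCohTot k A →ₗ[k] HHCohTot k A)
      (Δ : HHCohTot k A →ₗ[k] HHCohTot k A), IsCupProduct mul ∧ IsGerstenhaberBracket br ∧
        IsTransportedConnes Ψ Δ ∧ IsBVAlgebra (HHCohTot.deg k A) mul br Δ := by
  obtain ⟨θ, hθ₀, hθ, c, hc, -⟩ := exists_trace_eq_one Ψ.resolution Ψ.ψ Ψ.quasiIso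
  obtain ⟨D, B, mul, br, h1, h2, h3, h4, h5⟩ := BarPairing.exists_isBVAlgebra _ hc
  refine ⟨mul, br, _, h3, h4, ⟨c, D, B, ⟨barComparison hθ₀ hθ, _, fun a => ?_, hc⟩, h1, h2, rfl⟩, h5⟩
  refine (IsMulti.eval_tprod _ a).trans ?_
  rw [List.ofFn_succ, twistWord_cons]
  refine congrArg (fun r : Env k A => (flip k A).conj r • a 0) ?_
  refine (barLeft_eq θ Ψ.ψ (zero_add _) _ _).trans ?_
  rw [show barGen k d (List.ofFn fun i => a i.succ) = barTensor k A d (Fin.tail a) from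
    barGen_ofFn _, show barGen k 0 [] = barTensor k A 0 ![] from barGen_ofFn (n := 0) ![]]
  rfl

end Cycle

end

end CalabiYau

open scoped MonoidAlgebra

namespace CalabiYau

noncomputable section

/-! ### Induction of modules over the group algebra to bimodules -/

section Induction

variable (k : Type*) [Field k] (G : Type*) [Group G]

/-- The homomorphism `g ↦ g ⊗ g⁻¹` from the group algebra to its enveloping algebra. -/
def adjointAlgHom : k[G] →ₐ[k] Env k k[G] := MonoidAlgebra.lift k _ G
    { toFun := fun g => leftAct k (MonoidAlgebra.of k G g) * rightAct k (MonoidAlgebra.of k G g⁻¹)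
      map_one' := by rw [inv_one, map_one, leftAct_one, rightAct_one, mul_one]
      map_mul' := fun g h => by
        rw [mul_inv_rev, map_mul (MonoidAlgebra.of k G), map_mul (MonoidAlgebra.of k G),
          leftAct_mul, rightAct_mul, mul_assoc, mul_assoc, ← mul_assoc (rightAct k _) (leftAct k _), rightAct_mul_leftAct, mul_assoc] }

variable {k G}

variable (k G) in
def adjointHom : k[G] →+* Env k k[G] := (adjointAlgHom k G).toRingHom

theorem adjointHom_algebraMap (c : k) :
    adjointHom k G (algebraMap k _ c) = algebraMap k _ c := (adjointAlgHom k G).commutes c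

theorem adjointHom_smul (c : k) (r : k[G]) :
    adjointHom k G (c • r) = c • adjointHom k G r := map_smul (adjointAlgHom k G) c r

theorem adjointHom_of (g : G) : adjointHom k G (MonoidAlgebra.of k G g) =
    leftAct k (MonoidAlgebra.of k G g) * rightAct k (MonoidAlgebra.of k G g⁻¹) :=
  MonoidAlgebra.lift_of _ _

/-- Each element `y ⊗ m` is `y` times `1 ⊗ m`, and right multiplication by `g` turns it into `y g ⊗
g⁻¹ m`; this identity makes a semilinear map extend compatibly with that action. -/
theorem leftAct_mul_adjointHom (y g : G) :
    leftAct k (MonoidAlgebra.of k G (y * g)) * adjointHom k G (MonoidAlgebra.of k G g⁻¹) =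
      rightAct k (MonoidAlgebra.of k G g) * leftAct k (MonoidAlgebra.of k G y) := by
  rw [adjointHom_of, ← mul_assoc, ← leftAct_mul, ← map_mul, mul_inv_cancel_right, inv_inv,
    rightAct_mul_leftAct]

/-- The homomorphism `g ↦ g ⊗ g⁻¹` intertwines inversion with the flip of the two tensor factors.
This is why induction is compatible with the two dualities. -/
theorem conj_adjointHom (r : k[G]) : (flip k k[G]).conj
    (adjointHom k G r) = adjointHom k G ((groupAntiInvolution k G).conj r) := by
  induction r using MonoidAlgebra.induction_on with
  | of g =>
    rw [show (groupAntiInvolution k G).conj (MonoidAlgebra.of k G g) = MonoidAlgebra.of k G g⁻¹ from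
      congrArg MulOpposite.unop (groupAntiInvolutionHom_of k G g), adjointHom_of, adjointHom_of,
      AntiInvolution.conj_mul, conj_leftAct, conj_rightAct, inv_inv]
  | add a b ha hb => rw [map_add, AntiInvolution.conj_add, AntiInvolution.conj_add, map_add, ha, hb]
  | smul c a ha =>
    rw [adjointHom_smul, BarPairing.conj_smul, ha, ← adjointHom_smul]
    exact congrArg _ (congrArg MulOpposite.unop (map_smul (groupAntiInvolutionHom k G) c a)).symm

theorem env_group_induction {p : Env k k[G] → Prop}
    (left : ∀ g, p (leftAct k (MonoidAlgebra.of k G g)))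
    (right : ∀ g, p (rightAct k (MonoidAlgebra.of k G g)))
    (scalar : ∀ c, p (algebraMap k _ c)) (add : ∀ r s, p r → p s → p (r + s))
    (mul : ∀ r s, p r → p s → p (r * s)) (r : Env k k[G]) : p r := by
  have key : ∀ f : k[G] →ₗ[k] Env k k[G],
      (∀ g, p (f (MonoidAlgebra.of k G g))) → ∀ a, p (f a) := fun f hf a => by
    induction a using MonoidAlgebra.induction_on with
    | of g => exact hf g
    | add a b ha hb => rw [map_add]; exact add _ _ ha hb
    | smul c a ha =>
      rw [map_smul, show c • f a = algebraMap k _ c * f a from Algebra.smul_def c (f a)]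
      exact mul _ _ (scalar c) ha
  exact env_induction (fun a b => mul _ _ (key _ left a) (key _ right b)) add r

section Action

variable (k G) (M : Type*) [AddCommGroup M] [Module k M] [Module k[G] M]
    [IsScalarTower k k[G] M]

/-- The left action on `⨁_y y ⊗ M`. -/
def leftIndAction : k[G] →ₐ[k] Module.End k (G →₀ M) := MonoidAlgebra.lift k _ G
    { toFun := fun g => Finsupp.lmapDomain M k (g * ·)
      map_one' := by ext; simp
      map_mul' := fun g h => by ext : 2; simp [mul_assoc] }

/-- The right action on `⨁_y y ⊗ M`. -/
def rightIndAction : k[G] →ₐ[k] (Module.End k (G →₀ M))ᵐᵒᵖ := MonoidAlgebra.lift k _ G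
    { toFun := fun h => MulOpposite.op (Finsupp.lmapDomain M k (· * h) ∘ₗ
        Finsupp.mapRange.linearMap (Algebra.lsmul k k M (MonoidAlgebra.of k G h⁻¹)))
      map_one' := congrArg MulOpposite.op (by
        ext : 2; simp only [inv_one, map_one]; simp)
      map_mul' := fun g h => congrArg MulOpposite.op (by
        ext : 2
        simp only [mul_inv_rev, map_mul]
        simp [mul_assoc]) }

variable {k G M}

theorem leftIndAction_of (g y : G) (m : M) : leftIndAction k G M (MonoidAlgebra.of k G g)
    (Finsupp.single y m) = Finsupp.single (g * y) m := by
  rw [leftIndAction, MonoidAlgebra.lift_of]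
  simp

theorem rightIndAction_of (h y : G) (m : M) : (rightIndAction k G M (MonoidAlgebra.of k G h)).unop
    (Finsupp.single y m) = Finsupp.single (y * h) (MonoidAlgebra.of k G h⁻¹ • m) := by
  rw [rightIndAction, MonoidAlgebra.lift_of]
  simp

variable (k G M)

/-- The action of the enveloping algebra on `⨁_y y ⊗ M`, where `g (y ⊗ m) h = g y h ⊗ h⁻¹ m`. -/
def indAction : Env k k[G] →ₐ[k] Module.End k (G →₀ M) :=
  Algebra.TensorProduct.lift (leftIndAction k G M) (AlgHom.opComm (rightIndAction k G M))
    (fun a b => by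
      obtain ⟨b, rfl⟩ := MulOpposite.op_surjective b
      induction a using MonoidAlgebra.induction_on with
      | add a a' ha ha' => rw [map_add]; exact ha.add_left ha'
      | smul c a ha => rw [map_smul]; exact ha.smul_left c
      | of g =>
        induction b using MonoidAlgebra.induction_on with
        | add b b' hb hb' => rw [MulOpposite.op_add, map_add]; exact hb.add_right hb'
        | smul c b hb => rw [MulOpposite.op_smul, map_smul]; exact hb.smul_right c
        | of h =>
          refine Finsupp.lhom_ext' fun y => LinearMap.ext fun m => ?_
          change leftIndAction k G M _ ((rightIndAction k G M _).unop (Finsupp.single y m)) =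
            (rightIndAction k G M _).unop (leftIndAction k G M _ (Finsupp.single y m))
          rw [leftIndAction_of]
          refine (congrArg _ (rightIndAction_of h y m)).trans
            (Eq.trans ?_ (rightIndAction_of h (g * y) m).symm)
          rw [leftIndAction_of, mul_assoc])

variable {k G M}

theorem indAction_left (g y : G) (m : M) :
    indAction k G M (leftAct k (MonoidAlgebra.of k G g)) (Finsupp.single y m) =
      Finsupp.single (g * y) m := by
  rw [leftAct_eq, indAction, Algebra.TensorProduct.lift_tmul, map_one, mul_one, leftIndAction_of]

theorem indAction_right (h y : G) (m : M) :
    indAction k G M (rightAct k (MonoidAlgebra.of k G h)) (Finsupp.single y m) =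
      Finsupp.single (y * h) (MonoidAlgebra.of k G h⁻¹ • m) := by
  rw [rightAct_eq, indAction, Algebra.TensorProduct.lift_tmul, map_one, one_mul]
  exact rightIndAction_of h y m

end Action

variable (k G)

/-- The bimodule induced from a module over the group algebra. -/
def Ind (M : Type*) [AddCommGroup M] [Module k[G] M] := G →₀ M

variable {k G} {M : Type*} [AddCommGroup M] [Module k[G] M]
  {N : Type*} [AddCommGroup N] [Module k[G] N]
  {V : Type*} [AddCommGroup V] [Module (Env k k[G]) V]

instance : AddCommGroup (Ind k G M) := inferInstanceAs (AddCommGroup (G →₀ M))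

instance : Module (Env k k[G]) (Ind k G M) :=
  letI : Module k M := Module.compHom M (algebraMap k k[G])
  haveI : IsScalarTower k k[G] M := .of_algebraMap_smul fun _ _ => rfl
  Module.compHom (G →₀ M) (indAction k G M).toRingHom

namespace Ind

/-- The element `y ⊗ m`. -/
def single (y : G) (m : M) : Ind k G M := Finsupp.single y m

/-- The component of an element at `y`. -/
def coeff (x : Ind k G M) (y : G) : M := (show G →₀ M from x) y

theorem single_add (y : G) (m m' : M) :
    (single y (m + m') : Ind k G M) = single y m + single y m' := Finsupp.single_add y m m'

theorem leftAct_smul_single (g y : G) (m : M) : leftAct k (MonoidAlgebra.of k G g) •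
    (single y m : Ind k G M) = single (g * y) m :=
  letI : Module k M := Module.compHom M (algebraMap k k[G])
  haveI : IsScalarTower k k[G] M := .of_algebraMap_smul fun _ _ => rfl
  indAction_left g y m

theorem rightAct_smul_single (h y : G) (m : M) : rightAct k (MonoidAlgebra.of k G h) •
    (single y m : Ind k G M) = single (y * h) (MonoidAlgebra.of k G h⁻¹ • m) :=
  letI : Module k M := Module.compHom M (algebraMap k k[G])
  haveI : IsScalarTower k k[G] M := .of_algebraMap_smul fun _ _ => rfl
  indAction_right h y m

theorem algebraMap_smul_single (c : k) (y : G) (m : M) :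
    algebraMap k (Env k k[G]) c • (single y m : Ind k G M) =
      single y (algebraMap k k[G] c • m) := by
  let _ : Module k M := Module.compHom M (algebraMap k k[G])
  have : IsScalarTower k k[G] M := .of_algebraMap_smul fun _ _ => rfl
  change indAction k G M (algebraMap k _ c) (Finsupp.single y m) = _
  rw [AlgHom.commutes]
  exact Finsupp.smul_single c y m

theorem induction {p : Ind k G M → Prop} (add : ∀ x x', p x → p x' → p (x + x'))
    (h : ∀ y m, p (single y m)) (x : Ind k G M) : p x :=
  Finsupp.induction_linear (motive := p) x
    (by rw [← Finsupp.single_zero (1 : G)]; exact h 1 0) add h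

variable (k G)

theorem semilinear_of {f : M →+ V}
    (h₁ : ∀ g m, f (MonoidAlgebra.of k G g • m) = adjointHom k G (MonoidAlgebra.of k G g) • f m)
    (h₂ : ∀ c m, f (algebraMap k k[G] c • m) = algebraMap k (Env k k[G]) c • f m)
    (r : k[G]) (m : M) : f (r • m) = adjointHom k G r • f m := by
  induction r using MonoidAlgebra.induction_on with
  | of g => exact h₁ g m
  | add a b ha hb => rw [add_smul, map_add, ha, hb, map_add, add_smul]
  | smul c a ha =>
    rw [Algebra.smul_def, mul_smul, h₂, ha, map_mul, mul_smul]
    rw [adjointHom_algebraMap]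

variable {k G}

/-- The unit `m ↦ 1 ⊗ m`. -/
def unit : M →ₛₗ[adjointHom k G] Ind k G M :=
  { AddMonoidHom.mk' (single 1) (single_add 1) with
    map_smul' := semilinear_of k G (f := AddMonoidHom.mk' (single 1) (single_add 1))
      (fun g m => by
        rw [adjointHom_of, mul_smul]
        change single 1 _ = _ • _ • single 1 m
        rw [rightAct_smul_single, leftAct_smul_single, inv_inv, one_mul, mul_inv_cancel])
      (fun c m => (algebraMap_smul_single c 1 m).symm) }

theorem single_eq (y : G) (m : M) :
    (single y m : Ind k G M) = leftAct k (MonoidAlgebra.of k G y) • unit m := by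
  rw [show unit (k := k) (G := G) m = single 1 m from rfl, leftAct_smul_single, mul_one]

theorem hom_ext {F F' : Ind k G M →ₗ[Env k k[G]] V}
    (h : ∀ m, F (unit m) = F' (unit m)) : F = F' :=
  LinearMap.ext fun x => induction (p := fun x => F x = F' x)
    (fun x x' hx hx' => by rw [map_add, map_add, hx, hx'])
    (fun y m => by rw [single_eq, map_smul, map_smul, h]) x

/-- The homomorphism on the induced module which extends a semilinear map. -/
def desc (f : M →ₛₗ[adjointHom k G] V) : Ind k G M →ₗ[Env k k[G]] V :=
  let F : Ind k G M →+ V := Finsupp.liftAddHom fun y =>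
    AddMonoidHom.mk' (fun m => leftAct k (MonoidAlgebra.of k G y) • f m) fun m m' => by
      rw [map_add, smul_add]
  have hF : ∀ y m, F (single y m) = leftAct k (MonoidAlgebra.of k G y) • f m := fun y m =>
    Finsupp.liftAddHom_apply_single _ _ _
  { F with
    map_smul' := fun r x => by
      change F (r • x) = r • F x
      induction r using env_group_induction generalizing x with
      | add r s hr hs => rw [add_smul, map_add, hr, hs, add_smul]
      | mul r s hr hs => rw [mul_smul, hr, hs, mul_smul]
      | left g =>
        refine induction (p := fun x => F (_ • x) = _ • F x) (fun x x' hx hx' => by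
          rw [smul_add, map_add, hx, hx', map_add, smul_add]) (fun y m => ?_) x
        rw [leftAct_smul_single, hF, hF, map_mul, leftAct_mul, mul_smul]
      | right g =>
        refine induction (p := fun x => F (_ • x) = _ • F x) (fun x x' hx hx' => by
          rw [smul_add, map_add, hx, hx', map_add, smul_add]) (fun y m => ?_) x
        rw [rightAct_smul_single, hF, hF, f.map_smulₛₗ, smul_smul, smul_smul]
        exact congrArg (· • f m) (leftAct_mul_adjointHom y g)
      | scalar c =>
        refine induction (p := fun x => F (_ • x) = _ • F x) (fun x x' hx hx' => by
          rw [smul_add, map_add, hx, hx', map_add, smul_add]) (fun y m => ?_) x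
        rw [algebraMap_smul_single, hF, hF, f.map_smulₛₗ, smul_smul, smul_smul]
        refine congrArg (· • f m) ?_
        rw [adjointHom_algebraMap, Algebra.commutes] }

theorem desc_unit (f : M →ₛₗ[adjointHom k G] V) (m : M) : desc f (unit m) = f m := by
  refine (Finsupp.liftAddHom_apply_single _ _ _).trans ?_
  change leftAct k (MonoidAlgebra.of k G 1) • f m = f m
  rw [map_one, leftAct_one]
  exact one_smul (Env k k[G]) _

/-- The functoriality of induction. -/
def map (β : M →ₗ[k[G]] N) : Ind k G M →ₗ[Env k k[G]] Ind k G N := desc (unit.comp β)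

theorem map_unit (β : M →ₗ[k[G]] N) (m : M) :
    map β (unit m : Ind k G M) = unit (β m) := desc_unit _ m

theorem map_coeff (β : M →ₗ[k[G]] N) (x : Ind k G M) (y : G) :
    (map β x).coeff y = β (x.coeff y) := by
  refine induction (p := fun x => (map β x).coeff y = β (x.coeff y)) (fun x x' hx hx' => ?_)
    (fun g m => ?_) x
  · rw [map_add]
    exact (congrArg₂ (· + ·) hx hx').trans (map_add β _ _).symm
  · rw [single_eq, map_smul, map_unit, ← single_eq, ← single_eq]
    change (Finsupp.single g (β m) : G →₀ N) y = β ((Finsupp.single g m : G →₀ M) y)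
    classical rw [Finsupp.single_apply, Finsupp.single_apply]
    split_ifs
    · rfl
    · rw [map_zero]

end Ind

end Induction

end

end CalabiYau

open scoped MonoidAlgebra

namespace CalabiYau

noncomputable section

universe u v

/-! ### Induced complexes and their duals -/

section InducedComplex

variable {k : Type u} [Field k] {G : Type v} [Group G]

namespace Ind

variable {M : Type*} [AddCommGroup M] [Module k[G] M]
  {N : Type*} [AddCommGroup N] [Module k[G] N]

theorem ext {x x' : Ind k G M} (h : ∀ y, x.coeff y = x'.coeff y) : x = x' := Finsupp.ext h

/-- Choosing zero wherever the given coefficient vanishes keeps the support finite. -/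
theorem exists_coeff (x : Ind k G M) {p : G → N → Prop} (h : ∀ y, ∃ n, p y n)
    (h₀ : ∀ y, x.coeff y = 0 → p y 0) : ∃ z : Ind k G N, ∀ y, p y (z.coeff y) := by
  classical
  choose f hf using h
  refine ⟨Finsupp.onFinset (Finsupp.support x) (fun y => if x.coeff y = 0 then 0 else f y)
    fun y hy => Finsupp.mem_support_iff.mpr fun h => hy (if_pos h), fun y => ?_⟩
  change p y (if x.coeff y = 0 then 0 else f y)
  split_ifs with h
  · exact h₀ y h
  · exact hf y

/-- The extension of a linear form to the induced module. -/
def extendLin (f : M →ₗ[k[G]] k[G]) :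
    Ind k G M →ₗ[Env k k[G]] Env k k[G] := desc
  { toFun := fun m => adjointHom k G (f m)
    map_add' := fun m m' => by rw [map_add, map_add]
    map_smul' := fun r m => by rw [map_smul, smul_eq_mul, map_mul, smul_eq_mul] }

theorem extendLin_unit (f : M →ₗ[k[G]] k[G]) (m : M) :
    extendLin f (unit m) = adjointHom k G (f m) := desc_unit _ m

variable {X : ModuleCat.{max u v} k[G]}

variable (X) in
abbrev obj : ModuleCat.{max u v} (Env k k[G]) := ModuleCat.of _ (Ind k G X)

/-- The value of a linear form on the element `1 ⊗ m`. -/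
def evalUnit (F : dualObj (flip k k[G]) (obj X)) (m : X) : Env k k[G] :=
  dualObj.toLin _ F (unit (k := k) (G := G) m)

theorem dual_hom_ext {F F' : dualObj (flip k k[G]) (obj X)}
    (h : ∀ m, evalUnit F m = evalUnit F' m) : F = F' := hom_ext h

theorem evalUnit_add (F F' : dualObj (flip k k[G]) (obj X)) (m : X) :
    evalUnit (F + F') m = evalUnit F m + evalUnit F' m := rfl

theorem evalUnit_smul (r : Env k k[G])
    (F : dualObj (flip k k[G]) (obj X)) (m : X) :
    evalUnit (r • F) m = evalUnit F m * (flip k k[G]).conj r := rfl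

theorem evalUnit_extendLin (f : X →ₗ[k[G]] k[G]) (m : X) :
    evalUnit (dualObj.ofLin _ (extendLin f)) m = adjointHom k G (f m) := desc_unit _ m

variable (X) in
/-- The semilinear map to the dual of the induced module which extends linear forms. -/
def extendForm : dualObj (groupAntiInvolution k G) X
    →ₛₗ[adjointHom k G] dualObj (flip k k[G]) (obj X) where
  toFun f := dualObj.ofLin _ (extendLin (dualObj.toLin _ f))
  map_add' f g := dual_hom_ext fun m => by
    rw [evalUnit_add, evalUnit_extendLin, evalUnit_extendLin, evalUnit_extendLin, dualObj.toLin_add,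
      map_add]
  map_smul' r f := dual_hom_ext fun m => by
    rw [evalUnit_smul, evalUnit_extendLin, evalUnit_extendLin, dualObj.toLin_smul, map_mul,
      conj_adjointHom]

theorem evalUnit_extendForm (f : dualObj (groupAntiInvolution k G) X) (m : X) :
    evalUnit (extendForm X f) m = adjointHom k G (dualObj.toLin _ f m) := desc_unit _ m

abbrev hom {Y : ModuleCat.{max u v} k[G]} (β : Y ⟶ X) : obj Y ⟶ obj X := ModuleCat.ofHom (map β.hom)

theorem hom_units_smul {Y : ModuleCat.{max u v} k[G]} (β : Y ⟶ X) (s : ℤˣ) :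
    hom (s • β) = s • hom β := ModuleCat.hom_ext (hom_ext fun m => by
  refine (map_unit _ m).trans ?_
  rw [units_smul_apply]
  refine Eq.trans ?_ (units_smul_apply s (hom β) (unit m)).symm
  refine Eq.trans ?_ (congrArg (s • ·) (map_unit β.hom m).symm)
  rcases Int.units_eq_one_or s with rfl | rfl <;> simp)

variable (X) in
/-- The comparison of the induced module of the dual with the dual of the induced module. -/
def dualHom : obj (dualObj (groupAntiInvolution k G) X) ⟶ dualObj (flip k k[G]) (obj X) :=
  ModuleCat.ofHom (Y := dualObj _ (obj X)) (desc (extendForm X))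

theorem dualHom_naturality {Y : ModuleCat.{max u v} k[G]} (β : Y ⟶ X) :
    dualHom X ≫ dualMap (flip k k[G]) (hom β) =
      hom (dualMap (groupAntiInvolution k G) β) ≫ dualHom Y :=
  ModuleCat.hom_ext (hom_ext fun f => by
    refine (congrArg (dualMap (flip k k[G]) (hom β)).hom
      (desc_unit (extendForm X) f)).trans ?_
    refine Eq.trans ?_ ((congrArg (desc (extendForm Y)) (map_unit _ f)).trans (desc_unit _ _)).symm
    refine dual_hom_ext fun m => ?_
    rw [evalUnit_extendForm]
    refine (congrArg (dualObj.toLin _ (extendForm X f)) (map_unit β.hom m)).trans ?_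
    exact evalUnit_extendForm f (β.hom m))

/-- A dual basis of `M` as a dual basis of the induced module. -/
theorem dual_basis {n : ℕ} {e : Fin n → M}
    {φ : Fin n → M →ₗ[k[G]] k[G]} (h : ∀ x, x = ∑ j, φ j x • e j)
    (x : Ind k G M) : x = ∑ j, extendLin (φ j) x • unit (e j) := by
  have : LinearMap.id = ∑ j, (extendLin (φ j)).smulRight (unit (e j) : Ind k G M) :=
    hom_ext fun m => by
      rw [LinearMap.sum_apply, LinearMap.id_apply]
      conv_lhs => rw [h m, map_sum]
      refine Finset.sum_congr rfl fun j _ => ?_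
      rw [LinearMap.smulRight_apply, extendLin_unit, LinearMap.map_smulₛₗ]
  refine (LinearMap.congr_fun this x).trans ?_
  rw [LinearMap.sum_apply]
  rfl

/-- The induced module of the dual is the dual of the induced module. -/
theorem desc_extendForm_bijective [Module.Projective k[G] X]
    [Module.Finite k[G] X] : Function.Bijective (desc (extendForm X)) := by
  obtain ⟨n, e, φ, h⟩ := exists_dual_basis (R := k[G]) X
  -- The inverse expands a form on the induced module in the dual basis `1 ⊗ e j`, whose coordinate
  -- forms extend the `φ j`.
  let inv : dualObj (flip k k[G]) (obj X) →ₗ[Env k k[G]]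
      Ind k G (dualObj (groupAntiInvolution k G) X) :=
    { toFun := fun F => ∑ j, (flip k k[G]).conj (evalUnit F (e j)) •
        unit (dualObj.ofLin (groupAntiInvolution k G) (φ j))
      map_add' := fun F F' => by
        simp only [evalUnit_add, AntiInvolution.conj_add, add_smul, Finset.sum_add_distrib]
      map_smul' := fun r F => by
        simp only [evalUnit_smul, AntiInvolution.conj_mul, AntiInvolution.conj_conj, mul_smul,
          RingHom.id_apply, Finset.smul_sum] }
  have h1 : inv ∘ₗ desc (extendForm X) = LinearMap.id := hom_ext fun f => by
    rw [LinearMap.comp_apply, desc_unit, LinearMap.id_apply]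
    conv_rhs => rw [dual_expansion _ h f, map_sum]
    change ∑ j : Fin n, _ = _
    refine Finset.sum_congr rfl fun j _ => ?_
    rw [evalUnit_extendForm, conj_adjointHom, LinearMap.map_smulₛₗ]
  refine ⟨Function.HasLeftInverse.injective ⟨inv, fun x => LinearMap.congr_fun h1 x⟩, fun F => ⟨inv F, ?_⟩⟩
  refine Eq.trans ?_ (dual_expansion (flip k k[G]) (P := obj X) (dual_basis h) F).symm
  change desc (extendForm X) (∑ j, _) = _
  rw [map_sum]
  exact Finset.sum_congr rfl fun j _ => (map_smul _ _ _).trans (congrArg _ (desc_unit _ _))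

end Ind

variable (P K L : ChainComplex (ModuleCat.{max u v} k[G]) ℤ)

/-- The complex of induced bimodules. -/
def indComplex : ChainComplex (ModuleCat.{max u v} (Env k k[G])) ℤ where
  X n := Ind.obj (P.X n)
  d i j := Ind.hom (P.d i j)
  shape i j h := by
    rw [P.shape i j h]
    exact ModuleCat.hom_ext (Ind.hom_ext fun m => (Ind.map_unit _ m).trans (map_zero _))
  d_comp_d' i j l _ _ := ModuleCat.hom_ext (Ind.hom_ext fun m => by
    change Ind.map _ (Ind.map _ _) = 0
    rw [Ind.map_unit, Ind.map_unit, d_apply_d, map_zero])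

variable {P K L}

theorem indComplex_d_coeff (i j : ℤ) (x : (indComplex P).X i) (y : G) :
    Ind.coeff (k := k) (((indComplex P).d i j).hom x) y = (P.d i j).hom (Ind.coeff (k := k) x y) :=
  Ind.map_coeff _ x y

def indComplexMap (f : K ⟶ L) : indComplex K ⟶ indComplex L where
  f n := ModuleCat.ofHom (Ind.map (f.f n).hom)
  comm' i j _ := ModuleCat.hom_ext (Ind.hom_ext fun m => by
    change Ind.map _ (Ind.map _ _) = Ind.map _ (Ind.map _ _)
    rw [Ind.map_unit, Ind.map_unit, Ind.map_unit, Ind.map_unit, f_apply_d])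

theorem indComplexMap_coeff (f : K ⟶ L) (i : ℤ) (x : (indComplex K).X i) (y : G) :
    Ind.coeff (k := k) (((indComplexMap f).f i).hom x) y = (f.f i).hom (Ind.coeff (k := k) x y) :=
  Ind.map_coeff _ x y

/-- Both conditions on elements hold coefficientwise; in the second one the element and the boundary
are chosen together as a pair. -/
theorem indComplexMap_quasiIso {f : K ⟶ L} (hf : IsElementwiseQuasiIso f) :
    QuasiIso (indComplexMap f) := by
  refine (quasiIso_iff_elementwise _).mpr fun i j l hj hl => ⟨fun x y hx hxy => ?_, fun y hy => ?_⟩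
  · obtain ⟨z, hz⟩ := Ind.exists_coeff x (p := fun g z => Ind.coeff (k := k) x g = (K.d l i).hom z)
      (fun g => (hf i j l hj hl).1 (Ind.coeff (k := k) x g) (Ind.coeff (k := k) y g)
        (by rw [← indComplex_d_coeff, hx]; rfl)
        (by rw [← indComplex_d_coeff, ← hxy]; exact (Ind.map_coeff _ x g).symm))
      (fun g hg => by rw [hg, map_zero])
    exact ⟨z, Ind.ext fun g => (hz g).trans (indComplex_d_coeff l i z g).symm⟩
  · obtain ⟨z, hz⟩ := Ind.exists_coeff y (N := K.X i × L.X l) (p := fun g z =>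
      (K.d i j).hom z.1 = 0 ∧ Ind.coeff (k := k) y g = (f.f i).hom z.1 + (L.d l i).hom z.2)
      (fun g => by
        obtain ⟨a, b, h⟩ := (hf i j l hj hl).2 (Ind.coeff (k := k) y g) (by rw [← indComplex_d_coeff, hy]; rfl)
        exact ⟨(a, b), h⟩)
      (fun g hg => ⟨map_zero _, hg.trans (by simp)⟩)
    obtain ⟨a, ha⟩ : ∃ a : (indComplex K).X i, ∀ g, Ind.coeff (k := k) a g = (Ind.coeff (k := k) z g).1 :=
      ⟨Ind.map (LinearMap.fst _ (K.X i) (L.X l)) z, Ind.map_coeff _ z⟩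
    obtain ⟨b, hb⟩ : ∃ b : (indComplex L).X l, ∀ g, Ind.coeff (k := k) b g = (Ind.coeff (k := k) z g).2 :=
      ⟨Ind.map (LinearMap.snd _ (K.X i) (L.X l)) z, Ind.map_coeff _ z⟩
    refine ⟨a, b, Ind.ext (k := k) fun g => ?_, Ind.ext (k := k) fun g => ?_⟩
    · rw [indComplex_d_coeff, ha]
      exact (hz g).1
    · refine (hz g).2.trans (congrArg₂ (· + ·) ?_ ?_)
      · exact (congrArg _ (ha g)).symm.trans (indComplexMap_coeff f i a g).symm
      · exact (congrArg _ (hb g)).symm.trans (indComplex_d_coeff l i b g).symm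

variable (P) in
/-- The comparison of the induced complex of the dual with the dual of the induced complex. -/
def indDual (d : ℤ) : indComplex (dualShift (groupAntiInvolution k G) d P) ⟶
    dualShift (flip k k[G]) d (indComplex P) where
  f n := Ind.dualHom (P.X (d - n))
  comm' i j _ := by
    change Ind.dualHom _ ≫ ((i + 1).negOnePow • dualMap _ (Ind.hom (P.d (d - j) (d - i)))) =
      Ind.hom ((i + 1).negOnePow • dualMap _ (P.d (d - j) (d - i))) ≫ Ind.dualHom _
    rw [Ind.hom_units_smul, Linear.units_smul_comp, Linear.comp_units_smul, Ind.dualHom_naturality]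

/-- Finite projectivity makes the comparison an isomorphism already in each degree. -/
theorem indDual_quasiIso (d : ℤ) (hp : ∀ n, Module.Projective k[G] (P.X n))
    (hf : ∀ n, Module.Finite k[G] (P.X n)) : QuasiIso (indDual P d) := by
  have : ∀ n, IsIso ((indDual P d).f n) := fun n =>
    (ConcreteCategory.isIso_iff_bijective _).mpr Ind.desc_extendForm_bijective
  have := HomologicalComplex.Hom.isIso_of_components (indDual P d)
  infer_instance

end InducedComplex

end

end CalabiYau

open scoped MonoidAlgebra

namespace CalabiYau

noncomputable section

universe u v

/-! ### The bimodule resolution of the group algebra -/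

section InducedResolution

attribute [local instance] TensorProduct.Algebra.module

variable {k : Type u} [Field k] {G : Type v} [Group G]

/-- The element of the field underlying an element of the trivial module. -/
def trivialValue : TrivialModule k G ≃+ k := (Representation.trivial k G k).asModuleEquiv.toAddEquiv

theorem trivialValue_of_smul (g : G) (x : TrivialModule k G) :
    trivialValue (MonoidAlgebra.of k G g • x) = trivialValue x := by
  refine (Representation.asModuleEquiv_map_smul _ _ _).trans ?_
  rw [Representation.asAlgebraHom_of]
  rfl

theorem trivialValue_algebraMap_smul (c : k) (x : TrivialModule k G) :
    trivialValue (algebraMap k k[G] c • x) = c * trivialValue x := by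
  refine (Representation.asModuleEquiv_map_smul _ _ _).trans ?_
  rw [AlgHom.commutes]
  rfl

variable {M : Type*} [AddCommGroup M] [Module k[G] M]

/-- The semilinear map to the group algebra which is given by a map to the trivial module. -/
def toGroupAlgebra (ε : M →ₗ[k[G]] TrivialModule k G) :
    M →ₛₗ[adjointHom k G] k[G] :=
  let f : M →+ k[G] := (algebraMap k k[G]).toAddMonoidHom.comp
    (trivialValue.toAddMonoidHom.comp ε.toAddMonoidHom)
  have hf : ∀ m, f m = algebraMap k _ (trivialValue (ε m)) := fun _ => rfl
  { f with
    map_smul' := Ind.semilinear_of k G (f := f)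
      (fun g m => by
        rw [hf, hf, map_smul, trivialValue_of_smul, adjointHom_of, mul_smul, rightAct_smul,
          leftAct_smul, Algebra.commutes, ← mul_assoc, ← map_mul, mul_inv_cancel, map_one, one_mul])
      (fun c m => by
        rw [hf, hf, map_smul, trivialValue_algebraMap_smul, map_mul]
        exact (leftAct_smul (k := k) (algebraMap k k[G] c) _).symm) }

theorem coeff_desc_toGroupAlgebra (ε : M →ₗ[k[G]] TrivialModule k G) (x : Ind k G M)
    (y : G) : (Ind.desc (toGroupAlgebra ε) x).coeff y = trivialValue (ε (x.coeff y)) := by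
  classical
  refine Ind.induction (p := fun x => (Ind.desc (toGroupAlgebra ε) x).coeff y =
    trivialValue (ε (x.coeff y))) (fun x x' hx hx' => ?_) (fun g m => ?_) x
  · rw [map_add]
    refine (congrArg₂ (· + ·) hx hx').trans ?_
    rw [← map_add, ← map_add]
    rfl
  · rw [Ind.single_eq, map_smul, Ind.desc_unit, ← Ind.single_eq, leftAct_smul]
    change (MonoidAlgebra.of k G g * algebraMap k _ (trivialValue (ε m))).coeff y =
      trivialValue (ε ((Finsupp.single g m : G →₀ M) y))
    rw [Finsupp.single_apply, ← Algebra.commutes, ← Algebra.smul_def]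
    rw [apply_ite (fun m => trivialValue (ε m)), map_zero, map_zero]
    simp [MonoidAlgebra.of_apply, Finsupp.single_apply]

theorem Ind.projective_finite [Module.Projective k[G] M]
    [Module.Finite k[G] M] : Module.Projective (Env k k[G]) (Ind k G M) ∧
      Module.Finite (Env k k[G]) (Ind k G M) := by
  obtain ⟨n, e, φ, h⟩ := exists_dual_basis (R := k[G]) M
  exact projective_of_dual_basis (fun j => (Ind.unit (e j) : Ind k G M))
    (fun j => Ind.extendLin (φ j)) (Ind.dual_basis h)

/-- The resolution of the group algebra by bimodules which is induced from a resolution of the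
trivial module. -/
def indResolution (P : FiniteProjectiveResolution k[G] (TrivialModule k G)) :
    FiniteProjectiveResolution (Env k k[G]) k[G] where
  complex := indComplex P.complex
  projective n :=
    have := P.projective n
    have := P.finite n
    (Ind.projective_finite (M := P.complex.X n)).1
  finite n :=
    have := P.projective n
    have := P.finite n
    (Ind.projective_finite (M := P.complex.X n)).2
  bounded := by
    obtain ⟨N, hN⟩ := P.bounded
    refine ⟨N, fun n hn => ⟨fun x x' => Ind.ext (k := k) fun y => ?_⟩⟩
    have := hN n hn
    exact Subsingleton.elim _ _
  augmentation := Ind.desc (toGroupAlgebra P.augmentation)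
  augmentation_surjective a := by
    classical
    choose s hs using P.augmentation_surjective
    -- Zero coefficients are lifted to zero by hand, because the chosen section need not preserve
    -- zero and the support has to remain finite.
    refine ⟨(a.coeff.mapRange (fun c => if c = 0 then 0 else s (trivialValue.symm c)) (if_pos rfl) :
      G →₀ P.complex.X 0), MonoidAlgebra.ext (Finsupp.ext fun y => ?_)⟩
    refine (coeff_desc_toGroupAlgebra _ _ y).trans ?_
    change trivialValue (P.augmentation (if a.coeff y = 0 then 0 else _)) = _
    split_ifs with h
    · rw [map_zero, map_zero, h]
    · rw [hs, AddEquiv.apply_symm_apply]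
  exact_augmentation x := by
    constructor
    · intro hx
      obtain ⟨z, hz⟩ := Ind.exists_coeff x
        (p := fun g z => Ind.coeff (k := k) x g = (P.complex.d 1 0).hom z) (fun g => by
          obtain ⟨z, hz⟩ := (P.exact_augmentation (Ind.coeff (k := k) x g)).mp (trivialValue.injective
            (((coeff_desc_toGroupAlgebra _ x g).symm.trans (congrArg (fun a => a.coeff g) hx)).trans
              (map_zero trivialValue).symm))
          exact ⟨z, hz.symm⟩)
        (fun g hg => by rw [hg, map_zero])
      exact ⟨z, Ind.ext (k := k) fun g => (indComplex_d_coeff 1 0 z g).trans (hz g).symm⟩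
    · rintro ⟨z, rfl⟩
      refine MonoidAlgebra.ext (Finsupp.ext fun y => ?_)
      refine (coeff_desc_toGroupAlgebra _ _ y).trans ?_
      refine (congrArg (fun m => trivialValue (P.augmentation m)) (indComplex_d_coeff 1 0 z y)).trans ?_
      rw [(P.exact_augmentation _).mpr ⟨_, rfl⟩, map_zero]
      rfl
  exactAt n hn := by
    refine (exactAt_iff_elementwise (sub_add_cancel n 1) rfl).mpr fun x hx => ?_
    have hP := (exactAt_iff_elementwise (sub_add_cancel n 1) rfl).mp (P.exactAt n hn)
    obtain ⟨z, hz⟩ := Ind.exists_coeff x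
      (p := fun g z => Ind.coeff (k := k) x g = (P.complex.d (n + 1) n).hom z)
      (fun g => hP _ (by rw [← indComplex_d_coeff, hx]; rfl)) (fun g hg => by rw [hg, map_zero])
    exact ⟨z, Ind.ext (k := k) fun g => (hz g).trans (indComplex_d_coeff (n + 1) n z g).symm⟩

end InducedResolution

end

end CalabiYau

open scoped MonoidAlgebra

namespace CalabiYau

noncomputable section

/-! ### The quasi-isomorphism given by Poincaré duality -/

section DualityMorphism

universe u

variable {R : Type u} [Ring R] {τ : AntiInvolution R} {d i j l : ℤ}
  {P : ChainComplex (ModuleCat.{u} R) ℤ}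

theorem ker_dualShift_d (i j : ℤ) : LinearMap.ker ((dualShift τ d P).d i j).hom =
    LinearMap.ker (dualMap τ (P.d (d - j) (d - i))).hom :=
  Submodule.ext fun f => by
    change ((dualShift τ d P).d i j).hom f = 0 ↔ (dualMap τ (P.d (d - j) (d - i))).hom f = 0
    rw [dualShift_d_apply]
    exact smul_eq_zero_iff_eq _

theorem exists_dualShift_d_iff (i j : ℤ) (f : (dualShift τ d P).X j) :
    (∃ g, f = ((dualShift τ d P).d i j).hom g) ↔
      ∃ g, f = (dualMap τ (P.d (d - j) (d - i))).hom g := by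
  have key : ∀ g, ((dualShift τ d P).d i j).hom ((i + 1).negOnePow • g) =
      (dualMap τ (P.d (d - j) (d - i))).hom g := fun g => by
    rw [dualShift_d_apply]
    rcases Int.units_eq_one_or (i + 1).negOnePow with h | h <;> rw [h]
    · rw [one_smul, one_smul]
    · rw [Units.neg_smul, Units.neg_smul, one_smul, one_smul]
      exact (congrArg Neg.neg (map_neg (dualMap τ (P.d (d - j) (d - i))).hom g)).trans (neg_neg _)
  exact ⟨fun ⟨g, hg⟩ => ⟨(i + 1).negOnePow • g, by
    rw [hg, ← key, smul_smul, Int.units_mul_self, one_smul]⟩, fun ⟨g, hg⟩ => ⟨_, hg.trans (key g).symm⟩⟩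

/-- The cohomology class of a cycle of the `d`-shifted dual. -/
theorem exists_dualShift_class (hj : j + 1 = i) (hl : i + 1 = l) (n : ℤ) (hn : d - i = 0 - n) :
    ∃ cls : LinearMap.ker ((dualShift τ d P).d i j).hom →ₗ[R] (dualShift τ 0 P).homology n,
      Function.Surjective cls ∧ ∀ f, cls f = 0 ↔ ∃ g, f.1 = ((dualShift τ d P).d l i).hom g := by
  -- Up to signs the shifted dual is the unshifted one with its degrees moved. Generalizing the
  -- three degrees over equations avoids transport along them.
  have key : ∀ a b c : ℤ, a = 0 - n → b = 0 - (n + 1) → c = 0 - (n - 1) →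
      ∃ cls : LinearMap.ker (dualMap τ (P.d c a)).hom →ₗ[R] (dualShift τ 0 P).homology n,
        Function.Surjective cls ∧ ∀ f, cls f = 0 ↔ ∃ g, f.1 = (dualMap τ (P.d a b)).hom g := by
    rintro _ _ _ rfl rfl rfl
    have hk := ker_dualShift_d (τ := τ) (d := 0) (P := P) n (n - 1)
    rw [← hk]
    exact ⟨homologyClass (dualShift τ 0 P) (sub_add_cancel n 1), homologyClass_surjective _, fun f =>
      (homologyClass_eq_zero_iff _ rfl f).trans (exists_dualShift_d_iff _ _ _)⟩
  obtain ⟨cls, h1, h2⟩ := key (d - i) (d - l) (d - j) hn (by omega) (by omega)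
  rw [ker_dualShift_d]
  exact ⟨cls, h1, fun f => (h2 f).trans (exists_dualShift_d_iff l i _).symm⟩

/-- A morphism from a resolution to its dual, when the dual has its cohomology in one degree. -/
theorem FiniteProjectiveResolution.exists_duality {M : Type*} [AddCommGroup M] [Module R M]
    (P : FiniteProjectiveResolution R M) (d : ℕ)
    (hz : ∀ i : ℤ, i ≠ d → Subsingleton ((dualShift τ 0 P.complex).homology (-i)))
    (e : (dualShift τ 0 P.complex).homology (-(d : ℤ)) ≃ₗ[R] M) :
    ∃ η : P.complex ⟶ dualShift τ d P.complex, IsElementwiseQuasiIso η := by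
  -- Vanishing of the cohomology outside degree `d` makes the shifted dual exact outside degree
  -- zero.
  have hex : ∀ i j l : ℤ, j + 1 = i → i + 1 = l → i ≠ 0 → ∀ y,
      ((dualShift τ d P.complex).d i j).hom y = 0 →
      ∃ z, y = ((dualShift τ d P.complex).d l i).hom z := fun i j l hj hl hi y hy => by
    obtain ⟨cls, -, hc⟩ := exists_dualShift_class (τ := τ) (d := d) (P := P.complex) hj hl (i - d)
      (by ring)
    have := hz (d - i) (by omega)
    rw [neg_sub] at this
    exact (hc ⟨y, hy⟩).mp (Subsingleton.elim _ _)
  obtain ⟨cls, hs, hc⟩ := exists_dualShift_class (τ := τ) (d := d) (P := P.complex) (j := -1) (i := 0)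
    (l := 1) rfl rfl (-(d : ℤ)) (by ring)
  have := P.projective 0
  -- The cycles of degree zero surject onto the cohomology, identified with `M`, so the augmentation
  -- lifts to them by projectivity.
  obtain ⟨η₀, hη⟩ := Module.projective_lifting_property (e.toLinearMap ∘ₗ cls) P.augmentation
    (e.surjective.comp hs)
  have hη : ∀ x, e (cls (η₀ x)) = P.augmentation x := LinearMap.congr_fun hη
  obtain ⟨f, hf₀, hf⟩ := exists_chainMap (P := fun n : ℕ => P.complex.X n)
    (N := fun n : ℕ => (dualShift τ d P.complex).X n)
    (dP := fun n => (P.complex.d ((n + 1 : ℕ) : ℤ) n).hom)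
    (dN := fun n => ((dualShift τ d P.complex).d ((n + 1 : ℕ) : ℤ) n).hom)
    (fun n => P.projective n) (fun n x => d_apply_d _ _ _ _ x)
    (fun n y => ⟨fun hy => by
      obtain ⟨z, h⟩ := hex ((n + 1 : ℕ) : ℤ) n ((n + 1 + 1 : ℕ) : ℤ) (by omega) (by omega) (by omega)
        y hy
      exact ⟨z, h.symm⟩, by rintro ⟨y, rfl⟩; exact d_apply_d _ _ _ _ y⟩)
    ((LinearMap.ker _).subtype ∘ₗ η₀) (fun x => by
      obtain ⟨z, h⟩ := (hc (η₀ ((P.complex.d 1 0).hom x))).mp (e.injective (by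
        rw [hη, map_zero, (P.exact_augmentation _).mpr ⟨x, rfl⟩]))
      exact ⟨z, h.symm⟩)
  obtain ⟨F, hF⟩ := exists_hom_of_nat (L := dualShift τ d P.complex) (fun n hn => P.subsingleton hn) f hf
    (fun x => by rw [hf₀]; exact (η₀ x).2)
  have hF₀ : ∀ x, (F.f 0).hom x = (η₀ x).1 := fun x =>
    (LinearMap.congr_fun (hF 0) x).trans (LinearMap.congr_fun hf₀ x)
  refine ⟨F, fun i j l hj hl => ?_⟩
  by_cases hi : i = 0
  · subst hi
    obtain rfl : j = -1 := by omega
    obtain rfl : l = 1 := by omega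
    refine ⟨fun x y hx hxy => ?_, fun y hy => ?_⟩
    · obtain ⟨z, h⟩ := (P.exact_augmentation x).mp (by
        rw [← hη, (hc (η₀ x)).mpr ⟨y, (hF₀ x).symm.trans hxy⟩, map_zero])
      exact ⟨z, h.symm⟩
    · obtain ⟨x, hx⟩ := P.augmentation_surjective (e (cls ⟨y, hy⟩))
      obtain ⟨z, h⟩ := (hc (⟨y, hy⟩ - η₀ x)).mp (e.injective (by
        rw [map_sub, map_sub, hη, hx, sub_self, map_zero]))
      have := P.subsingleton (n := -1) (by decide)
      refine ⟨x, z, Subsingleton.elim _ _, ?_⟩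
      rw [hF₀]
      exact eq_add_of_sub_eq' h
  · refine ⟨fun x y hx _ => ?_, fun y hy => ?_⟩
    · rcases lt_or_gt_of_ne hi with h | h
      · have := P.subsingleton h
        exact ⟨0, Subsingleton.elim _ _⟩
      · exact (exactAt_iff_elementwise hj hl).mp (P.exactAt i h) x hx
    · obtain ⟨z, h⟩ := hex i j l hj hl hi y hy
      exact ⟨0, z, map_zero _, by rw [map_zero, zero_add, h]⟩

end DualityMorphism

section PoincareDuality

attribute [local instance] TensorProduct.Algebra.module

universe u v

/-- The group algebra of an oriented Poincaré duality group is a Calabi–Yau algebra. -/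
theorem IsOrientedPoincareDualityGroup.nonempty_calabiYauStructure {k : Type u} [Field k]
    {G : Type v} [Group G] {d : ℕ} (hG : IsOrientedPoincareDualityGroup k G d) :
    Nonempty (CalabiYauStructure k k[G] d) := by
  obtain ⟨P, hz, ⟨e⟩⟩ := hG
  obtain ⟨η, hη⟩ := P.exists_duality d hz e
  have h1 := indComplexMap_quasiIso hη
  have h2 := indDual_quasiIso (P := P.complex) d P.projective P.finite
  have h3 : QuasiIso (indComplexMap η ≫ indDual P.complex d) := inferInstance
  -- Only the self-duality is retained; it holds for every quasi-isomorphism to the shifted dual, so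
  -- no symmetry of the Poincaré duality morphism has to be checked.
  obtain ⟨-, -, -, -, -, h4⟩ := exists_trace_eq_one (indResolution P) _ h3
  exact ⟨⟨indResolution P, _, h3, h4⟩⟩

end PoincareDuality

end

end CalabiYau

theorem mainTheorem8 {k : Type*} [Field k] {G : Type*} [Group G] [Group.FG G] (d : ℕ)
    (hG : CalabiYau.IsOrientedPoincareDualityGroup k G d) :
    Nonempty (CalabiYau.CalabiYauStructure k (MonoidAlgebra k G) d) ∧
    ∀ Ψ : CalabiYau.CalabiYauStructure k (MonoidAlgebra k G) d,
      ∃ (mul br : CalabiYau.HHCohTot k (MonoidAlgebra k G) →ₗ[k]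
            CalabiYau.HHCohTot k (MonoidAlgebra k G) →ₗ[k]
              CalabiYau.HHCohTot k (MonoidAlgebra k G))
        (Δ : CalabiYau.HHCohTot k (MonoidAlgebra k G) →ₗ[k]
          CalabiYau.HHCohTot k (MonoidAlgebra k G)),
        CalabiYau.IsCupProduct mul ∧ CalabiYau.IsGerstenhaberBracket br ∧
        CalabiYau.IsTransportedConnes Ψ Δ ∧
        CalabiYau.IsBVAlgebra (CalabiYau.HHCohTot.deg k (MonoidAlgebra k G)) mul br Δ :=
  ⟨hG.nonempty_calabiYauStructure, fun Ψ => Ψ.exists_isBVAlgebra⟩
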